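/- Let $E=L^2(\mathbb R)\cap L^\infty(\mathbb R)$ with $\|u\|_E=\|u\|_{L^2}+\|u\|_{L^\infty}$, and let $\alpha\in[0,1]$. **Relabeling functions.** $G$ is the group of homeomorphisms $f:\mathbb R\to\mathbb R$ with $f-\mathrm{id},\,f^{-1}-\mathrm{id}\in W^{1,\infty}(\mathbb R)$ and $f_\xi-1\in L^2(\mathbb R)$. **Lagrangian coordinates.** Consider tuples $\Theta=(y,U,y_\xi,U_\xi,\bar h,h,r)$ of functions on $\mathbb R$ (up to equality almost everywhere; $y,U$ are locally absolutely continuous with derivatives $y_\xi,U_\xi$). For $x\in\mathbb R^7$ put $g_1(x)=|x_4|+2x_3$, $g_2(x)=x_3+x_5$, and $g(x)=\alpha g_1(x)+(1-\alpha)g_2(x)$ if $g_1(x)\le g_2(x)$, $x_4\le 0$ and $x_7=0$, and $g(x)=g_2(x)$ otherwise. $\mathcal G$ is the set of $\Theta$ such that, with $\zeta=y-\mathrm{id}$: $\zeta\in L^\infty$; $U,\zeta_\xi,U_\xi,h,r\in E$; $g(\Theta)-1\in E$; $h\in L^1$; $y_\xi,h,\bar h\ge0$ a.e.; $\lim_{\xi\to-\infty}\zeta(\xi)=0$;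 $1/(y_\xi+h)\in L^\infty$; $y_\xi\bar h=U_\xi^2+r^2$ a.e.; and $\bar h\le h$ a.e. $\mathcal F$ is the set of $\Theta\in\mathcal G$ with $y+H\in G$, where $H(\xi)=\int_{-\infty}^\xi h$. For $f\in G$ put $$\Theta\circ f=(y\circ f,\;U\circ f,\;y_\xi\circ f\,f_\xi,\;U_\xi\circ f\,f_\xi,\;\bar h\circ f\,f_\xi,\;h\circ f\,f_\xi,\;r\circ f\,f_\xi).$$ Elements $\Theta,\Theta'\in\mathcal F$ are equivalent if $\Theta'=\Theta\circ f$ for some $f\in G$; $\mathcal F/G$ is the set of equivalence classes $[\Theta]$. **Solutions.** Put $$P(\xi)=\tfrac14\int_{\mathbb R}e^{-|y(\xi)-y(\eta)|}(2U^2y_\xi+\bar h)(\eta)\,d\eta,\qquad Q(\xi)=-\tfrac14\int_{\mathbb R}\operatorname{sgn}(\xi-\eta)e^{-|y(\xi)-y(\eta)|}(2U^2y_\xi+\bar h)(\eta)\,d\eta.$$ A global $\alpha$-dissipative solution is a family $\Theta(t)$, $t\ge0$, of tuples such that for every $T>0$ one has $y-\mathrm{id}\in L^\infty([0,T],W^{1,\infty})$,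 $U\in L^\infty([0,T],H^1)$, $\bar h\in L^\infty([0,T],L^2)$, while $y_\xi-1,U_\xi,r$ are bounded and Lipschitz from $[0,T]$ to $E$ and $h$ is bounded and Lipschitz from $[0,T]$ to $L^1\cap L^\infty$; and such that, for suitable representatives, the following holds for almost every $\xi$. Let $\tau_0(\xi)=0$ and, for $n\ge 1$ with $\tau_{n-1}(\xi)<\infty$, let $\tau_n(\xi)$ be the first time $t>\tau_{n-1}(\xi)$ with $y_\xi(t,\xi)=0$, provided such a time exists and $y_\xi(\cdot,\xi)>0$ on $(\tau_{n-1}(\xi),t)$; otherwise $\tau_n(\xi)=\infty$ (and $\tau_n(\xi)=\infty$ if $\tau_{n-1}(\xi)=\infty$). The functions $\tau_n$ are measurable and $\tau_n(\xi)\to\infty$. The functions $y,U,y_\xi,U_\xi,h,r$ are absolutely continuous in $t$ on bounded intervals and satisfy, in integrated form, $$y_t=U,\quad U_t=-Q,\quad y_{\xi,t}=U_\xi,\quad U_{\xi,t}=\tfrac12\bar h+(U^2-P)y_\xi,\quad h_t=2(U^2-P)U_\xi,\quad r_t=0,$$ while $\bar h-h$ is constant in $t$ on each interval $[\tau_{n-1}(\xi),\tau_n(\xi))$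 and $\bar h(\tau_n(\xi),\xi)=(1-\alpha)\lim_{t\uparrow\tau_n(\xi)}\bar h(t,\xi)$ for each $n\ge1$ with $\tau_n(\xi)<\infty$. **Theorem.** For every $\Theta_0\in\mathcal F$ there is a unique global $\alpha$-dissipative solution $\Theta$ with $\Theta(0)=\Theta_0$, and $S_t(\Theta_0):=\Theta(t)$ defines a semigroup of maps $S_t:\mathcal F\to\mathcal F$, $t\ge0$ (that is, $S_0=\mathrm{id}$ and $S_{s+t}=S_s\circ S_t$). For $\Theta\in\mathcal F$ and $f\in G$ one has $\Theta\circ f\in\mathcal F$ if and only if $f(\xi)-\xi\to0$ as $\xi\to-\infty$, and in this case $$S_t(\Theta\circ f)=S_t(\Theta)\circ f\qquad\text{for all }t>0.$$ For arbitrary $f\in G$ and $\Theta\in\mathcal F$, the family $t\mapsto S_t(\Theta)\circ f$ is the unique global $\alpha$-dissipative solution with initial value $\Theta\circ f$. Consequently $\tilde S_t([\Theta])=[S_t(\Theta)]$ is a well-defined map $\tilde S_t:\mathcal F/G\to\mathcal F/G$ for every $t\ge0$, and $\tilde S_0=\mathrm{id}$, $\tilde S_{s+t}=\tilde S_s\circ\tilde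 S_t$ for all $s,t\ge0$. -/

import Mathlib

open MeasureTheory Set Filter Topology
open scoped ENNReal NNReal

noncomputable section

/-! ### Function spaces on the real line -/

/-- `u ∈ E = L² ∩ L^∞`. -/
def MemE (u : ℝ → ℝ) : Prop := MemLp u 2 volume ∧ MemLp u ∞ volume

/-- The norm of `E`, `‖u‖_{L²} + ‖u‖_{L^∞}`. -/
def normE (u : ℝ → ℝ) : ℝ≥0∞ := eLpNorm u 2 volume + eLpNorm u ∞ volume

/-- The norm `‖u‖_{L¹} + ‖u‖_{L^∞}` of `L¹ ∩ L^∞`. -/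
def normL1Linf (u : ℝ → ℝ) : ℝ≥0∞ := eLpNorm u 1 volume + eLpNorm u ∞ volume

/-- `u` is the continuous representative of an element of `W^{1,∞}(ℝ)`: on the line these are
exactly the bounded Lipschitz functions. -/
def MemWOneInf (u : ℝ → ℝ) : Prop := (∃ C : ℝ, ∀ x, |u x| ≤ C) ∧ ∃ K : ℝ≥0, LipschitzWith K u

/-- `F` is the locally absolutely continuous function with (weak) derivative `f`. -/
def HasWeakDeriv (F f : ℝ → ℝ) : Prop :=
  ∀ a b : ℝ, IntervalIntegrable f volume a b ∧ F b - F a = ∫ x in a..b, f x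

/-! ### Lagrangian coordinates -/

/-- A tuple `Θ = (y, U, y_ξ, U_ξ, h̄, h, r)`, with `q = y_ξ` and `w = U_ξ`. The functions `y`, `U`
are given by their continuous representatives, the other ones are classes of measurable functions
modulo equality almost everywhere. -/
@[ext]
structure LagState where
  y : ℝ → ℝ
  U : ℝ → ℝ
  q : ℝ →ₘ[volume] ℝ
  w : ℝ →ₘ[volume] ℝ
  hb : ℝ →ₘ[volume] ℝ
  h : ℝ →ₘ[volume] ℝ
  r : ℝ →ₘ[volume] ℝ

/-- The seven numbers `Θ(ξ)`. -/
def LagState.toVec (Θ : LagState) (ξ : ℝ) : Fin 7 → ℝ :=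
  ![Θ.y ξ, Θ.U ξ, Θ.q ξ, Θ.w ξ, Θ.hb ξ, Θ.h ξ, Θ.r ξ]

/-- `g₁(x) = |x₄| + 2 x₃` (the coordinates of `x` are numbered from `0` here). -/
def gOne (x : Fin 7 → ℝ) : ℝ := |x 3| + 2 * x 2

/-- `g₂(x) = x₃ + x₅`. -/
def gTwo (x : Fin 7 → ℝ) : ℝ := x 2 + x 4

/-- `Ω₁ = {x | g₁(x) ≤ g₂(x), x₄ ≤ 0, x₇ = 0}`. -/
def OmegaOne : Set (Fin 7 → ℝ) := {x | gOne x ≤ gTwo x ∧ x 3 ≤ 0 ∧ x 6 = 0}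

open Classical in
/-- `g = α g₁ + (1 - α) g₂` on `Ω₁`, and `g = g₂` elsewhere. -/
def gFun (α : ℝ) (x : Fin 7 → ℝ) : ℝ :=
  if x ∈ OmegaOne then α * gOne x + (1 - α) * gTwo x else gTwo x

/-- The set `𝒢`. -/
structure MemG (α : ℝ) (Θ : LagState) : Prop where
  deriv_y : HasWeakDeriv Θ.y Θ.q
  deriv_U : HasWeakDeriv Θ.U Θ.w
  zeta_mem : MemLp (fun ξ => Θ.y ξ - ξ) ∞ volume
  U_mem : MemE Θ.U
  zetaXi_mem : MemE (fun ξ => Θ.q ξ - 1)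
  w_mem : MemE Θ.w
  h_mem : MemE Θ.h
  r_mem : MemE Θ.r
  g_mem : MemE (fun ξ => gFun α (Θ.toVec ξ) - 1)
  h_integrable : Integrable Θ.h volume
  nonneg : ∀ᵐ ξ, 0 ≤ Θ.q ξ ∧ 0 ≤ Θ.h ξ ∧ 0 ≤ Θ.hb ξ
  zeta_lim : Tendsto (fun ξ => Θ.y ξ - ξ) atBot (𝓝 0)
  inv_bdd : ∃ C : ℝ, ∀ᵐ ξ, 0 < Θ.q ξ + Θ.h ξ ∧ 1 / (Θ.q ξ + Θ.h ξ) ≤ C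
  relation : ∀ᵐ ξ, Θ.q ξ * Θ.hb ξ = Θ.w ξ ^ 2 + Θ.r ξ ^ 2
  hb_le : ∀ᵐ ξ, Θ.hb ξ ≤ Θ.h ξ

/-! ### Relabeling functions -/

/-- The homeomorphisms `f` of the line with `f - id, f⁻¹ - id ∈ W^{1,∞}` and `f_ξ - 1 ∈ L²`. -/
def IsRelabeling (f : ℝ ≃ₜ ℝ) : Prop :=
  MemWOneInf (fun ξ => f ξ - ξ) ∧ MemWOneInf (fun ξ => f.symm ξ - ξ) ∧
    MemLp (fun ξ => deriv f ξ - 1) 2 volume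

lemma MemWOneInf.lipschitz {u : ℝ → ℝ} (hu : MemWOneInf (fun ξ => u ξ - ξ)) :
    ∃ K : ℝ≥0, LipschitzWith K u := by
  obtain ⟨-, K, hK⟩ := hu
  refine ⟨K + 1, ?_⟩
  have h := hK.add LipschitzWith.id
  simpa using h

lemma MemWOneInf.comp {u v : ℝ → ℝ} (hu : MemWOneInf (fun ξ => u ξ - ξ))
    (hv : MemWOneInf (fun ξ => v ξ - ξ)) : MemWOneInf (fun ξ => u (v ξ) - ξ) := by
  obtain ⟨Kv, hKv⟩ := hv.lipschitz
  obtain ⟨⟨Cu, hCu⟩, Ku, hKu⟩ := hu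
  obtain ⟨⟨Cv, hCv⟩, Kv', hKv'⟩ := hv
  refine ⟨⟨Cu + Cv, fun x => ?_⟩, ⟨Ku * Kv + Kv', ?_⟩⟩
  · have h1 := abs_add_le (u (v x) - v x) (v x - x)
    have h2 := hCu (v x)
    have h3 := hCv x
    rw [sub_add_sub_cancel] at h1
    linarith
  · have h := (hKu.comp hKv).add hKv'
    simpa [Function.comp_def] using h

/-- A relabeling function does not increase the measure of preimages by more than a factor. -/
lemma IsRelabeling.map_le {f : ℝ ≃ₜ ℝ} (hf : IsRelabeling f) :
    ∃ K : ℝ≥0, Measure.map f volume ≤ (K : ℝ≥0∞) • (volume : Measure ℝ) := by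
  obtain ⟨K, hK⟩ := hf.2.1.lipschitz
  refine ⟨K, Measure.le_iff.2 fun s hs => ?_⟩
  rw [Measure.map_apply f.continuous.measurable hs, ← f.image_symm]
  have h := (hK.lipschitzOnWith (s := s)).hausdorffMeasure_image_le (d := 1) zero_le_one
  rw [hausdorffMeasure_real] at h
  simpa using h

lemma IsRelabeling.quasi {f : ℝ ≃ₜ ℝ} (hf : IsRelabeling f) :
    Measure.QuasiMeasurePreserving f volume volume := by
  obtain ⟨K, hK⟩ := hf.map_le
  exact ⟨f.continuous.measurable,
    (Measure.absolutelyContinuous_of_le hK).trans Measure.smul_absolutelyContinuous⟩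

lemma IsRelabeling.ae_differentiableAt {f : ℝ ≃ₜ ℝ} (hf : IsRelabeling f) :
    ∀ᵐ ξ, DifferentiableAt ℝ f ξ := by
  obtain ⟨K, hK⟩ := hf.1.lipschitz
  exact hK.ae_differentiableAt_of_real

lemma IsRelabeling.memLp_comp {f : ℝ ≃ₜ ℝ} (hf : IsRelabeling f) {u : ℝ → ℝ} {p : ℝ≥0∞}
    (hu : MemLp u p volume) : MemLp (fun ξ => u (f ξ) * deriv f ξ) p volume := by
  obtain ⟨K, hK⟩ := hf.map_le
  obtain ⟨L, hL⟩ := hf.1.lipschitz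
  have h1 : MemLp (fun ξ => u (f ξ)) p volume :=
    (hu.of_measure_le_smul ENNReal.coe_ne_top hK).comp_of_map f.continuous.aemeasurable
  refine h1.of_le_mul (c := L)
    (h1.aestronglyMeasurable.mul (measurable_deriv f).aestronglyMeasurable) (.of_forall fun ξ => ?_)
  rw [norm_mul, mul_comm]
  exact mul_le_mul_of_nonneg_right (norm_deriv_le_of_lipschitz hL) (norm_nonneg _)

lemma IsRelabeling.deriv_comp {f g : ℝ ≃ₜ ℝ} (hf : IsRelabeling f) (hg : IsRelabeling g) :
    ∀ᵐ ξ, deriv (f * g : ℝ ≃ₜ ℝ) ξ = deriv f (g ξ) * deriv g ξ := by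
  filter_upwards [hg.ae_differentiableAt, hg.quasi.ae hf.ae_differentiableAt] with ξ h1 h2
  exact _root_.deriv_comp (h₂ := f) (h := g) ξ h2 h1

lemma IsRelabeling.one : IsRelabeling 1 := by
  have h : MemWOneInf (fun _ => (0 : ℝ)) := ⟨⟨0, by simp⟩, 0, LipschitzWith.const 0⟩
  refine ⟨by simpa using h, ?_, ?_⟩
  · have : ∀ ξ : ℝ, (1 : ℝ ≃ₜ ℝ).symm ξ = ξ := fun _ => rfl
    simpa [this] using h
  · have : ((1 : ℝ ≃ₜ ℝ) : ℝ → ℝ) = id := rfl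
    simp [this]

lemma IsRelabeling.mul {f g : ℝ ≃ₜ ℝ} (hf : IsRelabeling f) (hg : IsRelabeling g) :
    IsRelabeling (f * g) := by
  refine ⟨hf.1.comp hg.1, hg.2.1.comp hf.2.1, ?_⟩
  refine ((hg.memLp_comp hf.2.2).add hg.2.2).ae_eq ?_
  filter_upwards [hf.deriv_comp hg] with ξ h
  simp only [Pi.add_apply, h]
  ring

lemma IsRelabeling.inv {f : ℝ ≃ₜ ℝ} (hf : IsRelabeling f) : IsRelabeling f⁻¹ := by
  have hquasi : Measure.QuasiMeasurePreserving f.symm volume volume := by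
    obtain ⟨K, hK⟩ := hf.1.lipschitz
    refine ⟨f.symm.continuous.measurable, Measure.AbsolutelyContinuous.mk fun s hs h0 => ?_⟩
    rw [Measure.map_apply f.symm.continuous.measurable hs, ← f.image_eq_preimage_symm]
    have h := (hK.lipschitzOnWith (s := s)).hausdorffMeasure_image_le (d := 1) zero_le_one
    rw [hausdorffMeasure_real, h0] at h
    simpa using h
  have hle : ∃ K : ℝ≥0, Measure.map f.symm volume ≤ (K : ℝ≥0∞) • (volume : Measure ℝ) := by
    obtain ⟨K, hK⟩ := hf.1.lipschitz
    refine ⟨K, Measure.le_iff.2 fun s hs => ?_⟩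
    rw [Measure.map_apply f.symm.continuous.measurable hs, ← f.image_eq_preimage_symm]
    have h := (hK.lipschitzOnWith (s := s)).hausdorffMeasure_image_le (d := 1) zero_le_one
    rw [hausdorffMeasure_real] at h
    simpa using h
  refine ⟨hf.2.1, hf.1, ?_⟩
  obtain ⟨K, hK⟩ := hle
  obtain ⟨L, hL⟩ := hf.2.1.lipschitz
  have h1 : MemLp (fun ξ => deriv f (f.symm ξ) - 1) 2 volume :=
    (hf.2.2.of_measure_le_smul ENNReal.coe_ne_top hK).comp_of_map f.symm.continuous.aemeasurable
  refine h1.of_le_mul (c := L)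
    ((measurable_deriv f.symm).sub measurable_const).aestronglyMeasurable ?_
  filter_upwards [hL.ae_differentiableAt_of_real, hquasi.ae hf.ae_differentiableAt] with ξ h2 h3
  have h4 : deriv f (f.symm ξ) * deriv f.symm ξ = 1 := by
    rw [← _root_.deriv_comp (h₂ := f) (h := f.symm) ξ h3 h2]
    have : (f ∘ f.symm : ℝ → ℝ) = id := by ext; simp
    rw [this, deriv_id]
  have h5 : deriv f.symm ξ - 1 = -(deriv f.symm ξ * (deriv f (f.symm ξ) - 1)) := by
    rw [mul_sub, mul_comm (deriv f.symm ξ), h4]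
    ring
  change ‖deriv f.symm ξ - 1‖ ≤ _
  rw [h5, norm_neg, norm_mul]
  exact mul_le_mul_of_nonneg_right (norm_deriv_le_of_lipschitz hL) (norm_nonneg _)

/-- The group `G` of relabeling functions; multiplication is composition. -/
def RelabelingGroup : Subgroup (ℝ ≃ₜ ℝ) where
  carrier := {f | IsRelabeling f}
  mul_mem' := IsRelabeling.mul
  one_mem' := IsRelabeling.one
  inv_mem' := IsRelabeling.inv

/-- The class of `u ∘ f · f_ξ`. -/
def relabelDensity (u : ℝ →ₘ[volume] ℝ) (f : ℝ ≃ₜ ℝ) : ℝ →ₘ[volume] ℝ :=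
  AEEqFun.mk (fun ξ => u (f ξ) * deriv f ξ)
    ((u.stronglyMeasurable.comp_measurable f.continuous.measurable).mul
      (measurable_deriv f).stronglyMeasurable).aestronglyMeasurable

/-- `Θ ∘ f = (y ∘ f, U ∘ f, y_ξ ∘ f f_ξ, U_ξ ∘ f f_ξ, h̄ ∘ f f_ξ, h ∘ f f_ξ, r ∘ f f_ξ)`. -/
def LagState.relabel (Θ : LagState) (f : RelabelingGroup) : LagState where
  y := Θ.y ∘ f.1
  U := Θ.U ∘ f.1
  q := relabelDensity Θ.q f.1
  w := relabelDensity Θ.w f.1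
  hb := relabelDensity Θ.hb f.1
  h := relabelDensity Θ.h f.1
  r := relabelDensity Θ.r f.1

lemma relabelDensity_one (u : ℝ →ₘ[volume] ℝ) : relabelDensity u 1 = u := by
  refine AEEqFun.ext ((AEEqFun.coeFn_mk _ _).trans (.of_forall fun ξ => ?_))
  have : ((1 : ℝ ≃ₜ ℝ) : ℝ → ℝ) = id := rfl
  simp [this]

lemma relabelDensity_mul (u : ℝ →ₘ[volume] ℝ) {f g : ℝ ≃ₜ ℝ} (hf : IsRelabeling f)
    (hg : IsRelabeling g) : relabelDensity u (f * g) = relabelDensity (relabelDensity u f) g := by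
  refine AEEqFun.ext ?_
  filter_upwards [AEEqFun.coeFn_mk (fun ξ => u ((f * g : ℝ ≃ₜ ℝ) ξ) * deriv (f * g : ℝ ≃ₜ ℝ) ξ) _,
    AEEqFun.coeFn_mk (fun ξ => relabelDensity u f (g ξ) * deriv g ξ) _,
    hg.quasi.ae (AEEqFun.coeFn_mk (fun ξ => u (f ξ) * deriv f ξ) _),
    hf.deriv_comp hg] with ξ h1 h2 h3 h4
  refine h1.trans (Eq.trans ?_ h2.symm)
  rw [h4, ← mul_assoc]
  exact congrArg (· * deriv g ξ) h3.symm

lemma LagState.relabel_one (Θ : LagState) : Θ.relabel 1 = Θ := by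
  ext1 <;> first | rfl | exact relabelDensity_one _

lemma LagState.relabel_mul (Θ : LagState) (f g : RelabelingGroup) :
    Θ.relabel (f * g) = (Θ.relabel f).relabel g := by
  ext1 <;> first | rfl | exact relabelDensity_mul _ f.2 g.2

/-- The set `ℱ`: the elements of `𝒢` with `y + H ∈ G`, where `H(ξ) = ∫_{-∞}^ξ h`. -/
def MemF (α : ℝ) (Θ : LagState) : Prop :=
  MemG α Θ ∧ ∃ f : RelabelingGroup, ∀ ξ, f.1 ξ = Θ.y ξ + ∫ x in Iic ξ, Θ.h x

/-- The set `ℱ` as a type. -/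
abbrev LagF (α : ℝ) : Type := {Θ : LagState // MemF α Θ}

/-- The equivalence relation on `ℱ`: `Θ' = Θ ∘ f` for some relabeling function `f`. -/
instance relabelingSetoid (α : ℝ) : Setoid (LagF α) where
  r Θ Θ' := ∃ f : RelabelingGroup, Θ'.1 = Θ.1.relabel f
  iseqv :=
    { refl := fun Θ => ⟨1, (LagState.relabel_one _).symm⟩
      symm := by
        rintro Θ Θ' ⟨f, hf⟩
        exact ⟨f⁻¹, by rw [hf, ← LagState.relabel_mul, mul_inv_cancel, LagState.relabel_one]⟩
      trans := by
        rintro Θ Θ' Θ'' ⟨f, hf⟩ ⟨g, hg⟩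
        exact ⟨f * g, by rw [hg, hf, LagState.relabel_mul]⟩ }

/-- The quotient `ℱ/G`. -/
abbrev LagFQuot (α : ℝ) : Type := Quotient (relabelingSetoid α)

/-! ### Solutions of the Lagrangian system -/

/-- `P(ξ) = ¼ ∫ e^{-|y(ξ) - y(η)|} (2 U² y_ξ + h̄)(η) dη`. -/
def LagState.P (Θ : LagState) (ξ : ℝ) : ℝ :=
  1 / 4 * ∫ η, Real.exp (-|Θ.y ξ - Θ.y η|) * (2 * Θ.U η ^ 2 * Θ.q η + Θ.hb η)

/-- `Q(ξ) = -¼ ∫ sgn(ξ - η) e^{-|y(ξ) - y(η)|} (2 U² y_ξ + h̄)(η) dη`. -/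
def LagState.Q (Θ : LagState) (ξ : ℝ) : ℝ :=
  -(1 / 4) * ∫ η, Real.sign (ξ - η) * Real.exp (-|Θ.y ξ - Θ.y η|) *
    (2 * Θ.U η ^ 2 * Θ.q η + Θ.hb η)

open Classical in
/-- If `p` is positive right after time `a` and vanishes later on, the first time after `a` at
which it vanishes; otherwise `∞`. -/
def nextBreak (p : ℝ → ℝ) (a : ℝ) : EReal :=
  if ∃ t, a < t ∧ (∀ s ∈ Ioo a t, 0 < p s) ∧ p t = 0 then
    ((sSup {t | a < t ∧ ∀ s ∈ Ioo a t, 0 < p s} : ℝ) : EReal)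
  else ⊤

open Classical in
/-- The breaking times `0 = τ₀ < τ₁ < τ₂ < ⋯` of `p(t) = y_ξ(t, ξ)`, with `ξ` fixed; `τₙ = ∞` when
there are less than `n` of them. -/
def breakTime (p : ℝ → ℝ) : ℕ → EReal
  | 0 => 0
  | n + 1 => if breakTime p n = ⊤ then ⊤ else nextBreak p (breakTime p n).toReal

/-- `x_t = F` for `t ≥ 0`, with `x` absolutely continuous in time. -/
def Evolves (x F : ℝ → ℝ) : Prop :=
  ∀ t, 0 ≤ t → IntervalIntegrable F volume 0 t ∧ x t = x 0 + ∫ s in (0 : ℝ)..t, F s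

/-- `u ∈ L^∞([0,T], B)` for every `T`, where `N` is the norm of `B`. -/
def BoundedInTime (N : (ℝ → ℝ) → ℝ≥0∞) (u : ℝ → ℝ → ℝ) : Prop :=
  ∀ T : ℝ, ∃ C : ℝ≥0, ∀ t ∈ Icc 0 T, N (u t) ≤ C

/-- `u ∈ W^{1,∞}([0,T], B)` for every `T`, that is, `u` is bounded and Lipschitz in time, where `N`
is the norm of `B`. -/
def LipschitzInTime (N : (ℝ → ℝ) → ℝ≥0∞) (u : ℝ → ℝ → ℝ) : Prop :=
  BoundedInTime N u ∧
    ∀ T : ℝ, ∃ C : ℝ≥0, ∀ s ∈ Icc 0 T, ∀ t ∈ Icc 0 T,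
      N (fun ξ => u t ξ - u s ξ) ≤ C * ENNReal.ofReal |t - s|

/-- The regularity required from solutions, together with the fact that `q` and `w` are the
derivatives of `y` and `U`. -/
structure SolutionRegularity (Θ : ℝ → LagState) : Prop where
  deriv_y : ∀ t, 0 ≤ t → HasWeakDeriv (Θ t).y (Θ t).q
  deriv_U : ∀ t, 0 ≤ t → HasWeakDeriv (Θ t).U (Θ t).w
  zeta : BoundedInTime (fun u => eLpNorm u ∞ volume) (fun t ξ => (Θ t).y ξ - ξ)
  U : BoundedInTime (fun u => eLpNorm u 2 volume) (fun t => (Θ t).U)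
  zetaXi : LipschitzInTime normE (fun t ξ => (Θ t).q ξ - 1)
  w : LipschitzInTime normE (fun t => (Θ t).w)
  r : LipschitzInTime normE (fun t => (Θ t).r)
  hb : BoundedInTime (fun u => eLpNorm u 2 volume) (fun t => (Θ t).hb)
  h : LipschitzInTime normL1Linf (fun t => (Θ t).h)

/-- The functions `q(t,ξ), …, r(t,ξ)` represent, at each time `t ≥ 0`, the classes in `Θ(t)`. -/
def Represents (Θ : ℝ → LagState) (q w hb h r : ℝ → ℝ → ℝ) : Prop :=
  ∀ t, 0 ≤ t → (Θ t).q =ᵐ[volume] q t ∧ (Θ t).w =ᵐ[volume] w t ∧ (Θ t).hb =ᵐ[volume] hb t ∧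
    (Θ t).h =ᵐ[volume] h t ∧ (Θ t).r =ᵐ[volume] r t

/-- The system at a fixed label `ξ`. The functions `y, U, q, w, h, r` are continuous in time across
breaking times, and there are finitely many of these in bounded time intervals, so that their
equations hold in integrated form on all of `[0,t]`. On `[τₙ, τₙ₊₁)` one has `h̄_t = h_t`, and at a
breaking time `h̄` is right continuous and is multiplied by `1 - α`. -/
structure SolvesAt (α : ℝ) (Θ : ℝ → LagState) (ξ : ℝ) (q w hb h r : ℝ → ℝ) : Prop where
  tau_tendsto : Tendsto (breakTime q) atTop (𝓝 ⊤)
  y_eq : Evolves (fun t => (Θ t).y ξ) (fun t => (Θ t).U ξ)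
  U_eq : Evolves (fun t => (Θ t).U ξ) (fun t => -(Θ t).Q ξ)
  q_eq : Evolves q w
  w_eq : Evolves w (fun t => 1 / 2 * hb t + ((Θ t).U ξ ^ 2 - (Θ t).P ξ) * q t)
  h_eq : Evolves h (fun t => 2 * ((Θ t).U ξ ^ 2 - (Θ t).P ξ) * w t)
  r_eq : Evolves r (fun _ => 0)
  hb_eq : ∀ (n : ℕ) (a t : ℝ), breakTime q n = a → a ≤ t → (t : EReal) < breakTime q (n + 1) →
    hb t - hb a = h t - h a
  hb_jump : ∀ (n : ℕ) (a : ℝ), breakTime q (n + 1) = a →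
    ∃ l : ℝ, Tendsto hb (𝓝[<] a) (𝓝 l) ∧ hb a = (1 - α) * l

/-- `Θ` is a global `α`-dissipative solution in Lagrangian coordinates (only the values `Θ(t)` with
`t ≥ 0` matter). -/
def IsDissipativeSolution (α : ℝ) (Θ : ℝ → LagState) : Prop :=
  SolutionRegularity Θ ∧
    ∃ q w hb h r : ℝ → ℝ → ℝ, Represents Θ q w hb h r ∧
      (∀ n, AEMeasurable (fun ξ => breakTime (fun t => q t ξ) n) volume) ∧
      ∀ᵐ ξ, SolvesAt α Θ ξ (fun t => q t ξ) (fun t => w t ξ) (fun t => hb t ξ) (fun t => h t ξ)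
        (fun t => r t ξ)

end

noncomputable section

/-! ### Calculus of primitives -/

/-- `f` is the primitive of the integrable function `f'` on the interval between `a` and `b`. -/
def IsPrimitiveOn (f f' : ℝ → ℝ) (a b : ℝ) : Prop :=
  IntervalIntegrable f' volume a b ∧ ∀ t ∈ uIcc a b, f t = f a + ∫ x in a..t, f' x

namespace IsPrimitiveOn

variable {f f' g g' : ℝ → ℝ} {a b : ℝ}

lemma ac (h : IsPrimitiveOn f f' a b) : AbsolutelyContinuousOnInterval f a b := by
  have h1 := (h.1.absolutelyContinuousOnInterval_intervalIntegral (c := a) (by simp))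
  have h2 : AbsolutelyContinuousOnInterval (fun _ : ℝ => f a) a b :=
    (LipschitzWith.const (f a)).lipschitzOnWith.absolutelyContinuousOnInterval (K := 0)
  rw [absolutelyContinuousOnInterval_iff] at *
  intro ε hε
  obtain ⟨δ, hδ, H⟩ := h1 ε hε
  refine ⟨δ, hδ, fun E hE hlt => ?_⟩
  have := H E hE hlt
  convert this using 2 with i hi
  rw [h.2 _ (hE.1 i hi).1, h.2 _ (hE.1 i hi).2]
  simp

lemma continuousOn (h : IsPrimitiveOn f f' a b) : ContinuousOn f (uIcc a b) :=
  h.ac.continuousOn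

lemma ae_hasDerivAt (h : IsPrimitiveOn f f' a b) :
    ∀ᵐ t, t ∈ uIcc a b → HasDerivAt f (f' t) t := by
  have h₁ : ∀ᵐ x : ℝ, x ≠ a := by simp [ae_iff, measure_singleton]
  have h₂ : ∀ᵐ x : ℝ, x ≠ b := by simp [ae_iff, measure_singleton]
  filter_upwards [h.1.ae_hasDerivAt_integral, h₁, h₂] with t ht ha hb hm
  have h3 := (ht hm a (by simp)).const_add (f a)
  refine h3.congr_of_eventuallyEq ?_
  have : Ioo (min a b) (max a b) ∈ 𝓝 t := by
    refine Ioo_mem_nhds ?_ ?_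
    · rcases hm with ⟨h1, h2⟩
      rcases le_total a b with hab | hab
      · rw [inf_eq_left.2 hab] at *; exact lt_of_le_of_ne h1 (Ne.symm ha)
      · rw [inf_eq_right.2 hab] at *; exact lt_of_le_of_ne h1 (Ne.symm hb)
    · rcases hm with ⟨h1, h2⟩
      rcases le_total a b with hab | hab
      · rw [sup_eq_right.2 hab] at *; exact lt_of_le_of_ne h2 hb
      · rw [sup_eq_left.2 hab] at *; exact lt_of_le_of_ne h2 ha
  filter_upwards [this] with s hs
  exact h.2 s ⟨hs.1.le, hs.2.le⟩

lemma of_ac (h : AbsolutelyContinuousOnInterval f a b)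
    (hd : ∀ᵐ t, t ∈ uIcc a b → HasDerivAt f (f' t) t) : IsPrimitiveOn f f' a b := by
  have key : ∀ c ∈ uIcc a b, EqOn f' f' (uIcc a c) ∧ ∀ᵐ t, t ∈ uIoc a c → deriv f t = f' t := by
    intro c hc
    refine ⟨fun _ _ => rfl, ?_⟩
    filter_upwards [hd] with t ht hm
    exact (ht (uIcc_subset_uIcc_left hc (uIoc_subset_uIcc hm))).deriv
  refine ⟨?_, fun t ht => ?_⟩
  · refine h.intervalIntegrable_deriv.congr_ae ?_
    exact (ae_restrict_iff' measurableSet_uIoc).2 (key b (by simp)).2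
  · have h1 := (h.mono (uIcc_subset_uIcc_left ht)).integral_deriv_eq_sub
    rw [intervalIntegral.integral_congr_ae (key t ht).2] at h1
    linarith

lemma congr_deriv (h : IsPrimitiveOn f f' a b) (hd : ∀ᵐ t, t ∈ uIcc a b → f' t = g' t) :
    IsPrimitiveOn f g' a b := by
  refine of_ac h.ac ?_
  filter_upwards [h.ae_hasDerivAt, hd] with t h1 h2 ht
  rw [← h2 ht]; exact h1 ht

lemma congr (h : IsPrimitiveOn f f' a b) (hd : EqOn g f (uIcc a b)) :
    IsPrimitiveOn g f' a b :=
  ⟨h.1, fun t ht => by rw [hd ht, hd (by simp : a ∈ uIcc a b)]; exact h.2 t ht⟩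

lemma const (c : ℝ) : IsPrimitiveOn (fun _ => c) (fun _ => 0) a b :=
  ⟨by simp, by simp⟩

lemma add (hf : IsPrimitiveOn f f' a b) (hg : IsPrimitiveOn g g' a b) :
    IsPrimitiveOn (fun t => f t + g t) (fun t => f' t + g' t) a b := by
  refine of_ac (hf.ac.add hg.ac) ?_
  filter_upwards [hf.ae_hasDerivAt, hg.ae_hasDerivAt] with t h1 h2 ht
  exact (h1 ht).add (h2 ht)

lemma sub (hf : IsPrimitiveOn f f' a b) (hg : IsPrimitiveOn g g' a b) :
    IsPrimitiveOn (fun t => f t - g t) (fun t => f' t - g' t) a b := by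
  refine of_ac (hf.ac.sub hg.ac) ?_
  filter_upwards [hf.ae_hasDerivAt, hg.ae_hasDerivAt] with t h1 h2 ht
  exact (h1 ht).sub (h2 ht)

lemma mul (hf : IsPrimitiveOn f f' a b) (hg : IsPrimitiveOn g g' a b) :
    IsPrimitiveOn (fun t => f t * g t) (fun t => f' t * g t + f t * g' t) a b := by
  refine of_ac (hf.ac.mul hg.ac) ?_
  filter_upwards [hf.ae_hasDerivAt, hg.ae_hasDerivAt] with t h1 h2 ht
  exact (h1 ht).mul (h2 ht)

lemma const_mul (c : ℝ) (hf : IsPrimitiveOn f f' a b) :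
    IsPrimitiveOn (fun t => c * f t) (fun t => c * f' t) a b := by
  refine of_ac (hf.ac.const_mul c) ?_
  filter_upwards [hf.ae_hasDerivAt] with t h1 ht
  exact (h1 ht).const_mul c

lemma neg (hf : IsPrimitiveOn f f' a b) :
    IsPrimitiveOn (fun t => - f t) (fun t => - f' t) a b := by
  refine of_ac hf.ac.neg ?_
  filter_upwards [hf.ae_hasDerivAt] with t h1 ht
  exact (h1 ht).neg

lemma sum {ι : Type*} (s : Finset ι) {F F' : ι → ℝ → ℝ}
    (h : ∀ i ∈ s, IsPrimitiveOn (F i) (F' i) a b) :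
    IsPrimitiveOn (fun t => ∑ i ∈ s, F i t) (fun t => ∑ i ∈ s, F' i t) a b := by
  classical
  induction s using Finset.induction_on with
  | empty => simpa using const 0
  | insert i s hi ih =>
    simp only [Finset.sum_insert hi]
    exact (h i (by simp)).add (ih fun j hj => h j (by simp [hj]))

lemma mono (hf : IsPrimitiveOn f f' a b) {c d : ℝ} (hc : c ∈ uIcc a b) (hd : d ∈ uIcc a b) :
    IsPrimitiveOn f f' c d := by
  have hs : uIcc c d ⊆ uIcc a b := uIcc_subset_uIcc hc hd
  refine of_ac (hf.ac.mono hs) ?_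
  filter_upwards [hf.ae_hasDerivAt] with t h1 ht
  exact h1 (hs ht)

lemma eq_add (hf : IsPrimitiveOn f f' a b) : f b = f a + ∫ x in a..b, f' x :=
  hf.2 b (by simp)

lemma _root_.AbsolutelyContinuousOnInterval.comp_lipschitzOn {Φ : ℝ → ℝ} {s : Set ℝ} {K : ℝ≥0}
    (hf : AbsolutelyContinuousOnInterval f a b) (hΦ : LipschitzOnWith K Φ s)
    (hs : MapsTo f (uIcc a b) s) : AbsolutelyContinuousOnInterval (fun t => Φ (f t)) a b := by
  rw [absolutelyContinuousOnInterval_iff] at *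
  intro ε hε
  obtain ⟨δ, hδ, H⟩ := hf (ε / (K + 1)) (by positivity)
  refine ⟨δ, hδ, fun E hE hlt => ?_⟩
  have h1 := H E hE hlt
  have hE1 := hE.1
  have hK : (0 : ℝ) < K + 1 := by positivity
  calc _ ≤ ∑ i ∈ Finset.range E.1, (K + 1 : ℝ) * dist (f (E.2 i).1) (f (E.2 i).2) := by
        refine Finset.sum_le_sum fun i hi => ?_
        refine (hΦ.dist_le_mul _ (hs (hE1 i hi).1) _ (hs (hE1 i hi).2)).trans ?_
        gcongr; linarith
    _ = (K + 1) * ∑ i ∈ Finset.range E.1, dist (f (E.2 i).1) (f (E.2 i).2) := by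
        rw [Finset.mul_sum]
    _ < (K + 1) * (ε / (K + 1)) := by gcongr
    _ = ε := by field_simp

/-- Chain rule for a Lipschitz outer function that is differentiable at almost all times. -/
lemma comp_lipschitz {Φ Φ' : ℝ → ℝ} {K : ℝ≥0} (hf : IsPrimitiveOn f f' a b)
    (hΦ : LipschitzWith K Φ) (hd : ∀ᵐ t, t ∈ uIcc a b → HasDerivAt Φ (Φ' (f t)) (f t)) :
    IsPrimitiveOn (fun t => Φ (f t)) (fun t => Φ' (f t) * f' t) a b := by
  refine of_ac (hf.ac.comp_lipschitzOn (hΦ.lipschitzOnWith (s := univ)) (mapsTo_univ _ _)) ?_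
  filter_upwards [hf.ae_hasDerivAt, hd] with t h1 h2 ht
  exact (h2 ht).comp t (h1 ht)

/-- Chain rule for a continuously differentiable outer function. -/
lemma comp_contDiff {Φ Φ' : ℝ → ℝ} (hf : IsPrimitiveOn f f' a b)
    (hΦ : ContDiff ℝ 1 Φ) (hd : ∀ x, HasDerivAt Φ (Φ' x) x) :
    IsPrimitiveOn (fun t => Φ (f t)) (fun t => Φ' (f t) * f' t) a b := by
  obtain ⟨C, hC⟩ := hf.ac.exists_bound
  obtain ⟨K, hK⟩ := (hΦ.contDiffOn (s := Icc (-C) C)).exists_lipschitzOnWith (by decide)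
    (convex_Icc _ _) isCompact_Icc
  refine of_ac (hf.ac.comp_lipschitzOn hK fun t ht => ?_) ?_
  · exact abs_le.1 (hC t ht)
  · filter_upwards [hf.ae_hasDerivAt] with t h1 ht
    exact (hd _).comp t (h1 ht)

lemma exp (hf : IsPrimitiveOn f f' a b) :
    IsPrimitiveOn (fun t => Real.exp (f t)) (fun t => Real.exp (f t) * f' t) a b :=
  hf.comp_contDiff Real.contDiff_exp Real.hasDerivAt_exp

lemma le_of_deriv_nonneg (hf : IsPrimitiveOn f f' a b) (hab : a ≤ b)
    (h : ∀ᵐ t, t ∈ Icc a b → 0 ≤ f' t) : f a ≤ f b := by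
  rw [hf.eq_add]
  have : 0 ≤ ∫ x in a..b, f' x := by
    refine intervalIntegral.integral_nonneg_of_ae_restrict hab ?_
    exact (ae_restrict_iff' measurableSet_Icc).2 h
  linarith

lemma abs_sub_le (hf : IsPrimitiveOn f f' a b) (hab : a ≤ b) {C : ℝ}
    (h : ∀ t ∈ Icc a b, |f' t| ≤ C) : |f b - f a| ≤ C * (b - a) := by
  rw [hf.eq_add, add_sub_cancel_left]
  have := intervalIntegral.norm_integral_le_of_norm_le_const (a := a) (b := b) (f := f') (C := C)
    (fun x hx => h x (by rw [uIoc_of_le hab] at hx; exact ⟨hx.1.le, hx.2⟩))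
  rwa [Real.norm_eq_abs, abs_of_nonneg (sub_nonneg.2 hab)] at this

end IsPrimitiveOn

lemma intervalIntegrable_of_abs_le {f : ℝ → ℝ} {a b C : ℝ}
    (hf : AEMeasurable f (volume.restrict (uIoc a b))) (hC : ∀ t ∈ uIoc a b, |f t| ≤ C) :
    IntervalIntegrable f volume a b := by
  rw [intervalIntegrable_iff]
  have : IsFiniteMeasure (volume.restrict (uIoc a b)) := ⟨by simp [uIoc]⟩
  refine Integrable.of_bound (C := C) hf.aestronglyMeasurable ?_
  exact (ae_restrict_iff' measurableSet_uIoc).2 (.of_forall hC)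

/-! ### Angle variables -/

/-- The factor picked up by the energy density when the angle has reached the value `θ`: it is
multiplied by `β` whenever a positive multiple of `π` is passed. -/
def crossFactor (β θ : ℝ) : ℝ := β ^ ⌊θ / Real.pi⌋₊

lemma crossFactor_nonneg {β : ℝ} (hβ : 0 ≤ β) (θ : ℝ) : 0 ≤ crossFactor β θ := pow_nonneg hβ _

lemma crossFactor_le_one {β : ℝ} (hβ : 0 ≤ β) (hβ1 : β ≤ 1) (θ : ℝ) : crossFactor β θ ≤ 1 :=
  pow_le_one₀ hβ hβ1

lemma abs_crossFactor_le {β : ℝ} (hβ : β ∈ Icc (0 : ℝ) 1) (θ : ℝ) : |crossFactor β θ| ≤ 1 := by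
  rw [abs_of_nonneg (crossFactor_nonneg hβ.1 θ)]; exact crossFactor_le_one hβ.1 hβ.2 θ

lemma crossFactor_one (θ : ℝ) : crossFactor 1 θ = 1 := one_pow _

lemma measurable_crossFactor : Measurable (fun p : ℝ × ℝ => crossFactor p.1 p.2) := by
  unfold crossFactor
  have h1 : Measurable fun p : ℝ × ℝ => ⌊p.2 / Real.pi⌋₊ :=
    Nat.measurable_floor.comp (measurable_snd.div_const _)
  exact measurable_fst.pow h1

lemma floor_div_pi_eq {θ : ℝ} {n : ℕ} (h1 : n * Real.pi ≤ θ) (h2 : θ < (n + 1) * Real.pi) :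
    ⌊θ / Real.pi⌋₊ = n := by
  have hp := Real.pi_pos
  rw [Nat.floor_eq_iff (div_nonneg (le_trans (by positivity) h1) hp.le)]
  exact ⟨by rwa [le_div_iff₀ hp], by rwa [div_lt_iff₀ hp]⟩

lemma le_floor_div_pi_iff {θ : ℝ} {n : ℕ} (hn : n ≠ 0) :
    n ≤ ⌊θ / Real.pi⌋₊ ↔ n * Real.pi ≤ θ := by
  rw [Nat.le_floor_iff' hn, le_div_iff₀ Real.pi_pos]

lemma exists_between_of_floor_lt {θ θ' : ℝ} (h : ⌊θ / Real.pi⌋₊ < ⌊θ' / Real.pi⌋₊) :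
    ∃ n : ℕ, n ≠ 0 ∧ θ < n * Real.pi ∧ n * Real.pi ≤ θ' := by
  refine ⟨⌊θ' / Real.pi⌋₊, by omega, ?_, (le_floor_div_pi_iff (by omega)).1 le_rfl⟩
  by_contra hc
  have := (le_floor_div_pi_iff (θ := θ) (n := ⌊θ' / Real.pi⌋₊) (by omega)).2 (not_lt.1 hc)
  omega

/-- If the factors differ, a multiple of `π` lies between the angles. -/
lemma exists_between_of_crossFactor_ne {β θ θ' : ℝ} (h : crossFactor β θ ≠ crossFactor β θ') :
    ∃ n : ℕ, n ≠ 0 ∧ |θ - n * Real.pi| ≤ |θ - θ'| ∧ |θ' - n * Real.pi| ≤ |θ - θ'| ∧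
      |θ - n * Real.pi| + |θ' - n * Real.pi| = |θ - θ'| := by
  rcases lt_trichotomy ⌊θ / Real.pi⌋₊ ⌊θ' / Real.pi⌋₊ with h1 | h1 | h1
  · obtain ⟨n, hn, h2, h3⟩ := exists_between_of_floor_lt h1
    refine ⟨n, hn, ?_, ?_, ?_⟩ <;>
    rw [abs_of_nonpos (by linarith : θ - θ' ≤ 0)] <;>
    first | rw [abs_of_neg (by linarith : θ - n * Real.pi < 0),
            abs_of_nonneg (by linarith : 0 ≤ θ' - n * Real.pi)]
          | rw [abs_of_neg (by linarith : θ - n * Real.pi < 0)]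
          | rw [abs_of_nonneg (by linarith : 0 ≤ θ' - n * Real.pi)]
    all_goals linarith
  · exact absurd (by unfold crossFactor; rw [h1]) h
  · obtain ⟨n, hn, h2, h3⟩ := exists_between_of_floor_lt h1
    refine ⟨n, hn, ?_, ?_, ?_⟩ <;>
    rw [abs_of_nonneg (by linarith : 0 ≤ θ - θ')] <;>
    first | rw [abs_of_neg (by linarith : θ' - n * Real.pi < 0),
            abs_of_nonneg (by linarith : 0 ≤ θ - n * Real.pi)]
          | rw [abs_of_neg (by linarith : θ' - n * Real.pi < 0)]
          | rw [abs_of_nonneg (by linarith : 0 ≤ θ - n * Real.pi)]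
    all_goals linarith

/-- A Lipschitz function that vanishes at the multiples of `π` stays Lipschitz with the factor. -/
lemma abs_crossFactor_mul_sub_le {β L : ℝ} (hβ : β ∈ Icc (0 : ℝ) 1) {f : ℝ → ℝ}
    (hf : ∀ x y, |f x - f y| ≤ L * |x - y|) (h0 : ∀ n : ℕ, f (n * Real.pi) = 0) (θ θ' : ℝ) :
    |crossFactor β θ * f θ - crossFactor β θ' * f θ'| ≤ L * |θ - θ'| := by
  by_cases h : crossFactor β θ = crossFactor β θ'
  · rw [h, ← mul_sub, abs_mul]
    exact (mul_le_of_le_one_left (abs_nonneg _) (abs_crossFactor_le hβ _)).trans (hf _ _)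
  · obtain ⟨n, -, -, -, h3⟩ := exists_between_of_crossFactor_ne h
    have key : ∀ x, |crossFactor β x * f x| ≤ L * |x - n * Real.pi| := fun x => by
      rw [abs_mul]
      refine (mul_le_of_le_one_left (abs_nonneg _) (abs_crossFactor_le hβ _)).trans ?_
      have := hf x (n * Real.pi)
      rwa [h0, sub_zero] at this
    refine (abs_sub _ _).trans ?_
    rw [← h3, mul_add]
    exact add_le_add (key θ) (key θ')

lemma crossFactor_eventually_eq {β θ : ℝ} (h : ∀ n : ℕ, θ ≠ n * Real.pi) :
    ∀ᶠ x in 𝓝 θ, crossFactor β x = crossFactor β θ := by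
  have hp := Real.pi_pos
  rcases lt_or_ge θ 0 with h0 | h0
  · have : ∀ x < 0, crossFactor β x = 1 := fun x hx => by
      unfold crossFactor
      rw [Nat.floor_of_nonpos (div_nonpos_of_nonpos_of_nonneg hx.le hp.le), pow_zero]
    filter_upwards [Iio_mem_nhds h0] with x hx
    rw [this x hx, this θ h0]
  · set n := ⌊θ / Real.pi⌋₊ with hn
    have h1 : n * Real.pi ≤ θ := by
      rw [← le_div_iff₀ hp]; exact Nat.floor_le (div_nonneg h0 hp.le)
    have h2 : θ < (n + 1) * Real.pi := by
      rw [← div_lt_iff₀ hp]; exact Nat.lt_floor_add_one _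
    have h3 : n * Real.pi < θ := lt_of_le_of_ne h1 (h n).symm
    filter_upwards [Ioo_mem_nhds h3 h2] with x hx
    unfold crossFactor
    rw [floor_div_pi_eq hx.1.le hx.2, floor_div_pi_eq h1 h2]

lemma hasDerivAt_crossFactor_mul {β θ : ℝ} {f : ℝ → ℝ} {f' : ℝ} (h : ∀ n : ℕ, θ ≠ n * Real.pi)
    (hf : HasDerivAt f f' θ) :
    HasDerivAt (fun x => crossFactor β x * f x) (crossFactor β θ * f') θ := by
  refine (hf.const_mul (crossFactor β θ)).congr_of_eventuallyEq ?_
  filter_upwards [crossFactor_eventually_eq (β := β) h] with x hx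
  rw [hx]

/-- The contributions of one component to `y_ξ`, `U_ξ` and `h̄`. -/
def angQ (β θ κ : ℝ) : ℝ := Real.exp κ * (crossFactor β θ * Real.sin θ ^ 2)
def angW (β θ κ : ℝ) : ℝ := Real.exp κ * (crossFactor β θ * (Real.sin θ * Real.cos θ))
def angH (β θ κ : ℝ) : ℝ := Real.exp κ * (crossFactor β θ * Real.cos θ ^ 2)

/-- The right hand sides of the equations for `θ` and `κ`. -/
def angF (a θ : ℝ) : ℝ := 1 / 2 * Real.cos θ ^ 2 - a * Real.sin θ ^ 2
def angG (a θ : ℝ) : ℝ := (1 / 2 + a) * (2 * (Real.sin θ * Real.cos θ))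

lemma abs_sin_sq_sub_le (x y : ℝ) : |Real.sin x ^ 2 - Real.sin y ^ 2| ≤ 2 * |x - y| := by
  have h1 : |Real.sin x - Real.sin y| ≤ |x - y| := by
    simpa [Real.dist_eq] using Real.lipschitzWith_sin.dist_le_mul x y
  have h2 : |Real.sin x + Real.sin y| ≤ 2 := (abs_add_le _ _).trans
    (by linarith [Real.abs_sin_le_one x, Real.abs_sin_le_one y])
  rw [sq_sub_sq, abs_mul]
  exact mul_le_mul h2 h1 (abs_nonneg _) (by norm_num)

lemma abs_cos_sq_sub_le (x y : ℝ) : |Real.cos x ^ 2 - Real.cos y ^ 2| ≤ 2 * |x - y| := by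
  rw [Real.cos_sq', Real.cos_sq', sub_sub_sub_cancel_left, abs_sub_comm]
  exact abs_sin_sq_sub_le x y

lemma abs_sin_mul_cos_sub_le (x y : ℝ) :
    |Real.sin x * Real.cos x - Real.sin y * Real.cos y| ≤ 2 * |x - y| := by
  have h1 : |Real.sin x - Real.sin y| ≤ |x - y| := by
    simpa [Real.dist_eq] using Real.lipschitzWith_sin.dist_le_mul x y
  have h2 : |Real.cos x - Real.cos y| ≤ |x - y| := by
    simpa [Real.dist_eq] using Real.lipschitzWith_cos.dist_le_mul x y
  have : Real.sin x * Real.cos x - Real.sin y * Real.cos y =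
    (Real.sin x - Real.sin y) * Real.cos x + Real.sin y * (Real.cos x - Real.cos y) := by ring
  rw [this]
  refine (abs_add_le _ _).trans ?_
  rw [abs_mul, abs_mul, two_mul]
  exact add_le_add
    ((mul_le_of_le_one_right (abs_nonneg _) (Real.abs_cos_le_one x)).trans h1)
    ((mul_le_of_le_one_left (abs_nonneg _) (Real.abs_sin_le_one y)).trans h2)

lemma abs_sin_mul_cos_le (x : ℝ) : |Real.sin x * Real.cos x| ≤ 1 / 2 := by
  rw [abs_le]
  constructor <;> nlinarith [Real.sin_sq_add_cos_sq x, sq_nonneg (Real.sin x - Real.cos x),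
    sq_nonneg (Real.sin x + Real.cos x)]

lemma angF_bound {a A θ : ℝ} (ha : |a| ≤ A) : |angF a θ| ≤ 1 / 2 + A := by
  unfold angF
  have h1 := Real.sin_sq_add_cos_sq θ
  have h2 := sq_nonneg (Real.sin θ)
  have h3 := sq_nonneg (Real.cos θ)
  have hA := (abs_nonneg a).trans ha
  rw [abs_le] at *
  constructor <;> nlinarith [mul_nonneg hA h2, mul_nonneg hA h3]

lemma angG_bound {a A θ : ℝ} (ha : |a| ≤ A) : |angG a θ| ≤ 1 / 2 + A := by
  unfold angG
  have hA := (abs_nonneg a).trans ha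
  rw [abs_mul, abs_mul, abs_two]
  have h1 := abs_sin_mul_cos_le θ
  have h2 : |1 / 2 + a| ≤ 1 / 2 + A := (abs_add_le _ _).trans (by norm_num; exact ha)
  calc _ ≤ (1 / 2 + A) * 1 := mul_le_mul h2 (by linarith) (by positivity) (by linarith)
    _ = _ := mul_one _

section AngleDynamics

variable {a θ κ : ℝ → ℝ} {s t A β : ℝ}

/-- Multiples of `π` are crossed upwards only. -/
lemma angle_lt_of_le (hst : s < t) (hθ : IsPrimitiveOn θ (fun r => angF (a r) (θ r)) s t)
    (hA : ∀ r ∈ Icc s t, |a r| ≤ A) {z : ℤ} (hz : z * Real.pi ≤ θ s) : z * Real.pi < θ t := by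
  have hA0 : 0 ≤ A := (abs_nonneg _).trans (hA s ⟨le_rfl, hst.le⟩)
  set L := 1 / 2 + A
  set φ : ℝ → ℝ := fun r => θ r - z * Real.pi with hφ
  have hφp : IsPrimitiveOn φ (fun r => angF (a r) (θ r)) s t := by
    simpa using hθ.sub (IsPrimitiveOn.const (z * Real.pi))
  set c : ℝ → ℝ := fun r => if 0 ≤ φ r then L else -L with hc
  have hcint : IntervalIntegrable c volume s t := by
    refine intervalIntegrable_of_abs_le (C := L) ?_ (fun r _ => ?_)
    · have h1 : AEMeasurable φ (volume.restrict (uIoc s t)) :=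
        (hφp.continuousOn.mono uIoc_subset_uIcc).aemeasurable measurableSet_uIoc
      have h2 : Measurable (fun x : ℝ => if 0 ≤ x then L else -L) :=
        Measurable.ite measurableSet_Ici measurable_const measurable_const
      exact h2.comp_aemeasurable h1
    · simp only [hc]; split_ifs <;> simp [abs_of_nonneg (by positivity : 0 ≤ L)]
  have hCp : IsPrimitiveOn (fun r => ∫ x in s..r, c x) c s t := ⟨hcint, by simp⟩
  have hprod := hCp.exp.mul hφp
  have hlow : ∀ r ∈ Icc s t, 1 / 2 ≤ c r * φ r + angF (a r) (θ r) := by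
    intro r hr
    have h1 : Real.sin (θ r) ^ 2 ≤ |φ r| := by
      have h2 : |Real.sin (θ r)| = |Real.sin (φ r)| := by
        simp only [hφ, Real.sin_sub_int_mul_pi]
        rw [abs_mul, abs_zpow]; simp
      rw [← sq_abs, h2]
      have h3 := Real.abs_sin_le_one (φ r)
      have h4 : |Real.sin (φ r)| ≤ |φ r| := Real.abs_sin_le_abs
      nlinarith [abs_nonneg (Real.sin (φ r))]
    have h2 : 1 / 2 - L * Real.sin (θ r) ^ 2 ≤ angF (a r) (θ r) := by
      unfold angF
      rw [Real.cos_sq']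
      have := (abs_le.1 (hA r hr)).2
      have h3 := sq_nonneg (Real.sin (θ r))
      simp only [L]
      nlinarith
    have h3 : c r * φ r = L * |φ r| := by
      simp only [hc]; split_ifs with h
      · rw [abs_of_nonneg h]
      · rw [abs_of_neg (not_le.1 h)]; ring
    have : L * Real.sin (θ r) ^ 2 ≤ L * |φ r| := by gcongr
    linarith
  set E : ℝ → ℝ := fun r => Real.exp (∫ x in s..r, c x)
  have hEc : ContinuousOn E (uIcc s t) := hCp.exp.continuousOn
  have hEint : IntervalIntegrable E volume s t := hEc.intervalIntegrable
  have hEp : IsPrimitiveOn (fun r => ∫ x in s..r, 1 / 2 * E x) (fun r => 1 / 2 * E r) s t :=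
    ⟨hEint.const_mul _, by simp⟩
  have h5 := (hprod.sub hEp).le_of_deriv_nonneg hst.le (.of_forall fun r hr => by
    have h6 := hlow r hr
    have h7 : 0 < E r := Real.exp_pos _
    have : E r * c r * φ r + E r * angF (a r) (θ r) - 1 / 2 * E r
      = E r * (c r * φ r + angF (a r) (θ r) - 1 / 2) := by ring
    exact this ▸ mul_nonneg h7.le (by linarith))
  have h6 : 0 < ∫ x in s..t, 1 / 2 * E x :=
    intervalIntegral.intervalIntegral_pos_of_pos_on (hEint.const_mul _)
      (fun x _ => by positivity) hst
  simp only [intervalIntegral.integral_same, Real.exp_zero, one_mul, sub_zero] at h5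
  have h7 : 0 ≤ φ s := by simp only [hφ]; linarith
  have h8 : 0 < E t * φ t := by
    have : φ s ≤ E t * φ t - ∫ x in s..t, 1 / 2 * E x := h5
    linarith
  have h9 : 0 < φ t := (pos_iff_pos_of_mul_pos h8).1 (Real.exp_pos _)
  simp only [hφ] at h9
  linarith

variable (hst : s ≤ t) (hθ : IsPrimitiveOn θ (fun r => angF (a r) (θ r)) s t)
  (hκ : IsPrimitiveOn κ (fun r => angG (a r) (θ r)) s t)
  (hA : ∀ r ∈ Icc s t, |a r| ≤ A) (hβ : β ∈ Icc (0 : ℝ) 1)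

include hθ hA in
lemma angle_lt_of_le' {r r' : ℝ} (hr : r ∈ Icc s t) (hr' : r' ∈ Icc s t) (hlt : r < r') {n : ℕ}
    (hz : n * Real.pi ≤ θ r) : n * Real.pi < θ r' := by
  have hst := hr.1.trans hr.2
  have hsub : IsPrimitiveOn θ (fun r => angF (a r) (θ r)) r r' :=
    hθ.mono (by rwa [uIcc_of_le hst]) (by rwa [uIcc_of_le hst])
  have := angle_lt_of_le (z := (n : ℤ)) hlt hsub
    (fun x hx => hA x ⟨hr.1.trans hx.1, hx.2.trans hr'.2⟩) (by simpa using hz)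
  simpa using this

include hst hθ hA in
lemma ae_angle_ne : ∀ᵐ r, r ∈ uIcc s t → ∀ n : ℕ, θ r ≠ n * Real.pi := by
  have h1 : (⋃ n : ℕ, {r | r ∈ Icc s t ∧ θ r = n * Real.pi}).Countable := by
    refine countable_iUnion fun n => Set.Subsingleton.countable fun r hr r' hr' => ?_
    by_contra hne
    rcases lt_or_gt_of_ne hne with h | h
    · exact absurd hr'.2 (angle_lt_of_le' hθ hA hr.1 hr'.1 h hr.2.ge).ne'
    · exact absurd hr.2 (angle_lt_of_le' hθ hA hr'.1 hr.1 h hr'.2.ge).ne'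
  filter_upwards [h1.ae_notMem volume] with r hr hm n hn
  rw [uIcc_of_le hst] at hm
  exact hr (mem_iUnion.2 ⟨n, hm, hn⟩)

include hθ hA hβ in
lemma crossFactor_antitoneOn : AntitoneOn (fun r => crossFactor β (θ r)) (Icc s t) := by
  intro r hr r' hr' hle
  refine pow_le_pow_of_le_one hβ.1 hβ.2 ?_
  rcases hle.eq_or_lt with rfl | hlt
  · exact le_rfl
  by_cases h0 : ⌊θ r / Real.pi⌋₊ = 0
  · omega
  · exact (le_floor_div_pi_iff h0).2
      (angle_lt_of_le' hθ hA hr hr' hlt ((le_floor_div_pi_iff h0).1 le_rfl)).le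

include hst hθ hκ hA hβ in
lemma isPrimitiveOn_ang {f f' : ℝ → ℝ} (hf : ∀ x y, |f x - f y| ≤ 2 * |x - y|)
    (h0 : ∀ n : ℕ, f (n * Real.pi) = 0) (hd : ∀ x, HasDerivAt f (f' x) x) :
    IsPrimitiveOn (fun r => Real.exp (κ r) * (crossFactor β (θ r) * f (θ r)))
      (fun r => Real.exp (κ r) * (crossFactor β (θ r) *
        (angG (a r) (θ r) * f (θ r) + f' (θ r) * angF (a r) (θ r)))) s t := by
  have h1 : LipschitzWith 2 (fun x => crossFactor β x * f x) :=
    LipschitzWith.of_dist_le_mul fun x y => by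
      simpa [Real.dist_eq] using abs_crossFactor_mul_sub_le hβ hf h0 x y
  have h2 := hθ.comp_lipschitz (Φ' := fun x => crossFactor β x * f' x) h1 (by
    filter_upwards [ae_angle_ne hst hθ hA] with r hr hm
    exact hasDerivAt_crossFactor_mul (hr hm) (hd _))
  refine (hκ.exp.mul h2).congr_deriv (.of_forall fun r _ => ?_)
  ring

include hst hθ hκ hA hβ in
lemma isPrimitiveOn_angQ : IsPrimitiveOn (fun r => angQ β (θ r) (κ r))
    (fun r => angW β (θ r) (κ r)) s t := by
  refine (isPrimitiveOn_ang hst hθ hκ hA hβ (f := fun x => Real.sin x ^ 2)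
    (f' := fun x => 2 * Real.sin x * Real.cos x)
    abs_sin_sq_sub_le (fun n => by simp) (fun x => ?_)).congr_deriv (.of_forall fun r _ => ?_)
  · have := (Real.hasDerivAt_sin x).fun_pow 2
    simpa using this
  · unfold angW angG angF
    have := Real.sin_sq_add_cos_sq (θ r)
    have h2 : Real.cos (θ r) ^ 2 = 1 - Real.sin (θ r) ^ 2 := by linarith
    linear_combination (Real.exp (κ r) * crossFactor β (θ r) * Real.sin (θ r) * Real.cos (θ r)) * this

include hst hθ hκ hA hβ in
lemma isPrimitiveOn_angW : IsPrimitiveOn (fun r => angW β (θ r) (κ r))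
    (fun r => 1 / 2 * angH β (θ r) (κ r) + a r * angQ β (θ r) (κ r)) s t := by
  refine (isPrimitiveOn_ang hst hθ hκ hA hβ (f := fun x => Real.sin x * Real.cos x)
    (f' := fun x => Real.cos x * Real.cos x + Real.sin x * (-Real.sin x))
    abs_sin_mul_cos_sub_le (fun n => by simp) (fun x => ?_)).congr_deriv (.of_forall fun r _ => ?_)
  · exact (Real.hasDerivAt_sin x).mul (Real.hasDerivAt_cos x)
  · unfold angH angQ angG angF
    have := Real.sin_sq_add_cos_sq (θ r)
    linear_combination (Real.exp (κ r) * crossFactor β (θ r) *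
      (1 / 2 * Real.cos (θ r) ^ 2 + a r * Real.sin (θ r) ^ 2)) * this

include hθ hκ in
/-- Between crossings the energy density solves `h̄' = 2 a U_ξ`. -/
lemma isPrimitiveOn_angH {c : ℝ} (hc : ∀ r ∈ uIcc s t, crossFactor β (θ r) = c) :
    IsPrimitiveOn (fun r => angH β (θ r) (κ r)) (fun r => 2 * (a r * angW β (θ r) (κ r))) s t := by
  have h1 : IsPrimitiveOn (fun r => Real.exp (κ r) * (c * Real.cos (θ r) ^ 2)) _ s t :=
    hκ.exp.mul ((hθ.comp_contDiff (Φ := fun x => c * Real.cos x ^ 2)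
      (Φ' := fun x => c * (2 * Real.cos x * (-Real.sin x))) (by fun_prop)
      (fun x => by simpa using ((Real.hasDerivAt_cos x).pow 2).const_mul c)))
  refine (h1.congr fun r hr => by simp only [angH, hc r hr]).congr_deriv (.of_forall fun r hr => ?_)
  unfold angW angG angF
  rw [hc r hr]
  have := Real.sin_sq_add_cos_sq (θ r)
  linear_combination (2 * a r * Real.exp (κ r) * c * Real.sin (θ r) * Real.cos (θ r)) * this

end AngleDynamics

/-- A nonincreasing factor in front of a Lipschitz function. -/
lemma antitone_mul_le {m E E' : ℝ → ℝ} {s t C : ℝ} (hst : s ≤ t) (hm : AntitoneOn m (Icc s t))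
    (hE : IsPrimitiveOn E E' s t) (hE0 : ∀ r ∈ Icc s t, 0 ≤ E r)
    (hC : ∀ r ∈ Icc s t, |E' r| ≤ C) (hint : IntervalIntegrable (fun r => m r * E' r) volume s t) :
    m t * E t ≤ m s * E s + ∫ r in s..t, m r * E' r := by
  have hC0 : 0 ≤ C := (abs_nonneg _).trans (hC s ⟨le_rfl, hst⟩)
  have hmint : IntervalIntegrable m volume s t := by
    rw [← uIcc_of_le hst] at hm; exact hm.intervalIntegrable
  have step : ∀ x y, s ≤ x → x ≤ y → y ≤ t →
      m y * E y - m x * E x - ∫ r in x..y, m r * E' r ≤ (m x - m y) * (C * (y - x)) := by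
    intro x y hx hxy hy
    have hxm : x ∈ Icc s t := ⟨hx, hxy.trans hy⟩
    have hym : y ∈ Icc s t := ⟨hx.trans hxy, hy⟩
    have hsub : uIcc x y ⊆ uIcc s t := by
      rw [uIcc_of_le hst]; exact uIcc_subset_Icc hxm hym
    have hEp := hE.mono (c := x) (d := y) (by rwa [uIcc_of_le hst]) (by rwa [uIcc_of_le hst])
    have h1 := hEp.eq_add
    have hi1 := (hint.mono_set hsub)
    have hi2 := hEp.1.const_mul (m y)
    have h2 : m y * (E y - E x) - ∫ r in x..y, m r * E' r = ∫ r in x..y, (m y - m r) * E' r := by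
      rw [h1, add_sub_cancel_left, ← intervalIntegral.integral_const_mul,
        ← intervalIntegral.integral_sub hi2 hi1]
      exact intervalIntegral.integral_congr fun r _ => by ring
    have h3 : ∫ r in x..y, (m y - m r) * E' r ≤ (m x - m y) * C * (y - x) := by
      have := intervalIntegral.norm_integral_le_of_norm_le_const (a := x) (b := y)
        (f := fun r => (m y - m r) * E' r) (C := (m x - m y) * C) (fun r hr => ?_)
      · rw [abs_of_nonneg (sub_nonneg.2 hxy)] at this
        exact (le_abs_self _).trans this
      · rw [uIoc_of_le hxy] at hr
        have hrm : r ∈ Icc s t := ⟨hx.trans hr.1.le, hr.2.trans hy⟩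
        rw [norm_mul, Real.norm_eq_abs, Real.norm_eq_abs]
        have h4 := hm hxm hrm hr.1.le
        have h5 := hm hrm hym hr.2
        refine mul_le_mul ?_ (hC r hrm) (abs_nonneg _) (by linarith)
        rw [abs_le]; constructor <;> linarith
    have h4 := mul_nonneg (sub_nonneg.2 (hm hxm hym hxy)) (hE0 x hxm)
    nlinarith
  have part : ∀ n : ℕ, 0 < n → ∀ k : ℕ, k ≤ n →
      m (s + k * ((t - s) / n)) * E (s + k * ((t - s) / n)) - m s * E s -
        ∫ r in s..(s + k * ((t - s) / n)), m r * E' r ≤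
      (m s - m (s + k * ((t - s) / n))) * (C * ((t - s) / n)) := by
    intro n hn k
    induction k with
    | zero => simp
    | succ k ih =>
      intro hk
      have hd : 0 ≤ (t - s) / n := div_nonneg (sub_nonneg.2 hst) (Nat.cast_nonneg n)
      have hnd : n * ((t - s) / n) = t - s := by field_simp
      set d := (t - s) / n
      have h1 := ih (by omega)
      have hk' : (k + 1 : ℝ) * d ≤ t - s := by
        rw [← hnd]; gcongr; exact_mod_cast hk
      have h2 := step (s + k * d) (s + (k + 1 : ℕ) * d) (by nlinarith [mul_nonneg (Nat.cast_nonneg (α := ℝ) k) hd])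
        (by push_cast; nlinarith) (by push_cast; linarith)
      have h0k := mul_nonneg (Nat.cast_nonneg (α := ℝ) k) hd
      have hadd := intervalIntegral.integral_add_adjacent_intervals
        (hint.mono_set (c := s) (d := s + k * d) ?_)
        (hint.mono_set (c := s + k * d) (d := s + (k + 1 : ℕ) * d) ?_)
      · rw [← hadd]
        have : s + (k + 1 : ℕ) * d - (s + k * d) = d := by push_cast; ring
        rw [this] at h2
        linarith
      · rw [uIcc_of_le hst]
        exact uIcc_subset_Icc ⟨le_rfl, hst⟩ ⟨by linarith, by nlinarith⟩
      · rw [uIcc_of_le hst]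
        exact uIcc_subset_Icc ⟨by linarith, by nlinarith⟩ ⟨by push_cast; nlinarith, by push_cast; linarith⟩
  have lim : Tendsto (fun n : ℕ => (m s - m t) * (C * ((t - s) / n))) atTop (𝓝 0) := by
    have h1 := (tendsto_const_div_atTop_nhds_zero_nat (t - s)).const_mul C |>.const_mul (m s - m t)
    simpa using h1
  have := ge_of_tendsto lim (b := m t * E t - m s * E s - ∫ r in s..t, m r * E' r) (by
    filter_upwards [eventually_gt_atTop 0] with n hn
    have h1 := part n hn n le_rfl
    have hnd : s + n * ((t - s) / n) = t := by field_simp; ring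
    rwa [hnd] at h1)
  linarith

lemma angQ_add_angH (β θ κ : ℝ) : angQ β θ κ + angH β θ κ = Real.exp κ * crossFactor β θ := by
  unfold angQ angH
  linear_combination (Real.exp κ * crossFactor β θ) * Real.sin_sq_add_cos_sq θ

/-- Crossings can only decrease the energy density. -/
lemma angH_le {a θ κ : ℝ → ℝ} {s t A β : ℝ} (hst : s ≤ t)
    (hθ : IsPrimitiveOn θ (fun r => angF (a r) (θ r)) s t)
    (hκ : IsPrimitiveOn κ (fun r => angG (a r) (θ r)) s t)
    (hA : ∀ r ∈ Icc s t, |a r| ≤ A) (hβ : β ∈ Icc (0 : ℝ) 1) (ha : AEMeasurable a (volume.restrict (uIoc s t))) :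
    IntervalIntegrable (fun r => 2 * (a r * angW β (θ r) (κ r))) volume s t ∧
    angH β (θ t) (κ t) ≤ angH β (θ s) (κ s) + ∫ r in s..t, 2 * (a r * angW β (θ r) (κ r)) := by
  obtain ⟨B, hB⟩ := hκ.exp.ac.exists_bound
  rw [uIcc_of_le hst] at hB
  have hW := isPrimitiveOn_angW hst hθ hκ hA hβ
  have hQ := isPrimitiveOn_angQ hst hθ hκ hA hβ
  have hA0 : 0 ≤ A := (abs_nonneg _).trans (hA s ⟨le_rfl, hst⟩)
  have hWc : ContinuousOn (fun r => angW β (θ r) (κ r)) (uIcc s t) := hW.continuousOn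
  obtain ⟨B2, hB2⟩ := hW.ac.exists_bound
  have hint : IntervalIntegrable (fun r => 2 * (a r * angW β (θ r) (κ r))) volume s t := by
    refine intervalIntegrable_of_abs_le (C := 2 * (A * B2)) ?_ (fun r hr => ?_)
    · exact (ha.mul ((hWc.mono uIoc_subset_uIcc).aemeasurable measurableSet_uIoc)).const_mul 2
    · have hr' := uIoc_subset_uIcc hr
      rw [abs_mul, abs_mul, abs_two]
      gcongr
      · rw [uIcc_of_le hst] at hr'; exact hA r hr'
      · exact hB2 r hr'
  refine ⟨hint, ?_⟩
  have hmE : ∀ r, crossFactor β (θ r) * (Real.exp (κ r) * angG (a r) (θ r)) =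
      angW β (θ r) (κ r) + 2 * (a r * angW β (θ r) (κ r)) := fun r => by
    unfold angW angG; ring
  have h1 := antitone_mul_le hst (crossFactor_antitoneOn hθ hA hβ) hκ.exp
    (fun r _ => (Real.exp_pos _).le) (C := B * (1 / 2 + A)) (fun r hr => by
      rw [abs_mul]
      exact mul_le_mul (hB r hr) (angG_bound (hA r hr)) (abs_nonneg _)
        ((norm_nonneg _).trans (hB r hr))) (by
      simp only [hmE]; exact hQ.1.add hint)
  simp only [hmE] at h1
  rw [intervalIntegral.integral_add hQ.1 hint] at h1
  have h2 := hQ.eq_add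
  have h3 := angQ_add_angH β (θ s) (κ s)
  have h4 := angQ_add_angH β (θ t) (κ t)
  rw [mul_comm] at h3 h4
  rw [mul_comm (crossFactor β (θ s)), mul_comm (crossFactor β (θ t))] at h1
  nlinarith

/-! ### Exponential kernels -/

lemma integral_exp_neg_mul_abs {c : ℝ} (hc : 0 < c) :
    ∫ x : ℝ, Real.exp (-(c * |x|)) = 2 / c := by
  rw [integral_comp_abs (f := fun x => Real.exp (-(c * x)))]
  have := integral_exp_mul_Ioi (a := -c) (by linarith) 0
  simp only [neg_mul] at this
  rw [this]; simp; field_simp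

lemma integrable_exp_neg_mul_abs {c : ℝ} (hc : 0 < c) :
    Integrable (fun x : ℝ => Real.exp (-(c * |x|))) := by
  by_contra h
  have h1 := integral_exp_neg_mul_abs hc
  rw [integral_undef h] at h1
  exact absurd h1 (by positivity)

/-- Convolution with `e^{-c|x|}`. -/
def expConv (c : ℝ) (f : ℝ → ℝ) (ξ : ℝ) : ℝ := ∫ η, Real.exp (-(c * |ξ - η|)) * f η

lemma integrable_expKernel {c : ℝ} (hc : 0 < c) (ξ : ℝ) :
    Integrable (fun η : ℝ => Real.exp (-(c * |ξ - η|))) :=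
  (integrable_exp_neg_mul_abs hc).comp_sub_left ξ

lemma integral_expKernel {c : ℝ} (hc : 0 < c) (ξ : ℝ) :
    ∫ η : ℝ, Real.exp (-(c * |ξ - η|)) = 2 / c := by
  rw [← integral_exp_neg_mul_abs hc]
  exact integral_sub_left_eq_self (fun x => Real.exp (-(c * |x|))) volume ξ

lemma integrable_expKernel_mul {c R : ℝ} (hc : 0 < c) {f : ℝ → ℝ} (hf : AEStronglyMeasurable f)
    (hR : ∀ᵐ η, |f η| ≤ R) (ξ : ℝ) : Integrable (fun η => Real.exp (-(c * |ξ - η|)) * f η) :=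
  (integrable_expKernel hc ξ).mul_bdd hf hR

lemma expConv_nonneg {c : ℝ} {f : ℝ → ℝ} (hf : ∀ᵐ η, 0 ≤ f η) (ξ : ℝ) : 0 ≤ expConv c f ξ :=
  integral_nonneg_of_ae (by filter_upwards [hf] with η h using mul_nonneg (Real.exp_pos _).le h)

lemma expConv_mono {c R : ℝ} (hc : 0 < c) {f g : ℝ → ℝ} (hf : AEStronglyMeasurable f)
    (hg : AEStronglyMeasurable g) (hgR : ∀ᵐ η, |g η| ≤ R) (hf0 : ∀ᵐ η, 0 ≤ f η)
    (h : ∀ᵐ η, f η ≤ g η) (ξ : ℝ) : expConv c f ξ ≤ expConv c g ξ := by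
  refine integral_mono_ae (integrable_expKernel_mul (R := R) hc hf ?_ ξ)
    (integrable_expKernel_mul hc hg hgR ξ) ?_
  · filter_upwards [hf0, h, hgR] with η h1 h2 h3
    rw [abs_of_nonneg h1]; exact h2.trans ((le_abs_self _).trans h3)
  · filter_upwards [h] with η h2
    exact mul_le_mul_of_nonneg_left h2 (Real.exp_pos _).le

lemma expConv_le_const {c R : ℝ} (hc : 0 < c) {f : ℝ → ℝ} (hf : AEStronglyMeasurable f)
    (h0 : ∀ᵐ η, 0 ≤ f η) (hR : ∀ᵐ η, f η ≤ R) (ξ : ℝ) : expConv c f ξ ≤ 2 / c * R := by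
  rw [← integral_expKernel hc ξ, ← integral_mul_const]
  refine integral_mono_ae (integrable_expKernel_mul (R := R) hc hf ?_ ξ)
    ((integrable_expKernel hc ξ).mul_const _) ?_
  · filter_upwards [h0, hR] with η h1 h2
    rwa [abs_of_nonneg h1]
  · filter_upwards [hR] with η h2
    exact mul_le_mul_of_nonneg_left h2 (Real.exp_pos _).le

lemma expConv_const_mul (c k : ℝ) (f : ℝ → ℝ) (ξ : ℝ) :
    expConv c (fun η => k * f η) ξ = k * expConv c f ξ := by
  unfold expConv
  rw [← integral_const_mul]; congr 1; ext η; ring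

lemma measurable_expConv {c : ℝ} {f : ℝ → ℝ} (hf : Measurable f) : Measurable (expConv c f) := by
  have h1 : StronglyMeasurable (Function.uncurry
      fun ξ η : ℝ => Real.exp (-(c * |ξ - η|)) * f η) := by
    apply Measurable.stronglyMeasurable
    unfold Function.uncurry
    fun_prop
  exact h1.integral_prod_right.measurable

lemma integrable_expConv {c : ℝ} (hc : 0 < c) {f : ℝ → ℝ} (hf : Integrable f) :
    Integrable (expConv c f) := by
  have h := hf.integrable_convolution (ContinuousLinearMap.mul ℝ ℝ) (integrable_exp_neg_mul_abs hc)
  refine h.congr (.of_forall fun ξ => ?_)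
  simp only [MeasureTheory.convolution, expConv, ContinuousLinearMap.mul_apply']
  congr 1; ext η; ring

/-- The majorant `D₀ + e^{-|x|/4} * D₀`. -/
def decayWeight (D₀ : ℝ → ℝ) (ξ : ℝ) : ℝ := D₀ ξ + expConv (1 / 4) D₀ ξ

section DecayWeight

variable {D₀ : ℝ → ℝ} {R : ℝ} (hm : Measurable D₀) (h0 : ∀ ξ, 0 ≤ D₀ ξ) (hR : ∀ ξ, D₀ ξ ≤ R)

include hm in
lemma measurable_decayWeight : Measurable (decayWeight D₀) := hm.add (measurable_expConv hm)

include h0 in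
lemma le_decayWeight (ξ : ℝ) : D₀ ξ ≤ decayWeight D₀ ξ :=
  le_add_of_nonneg_right (expConv_nonneg (.of_forall h0) ξ)

include hm h0 hR in
lemma decayWeight_le (ξ : ℝ) : decayWeight D₀ ξ ≤ 9 * R := by
  have := expConv_le_const (c := 1 / 4) (by norm_num) hm.aestronglyMeasurable (.of_forall h0)
    (.of_forall hR) ξ
  unfold decayWeight
  linarith [hR ξ]

lemma integrable_decayWeight (hi : Integrable D₀) : Integrable (decayWeight D₀) :=
  hi.add (integrable_expConv (by norm_num) hi)

include hm h0 hR in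
lemma expConv_decayWeight_le (ξ : ℝ) :
    expConv (1 / 2) (decayWeight D₀) ξ ≤ 9 * decayWeight D₀ ξ := by
  have hR' : ∀ᵐ η, |D₀ η| ≤ R := .of_forall fun η => by rw [abs_of_nonneg (h0 η)]; exact hR η
  have hK0 : ∀ η, 0 ≤ expConv (1 / 4) D₀ η := expConv_nonneg (.of_forall h0)
  have hKR : ∀ᵐ η, |expConv (1 / 4) D₀ η| ≤ 2 / (1 / 4) * R := .of_forall fun η => by
    rw [abs_of_nonneg (hK0 η)]
    exact expConv_le_const (by norm_num) hm.aestronglyMeasurable (.of_forall h0) (.of_forall hR) η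
  have hKm := (measurable_expConv (c := 1 / 4) hm).aestronglyMeasurable (μ := volume)
  have h1 : expConv (1 / 2) (decayWeight D₀) ξ =
      expConv (1 / 2) D₀ ξ + expConv (1 / 2) (expConv (1 / 4) D₀) ξ := by
    have h5 := integral_add
      (integrable_expKernel_mul (c := 1 / 2) (by norm_num) hm.aestronglyMeasurable hR' ξ)
      (integrable_expKernel_mul (c := 1 / 2) (by norm_num) hKm hKR ξ)
    refine Eq.trans ?_ h5
    unfold decayWeight
    conv_lhs => unfold expConv
    simp only [mul_add]
    rfl
  have h2 : expConv (1 / 2) D₀ ξ ≤ expConv (1 / 4) D₀ ξ := by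
    refine integral_mono (integrable_expKernel_mul (by norm_num) hm.aestronglyMeasurable hR' ξ)
      (integrable_expKernel_mul (by norm_num) hm.aestronglyMeasurable hR' ξ) fun η => ?_
    refine mul_le_mul_of_nonneg_right (Real.exp_le_exp.2 ?_) (h0 η)
    linarith [abs_nonneg (ξ - η)]
  have h3 : ∀ η, expConv (1 / 4) D₀ η ≤
      Real.exp (1 / 4 * |ξ - η|) * expConv (1 / 4) D₀ ξ := fun η => by
    unfold expConv
    rw [← integral_const_mul]
    refine integral_mono (integrable_expKernel_mul (by norm_num) hm.aestronglyMeasurable hR' η)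
      ((integrable_expKernel_mul (by norm_num) hm.aestronglyMeasurable hR' ξ).const_mul _)
      fun ζ => ?_
    simp only
    rw [← mul_assoc, ← Real.exp_add]
    refine mul_le_mul_of_nonneg_right (Real.exp_le_exp.2 ?_) (h0 ζ)
    have := abs_add_le (ξ - η) (η - ζ)
    rw [sub_add_sub_cancel] at this
    linarith
  have h4 : expConv (1 / 2) (expConv (1 / 4) D₀) ξ ≤ 8 * expConv (1 / 4) D₀ ξ := by
    have : 8 * expConv (1 / 4) D₀ ξ =
        ∫ η : ℝ, Real.exp (-(1 / 4 * |ξ - η|)) * expConv (1 / 4) D₀ ξ := by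
      rw [integral_mul_const, integral_expKernel (by norm_num)]; norm_num
    rw [this]
    refine integral_mono (integrable_expKernel_mul (by norm_num) hKm hKR ξ)
      ((integrable_expKernel (by norm_num) ξ).mul_const _) fun η => ?_
    refine (mul_le_mul_of_nonneg_left (h3 η) (Real.exp_pos _).le).trans ?_
    rw [← mul_assoc, ← Real.exp_add]
    refine mul_le_mul_of_nonneg_right (Real.exp_le_exp.2 ?_) (hK0 ξ)
    linarith
  rw [h1]
  unfold decayWeight
  linarith [h0 ξ]

end DecayWeight

/-! ### The nonlocal terms -/

lemma measurable_sign : Measurable Real.sign := by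
  unfold Real.sign
  exact Measurable.ite measurableSet_Iio measurable_const
    (Measurable.ite measurableSet_Ioi measurable_const measurable_const)

lemma abs_sign_le_one (x : ℝ) : |Real.sign x| ≤ 1 := by
  rcases Real.sign_apply_eq x with h | h | h <;> simp [h]

/-- `∫ σ(ξ - η) e^{-|∫_η^ξ q|} ρ(η) dη`. -/
def nonlocalTerm (σ q ρ : ℝ → ℝ) (ξ : ℝ) : ℝ :=
  ∫ η, σ (ξ - η) * Real.exp (-|∫ x in η..ξ, q x|) * ρ η

/-- The primitives of `q` grow at least linearly. -/
structure KernelBound (K : ℝ) (q : ℝ → ℝ) : Prop where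
  int : ∀ a b, IntervalIntegrable q volume a b
  lower : ∀ η ξ, η ≤ ξ → (ξ - η) / 2 - K ≤ ∫ x in η..ξ, q x

namespace KernelBound

variable {K R : ℝ} {q ρ σ : ℝ → ℝ}

lemma exp_le (h : KernelBound K q) (ξ η : ℝ) :
    Real.exp (-|∫ x in η..ξ, q x|) ≤ Real.exp K * Real.exp (-(1 / 2 * |ξ - η|)) := by
  rw [← Real.exp_add, Real.exp_le_exp]
  rcases le_total η ξ with h1 | h1
  · have := h.lower η ξ h1
    rw [abs_of_nonneg (sub_nonneg.2 h1)]
    linarith [le_abs_self (∫ x in η..ξ, q x)]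
  · have := h.lower ξ η h1
    rw [abs_of_nonpos (sub_nonpos.2 h1), intervalIntegral.integral_symm, abs_neg]
    linarith [le_abs_self (∫ x in ξ..η, q x)]

lemma continuous_kernel (h : KernelBound K q) (ξ : ℝ) :
    Continuous (fun η => Real.exp (-|∫ x in η..ξ, q x|)) := by
  have h1 : Continuous (fun η => ∫ x in ξ..η, q x) := intervalIntegral.continuous_primitive h.int ξ
  have h2 : (fun η => ∫ x in η..ξ, q x) = fun η => - ∫ x in ξ..η, q x := by
    ext η; exact intervalIntegral.integral_symm _ _
  have h3 : Continuous (fun η => ∫ x in η..ξ, q x) := h2 ▸ h1.neg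
  exact Real.continuous_exp.comp h3.abs.neg

lemma norm_integrand_le (h : KernelBound K q) (hσ : ∀ x, |σ x| ≤ 1) (ξ η : ℝ) :
    |σ (ξ - η) * Real.exp (-|∫ x in η..ξ, q x|) * ρ η| ≤
      Real.exp K * (Real.exp (-(1 / 2 * |ξ - η|)) * |ρ η|) := by
  rw [abs_mul, abs_mul, abs_of_pos (Real.exp_pos _), ← mul_assoc]
  refine mul_le_mul_of_nonneg_right ?_ (abs_nonneg _)
  exact (mul_le_of_le_one_left (Real.exp_pos _).le (hσ _)).trans (h.exp_le ξ η)

lemma integrable (h : KernelBound K q) (hσm : Measurable σ) (hσ : ∀ x, |σ x| ≤ 1)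
    (hρ : AEStronglyMeasurable ρ) (hR : ∀ᵐ η, |ρ η| ≤ R) (ξ : ℝ) :
    Integrable (fun η => σ (ξ - η) * Real.exp (-|∫ x in η..ξ, q x|) * ρ η) := by
  have h1 := (integrable_expKernel_mul (c := 1 / 2) (R := R) (by norm_num) hρ.norm
    (by simpa using hR) ξ).const_mul (Real.exp K)
  refine Integrable.mono' h1 ?_ (.of_forall fun η => h.norm_integrand_le hσ ξ η)
  exact (((hσm.comp (measurable_const.sub measurable_id)).aestronglyMeasurable).mul
    (h.continuous_kernel ξ).aestronglyMeasurable).mul hρ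

lemma abs_nonlocalTerm_le (h : KernelBound K q) (hσ : ∀ x, |σ x| ≤ 1)
    (hρ : AEStronglyMeasurable ρ) (hR : ∀ᵐ η, |ρ η| ≤ R) (ξ : ℝ) :
    |nonlocalTerm σ q ρ ξ| ≤ Real.exp K * expConv (1 / 2) (fun η => |ρ η|) ξ := by
  unfold expConv
  rw [← integral_const_mul]
  have h1 := (integrable_expKernel_mul (c := 1 / 2) (R := R) (by norm_num) hρ.norm
    (by simpa using hR) ξ).const_mul (Real.exp K)
  exact norm_integral_le_of_norm_le (f := fun η => σ (ξ - η) * Real.exp (-|∫ x in η..ξ, q x|) * ρ η)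
    h1 (.of_forall fun η => h.norm_integrand_le hσ ξ η)

lemma abs_nonlocalTerm_le_const (h : KernelBound K q) (hσ : ∀ x, |σ x| ≤ 1)
    (hρ : AEStronglyMeasurable ρ) (hR : ∀ᵐ η, |ρ η| ≤ R) (ξ : ℝ) :
    |nonlocalTerm σ q ρ ξ| ≤ Real.exp K * (4 * R) := by
  refine (h.abs_nonlocalTerm_le hσ hρ hR ξ).trans ?_
  gcongr
  have := expConv_le_const (c := 1 / 2) (by norm_num) hρ.norm
    (.of_forall fun η => abs_nonneg (ρ η)) hR ξ
  norm_num at this ⊢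
  exact this

end KernelBound

lemma abs_exp_neg_abs_sub_le {x y m : ℝ} (hx : Real.exp (-|x|) ≤ m) (hy : Real.exp (-|y|) ≤ m) :
    |Real.exp (-|x|) - Real.exp (-|y|)| ≤ m * |x - y| := by
  wlog h : |x| ≤ |y| generalizing x y
  · rw [abs_sub_comm, abs_sub_comm x]; exact this hy hx (not_le.1 h).le
  rw [abs_of_nonneg (sub_nonneg.2 (Real.exp_le_exp.2 (by linarith)))]
  have h1 : Real.exp (-|y|) = Real.exp (-|x|) * Real.exp (|x| - |y|) := by
    rw [← Real.exp_add]; ring_nf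
  have h2 := Real.add_one_le_exp (|x| - |y|)
  have h3 := abs_abs_sub_abs_le_abs_sub x y
  rw [abs_of_nonpos (by linarith : |x| - |y| ≤ 0)] at h3
  rw [h1]
  have h4 := Real.exp_pos (-|x|)
  calc _ = Real.exp (-|x|) * (1 - Real.exp (|x| - |y|)) := by ring
    _ ≤ Real.exp (-|x|) * |x - y| := by gcongr; linarith
    _ ≤ m * |x - y| := by gcongr

lemma mul_exp_neg_half_le (x : ℝ) : |x| * Real.exp (-(1 / 2 * |x|)) ≤ 4 * Real.exp (-(1 / 4 * |x|)) := by
  have h1 := Real.add_one_le_exp (1 / 4 * |x|)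
  have h2 : Real.exp (-(1 / 2 * |x|)) = Real.exp (-(1 / 4 * |x|)) * Real.exp (-(1 / 4 * |x|)) := by
    rw [← Real.exp_add]; ring_nf
  have h3 := Real.exp_pos (-(1 / 4 * |x|))
  have h4 : Real.exp (1 / 4 * |x|) * Real.exp (-(1 / 4 * |x|)) = 1 := by
    rw [← Real.exp_add]; simp
  rw [h2]
  nlinarith [abs_nonneg x, mul_le_mul_of_nonneg_right h1 h3.le]

/-- The nonlocal terms depend in a Lipschitz way on `q` and `ρ`. -/
lemma abs_nonlocalTerm_sub_le {K R d : ℝ} {q q' ρ ρ' σ : ℝ → ℝ} (h : KernelBound K q)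
    (h' : KernelBound K q') (hσm : Measurable σ) (hσ : ∀ x, |σ x| ≤ 1)
    (hρ : AEStronglyMeasurable ρ) (hρ' : AEStronglyMeasurable ρ')
    (hR : ∀ᵐ η, |ρ η| ≤ R) (hR' : ∀ᵐ η, |ρ' η| ≤ R) (hd : ∀ᵐ η, |q η - q' η| ≤ d) (ξ : ℝ) :
    |nonlocalTerm σ q ρ ξ - nonlocalTerm σ q' ρ' ξ| ≤
      Real.exp K * (32 * R * d + expConv (1 / 2) (fun η => |ρ η - ρ' η|) ξ) := by
  have hd0 : 0 ≤ d := by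
    obtain ⟨η, hη⟩ := hd.exists
    exact (abs_nonneg _).trans hη
  have hR0 : 0 ≤ R := by
    obtain ⟨η, hη⟩ := hR.exists
    exact (abs_nonneg _).trans hη
  unfold nonlocalTerm
  rw [← integral_sub (h.integrable hσm hσ hρ hR ξ) (h'.integrable hσm hσ hρ' hR' ξ)]
  have hdiff : ∀ᵐ η, |ρ η - ρ' η| ≤ 2 * R := by
    filter_upwards [hR, hR'] with η h1 h2
    exact (abs_sub _ _).trans (by linarith)
  have hi1 := ((integrable_expKernel (c := 1 / 4) (by norm_num) ξ).const_mul (4 * R * d))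
  have hi2 : Integrable (fun η => Real.exp (-(1 / 2 * |ξ - η|)) * |ρ η - ρ' η|) :=
    integrable_expKernel_mul (c := 1 / 2) (R := 2 * R) (by norm_num) (hρ.sub hρ').norm
    (by simpa using hdiff) ξ
  have hrhs : Real.exp K * (32 * R * d + expConv (1 / 2) (fun η => |ρ η - ρ' η|) ξ) =
      ∫ η, Real.exp K * (4 * R * d * Real.exp (-(1 / 4 * |ξ - η|)) +
        Real.exp (-(1 / 2 * |ξ - η|)) * |ρ η - ρ' η|) := by
    rw [integral_const_mul, integral_add hi1 hi2, integral_const_mul,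
      integral_expKernel (by norm_num)]
    unfold expConv
    ring_nf
  rw [hrhs]
  refine norm_integral_le_of_norm_le (f := fun η => σ (ξ - η) * Real.exp (-|∫ x in η..ξ, q x|) * ρ η -
    σ (ξ - η) * Real.exp (-|∫ x in η..ξ, q' x|) * ρ' η)
    (g := fun η => Real.exp K * (4 * R * d * Real.exp (-(1 / 4 * |ξ - η|)) +
      Real.exp (-(1 / 2 * |ξ - η|)) * |ρ η - ρ' η|)) ((hi1.add hi2).const_mul _) ?_
  have hY : ∀ η, |(∫ x in η..ξ, q x) - ∫ x in η..ξ, q' x| ≤ d * |ξ - η| := fun η => by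
    rw [← intervalIntegral.integral_sub (h.int _ _) (h'.int _ _)]
    exact intervalIntegral.norm_integral_le_of_norm_le_const_ae
      (f := fun x => q x - q' x) (by filter_upwards [hd] with x hx _ using hx)
  filter_upwards [hR] with η h1
  have e1 := h.exp_le ξ η
  have e2 := h'.exp_le ξ η
  set Y := ∫ x in η..ξ, q x
  set Y' := ∫ x in η..ξ, q' x
  have h2 := (abs_exp_neg_abs_sub_le e1 e2).trans (mul_le_mul_of_nonneg_left (hY η) (by positivity))
  have h3 := mul_exp_neg_half_le (ξ - η)
  have e0 := Real.exp_pos K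
  have h4 : σ (ξ - η) * Real.exp (-|Y|) * ρ η - σ (ξ - η) * Real.exp (-|Y'|) * ρ' η =
      σ (ξ - η) * ((Real.exp (-|Y|) - Real.exp (-|Y'|)) * ρ η +
        Real.exp (-|Y'|) * (ρ η - ρ' η)) := by ring
  rw [h4, Real.norm_eq_abs, abs_mul]
  refine (mul_le_of_le_one_left (abs_nonneg _) (hσ _)).trans ((abs_add_le _ _).trans ?_)
  rw [abs_mul, abs_mul, abs_of_pos (Real.exp_pos (-|Y'|)), mul_add]
  refine add_le_add ?_ ?_
  · calc |Real.exp (-|Y|) - Real.exp (-|Y'|)| * |ρ η|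
        ≤ (Real.exp K * Real.exp (-(1 / 2 * |ξ - η|)) * (d * |ξ - η|)) * R := by gcongr
      _ = Real.exp K * (|ξ - η| * Real.exp (-(1 / 2 * |ξ - η|))) * (R * d) := by ring
      _ ≤ Real.exp K * (4 * Real.exp (-(1 / 4 * |ξ - η|))) * (R * d) := by gcongr
      _ = _ := by ring
  · rw [← mul_assoc]
    gcongr

/-- Fubini for the exponential kernel. -/
lemma integral_expConv_le {s t ε B : ℝ} (hst : s ≤ t) {Δ : ℝ → ℝ → ℝ}
    (hm : AEMeasurable (Function.uncurry Δ) ((volume.restrict (Ioc s t)).prod volume))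
    (h0 : ∀ r η, 0 ≤ Δ r η)
    (hB : ∀ᵐ p ∂(volume.restrict (Ioc s t)).prod volume, Function.uncurry Δ p ≤ B)
    (hε : ∀ᵐ η, ∫ r in s..t, Δ r η ≤ ε) (ξ : ℝ) :
    IntervalIntegrable (fun r => expConv (1 / 2) (Δ r) ξ) volume s t ∧
      ∫ r in s..t, expConv (1 / 2) (Δ r) ξ ≤ 4 * ε := by
  have hk : Integrable (fun p : ℝ × ℝ => (1 : ℝ) * Real.exp (-(1 / 2 * |ξ - p.2|)))
      ((volume.restrict (Ioc s t)).prod volume) :=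
    Integrable.mul_prod (f := fun _ : ℝ => (1 : ℝ)) (integrable_const _)
      (integrable_expKernel (by norm_num) ξ)
  have hint : Integrable (Function.uncurry fun r η => Real.exp (-(1 / 2 * |ξ - η|)) * Δ r η)
      ((volume.restrict (Ioc s t)).prod volume) := by
    simp only [one_mul] at hk
    refine (hk.mul_bdd (c := B) hm.aestronglyMeasurable ?_)
    filter_upwards [hB] with p hp
    rw [Real.norm_eq_abs, abs_of_nonneg (h0 _ _)]; exact hp
  refine ⟨?_, ?_⟩
  · rw [intervalIntegrable_iff_integrableOn_Ioc_of_le hst]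
    exact hint.integral_prod_left
  · rw [intervalIntegral.integral_of_le hst]
    unfold expConv
    rw [integral_integral_swap hint]
    have h4 : 4 * ε = ∫ η : ℝ, Real.exp (-(1 / 2 * |ξ - η|)) * ε := by
      rw [integral_mul_const, integral_expKernel (by norm_num)]; norm_num
    rw [h4]
    refine integral_mono_ae hint.integral_prod_right
      ((integrable_expKernel (by norm_num) ξ).mul_const _) ?_
    filter_upwards [hε] with η h1
    rw [integral_const_mul, ← intervalIntegral.integral_of_le hst]
    gcongr

/-! ### Spatial derivatives of the nonlocal terms -/

section SpatialDerivative

variable {K R : ℝ} {q ρ : ℝ → ℝ}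

lemma KernelBound.integrable_left (h : KernelBound K q) (hρ : AEStronglyMeasurable ρ)
    (hR : ∀ᵐ η, |ρ η| ≤ R) (h0 : ∀ x, 0 ≤ q x) (ξ : ℝ) :
    IntegrableOn (fun η => Real.exp (∫ x in (0 : ℝ)..η, q x) * ρ η) (Iic ξ) ∧
    IntegrableOn (fun η => Real.exp (-∫ x in (0 : ℝ)..η, q x) * ρ η) (Ioi ξ) := by
  have h1 := h.integrable (σ := fun _ => 1) measurable_const (by simp) hρ hR ξ
  have hadd : ∀ η, (∫ x in η..ξ, q x) = (∫ x in (0 : ℝ)..ξ, q x) - ∫ x in (0 : ℝ)..η, q x :=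
    fun η => (intervalIntegral.integral_interval_sub_left (h.int _ _) (h.int _ _)).symm
  constructor
  · refine IntegrableOn.congr_fun ((h1.integrableOn (s := Iic ξ)).const_mul
      (Real.exp (∫ x in (0 : ℝ)..ξ, q x))) (fun η hη => ?_) measurableSet_Iic
    have h2 : 0 ≤ ∫ x in η..ξ, q x := intervalIntegral.integral_nonneg hη fun x _ => h0 x
    simp only [one_mul]
    rw [abs_of_nonneg h2, hadd η, ← mul_assoc, ← Real.exp_add]
    congr 2; ring
  · refine IntegrableOn.congr_fun ((h1.integrableOn (s := Ioi ξ)).const_mul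
      (Real.exp (-∫ x in (0 : ℝ)..ξ, q x))) (fun η hη => ?_) measurableSet_Ioi
    have h2 : 0 ≤ ∫ x in ξ..η, q x :=
      intervalIntegral.integral_nonneg (mem_Ioi.1 hη).le fun x _ => h0 x
    simp only [one_mul]
    have h3 : (∫ x in η..ξ, q x) ≤ 0 := by
      rw [intervalIntegral.integral_symm]; exact neg_nonpos.2 h2
    rw [abs_of_nonpos h3, hadd η, ← mul_assoc, ← Real.exp_add]
    congr 2; ring

lemma KernelBound.nonlocalTerm_eq (h : KernelBound K q) (hρ : AEStronglyMeasurable ρ)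
    (hR : ∀ᵐ η, |ρ η| ≤ R) (h0 : ∀ x, 0 ≤ q x) (ξ : ℝ) :
    nonlocalTerm (fun _ => 1) q ρ ξ =
      Real.exp (-∫ x in (0 : ℝ)..ξ, q x) *
        (∫ η in Iic ξ, Real.exp (∫ x in (0 : ℝ)..η, q x) * ρ η) +
      Real.exp (∫ x in (0 : ℝ)..ξ, q x) *
        (∫ η in Ioi ξ, Real.exp (-∫ x in (0 : ℝ)..η, q x) * ρ η) ∧
    nonlocalTerm Real.sign q ρ ξ =
      Real.exp (-∫ x in (0 : ℝ)..ξ, q x) *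
        (∫ η in Iic ξ, Real.exp (∫ x in (0 : ℝ)..η, q x) * ρ η) -
      Real.exp (∫ x in (0 : ℝ)..ξ, q x) *
        (∫ η in Ioi ξ, Real.exp (-∫ x in (0 : ℝ)..η, q x) * ρ η) := by
  have h1 := h.integrable (σ := fun _ => 1) measurable_const (by simp) hρ hR ξ
  have h2 := h.integrable (σ := Real.sign) measurable_sign abs_sign_le_one hρ hR ξ
  have hadd : ∀ η, (∫ x in η..ξ, q x) = (∫ x in (0 : ℝ)..ξ, q x) - ∫ x in (0 : ℝ)..η, q x :=
    fun η => (intervalIntegral.integral_interval_sub_left (h.int _ _) (h.int _ _)).symm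
  have hl : ∀ η ∈ Iio ξ, Real.exp (-|∫ x in η..ξ, q x|) =
      Real.exp (-∫ x in (0 : ℝ)..ξ, q x) * Real.exp (∫ x in (0 : ℝ)..η, q x) := fun η hη => by
    rw [abs_of_nonneg (intervalIntegral.integral_nonneg (mem_Iio.1 hη).le fun x _ => h0 x), hadd,
      ← Real.exp_add]
    ring_nf
  have hr : ∀ η ∈ Ioi ξ, Real.exp (-|∫ x in η..ξ, q x|) =
      Real.exp (∫ x in (0 : ℝ)..ξ, q x) * Real.exp (-∫ x in (0 : ℝ)..η, q x) := fun η hη => by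
    have h3 : (∫ x in η..ξ, q x) ≤ 0 := by
      rw [intervalIntegral.integral_symm]
      exact neg_nonpos.2 (intervalIntegral.integral_nonneg (mem_Ioi.1 hη).le fun x _ => h0 x)
    rw [abs_of_nonpos h3, hadd, ← Real.exp_add]
    ring_nf
  have split : ∀ f : ℝ → ℝ, Integrable f → ∫ η, f η = (∫ η in Iio ξ, f η) + ∫ η in Ioi ξ, f η :=
    fun f hf => by
      rw [← intervalIntegral.integral_Iic_add_Ioi (b := ξ) hf.integrableOn hf.integrableOn,
        integral_Iic_eq_integral_Iio]
  constructor
  · unfold nonlocalTerm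
    rw [split _ h1, ← integral_const_mul, ← integral_const_mul, integral_Iic_eq_integral_Iio]
    congr 1
    · exact setIntegral_congr_fun measurableSet_Iio fun η hη => by simp only [hl η hη]; ring
    · exact setIntegral_congr_fun measurableSet_Ioi fun η hη => by simp only [hr η hη]; ring
  · unfold nonlocalTerm
    rw [split _ h2, ← integral_const_mul, ← integral_const_mul, integral_Iic_eq_integral_Iio,
      sub_eq_add_neg, ← integral_neg]
    congr 1
    · refine setIntegral_congr_fun measurableSet_Iio fun η hη => ?_
      simp only [hl η hη, Real.sign_of_pos (sub_pos.2 (mem_Iio.1 hη))]; ring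
    · refine setIntegral_congr_fun measurableSet_Ioi fun η hη => ?_
      simp only [hr η hη, Real.sign_of_neg (sub_neg.2 (mem_Ioi.1 hη))]; ring

/-- `P_ξ = Q q` and `Q_ξ = P q - ρ / 2`, up to normalization. -/
lemma KernelBound.isPrimitiveOn_nonlocalTerm (h : KernelBound K q) (hρ : AEStronglyMeasurable ρ)
    (hR : ∀ᵐ η, |ρ η| ≤ R) (h0 : ∀ x, 0 ≤ q x) (a b : ℝ) :
    IsPrimitiveOn (nonlocalTerm (fun _ => 1) q ρ)
      (fun ξ => -(q ξ * nonlocalTerm Real.sign q ρ ξ)) a b ∧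
    IsPrimitiveOn (nonlocalTerm Real.sign q ρ)
      (fun ξ => 2 * ρ ξ - q ξ * nonlocalTerm (fun _ => 1) q ρ ξ) a b := by
  set Y : ℝ → ℝ := fun ξ => ∫ x in (0 : ℝ)..ξ, q x
  set A : ℝ → ℝ := fun ξ => ∫ η in Iic ξ, Real.exp (Y η) * ρ η
  set B : ℝ → ℝ := fun ξ => ∫ η in Ioi ξ, Real.exp (-Y η) * ρ η
  have hint := h.integrable_left hρ hR h0
  have hY : IsPrimitiveOn Y q a b := ⟨h.int _ _, fun t _ =>
    (intervalIntegral.integral_add_adjacent_intervals (h.int _ _) (h.int _ _)).symm⟩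
  have hA : IsPrimitiveOn A (fun η => Real.exp (Y η) * ρ η) a b := by
    refine ⟨?_, fun t _ => ?_⟩
    · rw [intervalIntegrable_iff]
      exact (hint (max a b)).1.mono_set fun x hx => hx.2
    · have := intervalIntegral.integral_Iic_sub_Iic (hint a).1 (hint t).1
      simp only [A]; rw [← this]; ring
  have hB : IsPrimitiveOn B (fun η => -(Real.exp (-Y η) * ρ η)) a b := by
    refine ⟨IntervalIntegrable.neg ?_, fun t _ => ?_⟩
    · rw [intervalIntegrable_iff]
      exact (hint (min a b)).2.mono_set fun x hx => hx.1
    · have := intervalIntegral.integral_Ioi_sub_Ioi' (hint a).2 (hint t).2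
      simp only [B]; rw [intervalIntegral.integral_neg, ← this]; ring
  have hee : ∀ x, Real.exp (-Y x) * Real.exp (Y x) = 1 := fun x => by rw [← Real.exp_add]; simp
  have e1 := hY.neg.exp.mul hA
  have e2 := hY.exp.mul hB
  constructor
  · refine ((e1.add e2).congr fun x _ => (h.nonlocalTerm_eq hρ hR h0 x).1).congr_deriv
      (.of_forall fun x _ => ?_)
    rw [(h.nonlocalTerm_eq hρ hR h0 x).2]
    change _ = -(q x * (Real.exp (-Y x) * A x - Real.exp (Y x) * B x))
    ring
  · refine ((e1.sub e2).congr fun x _ => (h.nonlocalTerm_eq hρ hR h0 x).2).congr_deriv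
      (.of_forall fun x _ => ?_)
    rw [(h.nonlocalTerm_eq hρ hR h0 x).1]
    change _ = 2 * ρ x - q x * (Real.exp (-Y x) * A x + Real.exp (Y x) * B x)
    linear_combination (2 * ρ x) * hee x

end SpatialDerivative

/-! ### Measurability of the nonlocal terms -/

lemma measurable_primitive {q : ℝ → ℝ → ℝ} (hq : Measurable (Function.uncurry q))
    (hint : ∀ t a b, IntervalIntegrable (q t) volume a b) :
    Measurable (fun p : ℝ × ℝ => ∫ x in (0 : ℝ)..p.2, q p.1 x) := by
  have h1 : ∀ ξ, Measurable fun t => ∫ x in (0 : ℝ)..ξ, q t x := fun ξ => by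
    unfold intervalIntegral
    exact (hq.stronglyMeasurable.integral_prod_right.measurable).sub
      (hq.stronglyMeasurable.integral_prod_right.measurable)
  have h2 := measurable_uncurry_of_continuous_of_measurable
    (u := fun ξ t => ∫ x in (0 : ℝ)..ξ, q t x)
    (fun t => intervalIntegral.continuous_primitive (hint t) 0) h1
  exact h2.comp measurable_swap

lemma measurable_nonlocalTerm {q ρ : ℝ → ℝ → ℝ} {σ : ℝ → ℝ} (hσ : Measurable σ)
    (hq : Measurable (Function.uncurry q)) (hρ : Measurable (Function.uncurry ρ))
    (hint : ∀ t a b, IntervalIntegrable (q t) volume a b) :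
    Measurable (fun p : ℝ × ℝ => nonlocalTerm σ (q p.1) (ρ p.1) p.2) := by
  have hY := measurable_primitive hq hint
  have h1 : ∀ t η ξ, ∫ x in η..ξ, q t x =
      (∫ x in (0 : ℝ)..ξ, q t x) - ∫ x in (0 : ℝ)..η, q t x := fun t η ξ =>
    (intervalIntegral.integral_interval_sub_left (hint _ _ _) (hint _ _ _)).symm
  have h2 : (fun p : ℝ × ℝ => nonlocalTerm σ (q p.1) (ρ p.1) p.2) = fun p => ∫ η, σ (p.2 - η) *
    Real.exp (-|(∫ x in (0 : ℝ)..p.2, q p.1 x) - ∫ x in (0 : ℝ)..η, q p.1 x|) * ρ p.1 η := by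
    ext p
    exact integral_congr_ae (.of_forall fun η => by simp only; rw [h1])
  rw [h2]
  refine (StronglyMeasurable.integral_prod_right (f := fun (p : ℝ × ℝ) η => σ (p.2 - η) *
    Real.exp (-|(∫ x in (0 : ℝ)..p.2, q p.1 x) - ∫ x in (0 : ℝ)..η, q p.1 x|) * ρ p.1 η)
    (Measurable.stronglyMeasurable ?_)).measurable
  have hY1 : Measurable (fun p : (ℝ × ℝ) × ℝ => ∫ x in (0 : ℝ)..p.1.2, q p.1.1 x) :=
    hY.comp measurable_fst
  have hY2 : Measurable (fun p : (ℝ × ℝ) × ℝ => ∫ x in (0 : ℝ)..p.2, q p.1.1 x) :=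
    hY.comp ((measurable_fst.comp measurable_fst).prodMk measurable_snd)
  have hρ2 : Measurable (fun p : (ℝ × ℝ) × ℝ => ρ p.1.1 p.2) :=
    hρ.comp ((measurable_fst.comp measurable_fst).prodMk measurable_snd)
  have hσ2 : Measurable (fun p : (ℝ × ℝ) × ℝ => σ (p.1.2 - p.2)) :=
    hσ.comp ((measurable_snd.comp measurable_fst).sub measurable_snd)
  have habs : Measurable (fun x : ℝ => Real.exp (-|x|)) := by fun_prop
  exact (hσ2.mul (habs.comp (hY1.sub hY2))).mul hρ2

/-! ### The state at one label -/

/-- `y_ξ`, `U_ξ`, `h̄` and `2 U² y_ξ + h̄` at one label with component weights `N`, jump factors `β`,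
angles `θ` and logarithmic amplitudes `κ`. -/
def labQ (N β θ κ : Fin 2 → ℝ) : ℝ := ∑ i, N i * angQ (β i) (θ i) (κ i)
def labW (N β θ κ : Fin 2 → ℝ) : ℝ := ∑ i, N i * angW (β i) (θ i) (κ i)
def labH (N β θ κ : Fin 2 → ℝ) : ℝ := ∑ i, N i * angH (β i) (θ i) (κ i)
def labRho (N β : Fin 2 → ℝ) (U : ℝ) (θ κ : Fin 2 → ℝ) : ℝ :=
  2 * U ^ 2 * labQ N β θ κ + labH N β θ κ

section AngBounds

variable {β θ κ θ' κ' B : ℝ}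

lemma angQ_nonneg (hβ : β ∈ Icc (0 : ℝ) 1) : 0 ≤ angQ β θ κ := by
  have := crossFactor_nonneg hβ.1 θ
  unfold angQ; positivity

lemma angH_nonneg (hβ : β ∈ Icc (0 : ℝ) 1) : 0 ≤ angH β θ κ := by
  have := crossFactor_nonneg hβ.1 θ
  unfold angH; positivity

lemma angQ_add_angH_le (hβ : β ∈ Icc (0 : ℝ) 1) (hκ : |κ| ≤ B) :
    angQ β θ κ + angH β θ κ ≤ Real.exp B := by
  rw [angQ_add_angH]
  have h1 := crossFactor_le_one hβ.1 hβ.2 θ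
  have h2 : Real.exp κ ≤ Real.exp B := Real.exp_le_exp.2 ((le_abs_self _).trans hκ)
  have := crossFactor_nonneg hβ.1 θ
  calc _ ≤ Real.exp B * 1 := by gcongr
    _ = _ := mul_one _

lemma angW_sq (β θ κ : ℝ) : angW β θ κ ^ 2 = angQ β θ κ * angH β θ κ := by
  unfold angW angQ angH; ring

lemma abs_angW_le (hβ : β ∈ Icc (0 : ℝ) 1) : |angW β θ κ| ≤ (angQ β θ κ + angH β θ κ) / 2 := by
  have h1 := angW_sq β θ κ
  have hq := angQ_nonneg (θ := θ) (κ := κ) hβ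
  have hh := angH_nonneg (θ := θ) (κ := κ) hβ
  refine abs_le_of_sq_le_sq (by nlinarith [sq_nonneg (angQ β θ κ - angH β θ κ)]) (by positivity)

lemma angH_le_cos_sq (hβ : β ∈ Icc (0 : ℝ) 1) (hκ : |κ| ≤ B) :
    angH β θ κ ≤ Real.exp B * Real.cos θ ^ 2 := by
  have h1 := crossFactor_le_one hβ.1 hβ.2 θ
  have h2 : Real.exp κ ≤ Real.exp B := Real.exp_le_exp.2 ((le_abs_self _).trans hκ)
  have := crossFactor_nonneg hβ.1 θ
  unfold angH
  calc _ ≤ Real.exp B * (1 * Real.cos θ ^ 2) := by gcongr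
    _ = _ := by ring

lemma abs_exp_sub_le (hκ : |κ| ≤ B) (hκ' : |κ'| ≤ B) :
    |Real.exp κ - Real.exp κ'| ≤ Real.exp B * |κ - κ'| := by
  wlog h : κ ≤ κ' generalizing κ κ'
  · rw [abs_sub_comm, abs_sub_comm κ]; exact this hκ' hκ (not_le.1 h).le
  rw [abs_of_nonpos (sub_nonpos.2 (Real.exp_le_exp.2 h)), abs_of_nonpos (sub_nonpos.2 h)]
  have h1 : Real.exp κ = Real.exp κ' * Real.exp (κ - κ') := by rw [← Real.exp_add]; ring_nf
  have h2 := Real.add_one_le_exp (κ - κ')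
  have h3 : Real.exp κ' ≤ Real.exp B := Real.exp_le_exp.2 ((le_abs_self _).trans hκ')
  have h4 := Real.exp_pos κ'
  rw [h1]
  calc _ = Real.exp κ' * (1 - Real.exp (κ - κ')) := by ring
    _ ≤ Real.exp κ' * (-(κ - κ')) := by gcongr; linarith
    _ ≤ Real.exp B * (-(κ - κ')) := by gcongr; linarith

lemma abs_exp_mul_sub_le {g g' : ℝ} (hκ : |κ| ≤ B) (hκ' : |κ'| ≤ B) (hg : |g| ≤ 1) :
    |Real.exp κ * g - Real.exp κ' * g'| ≤ Real.exp B * (|κ - κ'| + |g - g'|) := by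
  have h1 : Real.exp κ * g - Real.exp κ' * g' =
    (Real.exp κ - Real.exp κ') * g + Real.exp κ' * (g - g') := by ring
  have h3 : Real.exp κ' ≤ Real.exp B := Real.exp_le_exp.2 ((le_abs_self _).trans hκ')
  rw [h1, mul_add]
  refine (abs_add_le _ _).trans (add_le_add ?_ ?_)
  · rw [abs_mul]
    exact (mul_le_of_le_one_right (abs_nonneg _) hg).trans (abs_exp_sub_le hκ hκ')
  · rw [abs_mul, abs_of_pos (Real.exp_pos _)]
    gcongr

lemma abs_angQ_sub_le (hβ : β ∈ Icc (0 : ℝ) 1) (hκ : |κ| ≤ B) (hκ' : |κ'| ≤ B) :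
    |angQ β θ κ - angQ β θ' κ'| ≤ Real.exp B * (|κ - κ'| + 2 * |θ - θ'|) := by
  refine (abs_exp_mul_sub_le hκ hκ' ?_).trans ?_
  · rw [abs_mul]
    refine mul_le_one₀ (abs_crossFactor_le hβ _) (abs_nonneg _) ?_
    rw [abs_of_nonneg (sq_nonneg _)]; exact Real.sin_sq_le_one _
  · gcongr
    exact abs_crossFactor_mul_sub_le hβ abs_sin_sq_sub_le (fun n => by simp) _ _

lemma abs_angH_sub_le (hβ : β ∈ Icc (0 : ℝ) 1) (hκ : |κ| ≤ B) (hκ' : |κ'| ≤ B) :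
    |angH β θ κ - angH β θ' κ'| ≤ Real.exp B *
      (|κ - κ'| + 2 * |θ - θ'| + |crossFactor β θ - crossFactor β θ'|) := by
  refine (abs_exp_mul_sub_le hκ hκ' ?_).trans ?_
  · rw [abs_mul]
    refine mul_le_one₀ (abs_crossFactor_le hβ _) (abs_nonneg _) ?_
    rw [abs_of_nonneg (sq_nonneg _)]; exact Real.cos_sq_le_one _
  · have h1 : crossFactor β θ * Real.cos θ ^ 2 - crossFactor β θ' * Real.cos θ' ^ 2 =
      crossFactor β θ * (Real.cos θ ^ 2 - Real.cos θ' ^ 2) +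
      (crossFactor β θ - crossFactor β θ') * Real.cos θ' ^ 2 := by ring
    rw [h1, add_assoc]
    gcongr
    refine (abs_add_le _ _).trans (add_le_add ?_ ?_)
    · rw [abs_mul]
      exact (mul_le_of_le_one_left (abs_nonneg _) (abs_crossFactor_le hβ _)).trans
        (abs_cos_sq_sub_le _ _)
    · rw [abs_mul]
      refine mul_le_of_le_one_right (abs_nonneg _) ?_
      rw [abs_of_nonneg (sq_nonneg _)]; exact Real.cos_sq_le_one _

end AngBounds

/-- Bounds on the component weights and jump factors at one label. -/
structure LabelBound (M : ℝ) (N β : Fin 2 → ℝ) : Prop where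
  nonneg : ∀ i, 0 ≤ N i
  le : ∀ i, N i ≤ M
  beta : ∀ i, β i ∈ Icc (0 : ℝ) 1

/-- The bound for `y_ξ`, `U_ξ`, `h̄` that goes with the bounds `M` and `M + 1` for `N` and `κ`. -/
def densBound (M : ℝ) : ℝ := 2 * (M * Real.exp (M + 1))

/-- The corresponding bounds for `2 U² y_ξ + h̄`, for the nonlocal terms, and for the time
derivatives of `U`, `θ` and `κ`. -/
def rhoBound (M : ℝ) : ℝ := 2 * (M + 1) ^ 2 * densBound M + densBound M
def nonlocalBound (M : ℝ) : ℝ := Real.exp M * (4 * rhoBound M)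
def speedBound (M : ℝ) : ℝ := 2 * ((M + 1) ^ 2 + nonlocalBound M) + 2

section LabelBounds

variable {M : ℝ} {N β θ κ θ' κ' : Fin 2 → ℝ} {U U' d : ℝ}

lemma LabelBound.M_nonneg (h : LabelBound M N β) : 0 ≤ M := (h.nonneg 0).trans (h.le 0)

lemma densBound_nonneg (hM : 0 ≤ M) : 0 ≤ densBound M := by unfold densBound; positivity

lemma rhoBound_nonneg (hM : 0 ≤ M) : 0 ≤ rhoBound M := by
  have := densBound_nonneg hM
  unfold rhoBound; positivity

lemma nonlocalBound_nonneg (hM : 0 ≤ M) : 0 ≤ nonlocalBound M := by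
  have := rhoBound_nonneg hM
  unfold nonlocalBound; positivity

lemma speedBound_pos (hM : 0 ≤ M) : 0 < speedBound M := by
  have := nonlocalBound_nonneg hM
  unfold speedBound; positivity

lemma LabelBound.labQ_nonneg (h : LabelBound M N β) : 0 ≤ labQ N β θ κ :=
  Finset.sum_nonneg fun i _ => mul_nonneg (h.nonneg i) (angQ_nonneg (h.beta i))

lemma LabelBound.labH_nonneg (h : LabelBound M N β) : 0 ≤ labH N β θ κ :=
  Finset.sum_nonneg fun i _ => mul_nonneg (h.nonneg i) (angH_nonneg (h.beta i))

lemma LabelBound.labQ_add_labH_le (h : LabelBound M N β) (hκ : ∀ i, |κ i| ≤ M + 1) :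
    labQ N β θ κ + labH N β θ κ ≤ densBound M := by
  unfold labQ labH densBound
  rw [← Finset.sum_add_distrib]
  refine (Finset.sum_le_card_nsmul _ _ (M * Real.exp (M + 1)) fun i _ => ?_).trans (by simp)
  rw [← mul_add]
  exact mul_le_mul (h.le i) (angQ_add_angH_le (h.beta i) (hκ i))
    (add_nonneg (angQ_nonneg (h.beta i)) (angH_nonneg (h.beta i))) h.M_nonneg

lemma LabelBound.abs_labW_le (h : LabelBound M N β) :
    |labW N β θ κ| ≤ (labQ N β θ κ + labH N β θ κ) / 2 := by
  unfold labW labQ labH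
  refine (Finset.abs_sum_le_sum_abs _ _).trans ?_
  rw [← Finset.sum_add_distrib, Finset.sum_div]
  refine Finset.sum_le_sum fun i _ => ?_
  rw [abs_mul, abs_of_nonneg (h.nonneg i), ← mul_add, mul_div_assoc]
  exact mul_le_mul_of_nonneg_left (abs_angW_le (h.beta i)) (h.nonneg i)

lemma LabelBound.labRho_nonneg (h : LabelBound M N β) : 0 ≤ labRho N β U θ κ := by
  have := h.labQ_nonneg (θ := θ) (κ := κ)
  have := h.labH_nonneg (θ := θ) (κ := κ)
  unfold labRho; positivity

lemma LabelBound.labRho_le (h : LabelBound M N β) (hκ : ∀ i, |κ i| ≤ M + 1) (hU : |U| ≤ M + 1) :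
    labRho N β U θ κ ≤ rhoBound M := by
  have h1 := h.labQ_nonneg (θ := θ) (κ := κ)
  have h2 := h.labH_nonneg (θ := θ) (κ := κ)
  have h3 := h.labQ_add_labH_le (θ := θ) hκ
  have hU2 : U ^ 2 ≤ (M + 1) ^ 2 := sq_le_sq' (abs_le.1 hU).1 (abs_le.1 hU).2
  have hM := h.M_nonneg
  unfold labRho rhoBound
  have : U ^ 2 * labQ N β θ κ ≤ (M + 1) ^ 2 * densBound M := by
    refine mul_le_mul hU2 (by linarith) h1 (by positivity)
  linarith

lemma LabelBound.abs_labQ_sub_le (h : LabelBound M N β) (hκ : ∀ i, |κ i| ≤ M + 1)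
    (hκ' : ∀ i, |κ' i| ≤ M + 1) (hdκ : ∀ i, |κ i - κ' i| ≤ d) (hdθ : ∀ i, |θ i - θ' i| ≤ d) :
    |labQ N β θ κ - labQ N β θ' κ'| ≤ 3 * densBound M * d := by
  unfold labQ densBound
  rw [← Finset.sum_sub_distrib]
  refine (Finset.abs_sum_le_sum_abs _ _).trans ?_
  refine (Finset.sum_le_card_nsmul _ _ (M * (Real.exp (M + 1) * (3 * d))) fun i _ => ?_).trans
    (by simp; linarith)
  rw [← mul_sub, abs_mul, abs_of_nonneg (h.nonneg i)]
  refine mul_le_mul (h.le i) ((abs_angQ_sub_le (h.beta i) (hκ i) (hκ' i)).trans ?_)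
    (abs_nonneg _) h.M_nonneg
  gcongr
  linarith [hdκ i, hdθ i]

lemma LabelBound.abs_labH_sub_le (h : LabelBound M N β) (hκ : ∀ i, |κ i| ≤ M + 1)
    (hκ' : ∀ i, |κ' i| ≤ M + 1) (hdκ : ∀ i, |κ i - κ' i| ≤ d) (hdθ : ∀ i, |θ i - θ' i| ≤ d) :
    |labH N β θ κ - labH N β θ' κ'| ≤ densBound M *
      (3 * d + ∑ i, |crossFactor (β i) (θ i) - crossFactor (β i) (θ' i)|) := by
  unfold labH
  rw [← Finset.sum_sub_distrib]
  set S := ∑ i, |crossFactor (β i) (θ i) - crossFactor (β i) (θ' i)|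
  refine (Finset.abs_sum_le_sum_abs _ _).trans ?_
  refine (Finset.sum_le_card_nsmul _ _ (M * (Real.exp (M + 1) * (3 * d + S))) fun i _ => ?_).trans
    (by simp only [densBound, Finset.card_univ, Fintype.card_fin, nsmul_eq_mul]; push_cast; linarith)
  rw [← mul_sub, abs_mul, abs_of_nonneg (h.nonneg i)]
  refine mul_le_mul (h.le i) ((abs_angH_sub_le (h.beta i) (hκ i) (hκ' i)).trans ?_)
    (abs_nonneg _) h.M_nonneg
  have : |crossFactor (β i) (θ i) - crossFactor (β i) (θ' i)| ≤ S :=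
    Finset.single_le_sum (f := fun i => |crossFactor (β i) (θ i) - crossFactor (β i) (θ' i)|)
      (fun j _ => abs_nonneg _) (Finset.mem_univ i)
  gcongr
  linarith [hdκ i, hdθ i]

/-- The Lipschitz constant of `2 U² y_ξ + h̄` away from crossings. -/
def rhoLip (M : ℝ) : ℝ := 6 * (M + 1) ^ 2 * densBound M + 4 * (M + 1) * densBound M + 3 * densBound M

lemma rhoLip_nonneg (hM : 0 ≤ M) : 0 ≤ rhoLip M := by
  have := densBound_nonneg hM
  unfold rhoLip; positivity

lemma LabelBound.abs_labRho_sub_le (h : LabelBound M N β) (hκ : ∀ i, |κ i| ≤ M + 1)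
    (hκ' : ∀ i, |κ' i| ≤ M + 1) (hU : |U| ≤ M + 1) (hU' : |U'| ≤ M + 1)
    (hdκ : ∀ i, |κ i - κ' i| ≤ d) (hdθ : ∀ i, |θ i - θ' i| ≤ d) (hdU : |U - U'| ≤ d) :
    |labRho N β U θ κ - labRho N β U' θ' κ'| ≤ rhoLip M * d +
      densBound M * ∑ i, |crossFactor (β i) (θ i) - crossFactor (β i) (θ' i)| := by
  have h1 := h.abs_labQ_sub_le hκ hκ' hdκ hdθ
  have h2 := h.abs_labH_sub_le hκ hκ' hdκ hdθ
  have h3 := h.labQ_nonneg (θ := θ') (κ := κ')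
  have h4 := h.labH_nonneg (θ := θ') (κ := κ')
  have h5 := h.labQ_add_labH_le (θ := θ') hκ'
  have hM := h.M_nonneg
  have hD := densBound_nonneg hM
  have hd0 := (abs_nonneg _).trans hdU
  have hU2 : U ^ 2 ≤ (M + 1) ^ 2 := sq_le_sq' (abs_le.1 hU).1 (abs_le.1 hU).2
  have e1 : labRho N β U θ κ - labRho N β U' θ' κ' =
      2 * U ^ 2 * (labQ N β θ κ - labQ N β θ' κ') + 2 * ((U + U') * (U - U')) * labQ N β θ' κ' +
      (labH N β θ κ - labH N β θ' κ') := by unfold labRho; ring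
  rw [e1]
  refine (abs_add_le _ _).trans ((add_le_add_left (abs_add_le _ _) _).trans ?_)
  have b1 : |2 * U ^ 2 * (labQ N β θ κ - labQ N β θ' κ')| ≤ 2 * (M + 1) ^ 2 * (3 * densBound M * d) := by
    rw [abs_mul, abs_of_nonneg (by positivity)]
    gcongr
  have b2 : |2 * ((U + U') * (U - U')) * labQ N β θ' κ'| ≤ 2 * ((2 * (M + 1)) * d) * densBound M := by
    rw [abs_mul, abs_mul, abs_mul, abs_two, abs_of_nonneg h3]
    have : |U + U'| ≤ 2 * (M + 1) := (abs_add_le _ _).trans (by linarith)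
    gcongr
    linarith
  unfold rhoLip
  nlinarith

lemma LabelBound.labH_le (h : LabelBound M N β) (hκ : ∀ i, |κ i| ≤ M + 1) :
    labH N β θ κ ≤ Real.exp (M + 1) * ∑ i, N i * Real.cos (θ i) ^ 2 := by
  unfold labH
  rw [Finset.mul_sum]
  refine Finset.sum_le_sum fun i _ => ?_
  calc N i * angH (β i) (θ i) (κ i) ≤ N i * (Real.exp (M + 1) * Real.cos (θ i) ^ 2) :=
        mul_le_mul_of_nonneg_left (angH_le_cos_sq (h.beta i) (hκ i)) (h.nonneg i)
    _ = _ := by ring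

end LabelBounds

lemma abs_angF_sub_le {a a' θ θ' A : ℝ} (ha : |a| ≤ A) :
    |angF a θ - angF a' θ'| ≤ (1 + 2 * A) * |θ - θ'| + |a - a'| * Real.sin θ' ^ 2 := by
  have h1 : angF a θ - angF a' θ' = 1 / 2 * (Real.cos θ ^ 2 - Real.cos θ' ^ 2) -
    a * (Real.sin θ ^ 2 - Real.sin θ' ^ 2) - (a - a') * Real.sin θ' ^ 2 := by unfold angF; ring
  have hA : 0 ≤ A := (abs_nonneg a).trans ha
  have h2 := abs_cos_sq_sub_le θ θ'
  have h3 := abs_sin_sq_sub_le θ θ'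
  rw [h1]
  refine (abs_sub _ _).trans (add_le_add ((abs_sub _ _).trans ?_) ?_)
  · rw [abs_mul, abs_mul, abs_of_pos (by norm_num : (0 : ℝ) < 1 / 2)]
    have : |a| * |Real.sin θ ^ 2 - Real.sin θ' ^ 2| ≤ A * (2 * |θ - θ'|) := by gcongr
    linarith
  · rw [abs_mul, abs_of_nonneg (sq_nonneg (Real.sin θ'))]

lemma abs_angG_sub_le {a a' θ θ' A : ℝ} (ha : |a| ≤ A) :
    |angG a θ - angG a' θ'| ≤ (2 + 4 * A) * |θ - θ'| + |a - a'| := by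
  have h1 : angG a θ - angG a' θ' =
    (1 / 2 + a) * (2 * (Real.sin θ * Real.cos θ - Real.sin θ' * Real.cos θ')) +
    (a - a') * (2 * (Real.sin θ' * Real.cos θ')) := by unfold angG; ring
  have hA : 0 ≤ A := (abs_nonneg a).trans ha
  have h2 := abs_sin_mul_cos_sub_le θ θ'
  have h3 : |1 / 2 + a| ≤ 1 / 2 + A := (abs_add_le _ _).trans (by norm_num; exact ha)
  rw [h1]
  refine (abs_add_le _ _).trans (add_le_add ?_ ?_)
  · rw [abs_mul, abs_mul, abs_two]
    calc _ ≤ (1 / 2 + A) * (2 * (2 * |θ - θ'|)) := by gcongr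
      _ = _ := by ring
  · rw [abs_mul]
    refine mul_le_of_le_one_right (abs_nonneg _) ?_
    rw [abs_mul, abs_two]
    linarith [abs_sin_mul_cos_le θ']

lemma quarter_le_angF {a θ L : ℝ} (ha : 1 / 2 + |a| ≤ L) (hs : L * Real.sin θ ^ 2 ≤ 1 / 4) :
    1 / 4 ≤ angF a θ := by
  unfold angF
  rw [Real.cos_sq']
  have h2 : (1 / 2 + a) * Real.sin θ ^ 2 ≤ L * Real.sin θ ^ 2 :=
    mul_le_mul_of_nonneg_right (by linarith [le_abs_self a]) (sq_nonneg _)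
  linarith

lemma sin_sq_le_of_near {θ e : ℝ} {n : ℕ} (h : |θ - n * Real.pi| ≤ e) : Real.sin θ ^ 2 ≤ e ^ 2 := by
  have h2 : |Real.sin θ| = |Real.sin (θ - n * Real.pi)| := by
    rw [Real.sin_sub_nat_mul_pi, abs_mul, abs_pow]; simp
  rw [← sq_abs, h2]
  have h3 : |Real.sin (θ - n * Real.pi)| ≤ e := Real.abs_sin_le_abs.trans h
  gcongr

/-- Two paths that stay close cross the multiples of `π` at almost the same times. -/
lemma integral_crossFactor_sub_le {β s t θ₀ η e : ℝ} {θ θ' : ℝ → ℝ} (hst : s ≤ t)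
    (hβ : β ∈ Icc (0 : ℝ) 1) (hη : η ≤ 1) (he : 0 ≤ e)
    (h1 : ∀ r ∈ Icc s t, |θ r - θ₀| ≤ η) (h2 : ∀ r ∈ Icc s t, |θ' r - θ₀| ≤ η)
    (hB : (∃ n : ℕ, |θ₀ - n * Real.pi| ≤ η) →
      (∀ r ∈ Icc s t, ∀ r' ∈ Icc s t, r ≤ r' → (r' - r) / 4 ≤ θ r' - θ r) ∧
      ∀ r ∈ Icc s t, |θ r - θ' r| ≤ e) :
    ∫ r in s..t, |crossFactor β (θ r) - crossFactor β (θ' r)| ≤ 8 * e := by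
  have hstay : ∀ x : ℝ, |x - θ₀| ≤ η → crossFactor β x ≠ crossFactor β θ₀ →
      ∃ n : ℕ, |θ₀ - n * Real.pi| ≤ η := fun x hx hne => by
    obtain ⟨n, -, -, h4, -⟩ := exists_between_of_crossFactor_ne hne
    exact ⟨n, h4.trans hx⟩
  by_cases hex : ∃ n : ℕ, |θ₀ - n * Real.pi| ≤ η
  · obtain ⟨hs, hd⟩ := hB hex
    set E : Set ℝ := {r | r ∈ Icc s t ∧ crossFactor β (θ r) ≠ crossFactor β (θ' r)} with hE
    have hclose : ∀ r ∈ E, ∀ r' ∈ E, |r - r'| ≤ 8 * e := by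
      have key : ∀ r ∈ E, ∃ n : ℕ, |θ r - n * Real.pi| ≤ e ∧ |n * Real.pi - θ₀| ≤ η := by
        rintro r ⟨hr, hne⟩
        obtain ⟨n, -, h4, h5, h6⟩ := exists_between_of_crossFactor_ne hne
        refine ⟨n, h4.trans (hd r hr), ?_⟩
        have a1 := h1 r hr
        have a2 := h2 r hr
        have a3 := abs_sub_abs_le_abs_sub (θ r) (θ' r)
        rw [abs_le] at *
        rcases le_total (θ r) (n * Real.pi) with b1 | b1 <;>
        rcases le_total (θ' r) (n * Real.pi) with b2 | b2
        · rw [abs_of_nonpos (by linarith), abs_of_nonpos (by linarith)] at h6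
          have := le_abs_self (θ r - θ' r)
          have := neg_abs_le (θ r - θ' r)
          rcases abs_cases (θ r - θ' r) with ⟨c, _⟩ | ⟨c, _⟩ <;> constructor <;> linarith
        · constructor <;> linarith
        · constructor <;> linarith
        · rw [abs_of_nonneg (by linarith), abs_of_nonneg (by linarith)] at h6
          rcases abs_cases (θ r - θ' r) with ⟨c, _⟩ | ⟨c, _⟩ <;> constructor <;> linarith
      have main : ∀ r ∈ E, ∀ r' ∈ E, r ≤ r' → r' - r ≤ 8 * e := by
        intro r hr r' hr' hle
        obtain ⟨n, h4, h5⟩ := key r hr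
        obtain ⟨n', h4', h5'⟩ := key r' hr'
        have hnn : n = n' := by
          have hp := Real.pi_gt_three
          have : |(n - n' : ℝ) * Real.pi| ≤ 2 := by
            have : (n - n' : ℝ) * Real.pi = (n * Real.pi - θ₀) - (n' * Real.pi - θ₀) := by ring
            rw [this]
            exact (abs_sub _ _).trans (by linarith)
          rw [abs_mul, abs_of_pos Real.pi_pos] at this
          by_contra hne
          have h6 : (1 : ℝ) ≤ |(n : ℝ) - n'| := by
            have : (1 : ℤ) ≤ |(n : ℤ) - n'| := Int.one_le_abs (by omega)
            exact_mod_cast this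
          nlinarith
        subst hnn
        have h6 := hs r hr.1 r' hr'.1 hle
        have a1 := abs_le.1 h4
        have a2 := abs_le.1 h4'
        linarith [a1.1, a1.2, a2.1, a2.2]
      intro r hr r' hr'
      rcases le_total r r' with h | h
      · rw [abs_of_nonpos (by linarith)]; linarith [main r hr r' hr' h]
      · rw [abs_of_nonneg (by linarith)]; linarith [main r' hr' r hr h]
    have hvol : volume E ≤ ENNReal.ofReal (8 * e) := by
      refine (Real.volume_le_diam E).trans ?_
      refine Metric.ediam_le fun x hx y hy => ?_
      rw [edist_dist, Real.dist_eq]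
      exact ENNReal.ofReal_le_ofReal (hclose x hx y hy)
    have hfin : volume E ≠ ∞ := ne_top_of_le_ne_top ENNReal.ofReal_ne_top hvol
    rw [intervalIntegral.integral_of_le hst]
    have h7 : ∫ r in Ioc s t, |crossFactor β (θ r) - crossFactor β (θ' r)| ≤
        ∫ r in Ioc s t, (toMeasurable volume E).indicator (fun _ => (1 : ℝ)) r := by
      by_cases hi : IntegrableOn (fun r => |crossFactor β (θ r) - crossFactor β (θ' r)|) (Ioc s t)
      · refine setIntegral_mono_on hi ?_ measurableSet_Ioc fun r hr => ?_
        · exact (integrable_const 1).indicator (measurableSet_toMeasurable _ _)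
        · by_cases hrE : r ∈ E
          · rw [indicator_of_mem (subset_toMeasurable _ _ hrE)]
            have b1 := crossFactor_nonneg hβ.1 (θ r)
            have b2 := crossFactor_nonneg hβ.1 (θ' r)
            have b3 := crossFactor_le_one hβ.1 hβ.2 (θ r)
            have b4 := crossFactor_le_one hβ.1 hβ.2 (θ' r)
            rw [abs_le]; constructor <;> linarith
          · have : crossFactor β (θ r) = crossFactor β (θ' r) := by
              by_contra hne; exact hrE ⟨⟨hr.1.le, hr.2⟩, hne⟩
            rw [this, sub_self, abs_zero]
            exact indicator_nonneg (fun _ _ => zero_le_one) _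
      · rw [integral_undef hi]
        exact setIntegral_nonneg measurableSet_Ioc fun r _ =>
          indicator_nonneg (fun _ _ => zero_le_one) _
    refine h7.trans ?_
    rw [setIntegral_indicator (measurableSet_toMeasurable _ _), setIntegral_const, smul_eq_mul,
      mul_one]
    refine ENNReal.toReal_le_of_le_ofReal (by positivity) ?_
    refine (measure_mono inter_subset_right).trans ?_
    rw [measure_toMeasurable]; exact hvol
  · have h8 : ∀ r ∈ Icc s t, |crossFactor β (θ r) - crossFactor β (θ' r)| = 0 := fun r hr => by
      have e1 : crossFactor β (θ r) = crossFactor β θ₀ := by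
        by_contra hne; exact hex (hstay _ (h1 r hr) hne)
      have e2 : crossFactor β (θ' r) = crossFactor β θ₀ := by
        by_contra hne; exact hex (hstay _ (h2 r hr) hne)
      rw [e1, e2, sub_self, abs_zero]
    rw [intervalIntegral.integral_congr (g := fun _ => 0) fun r hr => by
      rw [uIcc_of_le hst] at hr; exact h8 r hr]
    simp; exact he

/-! ### States -/

/-- Component weights and jump factors as functions of the label. -/
structure Weights where
  N : ℝ → Fin 2 → ℝ
  β : ℝ → Fin 2 → ℝ

/-- The evolving variables as functions of the label. -/
structure AngState where
  U : ℝ → ℝ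
  θ : ℝ → Fin 2 → ℝ
  κ : ℝ → Fin 2 → ℝ

namespace Weights

variable (c : Weights) (Z : AngState) (ξ : ℝ)

def q : ℝ := labQ (c.N ξ) (c.β ξ) (Z.θ ξ) (Z.κ ξ)
def w : ℝ := labW (c.N ξ) (c.β ξ) (Z.θ ξ) (Z.κ ξ)
def hb : ℝ := labH (c.N ξ) (c.β ξ) (Z.θ ξ) (Z.κ ξ)
def rho : ℝ := labRho (c.N ξ) (c.β ξ) (Z.U ξ) (Z.θ ξ) (Z.κ ξ)
def P : ℝ := 1 / 4 * nonlocalTerm (fun _ => 1) (c.q Z) (c.rho Z) ξ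
def Q : ℝ := -(1 / 4) * nonlocalTerm Real.sign (c.q Z) (c.rho Z) ξ
def a : ℝ := Z.U ξ ^ 2 - c.P Z ξ

lemma rho_eq : c.rho Z ξ = 2 * Z.U ξ ^ 2 * c.q Z ξ + c.hb Z ξ := rfl

/-- Measurable weights with values in `[0, M]` and jump factors in `[0, 1]`. -/
structure Valid (M : ℝ) : Prop where
  measN : ∀ i, Measurable fun ξ => c.N ξ i
  measβ : ∀ i, Measurable fun ξ => c.β ξ i
  bound : ∀ ξ, LabelBound M (c.N ξ) (c.β ξ)

end Weights

/-- All components are measurable. -/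
structure AngState.Meas (Z : AngState) : Prop where
  U : Measurable Z.U
  θ : ∀ i, Measurable fun ξ => Z.θ ξ i
  κ : ∀ i, Measurable fun ξ => Z.κ ξ i

/-- A path with measurable values and continuous in time at every label. -/
structure RegularPath (X : ℝ → AngState) : Prop where
  meas : ∀ t, (X t).Meas
  contU : ∀ ξ, Continuous fun t => (X t).U ξ
  contθ : ∀ ξ i, Continuous fun t => (X t).θ ξ i
  contκ : ∀ ξ i, Continuous fun t => (X t).κ ξ i

/-- The bounds under which the nonlocal terms are controlled. -/
structure Tube (c : Weights) (M : ℝ) (Z : AngState) : Prop where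
  meas : Z.Meas
  U : ∀ ξ, |Z.U ξ| ≤ M + 1
  κ : ∀ ξ i, |Z.κ ξ i| ≤ M + 1
  kernel : KernelBound M (c.q Z)

section Measurability

lemma measurable_angQ_comp {α : Type*} [MeasurableSpace α] {β θ κ : α → ℝ} (hβ : Measurable β)
    (hθ : Measurable θ) (hκ : Measurable κ) : Measurable fun x => angQ (β x) (θ x) (κ x) := by
  have := measurable_crossFactor.comp (hβ.prodMk hθ)
  exact hκ.exp.mul (this.mul ((Real.measurable_sin.comp hθ).pow_const 2))

lemma measurable_angW_comp {α : Type*} [MeasurableSpace α] {β θ κ : α → ℝ} (hβ : Measurable β)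
    (hθ : Measurable θ) (hκ : Measurable κ) : Measurable fun x => angW (β x) (θ x) (κ x) := by
  have := measurable_crossFactor.comp (hβ.prodMk hθ)
  exact hκ.exp.mul (this.mul ((Real.measurable_sin.comp hθ).mul (Real.measurable_cos.comp hθ)))

lemma measurable_angH_comp {α : Type*} [MeasurableSpace α] {β θ κ : α → ℝ} (hβ : Measurable β)
    (hθ : Measurable θ) (hκ : Measurable κ) : Measurable fun x => angH (β x) (θ x) (κ x) := by
  have := measurable_crossFactor.comp (hβ.prodMk hθ)
  exact hκ.exp.mul (this.mul ((Real.measurable_cos.comp hθ).pow_const 2))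

variable {c : Weights} {M : ℝ} {Z : AngState}

lemma Weights.Valid.M_nonneg (hc : c.Valid M) : 0 ≤ M := (hc.bound 0).M_nonneg

lemma Weights.Valid.q_nonneg (hc : c.Valid M) (ξ : ℝ) : 0 ≤ c.q Z ξ := (hc.bound ξ).labQ_nonneg

lemma Weights.Valid.hb_nonneg (hc : c.Valid M) (ξ : ℝ) : 0 ≤ c.hb Z ξ := (hc.bound ξ).labH_nonneg

lemma Weights.Valid.rho_nonneg (hc : c.Valid M) (ξ : ℝ) : 0 ≤ c.rho Z ξ :=
  (hc.bound ξ).labRho_nonneg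

lemma Weights.Valid.measurable_q (hc : c.Valid M) (hZ : Z.Meas) : Measurable (c.q Z) :=
  Finset.measurable_sum (f := fun i ξ => c.N ξ i * angQ (c.β ξ i) (Z.θ ξ i) (Z.κ ξ i))
    Finset.univ fun i _ => (hc.measN i).mul
    (measurable_angQ_comp (hc.measβ i) (hZ.θ i) (hZ.κ i))

lemma Weights.Valid.measurable_w (hc : c.Valid M) (hZ : Z.Meas) : Measurable (c.w Z) :=
  Finset.measurable_sum (f := fun i ξ => c.N ξ i * angW (c.β ξ i) (Z.θ ξ i) (Z.κ ξ i))
    Finset.univ fun i _ => (hc.measN i).mul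
    (measurable_angW_comp (hc.measβ i) (hZ.θ i) (hZ.κ i))

lemma Weights.Valid.measurable_hb (hc : c.Valid M) (hZ : Z.Meas) : Measurable (c.hb Z) :=
  Finset.measurable_sum (f := fun i ξ => c.N ξ i * angH (c.β ξ i) (Z.θ ξ i) (Z.κ ξ i))
    Finset.univ fun i _ => (hc.measN i).mul
    (measurable_angH_comp (hc.measβ i) (hZ.θ i) (hZ.κ i))

lemma Weights.Valid.measurable_rho (hc : c.Valid M) (hZ : Z.Meas) : Measurable (c.rho Z) :=
  (((hZ.U.pow_const 2).const_mul 2).mul (hc.measurable_q hZ)).add (hc.measurable_hb hZ)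

variable {X : ℝ → AngState}

lemma RegularPath.measurable_U (hX : RegularPath X) :
    Measurable (Function.uncurry fun t ξ => (X t).U ξ) :=
  measurable_uncurry_of_continuous_of_measurable hX.contU fun t => (hX.meas t).U

lemma RegularPath.measurable_θ (hX : RegularPath X) (i : Fin 2) :
    Measurable (Function.uncurry fun t ξ => (X t).θ ξ i) :=
  measurable_uncurry_of_continuous_of_measurable (fun ξ => hX.contθ ξ i) fun t => (hX.meas t).θ i

lemma RegularPath.measurable_κ (hX : RegularPath X) (i : Fin 2) :
    Measurable (Function.uncurry fun t ξ => (X t).κ ξ i) :=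
  measurable_uncurry_of_continuous_of_measurable (fun ξ => hX.contκ ξ i) fun t => (hX.meas t).κ i

lemma RegularPath.measurable_q (hX : RegularPath X) (hc : c.Valid M) :
    Measurable (Function.uncurry fun t => c.q (X t)) :=
  Finset.measurable_sum (f := fun i (p : ℝ × ℝ) =>
      c.N p.2 i * angQ (c.β p.2 i) ((X p.1).θ p.2 i) ((X p.1).κ p.2 i))
    Finset.univ fun i _ => ((hc.measN i).comp measurable_snd).mul
    (measurable_angQ_comp ((hc.measβ i).comp measurable_snd) (hX.measurable_θ i) (hX.measurable_κ i))

lemma RegularPath.measurable_w (hX : RegularPath X) (hc : c.Valid M) :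
    Measurable (Function.uncurry fun t => c.w (X t)) :=
  Finset.measurable_sum (f := fun i (p : ℝ × ℝ) =>
      c.N p.2 i * angW (c.β p.2 i) ((X p.1).θ p.2 i) ((X p.1).κ p.2 i))
    Finset.univ fun i _ => ((hc.measN i).comp measurable_snd).mul
    (measurable_angW_comp ((hc.measβ i).comp measurable_snd) (hX.measurable_θ i) (hX.measurable_κ i))

lemma RegularPath.measurable_hb (hX : RegularPath X) (hc : c.Valid M) :
    Measurable (Function.uncurry fun t => c.hb (X t)) :=
  Finset.measurable_sum (f := fun i (p : ℝ × ℝ) =>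
      c.N p.2 i * angH (c.β p.2 i) ((X p.1).θ p.2 i) ((X p.1).κ p.2 i))
    Finset.univ fun i _ => ((hc.measN i).comp measurable_snd).mul
    (measurable_angH_comp ((hc.measβ i).comp measurable_snd) (hX.measurable_θ i) (hX.measurable_κ i))

lemma RegularPath.measurable_rho (hX : RegularPath X) (hc : c.Valid M) :
    Measurable (Function.uncurry fun t => c.rho (X t)) :=
  (((hX.measurable_U.pow_const 2).const_mul 2).mul (hX.measurable_q hc)).add (hX.measurable_hb hc)

lemma RegularPath.measurable_P (hX : RegularPath X) (hc : c.Valid M)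
    (hi : ∀ t a b, IntervalIntegrable (c.q (X t)) volume a b) :
    Measurable (Function.uncurry fun t => c.P (X t)) :=
  (measurable_nonlocalTerm measurable_const (hX.measurable_q hc) (hX.measurable_rho hc)
    hi).const_mul _

lemma RegularPath.measurable_Q (hX : RegularPath X) (hc : c.Valid M)
    (hi : ∀ t a b, IntervalIntegrable (c.q (X t)) volume a b) :
    Measurable (Function.uncurry fun t => c.Q (X t)) :=
  (measurable_nonlocalTerm measurable_sign (hX.measurable_q hc) (hX.measurable_rho hc)
    hi).const_mul _

lemma RegularPath.measurable_a (hX : RegularPath X) (hc : c.Valid M)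
    (hi : ∀ t a b, IntervalIntegrable (c.q (X t)) volume a b) :
    Measurable (Function.uncurry fun t => c.a (X t)) :=
  (hX.measurable_U.pow_const 2).sub (hX.measurable_P hc hi)

end Measurability

section TubeBounds

variable {c : Weights} {M : ℝ} {Z : AngState} (hc : c.Valid M) (hZ : Tube c M Z)
include hc hZ

lemma Tube.rho_abs (ξ : ℝ) : |c.rho Z ξ| ≤ rhoBound M := by
  rw [abs_of_nonneg (hc.rho_nonneg ξ)]
  exact (hc.bound ξ).labRho_le (hZ.κ ξ) (hZ.U ξ)

lemma Tube.abs_P_le (ξ : ℝ) : |c.P Z ξ| ≤ nonlocalBound M := by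
  have h := hZ.kernel.abs_nonlocalTerm_le_const (σ := fun _ => 1) (by simp)
    (hc.measurable_rho hZ.meas).aestronglyMeasurable (.of_forall (hZ.rho_abs hc)) ξ
  unfold Weights.P nonlocalBound
  rw [abs_mul, abs_of_pos (by norm_num : (0 : ℝ) < 1 / 4)]
  linarith [abs_nonneg (nonlocalTerm (fun _ => 1) (c.q Z) (c.rho Z) ξ)]

lemma Tube.abs_Q_le (ξ : ℝ) : |c.Q Z ξ| ≤ nonlocalBound M := by
  have h := hZ.kernel.abs_nonlocalTerm_le_const abs_sign_le_one
    (hc.measurable_rho hZ.meas).aestronglyMeasurable (.of_forall (hZ.rho_abs hc)) ξ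
  unfold Weights.Q nonlocalBound
  rw [abs_mul, abs_neg, abs_of_pos (by norm_num : (0 : ℝ) < 1 / 4)]
  linarith [abs_nonneg (nonlocalTerm Real.sign (c.q Z) (c.rho Z) ξ)]

lemma Tube.abs_a_le (ξ : ℝ) : |c.a Z ξ| ≤ (M + 1) ^ 2 + nonlocalBound M := by
  unfold Weights.a
  refine (abs_sub _ _).trans (add_le_add ?_ (hZ.abs_P_le hc ξ))
  rw [abs_of_nonneg (sq_nonneg _)]
  exact sq_le_sq' (abs_le.1 (hZ.U ξ)).1 (abs_le.1 (hZ.U ξ)).2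

lemma Tube.abs_a_le' (ξ : ℝ) : 1 / 2 + |c.a Z ξ| ≤ speedBound M := by
  have h1 := hZ.abs_a_le hc ξ
  have h2 := (abs_nonneg _).trans h1
  unfold speedBound; linarith

lemma Tube.nonlocal_decay {D : ℝ → ℝ} {C B : ℝ} (hC : 0 ≤ C) (hD : Measurable D)
    (hD0 : ∀ ξ, 0 ≤ D ξ) (hDB : ∀ ξ, D ξ ≤ B) (hconv : ∀ ξ, expConv (1 / 2) D ξ ≤ 9 * D ξ)
    (hρ : ∀ᵐ ξ, c.rho Z ξ ≤ C * D ξ) (ξ : ℝ) :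
    |c.P Z ξ| ≤ 9 * Real.exp M * C * D ξ ∧ |c.Q Z ξ| ≤ 9 * Real.exp M * C * D ξ := by
  have hm := (hc.measurable_rho hZ.meas).aestronglyMeasurable (μ := volume)
  have h1 : expConv (1 / 2) (fun η => |c.rho Z η|) ξ ≤ C * (9 * D ξ) := by
    refine (expConv_mono (R := C * B) (by norm_num) hm.norm (hD.const_mul C).aestronglyMeasurable
      (.of_forall fun η => ?_) (.of_forall fun η => abs_nonneg _) ?_ ξ).trans ?_
    · rw [abs_of_nonneg (mul_nonneg hC (hD0 η))]
      exact mul_le_mul_of_nonneg_left (hDB η) hC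
    · filter_upwards [hρ] with η h
      rwa [Real.norm_eq_abs, abs_of_nonneg (hc.rho_nonneg η)]
    · rw [expConv_const_mul]
      exact mul_le_mul_of_nonneg_left (hconv ξ) hC
  have e0 := Real.exp_pos M
  have h2 := hZ.kernel.abs_nonlocalTerm_le (σ := fun _ => 1) (by simp) hm
    (.of_forall (hZ.rho_abs hc)) ξ
  have h3 := hZ.kernel.abs_nonlocalTerm_le abs_sign_le_one hm
    (.of_forall (hZ.rho_abs hc)) ξ
  have h4 : Real.exp M * expConv (1 / 2) (fun η => |c.rho Z η|) ξ ≤ 9 * Real.exp M * C * D ξ := by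
    calc _ ≤ Real.exp M * (C * (9 * D ξ)) := mul_le_mul_of_nonneg_left h1 e0.le
      _ = _ := by ring
  constructor
  · unfold Weights.P
    rw [abs_mul, abs_of_pos (by norm_num : (0 : ℝ) < 1 / 4)]
    linarith [abs_nonneg (nonlocalTerm (fun _ => 1) (c.q Z) (c.rho Z) ξ)]
  · unfold Weights.Q
    rw [abs_mul, abs_neg, abs_of_pos (by norm_num : (0 : ℝ) < 1 / 4)]
    linarith [abs_nonneg (nonlocalTerm Real.sign (c.q Z) (c.rho Z) ξ)]

lemma Tube.rho_le_cos (ξ : ℝ) : c.rho Z ξ ≤ 2 * densBound M * Z.U ξ ^ 2 +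
    Real.exp (M + 1) * ∑ i, c.N ξ i * Real.cos (Z.θ ξ i) ^ 2 := by
  have h1 := (hc.bound ξ).labH_le (θ := Z.θ ξ) (hZ.κ ξ)
  have h2 := (hc.bound ξ).labQ_add_labH_le (θ := Z.θ ξ) (hZ.κ ξ)
  have h3 := (hc.bound ξ).labH_nonneg (θ := Z.θ ξ) (κ := Z.κ ξ)
  have h4 : Z.U ξ ^ 2 * c.q Z ξ ≤ Z.U ξ ^ 2 * densBound M :=
    mul_le_mul_of_nonneg_left (by unfold Weights.q; linarith) (sq_nonneg _)
  rw [Weights.rho_eq]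
  unfold Weights.hb
  linarith

end TubeBounds

/-- A majorant for the difference of nonlocal terms along two paths. -/
lemma exists_nonlocal_majorant {K R d J s t : ℝ} {q q' ρ ρ' : ℝ → ℝ → ℝ} (hst : s ≤ t)
    (hq : ∀ r ∈ Icc s t, KernelBound K (q r)) (hq' : ∀ r ∈ Icc s t, KernelBound K (q' r))
    (hρ : ∀ r ∈ Icc s t, AEStronglyMeasurable (ρ r))
    (hρ' : ∀ r ∈ Icc s t, AEStronglyMeasurable (ρ' r))
    (hΔ : AEMeasurable (Function.uncurry fun r η => |ρ r η - ρ' r η|)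
      ((volume.restrict (Ioc s t)).prod volume))
    (hb : ∀ᵐ η, ∀ r ∈ Icc s t, |ρ r η| ≤ R ∧ |ρ' r η| ≤ R ∧ |q r η - q' r η| ≤ d)
    (hJ : ∀ᵐ η, ∫ r in s..t, |ρ r η - ρ' r η| ≤ J) (ξ : ℝ) :
    ∃ g : ℝ → ℝ, IntervalIntegrable g volume s t ∧
      (∀ σ : ℝ → ℝ, Measurable σ → (∀ x, |σ x| ≤ 1) → ∀ r ∈ Icc s t,
        |nonlocalTerm σ (q r) (ρ r) ξ - nonlocalTerm σ (q' r) (ρ' r) ξ| ≤ g r) ∧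
      ∫ r in s..t, g r ≤ Real.exp K * (32 * R * d * (t - s) + 4 * J) := by
  have hB : ∀ᵐ p ∂(volume.restrict (Ioc s t)).prod volume,
      Function.uncurry (fun r η => |ρ r η - ρ' r η|) p ≤ 2 * R := by
    have h1 : ∀ᵐ p ∂(volume.restrict (Ioc s t)).prod (volume : Measure ℝ),
        ∀ r ∈ Icc s t, |ρ r p.2| ≤ R ∧ |ρ' r p.2| ≤ R ∧ |q r p.2 - q' r p.2| ≤ d :=
      Measure.quasiMeasurePreserving_snd.ae hb
    have h2 : ∀ᵐ p ∂(volume.restrict (Ioc s t)).prod (volume : Measure ℝ), p.1 ∈ Ioc s t :=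
      Measure.quasiMeasurePreserving_fst.ae (ae_restrict_mem measurableSet_Ioc)
    filter_upwards [h1, h2] with p hp hp1
    obtain ⟨e1, e2, -⟩ := hp p.1 ⟨hp1.1.le, hp1.2⟩
    exact (abs_sub _ _).trans (by linarith)
  have h3 := integral_expConv_le hst hΔ (fun _ _ => abs_nonneg _) hB hJ ξ
  refine ⟨fun r => Real.exp K * (32 * R * d + expConv (1 / 2) (fun η => |ρ r η - ρ' r η|) ξ),
    (intervalIntegrable_const.add h3.1).const_mul _, fun σ hσm hσ r hr => ?_, ?_⟩
  · exact abs_nonlocalTerm_sub_le (hq r hr) (hq' r hr) hσm hσ (hρ r hr) (hρ' r hr)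
      (hb.mono fun η h => (h r hr).1) (hb.mono fun η h => (h r hr).2.1)
      (hb.mono fun η h => (h r hr).2.2) ξ
  · rw [intervalIntegral.integral_const_mul, intervalIntegral.integral_add intervalIntegrable_const
      h3.1, intervalIntegral.integral_const, smul_eq_mul]
    refine mul_le_mul_of_nonneg_left ?_ (Real.exp_pos K).le
    have := h3.2
    linarith

lemma abs_integral_sub_integral_le {f f' g : ℝ → ℝ} {s t T : ℝ} (hst : s ≤ t) (htT : t ≤ T)
    (hf : IntervalIntegrable f volume s T) (hf' : IntervalIntegrable f' volume s T)
    (hg : IntervalIntegrable g volume s T) (h : ∀ r ∈ Icc s T, |f r - f' r| ≤ g r) :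
    |(∫ r in s..t, f r) - ∫ r in s..t, f' r| ≤ ∫ r in s..T, g r := by
  have hsub : uIcc s t ⊆ uIcc s T := by
    rw [uIcc_of_le hst, uIcc_of_le (hst.trans htT)]; exact Icc_subset_Icc_right htT
  rw [← intervalIntegral.integral_sub (hf.mono_set hsub) (hf'.mono_set hsub)]
  refine (intervalIntegral.norm_integral_le_of_norm_le hst (f := fun r => f r - f' r) (g := g) (.of_forall fun r hr =>
    h r ⟨hr.1.le, hr.2.trans htT⟩) (hg.mono_set hsub)).trans ?_
  refine intervalIntegral.integral_mono_interval le_rfl hst htT ?_ hg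
  refine (ae_restrict_iff' measurableSet_Ioc).2 (.of_forall fun r hr => ?_)
  exact (abs_nonneg _).trans (h r ⟨hr.1.le, hr.2⟩)

/-! ### Step size -/

def decayBound (M : ℝ) : ℝ := 9 * (M ^ 2 + 2 * M)
def rhoDecay (M : ℝ) : ℝ := 8 * densBound M + 8 * Real.exp (M + 1)
def nonlocalDecay (M : ℝ) : ℝ := 9 * Real.exp M * rhoDecay M
def decaySpeed (M : ℝ) : ℝ :=
  1 + (1 + Real.sqrt M) * (4 + nonlocalDecay M) * Real.sqrt (decayBound M)
def nonlocalLip (M : ℝ) : ℝ :=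
  Real.exp M * (96 * rhoBound M * densBound M + 4 * rhoLip M + 64 * densBound M)
def aLip (M : ℝ) : ℝ := 2 * (M + 1) + nonlocalLip M
def stepLip (M : ℝ) : ℝ := 2 + 4 * speedBound M + aLip M

/-- `δ` is an admissible time step and `ε` the weight of the labels that may break. -/
structure SmallStep (M δ ε : ℝ) : Prop where
  pos : 0 < δ
  le_one : δ ≤ 1
  eps : 0 < ε
  speed : speedBound M * δ ≤ 1 / 2
  kernel : 3 * densBound M * (speedBound M * δ) ≤ 1 / 2
  slope : speedBound M * (2 * (speedBound M * δ)) ^ 2 ≤ 1 / 4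
  decay : decaySpeed M * δ ≤ 1
  lip : stepLip M * (δ + ε) ≤ 1 / 2
  brk : (1 + 2 * speedBound M + 2 * speedBound M ^ 2) * δ ≤ ε / 2

lemma nonlocalLip_nonneg {M : ℝ} (hM : 0 ≤ M) : 0 ≤ nonlocalLip M := by
  have := rhoBound_nonneg hM
  have := densBound_nonneg hM
  have := rhoLip_nonneg hM
  unfold nonlocalLip; positivity

lemma stepLip_pos {M : ℝ} (hM : 0 ≤ M) : 0 < stepLip M := by
  have := nonlocalLip_nonneg hM
  have := speedBound_pos hM
  unfold stepLip aLip; positivity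

lemma exists_smallStep {M : ℝ} (hM : 0 ≤ M) : ∃ δ ε, SmallStep M δ ε := by
  have hs := stepLip_pos hM
  set ε := 1 / (4 * stepLip M) with hε
  have hε0 : 0 < ε := by positivity
  have key : ∀ (f : ℝ → ℝ) (k : ℝ), Continuous f → f 0 < k → ∀ᶠ δ in 𝓝[>] (0 : ℝ), f δ ≤ k :=
    fun f k hf hk => (((hf.tendsto 0).mono_left nhdsWithin_le_nhds).eventually
      (gt_mem_nhds hk)).mono fun x hx => le_of_lt hx
  have hall := (eventually_mem_nhdsWithin (a := (0 : ℝ)) (s := Ioi 0)).and <|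
    (key (fun δ => δ) 1 (by fun_prop) (by norm_num)).and <|
    (key (fun δ => speedBound M * δ) (1 / 2) (by fun_prop) (by norm_num)).and <|
    (key (fun δ => 3 * densBound M * (speedBound M * δ)) (1 / 2) (by fun_prop) (by norm_num)).and <|
    (key (fun δ => speedBound M * (2 * (speedBound M * δ)) ^ 2) (1 / 4) (by fun_prop)
      (by norm_num)).and <|
    (key (fun δ => decaySpeed M * δ) 1 (by fun_prop) (by norm_num)).and <|
    (key (fun δ => stepLip M * (δ + ε)) (1 / 2) (by fun_prop)
      (by simp only [zero_add, hε]; field_simp; norm_num)).and <|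
    (key (fun δ => (1 + 2 * speedBound M + 2 * speedBound M ^ 2) * δ) (ε / 2) (by fun_prop)
      (by simp only [mul_zero]; positivity))
  obtain ⟨δ, h1, h2, h3, h4, h5, h6, h7, h8⟩ := hall.exists
  exact ⟨δ, ε, h1, h2, hε0, h3, h4, h5, h6, h7, h8⟩

/-! ### Local existence -/

/-- Projection of time to `[s, s + δ]`. -/
def timeClamp (s δ t : ℝ) : ℝ := max s (min t (s + δ))

lemma continuous_timeClamp (s δ : ℝ) : Continuous (timeClamp s δ) := by
  unfold timeClamp; fun_prop

lemma timeClamp_mem {s δ : ℝ} (hδ : 0 ≤ δ) (t : ℝ) : timeClamp s δ t ∈ Icc s (s + δ) :=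
  ⟨le_max_left _ _, max_le (by linarith) (min_le_right _ _)⟩

lemma timeClamp_eq {s δ t : ℝ} (ht : t ∈ Icc s (s + δ)) : timeClamp s δ t = t := by
  unfold timeClamp; rw [min_eq_left ht.2, max_eq_right ht.1]

/-- The Picard map on `[s, s + δ]`, constant outside of this interval. -/
def Weights.picard (c : Weights) (Z₀ : AngState) (s δ : ℝ) (X : ℝ → AngState) (t : ℝ) : AngState where
  U ξ := Z₀.U ξ - ∫ r in s..timeClamp s δ t, c.Q (X r) ξ
  θ ξ i := Z₀.θ ξ i + ∫ r in s..timeClamp s δ t, angF (c.a (X r) ξ) ((X r).θ ξ i)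
  κ ξ i := Z₀.κ ξ i + ∫ r in s..timeClamp s δ t, angG (c.a (X r) ξ) ((X r).θ ξ i)

/-- Bounds on a state from which the Picard map starts. -/
structure StartBound (c : Weights) (M : ℝ) (Z₀ : AngState) : Prop where
  meas : Z₀.Meas
  U : ∀ ξ, |Z₀.U ξ| ≤ M
  κ : ∀ ξ i, |Z₀.κ ξ i| ≤ M
  kernel : ∀ η ξ, η ≤ ξ → (ξ - η) - M ≤ ∫ x in η..ξ, c.q Z₀ x

/-- Pointwise majorants `D` that are propagated by the nonlocal terms. -/
structure DecayMajorant (M : ℝ) (D : ℝ → ℝ) : Prop where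
  meas : Measurable D
  nonneg : ∀ ξ, 0 ≤ D ξ
  le : ∀ ξ, D ξ ≤ decayBound M
  conv : ∀ ξ, expConv (1 / 2) D ξ ≤ 9 * D ξ

/-- The variables that decay at infinity are bounded by `k √D`. -/
structure Decays (c : Weights) (D : ℝ → ℝ) (k : ℝ) (Z : AngState) : Prop where
  U : ∀ ξ, |Z.U ξ| ≤ k * Real.sqrt (D ξ)
  θ : ∀ ξ i, Real.sqrt (c.N ξ i) * |Real.cos (Z.θ ξ i)| ≤ k * Real.sqrt (D ξ)

/-- The paths on which the Picard map is a contraction. -/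
structure NearPath (M : ℝ) (Z₀ : AngState) (δ : ℝ) (X : ℝ → AngState) : Prop where
  reg : RegularPath X
  U : ∀ t ξ, |(X t).U ξ - Z₀.U ξ| ≤ speedBound M * δ
  θ : ∀ t ξ i, |(X t).θ ξ i - Z₀.θ ξ i| ≤ speedBound M * δ
  κ : ∀ t ξ i, |(X t).κ ξ i - Z₀.κ ξ i| ≤ speedBound M * δ

/-- The angles that may reach a multiple of `π` are increasing. -/
def SlopeOn (M : ℝ) (Z₀ : AngState) (s δ : ℝ) (X : ℝ → AngState) : Prop :=
  ∀ ξ i, (∃ n : ℕ, |Z₀.θ ξ i - n * Real.pi| ≤ speedBound M * δ) →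
    ∀ r ∈ Icc s (s + δ), ∀ r' ∈ Icc s (s + δ), r ≤ r' →
      (r' - r) / 4 ≤ (X r').θ ξ i - (X r).θ ξ i

/-- The weighted sup distance of two paths is at most `d`. -/
structure PathClose (M : ℝ) (Z₀ : AngState) (δ ε d : ℝ) (X X' : ℝ → AngState) : Prop where
  U : ∀ t ξ, |(X t).U ξ - (X' t).U ξ| ≤ d
  θ : ∀ t ξ i, |(X t).θ ξ i - (X' t).θ ξ i| ≤ d
  κ : ∀ t ξ i, |(X t).κ ξ i - (X' t).κ ξ i| ≤ d
  brk : ∀ ξ i, (∃ n : ℕ, |Z₀.θ ξ i - n * Real.pi| ≤ speedBound M * δ) →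
    ∀ t, |(X t).θ ξ i - (X' t).θ ξ i| ≤ ε * d

lemma measurable_intervalIntegral_left {f : ℝ → ℝ → ℝ} (hf : Measurable (Function.uncurry f))
    (a b : ℝ) : Measurable fun ξ => ∫ r in a..b, f r ξ := by
  unfold intervalIntegral
  exact (hf.stronglyMeasurable.integral_prod_left.measurable).sub
    (hf.stronglyMeasurable.integral_prod_left.measurable)

lemma intervalIntegrable_of_measurable {f : ℝ → ℝ} {C : ℝ} (hf : Measurable f)
    (hC : ∀ x, |f x| ≤ C) (a b : ℝ) : IntervalIntegrable f volume a b :=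
  intervalIntegrable_of_abs_le hf.aemeasurable fun x _ => hC x

lemma continuous_integral_timeClamp {f : ℝ → ℝ} {C : ℝ} (hf : Measurable f) (hC : ∀ x, |f x| ≤ C)
    (s δ : ℝ) : Continuous fun t => ∫ r in s..timeClamp s δ t, f r :=
  (intervalIntegral.continuous_primitive (fun a b => intervalIntegrable_of_measurable hf hC a b)
    s).comp (continuous_timeClamp s δ)

lemma abs_integral_timeClamp_le {f : ℝ → ℝ} {C s δ : ℝ} (hδ : 0 ≤ δ) (hC : ∀ x, |f x| ≤ C) (t : ℝ) :
    |∫ r in s..timeClamp s δ t, f r| ≤ C * δ := by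
  have h1 := intervalIntegral.norm_integral_le_of_norm_le_const (a := s) (b := timeClamp s δ t)
    (f := f) (C := C) fun x _ => hC x
  have h2 := timeClamp_mem (s := s) hδ t
  have hC0 := (abs_nonneg _).trans (hC 0)
  refine h1.trans (mul_le_mul_of_nonneg_left ?_ hC0)
  rw [abs_of_nonneg (by linarith [h2.1])]
  linarith [h2.2]

lemma measurable_angF_comp {α : Type*} [MeasurableSpace α] {a θ : α → ℝ} (ha : Measurable a)
    (hθ : Measurable θ) : Measurable fun x => angF (a x) (θ x) := by
  unfold angF; fun_prop

lemma measurable_angG_comp {α : Type*} [MeasurableSpace α] {a θ : α → ℝ} (ha : Measurable a)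
    (hθ : Measurable θ) : Measurable fun x => angG (a x) (θ x) := by
  unfold angG; fun_prop

section Picard

variable {c : Weights} {M s δ ε d : ℝ} {D : ℝ → ℝ} {Z₀ : AngState} {X X' : ℝ → AngState}
  (hc : c.Valid M) (hZ : StartBound c M Z₀) (hs : SmallStep M δ ε)

include hc hZ hs in
lemma NearPath.tube (hX : NearPath M Z₀ δ X) (t : ℝ) : Tube c M (X t) := by
  have hM := hc.M_nonneg
  have hU : ∀ ξ, |(X t).U ξ| ≤ M + 1 := fun ξ => by
    have h1 := abs_sub_abs_le_abs_sub ((X t).U ξ) (Z₀.U ξ)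
    linarith [hX.U t ξ, hZ.U ξ, hs.speed]
  have hκ : ∀ ξ i, |(X t).κ ξ i| ≤ M + 1 := fun ξ i => by
    have h1 := abs_sub_abs_le_abs_sub ((X t).κ ξ i) (Z₀.κ ξ i)
    linarith [hX.κ t ξ i, hZ.κ ξ i, hs.speed]
  have hbd : ∀ (Z : AngState) ξ, (∀ i, |Z.κ ξ i| ≤ M + 1) → |c.q Z ξ| ≤ densBound M := fun Z ξ h => by
    rw [abs_of_nonneg (hc.q_nonneg ξ)]
    have := (hc.bound ξ).labQ_add_labH_le (θ := Z.θ ξ) h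
    have := hc.hb_nonneg (Z := Z) ξ
    unfold Weights.hb at this
    unfold Weights.q
    linarith
  have hκ0 : ∀ ξ i, |Z₀.κ ξ i| ≤ M + 1 := fun ξ i => (hZ.κ ξ i).trans (by linarith)
  have hi := intervalIntegrable_of_measurable (hc.measurable_q (hX.reg.meas t))
    (fun ξ => hbd _ ξ (hκ ξ))
  have hi0 := intervalIntegrable_of_measurable (hc.measurable_q hZ.meas)
    (fun ξ => hbd _ ξ (hκ0 ξ))
  refine ⟨hX.reg.meas t, hU, hκ, ⟨hi, fun η ξ h => ?_⟩⟩
  have h1 : ∀ x, |c.q (X t) x - c.q Z₀ x| ≤ 1 / 2 := fun x =>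
    ((hc.bound x).abs_labQ_sub_le (hκ x) (hκ0 x) (hX.κ t x) (hX.θ t x)).trans hs.kernel
  have h2 := intervalIntegral.norm_integral_le_of_norm_le_const (a := η) (b := ξ)
    (f := fun x => c.q (X t) x - c.q Z₀ x) (C := 1 / 2) fun x _ => h1 x
  rw [intervalIntegral.integral_sub (hi _ _) (hi0 _ _), abs_of_nonneg (sub_nonneg.2 h)] at h2
  have h3 := (abs_le.1 h2).1
  have h4 := hZ.kernel η ξ h
  linarith

include hc hZ hs in
lemma NearPath.interval (hX : NearPath M Z₀ δ X) (t a b : ℝ) :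
    IntervalIntegrable (c.q (X t)) volume a b := (hX.tube hc hZ hs t).kernel.int a b

include hc hZ hs in
lemma NearPath.abs_angF_le (hX : NearPath M Z₀ δ X) (t ξ : ℝ) (i : Fin 2) :
    |angF (c.a (X t) ξ) ((X t).θ ξ i)| ≤ speedBound M := by
  have h1 := (hX.tube hc hZ hs t).abs_a_le hc ξ
  refine (angF_bound h1).trans ?_
  have h2 := (abs_nonneg _).trans h1
  unfold speedBound; linarith

include hc hZ hs in
lemma NearPath.abs_angG_le (hX : NearPath M Z₀ δ X) (t ξ : ℝ) (i : Fin 2) :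
    |angG (c.a (X t) ξ) ((X t).θ ξ i)| ≤ speedBound M := by
  have h1 := (hX.tube hc hZ hs t).abs_a_le hc ξ
  refine (angG_bound h1).trans ?_
  have h2 := (abs_nonneg _).trans h1
  unfold speedBound; linarith

include hc hZ hs in
lemma NearPath.abs_Q_le (hX : NearPath M Z₀ δ X) (t ξ : ℝ) : |c.Q (X t) ξ| ≤ speedBound M := by
  refine ((hX.tube hc hZ hs t).abs_Q_le hc ξ).trans ?_
  have := nonlocalBound_nonneg hc.M_nonneg
  have := sq_nonneg (M + 1)
  unfold speedBound; linarith

include hc hZ hs in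
lemma NearPath.measurable_angF (hX : NearPath M Z₀ δ X) (i : Fin 2) :
    Measurable (Function.uncurry fun t ξ => angF (c.a (X t) ξ) ((X t).θ ξ i)) :=
  have h := hX.reg.measurable_a hc (hX.interval hc hZ hs)
  measurable_angF_comp h (hX.reg.measurable_θ i)

include hc hZ hs in
lemma NearPath.measurable_angG (hX : NearPath M Z₀ δ X) (i : Fin 2) :
    Measurable (Function.uncurry fun t ξ => angG (c.a (X t) ξ) ((X t).θ ξ i)) :=
  have h := hX.reg.measurable_a hc (hX.interval hc hZ hs)
  measurable_angG_comp h (hX.reg.measurable_θ i)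

include hc in
lemma Tube.nonlocal_le_of_decays {Z : AngState} (hT : Tube c M Z) (hD : DecayMajorant M D)
    (hZD : Decays c D 2 Z) (ξ : ℝ) :
    |c.P Z ξ| ≤ nonlocalDecay M * D ξ ∧ |c.Q Z ξ| ≤ nonlocalDecay M * D ξ := by
  have hM := hc.M_nonneg
  have hA := densBound_nonneg hM
  refine hT.nonlocal_decay hc (C := rhoDecay M) (B := decayBound M)
    (by unfold rhoDecay; positivity) hD.meas hD.nonneg hD.le hD.conv
    (.of_forall fun η => (hT.rho_le_cos hc η).trans ?_) ξ
  have hD0 := hD.nonneg η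
  have h1 : Z.U η ^ 2 ≤ 4 * D η := by
    rw [← sq_abs, ← Real.sq_sqrt hD0]
    have := hZD.U η
    nlinarith [abs_nonneg (Z.U η), Real.sqrt_nonneg (D η)]
  have h2 : ∀ i, c.N η i * Real.cos (Z.θ η i) ^ 2 ≤ 4 * D η := fun i => by
    have hN := (hc.bound η).nonneg i
    have e1 : c.N η i * Real.cos (Z.θ η i) ^ 2 =
        (Real.sqrt (c.N η i) * |Real.cos (Z.θ η i)|) ^ 2 := by
      rw [mul_pow, Real.sq_sqrt hN, sq_abs]
    rw [e1]
    have h3 := hZD.θ η i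
    have h4 : 0 ≤ Real.sqrt (c.N η i) * |Real.cos (Z.θ η i)| := by positivity
    nlinarith [Real.sq_sqrt hD0, Real.sqrt_nonneg (D η)]
  have h3 : ∑ i, c.N η i * Real.cos (Z.θ η i) ^ 2 ≤ 8 * D η := by
    rw [Fin.sum_univ_two]; linarith [h2 0, h2 1]
  have h4 := Real.exp_pos (M + 1)
  unfold rhoDecay
  nlinarith [mul_le_mul_of_nonneg_left h1 hA, mul_le_mul_of_nonneg_left h3 h4.le]

lemma DecayMajorant.le_sqrt (hD : DecayMajorant M D) (ξ : ℝ) :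
    D ξ ≤ Real.sqrt (decayBound M) * Real.sqrt (D ξ) := by
  have h1 := Real.mul_self_sqrt (hD.nonneg ξ)
  have h2 := Real.sqrt_le_sqrt (hD.le ξ)
  nlinarith [Real.sqrt_nonneg (D ξ)]

include hc hZ hs in
lemma NearPath.picard (hX : NearPath M Z₀ δ X) : NearPath M Z₀ δ (c.picard Z₀ s δ X) := by
  have hδ := hs.pos.le
  have hQm := hX.reg.measurable_Q hc (hX.interval hc hZ hs)
  have hFm := hX.measurable_angF hc hZ hs
  have hGm := hX.measurable_angG hc hZ hs
  refine ⟨⟨fun t => ⟨?_, fun i => ?_, fun i => ?_⟩, fun ξ => ?_, fun ξ i => ?_, fun ξ i => ?_⟩,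
    fun t ξ => ?_, fun t ξ i => ?_, fun t ξ i => ?_⟩
  · exact hZ.meas.U.sub (measurable_intervalIntegral_left hQm _ _)
  · exact (hZ.meas.θ i).add (measurable_intervalIntegral_left (hFm i) _ _)
  · exact (hZ.meas.κ i).add (measurable_intervalIntegral_left (hGm i) _ _)
  · exact continuous_const.sub (continuous_integral_timeClamp hQm.of_uncurry_right
      (fun t => hX.abs_Q_le hc hZ hs t ξ) s δ)
  · exact continuous_const.add (continuous_integral_timeClamp (hFm i).of_uncurry_right
      (fun t => hX.abs_angF_le hc hZ hs t ξ i) s δ)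
  · exact continuous_const.add (continuous_integral_timeClamp (hGm i).of_uncurry_right
      (fun t => hX.abs_angG_le hc hZ hs t ξ i) s δ)
  · simp only [Weights.picard, sub_sub_cancel_left, abs_neg]
    exact abs_integral_timeClamp_le hδ (fun r => hX.abs_Q_le hc hZ hs r ξ) t
  · simp only [Weights.picard, add_sub_cancel_left]
    exact abs_integral_timeClamp_le hδ (fun r => hX.abs_angF_le hc hZ hs r ξ i) t
  · simp only [Weights.picard, add_sub_cancel_left]
    exact abs_integral_timeClamp_le hδ (fun r => hX.abs_angG_le hc hZ hs r ξ i) t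

include hc hZ hs in
lemma NearPath.decays_picard (hX : NearPath M Z₀ δ X) (hD : DecayMajorant M D)
    (hZD : Decays c D 1 Z₀) (hXD : ∀ t, Decays c D 2 (X t)) (t : ℝ) :
    Decays c D 2 (c.picard Z₀ s δ X t) := by
  have hM := hc.M_nonneg
  have hδ := hs.pos.le
  have hA := densBound_nonneg hM
  have hnd : 0 ≤ nonlocalDecay M := by unfold nonlocalDecay rhoDecay; positivity
  have hdecay := fun t ξ => (hX.tube hc hZ hs t).nonlocal_le_of_decays hc hD (hXD t) ξ
  have hsB := Real.sqrt_nonneg (decayBound M)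
  have hsM := Real.sqrt_nonneg M
  refine ⟨fun ξ => ?_, fun ξ i => ?_⟩
  · have h1 := abs_integral_timeClamp_le (s := s) hδ (fun r => (hdecay r ξ).2) t
    refine (abs_sub _ _).trans ?_
    have h2 := hZD.U ξ
    have h3 : nonlocalDecay M * D ξ * δ ≤ Real.sqrt (D ξ) := by
      have e1 : nonlocalDecay M * D ξ * δ ≤
          nonlocalDecay M * (Real.sqrt (decayBound M) * Real.sqrt (D ξ)) * δ := by
        gcongr; exact hD.le_sqrt ξ
      have e2 : nonlocalDecay M * Real.sqrt (decayBound M) ≤ decaySpeed M := by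
        unfold decaySpeed
        nlinarith [mul_nonneg hnd hsB, mul_nonneg (mul_nonneg hsM hnd) hsB, mul_nonneg hsM hsB]
      have e3 : nonlocalDecay M * Real.sqrt (decayBound M) * δ ≤ 1 :=
        (mul_le_mul_of_nonneg_right e2 hδ).trans hs.decay
      nlinarith [Real.sqrt_nonneg (D ξ)]
    linarith
  · have hb : ∀ r, |angF (c.a (X r) ξ) ((X r).θ ξ i)| ≤ 1 / 2 * |Real.cos ((X r).θ ξ i)| +
        (4 + nonlocalDecay M) * D ξ := fun r => by
      unfold angF Weights.a
      have h0 := Real.abs_cos_le_one ((X r).θ ξ i)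
      have h1 : Real.cos ((X r).θ ξ i) ^ 2 ≤ |Real.cos ((X r).θ ξ i)| := by
        rw [← sq_abs]; nlinarith [abs_nonneg (Real.cos ((X r).θ ξ i))]
      have h2 : (X r).U ξ ^ 2 ≤ 4 * D ξ := by
        have h3 := (hXD r).U ξ
        rw [← sq_abs]
        nlinarith [abs_nonneg ((X r).U ξ), Real.sqrt_nonneg (D ξ), Real.sq_sqrt (hD.nonneg ξ)]
      have h3 := (hdecay r ξ).1
      have h4 : |((X r).U ξ ^ 2 - c.P (X r) ξ) * Real.sin ((X r).θ ξ i) ^ 2| ≤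
          (4 + nonlocalDecay M) * D ξ := by
        rw [abs_mul, abs_of_nonneg (sq_nonneg (Real.sin _))]
        refine (mul_le_of_le_one_right (abs_nonneg _) (Real.sin_sq_le_one _)).trans ?_
        refine (abs_sub _ _).trans ?_
        rw [abs_of_nonneg (sq_nonneg _)]
        linarith
      refine (abs_sub _ _).trans (add_le_add ?_ h4)
      rw [abs_of_nonneg (by positivity)]
      linarith
    have hN := (hc.bound ξ).nonneg i
    have hsN := Real.sqrt_nonneg (c.N ξ i)
    have hNM : Real.sqrt (c.N ξ i) ≤ Real.sqrt M := Real.sqrt_le_sqrt ((hc.bound ξ).le i)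
    have hb2 : ∀ r, |Real.sqrt (c.N ξ i) * angF (c.a (X r) ξ) ((X r).θ ξ i)| ≤
        decaySpeed M * Real.sqrt (D ξ) := fun r => by
      rw [abs_mul, abs_of_nonneg hsN]
      refine (mul_le_mul_of_nonneg_left (hb r) hsN).trans ?_
      have h3 := (hXD r).θ ξ i
      have h4 : Real.sqrt (c.N ξ i) * ((4 + nonlocalDecay M) * D ξ) ≤ Real.sqrt M *
          ((4 + nonlocalDecay M) * (Real.sqrt (decayBound M) * Real.sqrt (D ξ))) := by
        have := hD.nonneg ξ
        gcongr; exact hD.le_sqrt ξ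
      have h5 : 0 ≤ (4 + nonlocalDecay M) * Real.sqrt (decayBound M) * Real.sqrt (D ξ) := by
        positivity
      unfold decaySpeed
      linarith
    have h6 := abs_integral_timeClamp_le (s := s) hδ hb2 t
    rw [intervalIntegral.integral_const_mul, abs_mul, abs_of_nonneg hsN] at h6
    have h7 := hZD.θ ξ i
    have h8 : decaySpeed M * Real.sqrt (D ξ) * δ ≤ Real.sqrt (D ξ) := by
      have := mul_le_mul_of_nonneg_right hs.decay (Real.sqrt_nonneg (D ξ))
      linarith
    have h9 : |Real.cos ((c.picard Z₀ s δ X t).θ ξ i)| ≤ |Real.cos (Z₀.θ ξ i)| +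
        |∫ r in s..timeClamp s δ t, angF (c.a (X r) ξ) ((X r).θ ξ i)| := by
      have e1 : |Real.cos ((c.picard Z₀ s δ X t).θ ξ i) - Real.cos (Z₀.θ ξ i)| ≤
          |(c.picard Z₀ s δ X t).θ ξ i - Z₀.θ ξ i| := by
        simpa [Real.dist_eq] using
          Real.lipschitzWith_cos.dist_le_mul ((c.picard Z₀ s δ X t).θ ξ i) (Z₀.θ ξ i)
      simp only [Weights.picard, add_sub_cancel_left] at e1 ⊢
      linarith [abs_sub_abs_le_abs_sub (Real.cos (Z₀.θ ξ i + ∫ r in s..timeClamp s δ t,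
        angF (c.a (X r) ξ) ((X r).θ ξ i))) (Real.cos (Z₀.θ ξ i))]
    have := mul_le_mul_of_nonneg_left h9 hsN
    linarith

include hc hZ hs in
lemma NearPath.slopeOn_picard (hX : NearPath M Z₀ δ X) : SlopeOn M Z₀ s δ (c.picard Z₀ s δ X) := by
  rintro ξ i ⟨n, hn⟩ r hr r' hr' hle
  have hFm := (hX.measurable_angF hc hZ hs i).of_uncurry_right (y := ξ)
  have hi := intervalIntegrable_of_measurable hFm fun t => hX.abs_angF_le hc hZ hs t ξ i
  simp only [Weights.picard, timeClamp_eq hr, timeClamp_eq hr']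
  rw [add_sub_add_left_eq_sub, intervalIntegral.integral_interval_sub_left (hi _ _) (hi _ _)]
  have hq : ∀ x, 1 / 4 ≤ angF (c.a (X x) ξ) ((X x).θ ξ i) := fun x => by
    have h2 := sin_sq_le_of_near (n := n) (θ := (X x).θ ξ i) (e := 2 * (speedBound M * δ)) <| by
      have e : (X x).θ ξ i - n * Real.pi = ((X x).θ ξ i - Z₀.θ ξ i) + (Z₀.θ ξ i - n * Real.pi) := by
        ring
      rw [e]
      exact (abs_add_le _ _).trans (by linarith [hX.θ x ξ i])
    refine quarter_le_angF ((hX.tube hc hZ hs x).abs_a_le' hc ξ) ?_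
    exact (mul_le_mul_of_nonneg_left h2 (speedBound_pos hc.M_nonneg).le).trans hs.slope
  have := intervalIntegral.integral_mono_on hle intervalIntegrable_const (hi r r') fun x _ => hq x
  rw [intervalIntegral.integral_const, smul_eq_mul] at this
  linarith

end Picard

section Contraction

variable {c : Weights} {M s δ ε d : ℝ} {D : ℝ → ℝ} {Z₀ : AngState} {X X' : ℝ → AngState}

lemma NearPath.close (hX : NearPath M Z₀ δ X) (hX' : NearPath M Z₀ δ X')
    (hs : SmallStep M δ ε) : PathClose M Z₀ δ ε (1 + 1 / ε) X X' := by
  have h1 := hs.speed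
  have hε := hs.eps
  have h2 : 0 < 1 / ε := by positivity
  have h3 : ε * (1 + 1 / ε) = ε + 1 := by field_simp
  have key : ∀ x x' x₀ : ℝ, |x - x₀| ≤ speedBound M * δ → |x' - x₀| ≤ speedBound M * δ →
      |x - x'| ≤ 1 := fun x x' x₀ a b => by
    have : x - x' = (x - x₀) - (x' - x₀) := by ring
    rw [this]; exact (abs_sub _ _).trans (by linarith)
  exact ⟨fun t ξ => (key _ _ _ (hX.U t ξ) (hX'.U t ξ)).trans (by linarith),
    fun t ξ i => (key _ _ _ (hX.θ t ξ i) (hX'.θ t ξ i)).trans (by linarith),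
    fun t ξ i => (key _ _ _ (hX.κ t ξ i) (hX'.κ t ξ i)).trans (by linarith),
    fun ξ i _ t => (key _ _ _ (hX.θ t ξ i) (hX'.θ t ξ i)).trans (by linarith)⟩

variable (hc : c.Valid M) (hZ : StartBound c M Z₀) (hs : SmallStep M δ ε)

include hc hZ hs in
/-- The time integral of the difference of the densities `2 U² y_ξ + h̄`. -/
lemma NearPath.integral_rho_sub_le (hX : NearPath M Z₀ δ X) (hX' : NearPath M Z₀ δ X')
    (hsl : SlopeOn M Z₀ s δ X) (hd : PathClose M Z₀ δ ε d X X') (ξ : ℝ) :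
    ∫ r in s..(s + δ), |c.rho (X r) ξ - c.rho (X' r) ξ| ≤
      (rhoLip M * δ + 16 * densBound M * ε) * d := by
  have hd0 : 0 ≤ d := (abs_nonneg _).trans (hd.U 0 0)
  have hδ := hs.pos.le
  have hle : s ≤ s + δ := by linarith
  have hT := hX.tube hc hZ hs
  have hT' := hX'.tube hc hZ hs
  have h1 : ∀ r ∈ Icc s (s + δ), |c.rho (X r) ξ - c.rho (X' r) ξ| ≤ rhoLip M * d + densBound M *
      ∑ i, |crossFactor (c.β ξ i) ((X r).θ ξ i) - crossFactor (c.β ξ i) ((X' r).θ ξ i)| :=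
    fun r _ => (hc.bound ξ).abs_labRho_sub_le ((hT r).κ ξ) ((hT' r).κ ξ) ((hT r).U ξ) ((hT' r).U ξ)
      (hd.κ r ξ) (hd.θ r ξ) (hd.U r ξ)
  have hcross : ∀ i, IntervalIntegrable (fun r => |crossFactor (c.β ξ i) ((X r).θ ξ i) -
      crossFactor (c.β ξ i) ((X' r).θ ξ i)|) volume s (s + δ) := fun i => by
    refine intervalIntegrable_of_measurable (C := 2) ?_ (fun r => ?_) _ _
    · have e : ∀ {Y : ℝ → AngState}, RegularPath Y →
          Measurable fun r => crossFactor (c.β ξ i) ((Y r).θ ξ i) := fun hY =>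
        measurable_crossFactor.comp (measurable_const.prodMk (hY.contθ ξ i).measurable)
      exact ((e hX.reg).sub (e hX'.reg)).norm
    · rw [abs_abs]
      exact (abs_sub _ _).trans (by
        linarith [abs_crossFactor_le ((hc.bound ξ).beta i) ((X r).θ ξ i),
          abs_crossFactor_le ((hc.bound ξ).beta i) ((X' r).θ ξ i)])
  have hsum : IntervalIntegrable (fun r => ∑ i, |crossFactor (c.β ξ i) ((X r).θ ξ i) -
      crossFactor (c.β ξ i) ((X' r).θ ξ i)|) volume s (s + δ) := by
    have := IntervalIntegrable.sum Finset.univ fun i (_ : i ∈ Finset.univ) => hcross i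
    simpa only [Finset.sum_fn] using this
  have h2 : ∀ i, ∫ r in s..(s + δ), |crossFactor (c.β ξ i) ((X r).θ ξ i) -
      crossFactor (c.β ξ i) ((X' r).θ ξ i)| ≤ 8 * (ε * d) := fun i =>
    integral_crossFactor_sub_le hle ((hc.bound ξ).beta i) (hs.speed.trans (by norm_num))
      (mul_nonneg hs.eps.le hd0) (fun r _ => hX.θ r ξ i) (fun r _ => hX'.θ r ξ i)
      fun hn => ⟨hsl ξ i hn, fun r _ => hd.brk ξ i hn r⟩
  have hρ : IntervalIntegrable (fun r => |c.rho (X r) ξ - c.rho (X' r) ξ|) volume s (s + δ) := by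
    refine intervalIntegrable_of_measurable (C := 2 * rhoBound M) ?_ (fun r => ?_) _ _
    · exact ((hX.reg.measurable_rho hc).of_uncurry_right.sub
        (hX'.reg.measurable_rho hc).of_uncurry_right).norm
    · rw [abs_abs]
      exact (abs_sub _ _).trans (by linarith [(hT r).rho_abs hc ξ, (hT' r).rho_abs hc ξ])
  refine (intervalIntegral.integral_mono_on hle hρ
    (intervalIntegrable_const.add (hsum.const_mul _)) h1).trans ?_
  rw [intervalIntegral.integral_add intervalIntegrable_const (hsum.const_mul _),
    intervalIntegral.integral_const, intervalIntegral.integral_const_mul,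
    intervalIntegral.integral_finsetSum fun i _ => hcross i, Fin.sum_univ_two, smul_eq_mul]
  have := mul_le_mul_of_nonneg_left (add_le_add (h2 0) (h2 1)) (densBound_nonneg hc.M_nonneg)
  linarith

include hc hZ hs in
lemma NearPath.exists_nonlocal_majorant (hX : NearPath M Z₀ δ X) (hX' : NearPath M Z₀ δ X')
    (hsl : SlopeOn M Z₀ s δ X) (hd : PathClose M Z₀ δ ε d X X') (ξ : ℝ) :
    ∃ g : ℝ → ℝ, IntervalIntegrable g volume s (s + δ) ∧
      (∀ r ∈ Icc s (s + δ), |c.P (X r) ξ - c.P (X' r) ξ| ≤ g r ∧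
        |c.Q (X r) ξ - c.Q (X' r) ξ| ≤ g r) ∧
      ∫ r in s..(s + δ), g r ≤ nonlocalLip M * (δ + ε) * d := by
  have hd0 : 0 ≤ d := (abs_nonneg _).trans (hd.U 0 0)
  have hδ := hs.pos.le
  have hT := hX.tube hc hZ hs
  have hT' := hX'.tube hc hZ hs
  have hm := hX.reg.measurable_rho hc
  have hm' := hX'.reg.measurable_rho hc
  obtain ⟨g, hg, hgb, hgi⟩ := _root_.exists_nonlocal_majorant (R := rhoBound M)
    (d := 3 * densBound M * d) (by linarith : s ≤ s + δ)
    (fun r _ => (hT r).kernel) (fun r _ => (hT' r).kernel)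
    (fun r _ => (hc.measurable_rho (hT r).meas).aestronglyMeasurable)
    (fun r _ => (hc.measurable_rho (hT' r).meas).aestronglyMeasurable)
    (hm.sub hm').norm.aemeasurable
    (.of_forall fun η r _ => ⟨(hT r).rho_abs hc η, (hT' r).rho_abs hc η,
      (hc.bound η).abs_labQ_sub_le ((hT r).κ η) ((hT' r).κ η) (hd.κ r η) (hd.θ r η)⟩)
    (.of_forall fun η => hX.integral_rho_sub_le hc hZ hs hX' hsl hd η) ξ
  refine ⟨g, hg, fun r hr => ?_, hgi.trans ?_⟩
  · have a1 := hgb (fun _ => 1) measurable_const (by simp) r hr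
    have a2 := hgb Real.sign measurable_sign abs_sign_le_one r hr
    unfold Weights.P Weights.Q
    rw [← mul_sub, ← mul_sub, abs_mul, abs_mul, abs_neg, abs_of_pos (by norm_num : (0 : ℝ) < 1 / 4)]
    constructor
    · linarith [abs_nonneg (nonlocalTerm (fun _ => 1) (c.q (X r)) (c.rho (X r)) ξ -
        nonlocalTerm (fun _ => 1) (c.q (X' r)) (c.rho (X' r)) ξ)]
    · linarith [abs_nonneg (nonlocalTerm Real.sign (c.q (X r)) (c.rho (X r)) ξ -
        nonlocalTerm Real.sign (c.q (X' r)) (c.rho (X' r)) ξ)]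
  · have hA := densBound_nonneg hc.M_nonneg
    have hR := rhoBound_nonneg hc.M_nonneg
    have hL := rhoLip_nonneg hc.M_nonneg
    have hε := hs.eps.le
    unfold nonlocalLip
    have e : 32 * rhoBound M * (3 * densBound M * d) * (s + δ - s) +
        4 * ((rhoLip M * δ + 16 * densBound M * ε) * d) =
        ((96 * rhoBound M * densBound M + 4 * rhoLip M) * δ + 64 * densBound M * ε) * d := by ring
    rw [e, mul_assoc (Real.exp M), mul_assoc (Real.exp M)]
    gcongr
    nlinarith [mul_nonneg (mul_nonneg hR hA) hε, mul_nonneg hL hε, mul_nonneg hA hδ]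

include hc hZ hs in
lemma NearPath.picard_close (hX : NearPath M Z₀ δ X) (hX' : NearPath M Z₀ δ X')
    (hsl : SlopeOn M Z₀ s δ X) (hd : PathClose M Z₀ δ ε d X X') :
    PathClose M Z₀ δ ε (d / 2) (c.picard Z₀ s δ X) (c.picard Z₀ s δ X') := by
  have hd0 : 0 ≤ d := (abs_nonneg _).trans (hd.U 0 0)
  have hδ := hs.pos.le
  have hε := hs.eps.le
  have hM := hc.M_nonneg
  have hT := hX.tube hc hZ hs
  have hT' := hX'.tube hc hZ hs
  have hL := speedBound_pos hM
  have hnl := nonlocalLip_nonneg hM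
  have hsM := (stepLip_pos hM).le
  have hLA : 1 + 2 * ((M + 1) ^ 2 + nonlocalBound M) ≤ speedBound M := by unfold speedBound; linarith
  have hstep : stepLip M * (δ + ε) * d ≤ d / 2 := by nlinarith [hs.lip]
  have hcoef : 0 ≤ δ + ε := by linarith
  have hdε : 0 ≤ d * ε := mul_nonneg hd0 hε
  have hdδ : 0 ≤ d * δ := mul_nonneg hd0 hδ
  have hQ := fun ξ => intervalIntegrable_of_measurable
    (hX.reg.measurable_Q hc (hX.interval hc hZ hs)).of_uncurry_right
    (fun t => hX.abs_Q_le hc hZ hs t ξ) s (s + δ)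
  have hQ' := fun ξ => intervalIntegrable_of_measurable
    (hX'.reg.measurable_Q hc (hX'.interval hc hZ hs)).of_uncurry_right
    (fun t => hX'.abs_Q_le hc hZ hs t ξ) s (s + δ)
  have hF := fun ξ i => intervalIntegrable_of_measurable (hX.measurable_angF hc hZ hs i).of_uncurry_right
    (fun t => hX.abs_angF_le hc hZ hs t ξ i) s (s + δ)
  have hF' := fun ξ i => intervalIntegrable_of_measurable (hX'.measurable_angF hc hZ hs i).of_uncurry_right
    (fun t => hX'.abs_angF_le hc hZ hs t ξ i) s (s + δ)
  have hG := fun ξ i => intervalIntegrable_of_measurable (hX.measurable_angG hc hZ hs i).of_uncurry_right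
    (fun t => hX.abs_angG_le hc hZ hs t ξ i) s (s + δ)
  have hG' := fun ξ i => intervalIntegrable_of_measurable (hX'.measurable_angG hc hZ hs i).of_uncurry_right
    (fun t => hX'.abs_angG_le hc hZ hs t ξ i) s (s + δ)
  have hda : ∀ ξ, ∃ g : ℝ → ℝ, IntervalIntegrable g volume s (s + δ) ∧
      (∀ r ∈ Icc s (s + δ), |c.Q (X r) ξ - c.Q (X' r) ξ| ≤ g r ∧
        |c.a (X r) ξ - c.a (X' r) ξ| ≤ g r) ∧ 
      ∫ r in s..(s + δ), g r ≤ aLip M * (δ + ε) * d := fun ξ => by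
    obtain ⟨g, hg, hgb, hgi⟩ := hX.exists_nonlocal_majorant hc hZ hs hX' hsl hd ξ
    refine ⟨fun r => 2 * (M + 1) * d + g r, intervalIntegrable_const.add hg, fun r hr => ⟨?_, ?_⟩, ?_⟩
    · exact (hgb r hr).2.trans (le_add_of_nonneg_left (by positivity))
    · have e : c.a (X r) ξ - c.a (X' r) ξ = ((X r).U ξ + (X' r).U ξ) * ((X r).U ξ - (X' r).U ξ) -
          (c.P (X r) ξ - c.P (X' r) ξ) := by unfold Weights.a; ring
      rw [e]
      refine (abs_sub _ _).trans (add_le_add ?_ (hgb r hr).1)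
      rw [abs_mul]
      refine mul_le_mul ((abs_add_le _ _).trans ?_) (hd.U r ξ) (abs_nonneg _) (by positivity)
      linarith [(hT r).U ξ, (hT' r).U ξ]
    · rw [intervalIntegral.integral_add intervalIntegrable_const hg, intervalIntegral.integral_const,
        smul_eq_mul]
      unfold aLip
      nlinarith [mul_nonneg hM hdε]
  have haL : aLip M * (δ + ε) * d ≤ stepLip M * (δ + ε) * d := by
    gcongr; unfold stepLip; linarith
  have hmem : ∀ t, s ≤ timeClamp s δ t ∧ timeClamp s δ t ≤ s + δ := fun t => timeClamp_mem hδ t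
  refine ⟨fun t ξ => ?_, fun t ξ i => ?_, fun t ξ i => ?_, fun ξ i hn t => ?_⟩
  · obtain ⟨g, hg, hgb, hgi⟩ := hda ξ
    have h := abs_integral_sub_integral_le (hmem t).1 (hmem t).2 (hQ ξ) (hQ' ξ) hg
      fun r hr => (hgb r hr).1
    simp only [Weights.picard, sub_sub_sub_cancel_left]
    rw [abs_sub_comm]
    linarith
  · obtain ⟨g, hg, hgb, hgi⟩ := hda ξ
    have h := abs_integral_sub_integral_le (hmem t).1 (hmem t).2 (hF ξ i) (hF' ξ i)
      (g := fun r => speedBound M * d + g r) (intervalIntegrable_const.add hg)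
      fun r hr => by
        refine (abs_angF_sub_le ((hT r).abs_a_le hc ξ)).trans (add_le_add ?_ ?_)
        · exact mul_le_mul hLA (hd.θ r ξ i) (abs_nonneg _) hL.le
        · exact (mul_le_of_le_one_right (abs_nonneg _) (Real.sin_sq_le_one _)).trans (hgb r hr).2
    simp only [Weights.picard, add_sub_add_left_eq_sub]
    refine h.trans (le_trans ?_ hstep)
    rw [intervalIntegral.integral_add intervalIntegrable_const hg, intervalIntegral.integral_const,
      smul_eq_mul]
    unfold stepLip
    nlinarith [mul_nonneg hL.le hdε, mul_nonneg hL.le hdδ]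
  · obtain ⟨g, hg, hgb, hgi⟩ := hda ξ
    have h := abs_integral_sub_integral_le (hmem t).1 (hmem t).2 (hG ξ i) (hG' ξ i)
      (g := fun r => 2 * speedBound M * d + g r) (intervalIntegrable_const.add hg)
      fun r hr => by
        refine (abs_angG_sub_le ((hT r).abs_a_le hc ξ)).trans (add_le_add ?_ (hgb r hr).2)
        exact mul_le_mul (by linarith) (hd.θ r ξ i) (abs_nonneg _) (by positivity)
    simp only [Weights.picard, add_sub_add_left_eq_sub]
    refine h.trans (le_trans ?_ hstep)
    rw [intervalIntegral.integral_add intervalIntegrable_const hg, intervalIntegral.integral_const,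
      smul_eq_mul]
    unfold stepLip
    nlinarith [mul_nonneg hL.le hdε, mul_nonneg hL.le hdδ]
  · obtain ⟨g, hg, hgb, hgi⟩ := hda ξ
    obtain ⟨n, hn⟩ := hn
    have h := abs_integral_sub_integral_le (hmem t).1 (hmem t).2 (hF ξ i) (hF' ξ i)
      (g := fun r => speedBound M * d + (2 * (speedBound M * δ)) ^ 2 * g r)
      (intervalIntegrable_const.add (hg.const_mul _))
      fun r hr => by
        refine (abs_angF_sub_le ((hT r).abs_a_le hc ξ)).trans (add_le_add ?_ ?_)
        · exact mul_le_mul hLA (hd.θ r ξ i) (abs_nonneg _) hL.le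
        · rw [mul_comm]
          refine mul_le_mul (sin_sq_le_of_near (n := n) ?_) (hgb r hr).2 (abs_nonneg _) (by positivity)
          have e : (X' r).θ ξ i - n * Real.pi =
            ((X' r).θ ξ i - Z₀.θ ξ i) + (Z₀.θ ξ i - n * Real.pi) := by ring
          rw [e]
          exact (abs_add_le _ _).trans (by linarith [hX'.θ r ξ i])
    simp only [Weights.picard, add_sub_add_left_eq_sub]
    refine h.trans ?_
    rw [intervalIntegral.integral_add intervalIntegrable_const (hg.const_mul _),
      intervalIntegral.integral_const, smul_eq_mul, intervalIntegral.integral_const_mul]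
    have h1 : (2 * (speedBound M * δ)) ^ 2 * ∫ r in s..(s + δ), g r ≤
        (2 * (speedBound M * δ)) ^ 2 * (d / 2) :=
      mul_le_mul_of_nonneg_left (hgi.trans (haL.trans hstep)) (by positivity)
    have h2 : (2 * (speedBound M * δ)) ^ 2 * (d / 2) ≤ 2 * speedBound M ^ 2 * δ * d := by
      have e : (2 * (speedBound M * δ)) ^ 2 * (d / 2) = 2 * speedBound M ^ 2 * δ * d * δ := by ring
      rw [e]
      exact mul_le_of_le_one_right (by positivity) hs.le_one
    have h3 := mul_le_mul_of_nonneg_right hs.brk hd0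
    nlinarith [mul_nonneg hL.le hdδ]

end Contraction

section FixedPoint

variable {c : Weights} {M s δ ε d : ℝ} {D : ℝ → ℝ} {Z₀ : AngState} {X X' : ℝ → AngState}

lemma PathClose.ext (h : ∀ n : ℕ, PathClose M Z₀ δ ε (d / 2 ^ n) X X') : X = X' := by
  have h0 : ∀ x y : ℝ, (∀ n : ℕ, |x - y| ≤ d / 2 ^ n) → x = y := fun x y hxy => by
    have ht : Tendsto (fun n : ℕ => d / 2 ^ n) atTop (𝓝 0) := by
      have := (tendsto_pow_atTop_nhds_zero_of_lt_one (r := (1 / 2 : ℝ)) (by norm_num)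
        (by norm_num)).const_mul d
      simpa [div_eq_mul_inv] using this
    have := ge_of_tendsto' ht hxy
    exact sub_eq_zero.1 (abs_nonpos_iff.1 this)
  funext t
  have hU : (X t).U = (X' t).U := funext fun ξ => h0 _ _ fun n => (h n).U t ξ
  have hθ : (X t).θ = (X' t).θ := funext fun ξ => funext fun i => h0 _ _ fun n => (h n).θ t ξ i
  have hκ : (X t).κ = (X' t).κ := funext fun ξ => funext fun i => h0 _ _ fun n => (h n).κ t ξ i
  cases hX : X t
  cases hX' : X' t
  simp only [hX, hX'] at hU hθ hκ
  simp [hU, hθ, hκ]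

section Limit

variable {f : ℕ → ℝ → ℝ → ℝ} {g : ℝ → ℝ → ℝ}

/-- The limit of a sequence of functions with geometrically small increments. -/
lemma exists_limit_of_geometric (h : ∀ n t ξ, |f n t ξ - f (n + 1) t ξ| ≤ d / 2 ^ n) :
    ∃ g : ℝ → ℝ → ℝ, (∀ t ξ, Tendsto (fun n => f n t ξ) atTop (𝓝 (g t ξ))) ∧
      ∀ n t ξ, |f n t ξ - g t ξ| ≤ 2 * d / 2 ^ n := by
  have h' : ∀ t ξ n, dist (f n t ξ) (f (n + 1) t ξ) ≤ 2 * d / 2 / 2 ^ n := fun t ξ n => by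
    rw [Real.dist_eq, mul_div_cancel_left₀ _ (two_ne_zero)]; exact h n t ξ
  have h1 : ∀ t ξ, ∃ l, Tendsto (fun n => f n t ξ) atTop (𝓝 l) := fun t ξ =>
    cauchySeq_tendsto_of_complete (cauchySeq_of_le_geometric_two (h' t ξ))
  choose g hg using h1
  exact ⟨g, hg, fun n t ξ => by
    simpa [Real.dist_eq] using dist_le_of_le_geometric_two_of_tendsto (h' t ξ) (hg t ξ) n⟩

lemma continuous_of_geometric (h : ∀ n t ξ, |f n t ξ - g t ξ| ≤ d / 2 ^ n)
    (hc : ∀ n ξ, Continuous fun t => f n t ξ) (ξ : ℝ) : Continuous fun t => g t ξ := by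
  have hu : TendstoUniformly (fun n t => f n t ξ) (fun t => g t ξ) atTop := by
    rw [Metric.tendstoUniformly_iff]
    intro e he
    have ht : Tendsto (fun n : ℕ => d / 2 ^ n) atTop (𝓝 0) := by
      have := (tendsto_pow_atTop_nhds_zero_of_lt_one (r := (1 / 2 : ℝ)) (by norm_num)
        (by norm_num)).const_mul d
      simpa [div_eq_mul_inv] using this
    filter_upwards [ht.eventually (gt_mem_nhds he)] with n hn t
    rw [dist_comm, Real.dist_eq]
    exact (h n t ξ).trans_lt hn
  exact hu.continuous (Eventually.of_forall fun n => hc n ξ).frequently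

end Limit

variable (hc : c.Valid M) (hZ : StartBound c M Z₀) (hs : SmallStep M δ ε)

include hc hZ hs in
lemma NearPath.eq_of_picard_eq (hX : NearPath M Z₀ δ X) (hX' : NearPath M Z₀ δ X')
    (h : c.picard Z₀ s δ X = X) (h' : c.picard Z₀ s δ X' = X') : X = X' := by
  refine PathClose.ext (M := M) (Z₀ := Z₀) (δ := δ) (ε := ε) (d := 1 + 1 / ε) fun n => ?_
  induction n with
  | zero => simpa using hX.close hX' hs
  | succ n ih =>
    have hsl := hX.slopeOn_picard (s := s) hc hZ hs
    rw [h] at hsl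
    have := hX.picard_close hc hZ hs hX' hsl ih
    rw [h, h'] at this
    rwa [pow_succ, ← div_div]

lemma NearPath.const (hM : 0 ≤ M) (hδ : 0 ≤ δ) (hZ : Z₀.Meas) : NearPath M Z₀ δ fun _ => Z₀ := by
  have := mul_nonneg (speedBound_pos hM).le hδ
  exact ⟨⟨fun _ => hZ, fun _ => continuous_const, fun _ _ => continuous_const,
    fun _ _ => continuous_const⟩, by simpa using this, by simpa using this, by simpa using this⟩

lemma Decays.mono {k k' : ℝ} {Z : AngState} (h : Decays c D k Z) (hk : k ≤ k') : Decays c D k' Z :=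
  ⟨fun ξ => (h.U ξ).trans (mul_le_mul_of_nonneg_right hk (Real.sqrt_nonneg _)),
    fun ξ i => (h.θ ξ i).trans (mul_le_mul_of_nonneg_right hk (Real.sqrt_nonneg _))⟩

include hc hZ hs in
/-- Solutions on a short time interval. -/
theorem exists_local_solution (s : ℝ) (hD : DecayMajorant M D) (hZD : Decays c D 1 Z₀) :
    ∃ X, NearPath M Z₀ δ X ∧ (∀ t, Decays c D 2 (X t)) ∧ c.picard Z₀ s δ X = X := by
  set Y : ℕ → ℝ → AngState := fun n => (c.picard Z₀ s δ)^[n] fun _ => Z₀ with hY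
  have hsucc : ∀ n, Y (n + 1) = c.picard Z₀ s δ (Y n) := fun n => Function.iterate_succ_apply' _ _ _
  have hN : ∀ n, NearPath M Z₀ δ (Y n) := fun n => by
    induction n with
    | zero => exact NearPath.const hc.M_nonneg hs.pos.le hZ.meas
    | succ n ih => rw [hsucc]; exact ih.picard hc hZ hs
  have hDec : ∀ n t, Decays c D 2 (Y n t) := fun n => by
    induction n with
    | zero => exact fun t => hZD.mono (by norm_num)
    | succ n ih => rw [hsucc]; exact (hN n).decays_picard hc hZ hs hD hZD ih
  have hsl : ∀ n, SlopeOn M Z₀ s δ (Y (n + 1)) := fun n => by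
    rw [hsucc]; exact (hN n).slopeOn_picard hc hZ hs
  have hcl : ∀ n, PathClose M Z₀ δ ε ((1 + 1 / ε) / 2 ^ n) (Y (n + 1)) (Y (n + 2)) := fun n => by
    induction n with
    | zero => simpa using (hN 1).close (hN 2) hs
    | succ n ih =>
      rw [hsucc (n + 1), hsucc (n + 2), pow_succ, ← div_div]
      exact (hN (n + 1)).picard_close hc hZ hs (hN (n + 2)) (hsl n) ih
  obtain ⟨LU, hLU, hLU'⟩ := exists_limit_of_geometric (f := fun n t ξ => (Y (n + 1) t).U ξ)
    fun n => (hcl n).U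
  have hlimθ := fun i => exists_limit_of_geometric (f := fun n t ξ => (Y (n + 1) t).θ ξ i)
    fun n t ξ => (hcl n).θ t ξ i
  have hlimκ := fun i => exists_limit_of_geometric (f := fun n t ξ => (Y (n + 1) t).κ ξ i)
    fun n t ξ => (hcl n).κ t ξ i
  choose Lθ hLθ hLθ' using hlimθ
  choose Lκ hLκ hLκ' using hlimκ
  set X : ℝ → AngState := fun t => ⟨LU t, fun ξ i => Lθ i t ξ, fun ξ i => Lκ i t ξ⟩
  have hXN : NearPath M Z₀ δ X := by
    refine ⟨⟨fun t => ⟨?_, fun i => ?_, fun i => ?_⟩,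
      continuous_of_geometric hLU' fun n => (hN _).reg.contU,
      fun ξ i => continuous_of_geometric (hLθ' i) (fun n ξ => (hN (n + 1)).reg.contθ ξ i) ξ,
      fun ξ i => continuous_of_geometric (hLκ' i) (fun n ξ => (hN (n + 1)).reg.contκ ξ i) ξ⟩,
      fun t ξ => ?_, fun t ξ i => ?_, fun t ξ i => ?_⟩
    · exact measurable_of_tendsto_metrizable (fun n => ((hN (n + 1)).reg.meas t).U)
        (tendsto_pi_nhds.2 fun ξ => hLU t ξ)
    · exact measurable_of_tendsto_metrizable (fun n => ((hN (n + 1)).reg.meas t).θ i)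
        (tendsto_pi_nhds.2 fun ξ => hLθ i t ξ)
    · exact measurable_of_tendsto_metrizable (fun n => ((hN (n + 1)).reg.meas t).κ i)
        (tendsto_pi_nhds.2 fun ξ => hLκ i t ξ)
    · exact le_of_tendsto' ((hLU t ξ).sub_const _).abs fun n => (hN (n + 1)).U t ξ
    · exact le_of_tendsto' ((hLθ i t ξ).sub_const _).abs fun n => (hN (n + 1)).θ t ξ i
    · exact le_of_tendsto' ((hLκ i t ξ).sub_const _).abs fun n => (hN (n + 1)).κ t ξ i
  have hclX : ∀ n, PathClose M Z₀ δ ε (2 * (1 + 1 / ε) / 2 ^ n) (Y (n + 1)) X := fun n => by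
    refine ⟨hLU' n, fun t ξ i => hLθ' i n t ξ, fun t ξ i => hLκ' i n t ξ, fun ξ i hn t => ?_⟩
    have h' : ∀ m, dist ((Y (m + 1) t).θ ξ i) ((Y (m + 1 + 1) t).θ ξ i) ≤
        2 * (ε * (1 + 1 / ε)) / 2 / 2 ^ m := fun m => by
      rw [Real.dist_eq, mul_div_cancel_left₀ _ (two_ne_zero), mul_div_assoc]
      exact (hcl m).brk ξ i hn t
    have := dist_le_of_le_geometric_two_of_tendsto h' (hLθ i t ξ) n
    rw [Real.dist_eq] at this
    refine this.trans (le_of_eq ?_)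
    ring
  refine ⟨X, hXN, fun t => ⟨fun ξ => ?_, fun ξ i => ?_⟩, ?_⟩
  · exact le_of_tendsto' (hLU t ξ).abs fun n => (hDec (n + 1) t).U ξ
  · exact le_of_tendsto' (((Real.continuous_cos.tendsto _).comp (hLθ i t ξ)).abs.const_mul _)
      fun n => (hDec (n + 1) t).θ ξ i
  · have hpic : ∀ n, PathClose M Z₀ δ ε (2 * (1 + 1 / ε) / 2 ^ n / 2) (Y (n + 2))
        (c.picard Z₀ s δ X) := fun n => by
      rw [hsucc (n + 1)]
      exact (hN (n + 1)).picard_close hc hZ hs hXN (hsl n) (hclX n)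
    have htri : ∀ n : ℕ, ∀ x y z : ℝ, |z - x| ≤ 2 * (1 + 1 / ε) / 2 ^ n / 2 →
        |z - y| ≤ 2 * (1 + 1 / ε) / 2 ^ (n + 1) → |x - y| ≤ (2 * (1 + 1 / ε)) / 2 ^ n := by
      intro n x y z h1 h2
      have e : x - y = (z - y) - (z - x) := by ring
      rw [e]
      refine (abs_sub _ _).trans ((add_le_add h2 h1).trans (le_of_eq ?_))
      rw [pow_succ]; field_simp; ring
    refine PathClose.ext (M := M) (Z₀ := Z₀) (δ := δ) (ε := 2 * ε) (d := 2 * (1 + 1 / ε)) fun n => ?_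
    have hε := hs.eps
    refine ⟨fun t ξ => htri n _ _ _ ((hpic n).U t ξ) ((hclX (n + 1)).U t ξ),
      fun t ξ i => htri n _ _ _ ((hpic n).θ t ξ i) ((hclX (n + 1)).θ t ξ i),
      fun t ξ i => htri n _ _ _ ((hpic n).κ t ξ i) ((hclX (n + 1)).κ t ξ i), fun ξ i hn t => ?_⟩
    have h1 := (hpic n).brk ξ i hn t
    have h2 := (hclX (n + 1)).brk ξ i hn t
    have e : (c.picard Z₀ s δ X t).θ ξ i - (X t).θ ξ i = ((Y (n + 2) t).θ ξ i - (X t).θ ξ i) -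
      ((Y (n + 2) t).θ ξ i - (c.picard Z₀ s δ X t).θ ξ i) := by ring
    rw [e]
    refine (abs_sub _ _).trans ((add_le_add h2 h1).trans ?_)
    rw [pow_succ]
    have : 0 ≤ ε * (2 * (1 + 1 / ε) / 2 ^ n) := by positivity
    have e2 : ε * (2 * (1 + 1 / ε) / (2 ^ n * 2)) = ε * (2 * (1 + 1 / ε) / 2 ^ n) / 2 := by
      field_simp
    rw [e2]
    linarith

end FixedPoint

/-! ### Solutions on bounded time intervals -/

/-- `X` solves the system in angle variables on `[0, T]`. -/
structure SolvesUpTo (c : Weights) (M T : ℝ) (X : ℝ → AngState) : Prop where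
  nonneg : 0 ≤ T
  reg : RegularPath X
  clamp : ∀ t, X t = X (timeClamp 0 T t)
  tube : ∀ t, Tube c M (X t)
  U_eq : ∀ t ∈ Icc 0 T, ∀ ξ, (X t).U ξ = (X 0).U ξ - ∫ r in (0 : ℝ)..t, c.Q (X r) ξ
  θ_eq : ∀ t ∈ Icc 0 T, ∀ ξ i, (X t).θ ξ i =
    (X 0).θ ξ i + ∫ r in (0 : ℝ)..t, angF (c.a (X r) ξ) ((X r).θ ξ i)
  κ_eq : ∀ t ∈ Icc 0 T, ∀ ξ i, (X t).κ ξ i =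
    (X 0).κ ξ i + ∫ r in (0 : ℝ)..t, angG (c.a (X r) ξ) ((X r).θ ξ i)

lemma integral_swap_of_abs_le {F : ℝ → ℝ → ℝ} {C : ℝ} (hF : Measurable (Function.uncurry F))
    (hC : ∀ x y, |F x y| ≤ C) (a b c d : ℝ) :
    ∫ x in a..b, ∫ y in c..d, F x y = ∫ y in c..d, ∫ x in a..b, F x y := by
  refine intervalIntegral_intervalIntegral_swap ?_
  refine Measure.integrableOn_of_bounded (M := C) ?_ hF.aestronglyMeasurable
    (.of_forall fun p => hC p.1 p.2)
  rw [Measure.volume_eq_prod, Measure.prod_prod]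
  exact ENNReal.mul_ne_top (by simp [uIoc]) (by simp [uIoc])

namespace SolvesUpTo

variable {c : Weights} {M T : ℝ} {X : ℝ → AngState} (hc : c.Valid M) (hX : SolvesUpTo c M T X)

include hX in
lemma interval (t a b : ℝ) : IntervalIntegrable (c.q (X t)) volume a b := (hX.tube t).kernel.int a b

include hc hX

lemma measurable_P : Measurable (Function.uncurry fun t => c.P (X t)) :=
  hX.reg.measurable_P hc hX.interval

lemma measurable_Q : Measurable (Function.uncurry fun t => c.Q (X t)) :=
  hX.reg.measurable_Q hc hX.interval

lemma measurable_a : Measurable (Function.uncurry fun t => c.a (X t)) :=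
  hX.reg.measurable_a hc hX.interval

lemma abs_a_le (t ξ : ℝ) : |c.a (X t) ξ| ≤ (M + 1) ^ 2 + nonlocalBound M := (hX.tube t).abs_a_le hc ξ

lemma abs_q_le (t ξ : ℝ) : |c.q (X t) ξ| ≤ densBound M := by
  rw [abs_of_nonneg (hc.q_nonneg ξ)]
  have := (hc.bound ξ).labQ_add_labH_le (θ := (X t).θ ξ) ((hX.tube t).κ ξ)
  have := hc.hb_nonneg (Z := X t) ξ
  unfold Weights.hb at this
  unfold Weights.q
  linarith

lemma abs_hb_le (t ξ : ℝ) : |c.hb (X t) ξ| ≤ densBound M := by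
  rw [abs_of_nonneg (hc.hb_nonneg ξ)]
  have := (hc.bound ξ).labQ_add_labH_le (θ := (X t).θ ξ) ((hX.tube t).κ ξ)
  have := hc.q_nonneg (Z := X t) ξ
  unfold Weights.q at this
  unfold Weights.hb
  linarith

lemma abs_w_le (t ξ : ℝ) : |c.w (X t) ξ| ≤ densBound M := by
  have h1 := (hc.bound ξ).abs_labW_le (θ := (X t).θ ξ) (κ := (X t).κ ξ)
  have h2 := (le_abs_self _).trans (hX.abs_q_le hc t ξ)
  have h3 := (le_abs_self _).trans (hX.abs_hb_le hc t ξ)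
  unfold Weights.q at h2
  unfold Weights.hb at h3
  unfold Weights.w
  linarith

lemma intervalIntegrable_angF (ξ : ℝ) (i : Fin 2) (a b : ℝ) :
    IntervalIntegrable (fun t => angF (c.a (X t) ξ) ((X t).θ ξ i)) volume a b :=
  intervalIntegrable_of_measurable
    (measurable_angF_comp (hX.measurable_a hc).of_uncurry_right (hX.reg.contθ ξ i).measurable)
    (fun t => angF_bound (hX.abs_a_le hc t ξ)) _ _

lemma intervalIntegrable_angG (ξ : ℝ) (i : Fin 2) (a b : ℝ) :
    IntervalIntegrable (fun t => angG (c.a (X t) ξ) ((X t).θ ξ i)) volume a b :=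
  intervalIntegrable_of_measurable
    (measurable_angG_comp (hX.measurable_a hc).of_uncurry_right (hX.reg.contθ ξ i).measurable)
    (fun t => angG_bound (hX.abs_a_le hc t ξ)) _ _

lemma intervalIntegrable_Q (ξ : ℝ) (a b : ℝ) :
    IntervalIntegrable (fun t => c.Q (X t) ξ) volume a b :=
  intervalIntegrable_of_measurable (hX.measurable_Q hc).of_uncurry_right
    (fun t => (hX.tube t).abs_Q_le hc ξ) _ _

lemma isPrimitiveOn_U (ξ : ℝ) :
    IsPrimitiveOn (fun t => (X t).U ξ) (fun t => -c.Q (X t) ξ) 0 T := by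
  refine ⟨(hX.intervalIntegrable_Q hc ξ _ _).neg, fun t ht => ?_⟩
  rw [uIcc_of_le hX.nonneg] at ht
  rw [intervalIntegral.integral_neg, ← sub_eq_add_neg]
  exact hX.U_eq t ht ξ

lemma isPrimitiveOn_θ (ξ : ℝ) (i : Fin 2) : IsPrimitiveOn (fun t => (X t).θ ξ i)
    (fun t => angF (c.a (X t) ξ) ((X t).θ ξ i)) 0 T :=
  ⟨hX.intervalIntegrable_angF hc ξ i _ _, fun t ht => hX.θ_eq t (uIcc_of_le hX.nonneg ▸ ht) ξ i⟩

lemma isPrimitiveOn_κ (ξ : ℝ) (i : Fin 2) : IsPrimitiveOn (fun t => (X t).κ ξ i)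
    (fun t => angG (c.a (X t) ξ) ((X t).θ ξ i)) 0 T :=
  ⟨hX.intervalIntegrable_angG hc ξ i _ _, fun t ht => hX.κ_eq t (uIcc_of_le hX.nonneg ▸ ht) ξ i⟩

lemma isPrimitiveOn_q (ξ : ℝ) :
    IsPrimitiveOn (fun t => c.q (X t) ξ) (fun t => c.w (X t) ξ) 0 T :=
  IsPrimitiveOn.sum Finset.univ fun i _ => (isPrimitiveOn_angQ hX.nonneg (hX.isPrimitiveOn_θ hc ξ i)
    (hX.isPrimitiveOn_κ hc ξ i) (fun t _ => hX.abs_a_le hc t ξ) ((hc.bound ξ).beta i)).const_mul _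

lemma isPrimitiveOn_w (ξ : ℝ) :
    IsPrimitiveOn (fun t => c.w (X t) ξ)
      (fun t => 1 / 2 * c.hb (X t) ξ + c.a (X t) ξ * c.q (X t) ξ) 0 T := by
  refine (IsPrimitiveOn.sum Finset.univ fun i _ => (isPrimitiveOn_angW hX.nonneg
    (hX.isPrimitiveOn_θ hc ξ i) (hX.isPrimitiveOn_κ hc ξ i) (fun t _ => hX.abs_a_le hc t ξ)
    ((hc.bound ξ).beta i)).const_mul (c.N ξ i)).congr_deriv (.of_forall fun t _ => ?_)
  simp only [Weights.hb, Weights.q, labH, labQ, Fin.sum_univ_two]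
  ring

lemma intervalIntegrable_hb_deriv (ξ a b : ℝ) :
    IntervalIntegrable (fun t => 2 * c.a (X t) ξ * c.w (X t) ξ) volume a b := by
  refine intervalIntegrable_of_measurable (C := 2 * ((M + 1) ^ 2 + nonlocalBound M) * densBound M)
    (((hX.measurable_a hc).of_uncurry_right.const_mul 2).mul
    (hX.reg.measurable_w hc).of_uncurry_right) (fun t => ?_) a b
  change |2 * c.a (X t) ξ * c.w (X t) ξ| ≤ _
  rw [abs_mul, abs_mul, abs_two]
  have h1 := hX.abs_a_le hc t ξ
  have h2 := hX.abs_w_le hc t ξ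
  have h3 := (abs_nonneg _).trans h1
  gcongr

lemma hb_le {s t : ℝ} (hs : 0 ≤ s) (hst : s ≤ t) (ht : t ≤ T) (ξ : ℝ) :
    c.hb (X t) ξ ≤ c.hb (X s) ξ + ∫ r in s..t, 2 * c.a (X r) ξ * c.w (X r) ξ := by
  have hsub : s ∈ uIcc 0 T ∧ t ∈ uIcc 0 T := by
    rw [uIcc_of_le hX.nonneg]; exact ⟨⟨hs, hst.trans ht⟩, ⟨hs.trans hst, ht⟩⟩
  have h := fun i => angH_le (β := c.β ξ i) hst ((hX.isPrimitiveOn_θ hc ξ i).mono hsub.1 hsub.2)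
    ((hX.isPrimitiveOn_κ hc ξ i).mono hsub.1 hsub.2) (fun t _ => hX.abs_a_le hc t ξ)
    ((hc.bound ξ).beta i) (hX.measurable_a hc).of_uncurry_right.aemeasurable
  have e : (fun r => 2 * c.a (X r) ξ * c.w (X r) ξ) = fun r => ∑ i, c.N ξ i *
      (2 * (c.a (X r) ξ * angW (c.β ξ i) ((X r).θ ξ i) ((X r).κ ξ i))) := by
    funext r
    simp only [Weights.w, labW, Fin.sum_univ_two]
    ring
  rw [e, intervalIntegral.integral_finsetSum fun i _ => (h i).1.const_mul _]
  simp only [intervalIntegral.integral_const_mul]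
  unfold Weights.hb labH
  rw [← Finset.sum_add_distrib]
  refine Finset.sum_le_sum fun i _ => ?_
  rw [← mul_add]
  refine mul_le_mul_of_nonneg_left ?_ ((hc.bound ξ).nonneg i)
  simpa only [intervalIntegral.integral_const_mul] using (h i).2

lemma isPrimitiveOn_P_Q (t a b : ℝ) :
    IsPrimitiveOn (c.P (X t)) (fun ξ => c.q (X t) ξ * c.Q (X t) ξ) a b ∧
    IsPrimitiveOn (c.Q (X t)) (fun ξ => c.q (X t) ξ * c.P (X t) ξ - 1 / 2 * c.rho (X t) ξ) a b := by
  have h := (hX.tube t).kernel.isPrimitiveOn_nonlocalTerm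
    (hc.measurable_rho (hX.tube t).meas).aestronglyMeasurable
    (.of_forall ((hX.tube t).rho_abs hc)) (fun ξ => hc.q_nonneg ξ) a b
  refine ⟨(h.1.const_mul (1 / 4)).congr_deriv (.of_forall fun ξ _ => ?_),
    (h.2.const_mul (-(1 / 4))).congr_deriv (.of_forall fun ξ _ => ?_)⟩
  · unfold Weights.Q; ring
  · unfold Weights.P; ring

/-- `U_ξ = w` is preserved by the evolution. -/
lemma U_sub_eq (h0 : ∀ a b, (X 0).U b - (X 0).U a = ∫ x in a..b, c.w (X 0) x) {t : ℝ}
    (ht : t ∈ Icc 0 T) (a b : ℝ) : (X t).U b - (X t).U a = ∫ x in a..b, c.w (X t) x := by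
  have hi : ∀ t a b, IntervalIntegrable (c.w (X t)) volume a b := fun t =>
    intervalIntegrable_of_measurable (hc.measurable_w (hX.tube t).meas) (hX.abs_w_le hc t)
  set F : ℝ → ℝ → ℝ := fun r x => 1 / 2 * c.hb (X r) x + c.a (X r) x * c.q (X r) x
  have hF : Measurable (Function.uncurry F) := ((hX.reg.measurable_hb hc).const_mul _).add
    ((hX.measurable_a hc).mul (hX.reg.measurable_q hc))
  have hFC : ∀ r x, |F r x| ≤ 1 / 2 * densBound M +
      ((M + 1) ^ 2 + nonlocalBound M) * densBound M := fun r x => by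
    refine (abs_add_le _ _).trans ?_
    rw [abs_mul, abs_mul, abs_of_pos (by norm_num : (0 : ℝ) < 1 / 2)]
    have h1 := hX.abs_a_le hc r x
    have h2 := hX.abs_hb_le hc r x
    have h3 := hX.abs_q_le hc r x
    have h4 := (abs_nonneg _).trans h1
    gcongr
  have e1 : (∫ x in a..b, c.w (X t) x) - ∫ x in a..b, c.w (X 0) x =
      ∫ x in a..b, ∫ r in (0 : ℝ)..t, F r x := by
    rw [← intervalIntegral.integral_sub (hi _ _ _) (hi _ _ _)]
    refine intervalIntegral.integral_congr fun x _ => ?_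
    have := (hX.isPrimitiveOn_w hc x).2 t (uIcc_of_le hX.nonneg ▸ ht)
    simp only at this ⊢
    rw [this, add_sub_cancel_left]
  have e2 : (X t).U b - (X t).U a - ((X 0).U b - (X 0).U a) =
      ∫ r in (0 : ℝ)..t, ∫ x in a..b, F r x := by
    rw [hX.U_eq t ht, hX.U_eq t ht]
    have : ∀ r, ∫ x in a..b, F r x = -(c.Q (X r) b - c.Q (X r) a) := fun r => by
      have h := (hX.isPrimitiveOn_P_Q hc r a b).2.eq_add
      rw [h, add_sub_cancel_left, ← intervalIntegral.integral_neg]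
      refine intervalIntegral.integral_congr fun x _ => ?_
      simp only [F, Weights.rho_eq, Weights.a]
      ring
    rw [intervalIntegral.integral_congr fun r _ => this r, intervalIntegral.integral_neg,
      intervalIntegral.integral_sub (hX.intervalIntegrable_Q hc b _ _)
      (hX.intervalIntegrable_Q hc a _ _)]
    ring
  have e3 := integral_swap_of_abs_le hF hFC 0 t a b
  linarith [h0 a b]

/-- `y_ξ = q` is preserved by the evolution. -/
lemma integral_q_eq (h0 : ∀ a b, (X 0).U b - (X 0).U a = ∫ x in a..b, c.w (X 0) x) {t : ℝ}
    (ht : t ∈ Icc 0 T) (a b : ℝ) : ∫ x in a..b, c.q (X t) x = (∫ x in a..b, c.q (X 0) x) +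
      ∫ r in (0 : ℝ)..t, ((X r).U b - (X r).U a) := by
  have e1 : (∫ x in a..b, c.q (X t) x) - ∫ x in a..b, c.q (X 0) x =
      ∫ x in a..b, ∫ r in (0 : ℝ)..t, c.w (X r) x := by
    rw [← intervalIntegral.integral_sub (hX.interval _ _ _) (hX.interval _ _ _)]
    refine intervalIntegral.integral_congr fun x _ => ?_
    have := (hX.isPrimitiveOn_q hc x).2 t (uIcc_of_le hX.nonneg ▸ ht)
    simp only at this ⊢
    rw [this, add_sub_cancel_left]
  have e3 := integral_swap_of_abs_le (hX.reg.measurable_w hc) (hX.abs_w_le hc) 0 t a b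
  have e4 : ∫ r in (0 : ℝ)..t, ((X r).U b - (X r).U a) =
      ∫ r in (0 : ℝ)..t, ∫ x in a..b, c.w (X r) x := by
    refine intervalIntegral.integral_congr fun r hr => ?_
    rw [uIcc_of_le ht.1] at hr
    exact hX.U_sub_eq hc h0 ⟨hr.1, hr.2.trans ht.2⟩ a b
  linarith

end SolvesUpTo

/-! ### Energy estimate -/

/-- `D` is an integrable majorant for the variables that decay at infinity, uniformly in time. -/
structure Dominates (c : Weights) (D : ℝ → ℝ) (X : ℝ → AngState) : Prop where
  integrable : Integrable D
  U : ∀ t ξ, (X t).U ξ ^ 2 ≤ D ξ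
  θ : ∀ t ξ i, c.N ξ i * Real.cos ((X t).θ ξ i) ^ 2 ≤ D ξ

lemma Dominates.nonneg {c : Weights} {D : ℝ → ℝ} {X : ℝ → AngState} (h : Dominates c D X) (ξ : ℝ) :
    0 ≤ D ξ := (sq_nonneg _).trans (h.U 0 ξ)

/-- The energy density `U² y_ξ + h̄`. -/
def Weights.energyDensity (c : Weights) (Z : AngState) (ξ : ℝ) : ℝ := Z.U ξ ^ 2 * c.q Z ξ + c.hb Z ξ

/-- An integrable function is small at arbitrarily large points and their opposites. -/
lemma exists_seq_small_of_integrable {D : ℝ → ℝ} (hD : Integrable D) (h0 : ∀ x, 0 ≤ D x) :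
    ∃ R : ℕ → ℝ, (∀ n : ℕ, (n : ℝ) ≤ R n) ∧ Tendsto (fun n => D (R n)) atTop (𝓝 0) ∧
      Tendsto (fun n => D (-R n)) atTop (𝓝 0) := by
  have hf : Integrable fun x => D x + D (-x) := hD.add hD.comp_neg
  have h1 : ∀ n : ℕ, ∃ x : ℝ, (n : ℝ) ≤ x ∧ D x + D (-x) ≤ 1 / ((n : ℝ) + 1) := fun n => by
    by_contra! hcon
    have h2 : IntegrableOn (fun _ : ℝ => 1 / ((n : ℝ) + 1)) (Ici (n : ℝ)) := by
      refine Integrable.mono' hf.integrableOn aestronglyMeasurable_const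
        ((ae_restrict_iff' measurableSet_Ici).2 (.of_forall fun x hx => ?_))
      rw [Real.norm_eq_abs, abs_of_pos (by positivity)]
      exact (hcon x hx).le
    rw [integrableOn_const_iff] at h2
    rcases h2 with h2 | h2
    · have : (0 : ℝ) < 1 / ((n : ℝ) + 1) := by positivity
      exact absurd h2 (by simpa using this.ne')
    · simp at h2
  choose R hR hR' using h1
  have ht : Tendsto (fun n : ℕ => 1 / ((n : ℝ) + 1)) atTop (𝓝 0) :=
    tendsto_one_div_add_atTop_nhds_zero_nat
  exact ⟨R, hR, squeeze_zero (fun n => h0 _) (fun n => by linarith [hR' n, h0 (-R n)]) ht,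
    squeeze_zero (fun n => h0 _) (fun n => by linarith [hR' n, h0 (R n)]) ht⟩

section Density

variable {c : Weights} {M : ℝ} {Z : AngState} (hc : c.Valid M)
include hc

lemma Weights.Valid.w_sq_le (ξ : ℝ) : c.w Z ξ ^ 2 ≤ c.q Z ξ * c.hb Z ξ := by
  unfold Weights.w Weights.q Weights.hb labW labQ labH
  refine Finset.sum_sq_le_sum_mul_sum_of_sq_le_mul _
    (fun i _ => mul_nonneg ((hc.bound ξ).nonneg i) (angQ_nonneg ((hc.bound ξ).beta i)))
    (fun i _ => mul_nonneg ((hc.bound ξ).nonneg i) (angH_nonneg ((hc.bound ξ).beta i)))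
    fun i _ => ?_
  rw [mul_pow, angW_sq]; exact le_of_eq (by ring)

lemma Weights.Valid.energyDensity_nonneg (ξ : ℝ) : 0 ≤ c.energyDensity Z ξ :=
  add_nonneg (mul_nonneg (sq_nonneg _) (hc.q_nonneg ξ)) (hc.hb_nonneg ξ)

lemma Weights.Valid.abs_two_mul_U_mul_w_le (ξ : ℝ) :
    |2 * (Z.U ξ * c.w Z ξ)| ≤ c.energyDensity Z ξ := by
  have h1 := hc.w_sq_le (Z := Z) ξ
  have h2 := hc.q_nonneg (Z := Z) ξ
  have h3 := hc.hb_nonneg (Z := Z) ξ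
  refine abs_le_of_sq_le_sq ?_ (hc.energyDensity_nonneg ξ)
  unfold Weights.energyDensity
  nlinarith [sq_nonneg (Z.U ξ ^ 2 * c.q Z ξ - c.hb Z ξ),
    mul_le_mul_of_nonneg_left h1 (sq_nonneg (Z.U ξ))]

end Density

namespace SolvesUpTo

variable {c : Weights} {M T : ℝ} {D : ℝ → ℝ} {X : ℝ → AngState} (hc : c.Valid M)
  (hX : SolvesUpTo c M T X) (hD : Dominates c D X)
  (h0 : ∀ a b, (X 0).U b - (X 0).U a = ∫ x in a..b, c.w (X 0) x)

include hc hX in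
lemma measurable_energyDensity (t : ℝ) : Measurable (c.energyDensity (X t)) :=
  (((hX.tube t).meas.U.pow_const 2).mul (hc.measurable_q (hX.tube t).meas)).add
    (hc.measurable_hb (hX.tube t).meas)

include hc hX hD in
lemma energyDensity_le (t ξ : ℝ) :
    c.energyDensity (X t) ξ ≤ (densBound M + 2 * Real.exp (M + 1)) * D ξ := by
  have h1 := (hc.bound ξ).labH_le (θ := (X t).θ ξ) ((hX.tube t).κ ξ)
  have h2 := (le_abs_self _).trans (hX.abs_q_le hc t ξ)
  have h3 := hc.q_nonneg (Z := X t) ξ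
  have h4 := Real.exp_pos (M + 1)
  rw [Fin.sum_univ_two] at h1
  have h5 : (X t).U ξ ^ 2 * c.q (X t) ξ ≤ D ξ * densBound M :=
    mul_le_mul (hD.U t ξ) h2 h3 (hD.nonneg ξ)
  have h6 := mul_le_mul_of_nonneg_left (add_le_add (hD.θ t ξ 0) (hD.θ t ξ 1)) h4.le
  unfold Weights.energyDensity Weights.hb
  linarith

include hc hX hD in
lemma integrable_energyDensity (t : ℝ) : Integrable (c.energyDensity (X t)) :=
  (hD.integrable.const_mul (densBound M + 2 * Real.exp (M + 1))).mono'
    (hX.measurable_energyDensity hc t).aestronglyMeasurable (.of_forall fun ξ => by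
      rw [Real.norm_eq_abs, abs_of_nonneg (hc.energyDensity_nonneg ξ)]
      exact hX.energyDensity_le hc hD t ξ)

/-- The rate of change of the energy density between breaking times. -/
def _root_.Weights.energyFlux (c : Weights) (Z : AngState) (ξ : ℝ) : ℝ :=
  3 * Z.U ξ ^ 2 * c.w Z ξ - 2 * c.P Z ξ * c.w Z ξ - 2 * Z.U ξ * c.Q Z ξ * c.q Z ξ

include hc hX in
lemma abs_energyFlux_le (t ξ : ℝ) : |c.energyFlux (X t) ξ| ≤ 3 * (M + 1) ^ 2 * densBound M +
    2 * nonlocalBound M * densBound M + 2 * (M + 1) * nonlocalBound M * densBound M := by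
  have h1 := (hX.tube t).U ξ
  have h2 := (hX.tube t).abs_P_le hc ξ
  have h3 := (hX.tube t).abs_Q_le hc ξ
  have h4 := hX.abs_w_le hc t ξ
  have h5 := hX.abs_q_le hc t ξ
  have hM := hc.M_nonneg
  have h6 := nonlocalBound_nonneg hM
  unfold Weights.energyFlux
  refine (abs_sub _ _).trans (add_le_add ((abs_sub _ _).trans (add_le_add ?_ ?_)) ?_)
  · rw [abs_mul, abs_mul, abs_pow, abs_of_pos (by norm_num : (0 : ℝ) < 3)]
    gcongr
  · rw [abs_mul, abs_mul, abs_two]; gcongr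
  · rw [abs_mul, abs_mul, abs_mul, abs_two]; gcongr

include hc hX in
lemma measurable_energyFlux : Measurable (Function.uncurry fun t => c.energyFlux (X t)) := by
  have hU := hX.reg.measurable_U
  have hw := hX.reg.measurable_w hc
  have hq := hX.reg.measurable_q hc
  exact ((((hU.pow_const 2).const_mul 3).mul hw).sub
    (((hX.measurable_P hc).const_mul 2).mul hw)).sub
    (((hU.const_mul 2).mul (hX.measurable_Q hc)).mul hq)

include hc hX in
lemma energyDensity_le_add {t : ℝ} (ht : t ∈ Icc 0 T) (ξ : ℝ) : c.energyDensity (X t) ξ ≤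
    c.energyDensity (X 0) ξ + ∫ r in (0 : ℝ)..t, c.energyFlux (X r) ξ := by
  have hU := hX.isPrimitiveOn_U hc ξ
  have h1 := ((hU.mul hU).mul (hX.isPrimitiveOn_q hc ξ)).2 t (uIcc_of_le hX.nonneg ▸ ht)
  have h1i := ((hU.mul hU).mul (hX.isPrimitiveOn_q hc ξ)).mono (c := 0) (d := t) (by simp)
    (uIcc_of_le hX.nonneg ▸ ht)
  have h2 := hX.hb_le hc le_rfl ht.1 ht.2 ξ
  have e : ∫ r in (0 : ℝ)..t, c.energyFlux (X r) ξ =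
      (∫ r in (0 : ℝ)..t, ((-c.Q (X r) ξ * (X r).U ξ + (X r).U ξ * -c.Q (X r) ξ) * c.q (X r) ξ +
        (X r).U ξ * (X r).U ξ * c.w (X r) ξ)) + ∫ r in (0 : ℝ)..t, 2 * c.a (X r) ξ * c.w (X r) ξ := by
    rw [← intervalIntegral.integral_add h1i.1 (hX.intervalIntegrable_hb_deriv hc ξ 0 t)]
    refine intervalIntegral.integral_congr fun r _ => ?_
    simp only [Weights.energyFlux, Weights.a]
    ring
  rw [e]
  unfold Weights.energyDensity
  simp only [pow_two]
  linarith

include hc hX h0 in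
lemma integral_energyFlux {r : ℝ} (hr : r ∈ Icc 0 T) (a b : ℝ) :
    ∫ x in a..b, c.energyFlux (X r) x =
      ((X r).U b ^ 3 - 2 * c.P (X r) b * (X r).U b) -
      ((X r).U a ^ 3 - 2 * c.P (X r) a * (X r).U a) := by
  have hU : IsPrimitiveOn (X r).U (c.w (X r)) a b :=
    ⟨intervalIntegrable_of_measurable (hc.measurable_w (hX.tube r).meas) (hX.abs_w_le hc r) _ _,
      fun t _ => by rw [← hX.U_sub_eq hc h0 hr]; ring⟩
  have h := (((hU.mul hU).mul hU).sub (((hX.isPrimitiveOn_P_Q hc r a b).1.mul hU).const_mul 2)).eq_add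
  have e : ∫ x in a..b, c.energyFlux (X r) x = ∫ x in a..b,
      ((c.w (X r) x * (X r).U x + (X r).U x * c.w (X r) x) * (X r).U x +
        (X r).U x * (X r).U x * c.w (X r) x -
        2 * (c.q (X r) x * c.Q (X r) x * (X r).U x + c.P (X r) x * c.w (X r) x)) := by
    refine intervalIntegral.integral_congr fun x _ => ?_
    simp only [Weights.energyFlux]
    ring
  rw [e]
  linarith

include hc hX hD h0 in
/-- The energy does not increase. -/
theorem energy_le {t : ℝ} (ht : t ∈ Icc 0 T) :
    ∫ ξ, c.energyDensity (X t) ξ ≤ ∫ ξ, c.energyDensity (X 0) ξ := by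
  obtain ⟨R, hR, hR1, hR2⟩ := exists_seq_small_of_integrable hD.integrable hD.nonneg
  have hRt : Tendsto R atTop atTop := tendsto_atTop_mono hR tendsto_natCast_atTop_atTop
  have hi := fun t => hX.integrable_energyDensity hc hD t
  have l1 := fun t => intervalIntegral_tendsto_integral (hi t)
    (tendsto_neg_atTop_atBot.comp hRt) hRt
  set C := (M + 1) ^ 2 + 2 * nonlocalBound M
  have l2 : Tendsto (fun n => t * (C * (Real.sqrt (D (R n)) + Real.sqrt (D (-R n))))) atTop (𝓝 0) := by
    have := ((hR1.sqrt.add hR2.sqrt).const_mul C).const_mul t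
    simpa using this
  have hbd : ∀ r x, |(X r).U x ^ 3 - 2 * c.P (X r) x * (X r).U x| ≤ C * Real.sqrt (D x) := by
    intro r x
    have e : (X r).U x ^ 3 - 2 * c.P (X r) x * (X r).U x =
      ((X r).U x ^ 2 - 2 * c.P (X r) x) * (X r).U x := by ring
    have h1 : |(X r).U x| ≤ Real.sqrt (D x) := Real.abs_le_sqrt (hD.U r x)
    have h2 : |(X r).U x ^ 2 - 2 * c.P (X r) x| ≤ C := by
      refine (abs_sub _ _).trans (add_le_add ?_ ?_)
      · rw [abs_pow]; exact pow_le_pow_left₀ (abs_nonneg _) ((hX.tube r).U x) 2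
      · rw [abs_mul, abs_two]
        linarith [(hX.tube r).abs_P_le hc x]
    rw [e, abs_mul]
    exact mul_le_mul h2 h1 (abs_nonneg _) ((abs_nonneg _).trans h2)
  have key : ∀ n, ∫ x in (-R n)..(R n), c.energyDensity (X t) x ≤
      (∫ x in (-R n)..(R n), c.energyDensity (X 0) x) +
      t * (C * (Real.sqrt (D (R n)) + Real.sqrt (D (-R n)))) := fun n => by
    have hle : -R n ≤ R n := by have := (Nat.cast_nonneg n).trans (hR n); linarith
    have hfi : ∀ s, Measurable fun x => ∫ r in (0 : ℝ)..s, c.energyFlux (X r) x := fun s =>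
      measurable_intervalIntegral_left (hX.measurable_energyFlux hc) _ _
    have hswap := integral_swap_of_abs_le (hX.measurable_energyFlux hc) (hX.abs_energyFlux_le hc)
      0 t (-R n) (R n)
    have hfii : IntervalIntegrable (fun x => ∫ r in (0 : ℝ)..t, c.energyFlux (X r) x) volume
        (-R n) (R n) := intervalIntegrable_of_measurable (hfi t) (fun x =>
          (Real.norm_eq_abs _).ge.trans <| intervalIntegral.norm_integral_le_of_norm_le_const
            fun r _ => (Real.norm_eq_abs _).le.trans (hX.abs_energyFlux_le hc r x)) _ _
    have h1 := intervalIntegral.integral_mono_on hle (hi t).intervalIntegrable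
      ((hi 0).intervalIntegrable.add hfii) fun x _ => hX.energyDensity_le_add hc ht x
    refine h1.trans ?_
    rw [intervalIntegral.integral_add (hi 0).intervalIntegrable hfii, ← hswap]
    gcongr
    have h2 := intervalIntegral.norm_integral_le_of_norm_le_const (a := 0) (b := t)
      (f := fun r => ∫ x in (-R n)..(R n), c.energyFlux (X r) x)
      (C := C * (Real.sqrt (D (R n)) + Real.sqrt (D (-R n)))) fun r hr => by
        rw [uIoc_of_le ht.1] at hr
        rw [hX.integral_energyFlux hc h0 ⟨hr.1.le, hr.2.trans ht.2⟩]
        refine (abs_sub _ _).trans ((add_le_add (hbd r _) (hbd r _)).trans (le_of_eq ?_))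
        ring
    rw [sub_zero, abs_of_nonneg ht.1] at h2
    rw [mul_comm]
    exact (le_abs_self _).trans h2
  have := le_of_tendsto_of_tendsto' (l1 t) ((l1 0).add l2) key
  simpa using this

include hc hX hD h0 in
lemma U_sq_le {t : ℝ} (ht : t ∈ Icc 0 T) (ξ : ℝ) :
    (X t).U ξ ^ 2 ≤ ∫ ξ, c.energyDensity (X 0) ξ := by
  refine le_trans ?_ (hX.energy_le hc hD h0 ht)
  obtain ⟨R, hR, -, hR2⟩ := exists_seq_small_of_integrable hD.integrable hD.nonneg
  have hRt : Tendsto R atTop atTop := tendsto_atTop_mono hR tendsto_natCast_atTop_atTop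
  have hi := hX.integrable_energyDensity hc hD t
  have key : ∀ᶠ n in atTop, (X t).U ξ ^ 2 ≤ D (-R n) + ∫ ξ, c.energyDensity (X t) ξ := by
    filter_upwards [hRt.eventually (eventually_ge_atTop (-ξ))] with n hn
    have hle : -R n ≤ ξ := by linarith
    have hU : IsPrimitiveOn (X t).U (c.w (X t)) (-R n) ξ :=
      ⟨intervalIntegrable_of_measurable (hc.measurable_w (hX.tube t).meas) (hX.abs_w_le hc t) _ _,
        fun x _ => by rw [← hX.U_sub_eq hc h0 ht]; ring⟩
    have h1 := (hU.mul hU)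
    have h2 := h1.eq_add
    have h3 := intervalIntegral.integral_mono_on hle h1.1 hi.intervalIntegrable fun x _ => by
      have := (le_abs_self _).trans (hc.abs_two_mul_U_mul_w_le (Z := X t) x)
      linarith
    have h4 : ∫ x in (-R n)..ξ, c.energyDensity (X t) x ≤ ∫ x, c.energyDensity (X t) x := by
      rw [intervalIntegral.integral_of_le hle]
      exact setIntegral_le_integral hi (.of_forall fun x => hc.energyDensity_nonneg x)
    have h5 := hD.U t (-R n)
    simp only [pow_two] at h5 ⊢
    linarith
  have l := hR2.add_const (∫ ξ, c.energyDensity (X t) ξ)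
  rw [zero_add] at l
  exact ge_of_tendsto l key

include hc hX hD h0 in
lemma P_le {t : ℝ} (ht : t ∈ Icc 0 T) (ξ : ℝ) :
    0 ≤ c.P (X t) ξ ∧ c.P (X t) ξ ≤ (∫ ξ, c.energyDensity (X 0) ξ) / 2 := by
  have hE := hX.energy_le hc hD h0 ht
  have hi := hX.integrable_energyDensity hc hD t
  have hnn : 0 ≤ nonlocalTerm (fun _ => 1) (c.q (X t)) (c.rho (X t)) ξ :=
    integral_nonneg fun η => by
      have := hc.rho_nonneg (Z := X t) η
      positivity
  have h1 : nonlocalTerm (fun _ => 1) (c.q (X t)) (c.rho (X t)) ξ ≤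
      ∫ ξ, 2 * c.energyDensity (X t) ξ := by
    refine integral_mono_of_nonneg (.of_forall fun η => ?_) (hi.const_mul 2)
      (.of_forall fun η => ?_)
    · have := hc.rho_nonneg (Z := X t) η
      simp only [Pi.zero_apply]; positivity
    · have h2 := hc.rho_nonneg (Z := X t) η
      have h3 := hc.hb_nonneg (Z := X t) η
      simp only [one_mul]
      refine (mul_le_of_le_one_left h2 (Real.exp_le_one_iff.2 (by simp))).trans ?_
      rw [Weights.rho_eq]; unfold Weights.energyDensity; linarith
  rw [integral_const_mul] at h1
  unfold Weights.P
  constructor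
  · positivity
  · linarith

include hc hX hD h0 in
/-- Bounds that depend on the initial state and the length of the time interval only. -/
theorem startBound {E K₀ C₀ M' : ℝ} (hE : E = ∫ ξ, c.energyDensity (X 0) ξ)
    (hκ : ∀ ξ i, |(X 0).κ ξ i| ≤ K₀) (hC : ∀ η ξ, η ≤ ξ → (ξ - η) - C₀ ≤ ∫ x in η..ξ, c.q (X 0) x)
    (h1 : Real.sqrt E ≤ M') (h2 : K₀ + (1 / 2 + 3 / 2 * E) * T ≤ M')
    (h3 : C₀ + 2 * Real.sqrt E * T ≤ M') (t : ℝ) : StartBound c M' (X t) := by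
  rw [hX.clamp]
  have ht := timeClamp_mem (s := 0) hX.nonneg t
  rw [zero_add] at ht
  set t' := timeClamp 0 T t
  have hE0 : 0 ≤ E := hE ▸ integral_nonneg fun ξ => hc.energyDensity_nonneg ξ
  have hU : ∀ r ∈ Icc 0 T, ∀ ξ, |(X r).U ξ| ≤ Real.sqrt E := fun r hr ξ =>
    Real.abs_le_sqrt (hE ▸ hX.U_sq_le hc hD h0 hr ξ)
  have hT := hX.nonneg
  refine ⟨(hX.tube _).meas, fun ξ => (hU _ ht ξ).trans h1, fun ξ i => ?_, fun η ξ hle => ?_⟩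
  · have ha : ∀ r ∈ Icc 0 T, |c.a (X r) ξ| ≤ 3 / 2 * E := fun r hr => by
      have b1 := hX.U_sq_le hc hD h0 hr ξ
      have b2 := hX.P_le hc hD h0 hr ξ
      have b3 := sq_nonneg ((X r).U ξ)
      rw [← hE] at b1 b2
      unfold Weights.a
      rw [abs_le]; constructor <;> linarith
    have h4 := (hX.isPrimitiveOn_κ hc ξ i).mono (c := 0) (d := t') (by simp)
      (uIcc_of_le hT ▸ ht)
    have h5 := h4.abs_sub_le ht.1 (C := 1 / 2 + 3 / 2 * E)
      (fun r hr => angG_bound (ha r ⟨hr.1, hr.2.trans ht.2⟩))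
    have h6 := abs_sub_abs_le_abs_sub ((X t').κ ξ i) ((X 0).κ ξ i)
    have h7 : (1 / 2 + 3 / 2 * E) * (t' - 0) ≤ (1 / 2 + 3 / 2 * E) * T := by
      gcongr; linarith [ht.2]
    linarith [hκ ξ i]
  · rw [hX.integral_q_eq hc h0 ht]
    have h4 := intervalIntegral.norm_integral_le_of_norm_le_const (a := 0) (b := t')
      (f := fun r => (X r).U ξ - (X r).U η) (C := 2 * Real.sqrt E) fun r hr => by
        rw [uIoc_of_le ht.1] at hr
        have hr' : r ∈ Icc 0 T := ⟨hr.1.le, hr.2.trans ht.2⟩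
        exact (abs_sub _ _).trans (by linarith [hU r hr' ξ, hU r hr' η])
    rw [sub_zero, abs_of_nonneg ht.1] at h4
    have h5 : 2 * Real.sqrt E * t' ≤ 2 * Real.sqrt E * T := by gcongr; exact ht.2
    linarith [(abs_le.1 h4).1, hC η ξ hle]

end SolvesUpTo

/-! ### Uniqueness and continuation -/

lemma SmallStep.mono {M δ δ' ε : ℝ} (hM : 0 ≤ M) (h : SmallStep M δ ε) (h0 : 0 < δ') (hle : δ' ≤ δ) :
    SmallStep M δ' ε := by
  have hL := (speedBound_pos hM).le
  have hA := densBound_nonneg hM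
  have hdec : 0 ≤ decaySpeed M := by unfold decaySpeed nonlocalDecay rhoDecay; positivity
  refine ⟨h0, hle.trans h.le_one, h.eps, le_trans (by gcongr) h.speed, le_trans (by gcongr) h.kernel,
    le_trans (by gcongr) h.slope, le_trans (by gcongr) h.decay, le_trans ?_ h.lip,
    le_trans (by gcongr) h.brk⟩
  exact mul_le_mul_of_nonneg_left (by linarith) (stepLip_pos hM).le

namespace SolvesUpTo

variable {c : Weights} {M M' T s δ ε : ℝ} {D : ℝ → ℝ} {X X' : ℝ → AngState}

lemma of_startBound (hX : SolvesUpTo c M T X) (h : ∀ t, StartBound c M' (X t)) :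
    SolvesUpTo c M' T X :=
  { hX with
    tube := fun t => ⟨(h t).meas, fun ξ => ((h t).U ξ).trans (by linarith),
      fun ξ i => ((h t).κ ξ i).trans (by linarith), hX.interval t, fun η ξ hle => by
        linarith [(h t).kernel η ξ hle]⟩ }

lemma nearPath (hc : c.Valid M) (hX : SolvesUpTo c M T X) (hs : 0 ≤ s) (hδ : 0 ≤ δ) (hT : s + δ ≤ T) :
    NearPath M (X s) δ fun t => X (timeClamp s δ t) := by
  have hM := hc.M_nonneg
  have hcl := continuous_timeClamp s δ
  have hnb := nonlocalBound_nonneg hM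
  have hb1 : nonlocalBound M ≤ speedBound M := by
    unfold speedBound; linarith [sq_nonneg (M + 1)]
  have hb2 : 1 / 2 + ((M + 1) ^ 2 + nonlocalBound M) ≤ speedBound M := by
    unfold speedBound; linarith [sq_nonneg (M + 1)]
  have hsub : ∀ t, s ∈ uIcc 0 T ∧ timeClamp s δ t ∈ uIcc 0 T := fun t => by
    have := timeClamp_mem (s := s) hδ t
    rw [uIcc_of_le hX.nonneg]
    exact ⟨⟨hs, by linarith⟩, ⟨hs.trans this.1, this.2.trans hT⟩⟩
  have hlen : ∀ t, speedBound M * (timeClamp s δ t - s) ≤ speedBound M * δ := fun t => by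
    have := timeClamp_mem (s := s) hδ t
    exact mul_le_mul_of_nonneg_left (by linarith [this.2]) (speedBound_pos hM).le
  refine ⟨⟨fun t => (hX.tube _).meas, fun ξ => (hX.reg.contU ξ).comp hcl,
    fun ξ i => (hX.reg.contθ ξ i).comp hcl, fun ξ i => (hX.reg.contκ ξ i).comp hcl⟩,
    fun t ξ => ?_, fun t ξ i => ?_, fun t ξ i => ?_⟩
  · exact (((hX.isPrimitiveOn_U hc ξ).mono (hsub t).1 (hsub t).2).abs_sub_le
      (timeClamp_mem hδ t).1 fun r _ => by
        rw [abs_neg]; exact ((hX.tube r).abs_Q_le hc ξ).trans hb1).trans (hlen t)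
  · exact (((hX.isPrimitiveOn_θ hc ξ i).mono (hsub t).1 (hsub t).2).abs_sub_le
      (timeClamp_mem hδ t).1 fun r _ => (angF_bound (hX.abs_a_le hc r ξ)).trans hb2).trans (hlen t)
  · exact (((hX.isPrimitiveOn_κ hc ξ i).mono (hsub t).1 (hsub t).2).abs_sub_le
      (timeClamp_mem hδ t).1 fun r _ => (angG_bound (hX.abs_a_le hc r ξ)).trans hb2).trans (hlen t)

lemma _root_.AngState.ext' {Z Z' : AngState} (hU : ∀ ξ, Z.U ξ = Z'.U ξ)
    (hθ : ∀ ξ i, Z.θ ξ i = Z'.θ ξ i) (hκ : ∀ ξ i, Z.κ ξ i = Z'.κ ξ i) : Z = Z' := by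
  cases Z; cases Z'
  simp only [AngState.mk.injEq]
  exact ⟨funext hU, funext fun ξ => funext (hθ ξ), funext fun ξ => funext (hκ ξ)⟩

lemma picard_eq (hc : c.Valid M) (hX : SolvesUpTo c M T X) (hs : 0 ≤ s) (hδ : 0 ≤ δ)
    (hT : s + δ ≤ T) :
    c.picard (X s) s δ (fun t => X (timeClamp s δ t)) = fun t => X (timeClamp s δ t) := by
  funext t
  have hm := timeClamp_mem (s := s) hδ t
  have hsub : s ∈ uIcc 0 T ∧ timeClamp s δ t ∈ uIcc 0 T := by
    rw [uIcc_of_le hX.nonneg]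
    exact ⟨⟨hs, by linarith⟩, ⟨hs.trans hm.1, hm.2.trans hT⟩⟩
  have hcl : ∀ r ∈ uIcc s (timeClamp s δ t), timeClamp s δ r = r := fun r hr => by
    rw [uIcc_of_le hm.1] at hr
    exact timeClamp_eq ⟨hr.1, hr.2.trans hm.2⟩
  refine AngState.ext' (fun ξ => ?_) (fun ξ i => ?_) fun ξ i => ?_
  · have h := ((hX.isPrimitiveOn_U hc ξ).mono hsub.1 hsub.2).eq_add
    rw [h, intervalIntegral.integral_neg, ← sub_eq_add_neg]
    simp only [Weights.picard]
    congr 1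
    exact intervalIntegral.integral_congr fun r hr => by simp only [hcl r hr]
  · have h := ((hX.isPrimitiveOn_θ hc ξ i).mono hsub.1 hsub.2).eq_add
    rw [h]
    simp only [Weights.picard]
    congr 1
    exact intervalIntegral.integral_congr fun r hr => by simp only [hcl r hr]
  · have h := ((hX.isPrimitiveOn_κ hc ξ i).mono hsub.1 hsub.2).eq_add
    rw [h]
    simp only [Weights.picard]
    congr 1
    exact intervalIntegral.integral_congr fun r hr => by simp only [hcl r hr]

/-- Solutions are determined by their initial values. -/
theorem unique (hc : c.Valid M) (hX : SolvesUpTo c M T X) (hX' : SolvesUpTo c M T X')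
    (hb : ∀ t, StartBound c M (X t)) (h0 : X 0 = X' 0) : X = X' := by
  have hT := hX.nonneg
  obtain ⟨δ, ε, hs⟩ := exists_smallStep hc.M_nonneg
  obtain ⟨n, hn⟩ := exists_nat_gt (T / δ)
  have hnp : (0 : ℝ) < n := lt_of_le_of_lt (div_nonneg hT hs.pos.le) hn
  have hT' : T / n ≤ δ := by
    rw [div_le_iff₀ hnp]; rw [div_lt_iff₀ hs.pos] at hn; linarith
  have key : ∀ k : ℕ, k ≤ n → ∀ t ∈ Icc 0 (k * (T / n)), X t = X' t := by
    intro k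
    induction k with
    | zero => intro _ t ht; simp at ht; rw [ht, h0]
    | succ k ih =>
      intro hk t ht
      have hk0 := ih (by omega)
      have hTn : 0 ≤ T / n := by positivity
      rcases hTn.eq_or_lt with hz | hpos
      · refine hk0 t ?_
        rw [← hz] at ht ⊢; simpa using ht
      rcases le_total t (k * (T / n)) with hle | hle
      · exact hk0 t ⟨ht.1, hle⟩
      have hs0 : 0 ≤ (k : ℝ) * (T / n) := by positivity
      have hsT : (k : ℝ) * (T / n) + T / n ≤ T := by
        have h1 : ((k + 1 : ℕ) : ℝ) * (T / n) ≤ n * (T / n) := by gcongr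
        rw [mul_div_cancel₀ _ hnp.ne'] at h1
        push_cast at h1
        linarith
      have hst := hs.mono hc.M_nonneg hpos hT'
      have e0 : X (k * (T / n)) = X' (k * (T / n)) := hk0 _ ⟨hs0, le_rfl⟩
      have p1 := hX.picard_eq hc hs0 hTn hsT
      have p2 := hX'.picard_eq hc hs0 hTn hsT
      have n1 := hX.nearPath hc hs0 hTn hsT
      have n2 := hX'.nearPath hc hs0 hTn hsT
      rw [← e0] at p2 n2
      have := congrFun (n1.eq_of_picard_eq hc (hb _) hst n2 p1 p2) t
      rw [timeClamp_eq] at this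
      · exact this
      · refine ⟨hle, ?_⟩
        have := ht.2
        push_cast at this
        linarith
  funext t
  rw [hX.clamp, hX'.clamp]
  refine key n le_rfl _ ?_
  have e : (n : ℝ) * (T / n) = T := by field_simp
  have := timeClamp_mem (s := 0) hT t
  rw [zero_add] at this
  rwa [e]

/-- Continuation by one time step. -/
theorem extend (hc : c.Valid M) (hX : SolvesUpTo c M T X) (hb : StartBound c M (X T))
    (hD : Dominates c D X) (hs : SmallStep M δ ε) :
    ∃ Y D', SolvesUpTo c M (T + δ) Y ∧ Y 0 = X 0 ∧ Dominates c D' Y := by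
  have hT := hX.nonneg
  have hM := hc.M_nonneg
  have hδ := hs.pos.le
  set D₀ : ℝ → ℝ := fun ξ => (X T).U ξ ^ 2 + ∑ i, c.N ξ i * Real.cos ((X T).θ ξ i) ^ 2 with hD₀
  have hN := fun ξ i => (hc.bound ξ).nonneg i
  have hterm : ∀ ξ i, 0 ≤ c.N ξ i * Real.cos ((X T).θ ξ i) ^ 2 := fun ξ i =>
    mul_nonneg (hN ξ i) (sq_nonneg _)
  have hm : Measurable D₀ := (hb.meas.U.pow_const 2).add (Finset.measurable_sum
    (f := fun i ξ => c.N ξ i * Real.cos ((X T).θ ξ i) ^ 2) Finset.univ fun i _ =>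
    (hc.measN i).mul ((Real.measurable_cos.comp (hb.meas.θ i)).pow_const 2))
  have hD00 : ∀ ξ, 0 ≤ D₀ ξ := fun ξ =>
    add_nonneg (sq_nonneg _) (Finset.sum_nonneg fun i _ => hterm ξ i)
  have hR : ∀ ξ, D₀ ξ ≤ M ^ 2 + 2 * M := fun ξ => by
    have h1 : (X T).U ξ ^ 2 ≤ M ^ 2 := sq_le_sq' (abs_le.1 (hb.U ξ)).1 (abs_le.1 (hb.U ξ)).2
    have h2 : ∀ i, c.N ξ i * Real.cos ((X T).θ ξ i) ^ 2 ≤ M := fun i =>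
      (mul_le_of_le_one_right (hN ξ i) (Real.cos_sq_le_one _)).trans ((hc.bound ξ).le i)
    simp only [hD₀, Fin.sum_univ_two]
    linarith [h2 0, h2 1]
  have hint : Integrable D₀ := (hD.integrable.const_mul 3).mono' hm.aestronglyMeasurable
    (.of_forall fun ξ => by
      rw [Real.norm_eq_abs, abs_of_nonneg (hD00 ξ)]
      simp only [hD₀, Fin.sum_univ_two]
      linarith [hD.U T ξ, hD.θ T ξ 0, hD.θ T ξ 1])
  have hmaj : DecayMajorant M (decayWeight D₀) :=
    ⟨measurable_decayWeight hm, fun ξ => (hD00 ξ).trans (le_decayWeight hD00 ξ),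
      fun ξ => decayWeight_le hm hD00 hR ξ, fun ξ => expConv_decayWeight_le hm hD00 hR ξ⟩
  have hdec : Decays c (decayWeight D₀) 1 (X T) := by
    refine ⟨fun ξ => ?_, fun ξ i => ?_⟩
    · rw [one_mul]
      refine Real.abs_le_sqrt (le_trans ?_ (le_decayWeight hD00 ξ))
      exact le_add_of_nonneg_right (Finset.sum_nonneg fun i _ => hterm ξ i)
    · rw [one_mul, ← Real.sqrt_sq_eq_abs, ← Real.sqrt_mul (hN ξ i)]
      refine Real.sqrt_le_sqrt (le_trans ?_ (le_decayWeight hD00 ξ))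
      refine le_trans ?_ (le_add_of_nonneg_left (sq_nonneg _))
      exact Finset.single_le_sum (f := fun i => c.N ξ i * Real.cos ((X T).θ ξ i) ^ 2)
        (fun j _ => hterm ξ j) (Finset.mem_univ i)
  obtain ⟨Z, hZ, hZD, hZp⟩ := exists_local_solution hc hb hs T hmaj hdec
  have hZT : ∀ t ≤ T, Z t = X T := fun t ht => by
    have h1 : timeClamp T δ t = T := by
      unfold timeClamp; exact max_eq_left ((min_le_left _ _).trans ht)
    rw [← hZp]
    refine AngState.ext' (fun ξ => ?_) (fun ξ i => ?_) fun ξ i => ?_ <;>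
    simp [Weights.picard, h1]
  have hZcl : ∀ t, Z t = Z (timeClamp T δ t) := fun t => by
    have h1 : timeClamp T δ (timeClamp T δ t) = timeClamp T δ t := timeClamp_eq (timeClamp_mem hδ t)
    rw [← hZp]
    simp only [Weights.picard, h1]
  have hXcl : ∀ t, T ≤ t → X t = X T := fun t ht => by
    rw [hX.clamp t]; congr 1; unfold timeClamp
    rw [zero_add, min_eq_right ht, max_eq_right hT]
  have hX0 : ∀ t ≤ 0, X t = X 0 := fun t ht => by
    rw [hX.clamp t]; congr 1; unfold timeClamp
    exact max_eq_left ((min_le_left _ _).trans ht)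
  set Y : ℝ → AngState := fun t => if t ≤ T then X t else Z t with hY
  have hYX : ∀ t ≤ T, Y t = X t := fun t ht => if_pos ht
  have hYZ : ∀ t, T ≤ t → Y t = Z t := fun t ht => by
    rcases ht.eq_or_lt with rfl | hlt
    · rw [hYX _ le_rfl, hZT _ le_rfl]
    · exact if_neg (not_le.2 hlt)
  have hcont : ∀ φ : AngState → ℝ, (Continuous fun t => φ (X t)) → (Continuous fun t => φ (Z t)) →
      Continuous fun t => φ (Y t) := fun φ h1 h2 => by
    have : (fun t => φ (Y t)) = fun t => if t ≤ T then φ (X t) else φ (Z t) := by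
      funext t; simp only [hY]; split_ifs <;> rfl
    rw [this]
    exact Continuous.if_le h1 h2 continuous_id continuous_const fun t ht => by
      rw [ht, hZT _ le_rfl]
  -- an integral from `0` splits at `T`
  have hsplit : ∀ (φ : AngState → ℝ) (t : ℝ), T ≤ t →
      (∀ a b, IntervalIntegrable (fun r => φ (X r)) volume a b) →
      (∀ a b, IntervalIntegrable (fun r => φ (Z r)) volume a b) →
      ∫ r in (0 : ℝ)..t, φ (Y r) = (∫ r in (0 : ℝ)..T, φ (X r)) + ∫ r in T..t, φ (Z r) := by
    intro φ t ht h1 h2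
    have e1 : EqOn (fun r => φ (Y r)) (fun r => φ (X r)) (uIcc 0 T) := fun r hr => by
      rw [uIcc_of_le hT] at hr; simp only [hYX r hr.2]
    have e2 : EqOn (fun r => φ (Y r)) (fun r => φ (Z r)) (uIcc T t) := fun r hr => by
      rw [uIcc_of_le ht] at hr; simp only [hYZ r hr.1]
    rw [← intervalIntegral.integral_congr e1, ← intervalIntegral.integral_congr e2]
    exact (intervalIntegral.integral_add_adjacent_intervals
      ((h1 0 T).congr (fun r hr => (e1 (uIoc_subset_uIcc hr)).symm))
      ((h2 T t).congr (fun r hr => (e2 (uIoc_subset_uIcc hr)).symm))).symm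
  have hZpt : ∀ t ∈ Icc T (T + δ), Z t = c.picard (X T) T δ Z t := fun t _ => by rw [hZp]
  refine ⟨Y, fun ξ => D ξ + 4 * decayWeight D₀ ξ, ⟨by linarith, ⟨fun t => ?_,
    fun ξ => hcont (fun S => S.U ξ) (hX.reg.contU ξ) (hZ.reg.contU ξ),
    fun ξ i => hcont (fun S => S.θ ξ i) (hX.reg.contθ ξ i) (hZ.reg.contθ ξ i),
    fun ξ i => hcont (fun S => S.κ ξ i) (hX.reg.contκ ξ i) (hZ.reg.contκ ξ i)⟩,
    fun t => ?_, fun t => ?_, fun t ht ξ => ?_, fun t ht ξ i => ?_, fun t ht ξ i => ?_⟩,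
    hYX 0 hT, ⟨?_, fun t ξ => ?_, fun t ξ i => ?_⟩⟩
  · simp only [hY]; split_ifs
    · exact hX.reg.meas t
    · exact hZ.reg.meas t
  · rcases le_total t T with h | h
    · rw [hYX t h]
      rcases le_total t 0 with h2 | h2
      · have : timeClamp 0 (T + δ) t = 0 := by
          unfold timeClamp; exact max_eq_left ((min_le_left _ _).trans h2)
        rw [this, hYX 0 hT, hX0 t h2]
      · rw [timeClamp_eq ⟨h2, by linarith⟩, hYX t h]
    · rw [hYZ t h]
      have : timeClamp 0 (T + δ) t = timeClamp T δ t := by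
        unfold timeClamp
        rw [zero_add, max_eq_right (le_min (hT.trans h) (by linarith)),
          max_eq_right (le_min h (by linarith))]
      rw [this, hYZ _ (timeClamp_mem hδ t).1, ← hZcl]
  · simp only [hY]; split_ifs
    · exact hX.tube t
    · exact hZ.tube hc hb hs t
  · rcases le_total t T with h | h
    · rw [hYX t h, hYX 0 hT, hX.U_eq t ⟨ht.1, h⟩]
      congr 1
      refine intervalIntegral.integral_congr fun r hr => ?_
      rw [uIcc_of_le ht.1] at hr
      simp only [hYX r (hr.2.trans h)]
    · rw [hYZ t h, hYX 0 hT, hsplit (fun S => c.Q S ξ) t h (hX.intervalIntegrable_Q hc ξ)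
        (intervalIntegrable_of_measurable
          (hZ.reg.measurable_Q hc (hZ.interval hc hb hs)).of_uncurry_right
          (fun r => hZ.abs_Q_le hc hb hs r ξ)), hZpt t ⟨h, ht.2⟩]
      simp only [Weights.picard, timeClamp_eq (show t ∈ Icc T (T + δ) from ⟨h, ht.2⟩)]
      rw [hX.U_eq T ⟨hT, le_rfl⟩]
      ring
  · rcases le_total t T with h | h
    · rw [hYX t h, hYX 0 hT, hX.θ_eq t ⟨ht.1, h⟩]
      congr 1
      refine intervalIntegral.integral_congr fun r hr => ?_
      rw [uIcc_of_le ht.1] at hr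
      simp only [hYX r (hr.2.trans h)]
    · rw [hYZ t h, hYX 0 hT, hsplit (fun S => angF (c.a S ξ) (S.θ ξ i)) t h
        (hX.intervalIntegrable_angF hc ξ i) (intervalIntegrable_of_measurable
          (hZ.measurable_angF hc hb hs i).of_uncurry_right
          (fun r => hZ.abs_angF_le hc hb hs r ξ i)), hZpt t ⟨h, ht.2⟩]
      simp only [Weights.picard, timeClamp_eq (show t ∈ Icc T (T + δ) from ⟨h, ht.2⟩)]
      rw [hX.θ_eq T ⟨hT, le_rfl⟩]
      ring
  · rcases le_total t T with h | h
    · rw [hYX t h, hYX 0 hT, hX.κ_eq t ⟨ht.1, h⟩]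
      congr 1
      refine intervalIntegral.integral_congr fun r hr => ?_
      rw [uIcc_of_le ht.1] at hr
      simp only [hYX r (hr.2.trans h)]
    · rw [hYZ t h, hYX 0 hT, hsplit (fun S => angG (c.a S ξ) (S.θ ξ i)) t h
        (hX.intervalIntegrable_angG hc ξ i) (intervalIntegrable_of_measurable
          (hZ.measurable_angG hc hb hs i).of_uncurry_right
          (fun r => hZ.abs_angG_le hc hb hs r ξ i)), hZpt t ⟨h, ht.2⟩]
      simp only [Weights.picard, timeClamp_eq (show t ∈ Icc T (T + δ) from ⟨h, ht.2⟩)]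
      rw [hX.κ_eq T ⟨hT, le_rfl⟩]
      ring
  · exact hD.integrable.add ((integrable_decayWeight hint).const_mul 4)
  · have hw := hmaj.nonneg ξ
    simp only [hY]; split_ifs
    · linarith [hD.U t ξ]
    · have h1 := (hZD t).U ξ
      have h2 : (Z t).U ξ ^ 2 ≤ (2 * Real.sqrt (decayWeight D₀ ξ)) ^ 2 :=
        sq_le_sq' (abs_le.1 h1).1 (abs_le.1 h1).2
      rw [mul_pow, Real.sq_sqrt hw] at h2
      linarith [hD.nonneg ξ]
  · have hw := hmaj.nonneg ξ
    simp only [hY]; split_ifs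
    · linarith [hD.θ t ξ i]
    · have h1 := (hZD t).θ ξ i
      have h2 : (Real.sqrt (c.N ξ i) * |Real.cos ((Z t).θ ξ i)|) ^ 2 ≤
          (2 * Real.sqrt (decayWeight D₀ ξ)) ^ 2 := pow_le_pow_left₀ (by positivity) h1 2
      rw [mul_pow, mul_pow, Real.sq_sqrt hw, Real.sq_sqrt (hN ξ i), sq_abs] at h2
      linarith [hD.nonneg ξ]

end SolvesUpTo

/-! ### Global existence -/

/-- Initial states for which the system in angle variables has a global solution. -/
structure Admissible (c : Weights) (M : ℝ) (D : ℝ → ℝ) (Z : AngState) : Prop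
    extends StartBound c M Z where
  valid : c.Valid M
  cons : ∀ a b, Z.U b - Z.U a = ∫ x in a..b, c.w Z x
  dom : Dominates c D fun _ => Z

/-- A solution on `[0, ∞)`. -/
def IsFlow (c : Weights) (X : ℝ → AngState) : Prop :=
  ∀ T, 0 ≤ T → ∃ M D, c.Valid M ∧ SolvesUpTo c M T (fun t => X (timeClamp 0 T t)) ∧
    (∀ t, StartBound c M (X (timeClamp 0 T t))) ∧ Dominates c D fun t => X (timeClamp 0 T t)

lemma timeClamp_timeClamp {T T' : ℝ} (hT : 0 ≤ T) (hTT : T ≤ T') (t : ℝ) :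
    timeClamp 0 T' (timeClamp 0 T t) = timeClamp 0 T t := by
  have := timeClamp_mem (s := 0) hT t
  exact timeClamp_eq ⟨this.1, by linarith [this.2]⟩

lemma timeClamp_self {T : ℝ} (hT : 0 ≤ T) : timeClamp 0 T T = T := timeClamp_eq ⟨hT, by simp⟩

lemma timeClamp_zero {T : ℝ} (hT : 0 ≤ T) : timeClamp 0 T 0 = 0 := timeClamp_eq ⟨le_rfl, by simpa⟩

lemma timeClamp_mem' {T : ℝ} (hT : 0 ≤ T) (t : ℝ) : timeClamp 0 T t ∈ Icc 0 T := by
  simpa using timeClamp_mem (s := 0) hT t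

section

variable {c : Weights} {M T T' : ℝ} {D : ℝ → ℝ} {X X' : ℝ → AngState} {Z : AngState}

lemma SolvesUpTo.restrict (hX : SolvesUpTo c M T' X) (hT : 0 ≤ T) (hTT : T ≤ T') :
    SolvesUpTo c M T fun t => X (timeClamp 0 T t) := by
  have hcl := continuous_timeClamp 0 T
  have h0 := timeClamp_zero hT
  have hin : ∀ t ∈ Icc 0 T, ∀ r ∈ uIcc 0 t, timeClamp 0 T r = r := fun t ht r hr => by
    rw [uIcc_of_le ht.1] at hr
    exact timeClamp_eq ⟨hr.1, by linarith [hr.2, ht.2]⟩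
  have hself : ∀ t ∈ Icc 0 T, timeClamp 0 T t = t := fun t ht => hin t ht t (by simp)
  refine ⟨hT, ⟨fun t => (hX.tube _).meas, fun ξ => (hX.reg.contU ξ).comp hcl,
    fun ξ i => (hX.reg.contθ ξ i).comp hcl, fun ξ i => (hX.reg.contκ ξ i).comp hcl⟩,
    fun t => by rw [timeClamp_timeClamp hT le_rfl], fun t => hX.tube _, fun t ht ξ => ?_,
    fun t ht ξ i => ?_, fun t ht ξ i => ?_⟩
  · rw [h0, hself t ht, hX.U_eq t ⟨ht.1, ht.2.trans hTT⟩]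
    congr 1
    exact intervalIntegral.integral_congr fun r hr => by simp only [hin t ht r hr]
  · rw [h0, hself t ht, hX.θ_eq t ⟨ht.1, ht.2.trans hTT⟩]
    congr 1
    exact intervalIntegral.integral_congr fun r hr => by simp only [hin t ht r hr]
  · rw [h0, hself t ht, hX.κ_eq t ⟨ht.1, ht.2.trans hTT⟩]
    congr 1
    exact intervalIntegral.integral_congr fun r hr => by simp only [hin t ht r hr]

lemma Dominates.comp (h : Dominates c D X) (φ : ℝ → ℝ) : Dominates c D fun t => X (φ t) :=
  ⟨h.integrable, fun _ => h.U _, fun _ => h.θ _⟩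

lemma Weights.Valid.mono (hc : c.Valid M) {M' : ℝ} (h : M ≤ M') : c.Valid M' :=
  ⟨hc.measN, hc.measβ, fun ξ => ⟨(hc.bound ξ).nonneg, fun i => ((hc.bound ξ).le i).trans h,
    (hc.bound ξ).beta⟩⟩

lemma StartBound.mono (h : StartBound c M Z) {M' : ℝ} (hM : M ≤ M') : StartBound c M' Z :=
  ⟨h.meas, fun ξ => (h.U ξ).trans hM, fun ξ i => (h.κ ξ i).trans hM,
    fun η ξ hle => by linarith [h.kernel η ξ hle]⟩

/-- Uniqueness without common bounds. -/
theorem SolvesUpTo.unique' {M' : ℝ} (hc : c.Valid M) (hX : SolvesUpTo c M T X)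
    (hX' : SolvesUpTo c M' T X') (hb : ∀ t, StartBound c M (X t))
    (hb' : ∀ t, StartBound c M' (X' t)) (h0 : X 0 = X' 0) : X = X' := by
  have hB := fun t => (hb t).mono (le_max_left M M')
  exact (hX.of_startBound hB).unique (hc.mono (le_max_left _ _))
    (hX'.of_startBound fun t => (hb' t).mono (le_max_right M M')) hB h0

/-- Bound for the state up to time `T`, from the energy `E` and the bound `M` for the initial
state. -/
def aprioriBound (E M T : ℝ) : ℝ :=
  M + Real.sqrt E + (1 / 2 + 3 / 2 * E) * T + 2 * Real.sqrt E * T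

lemma Admissible.energy_nonneg (h : Admissible c M D Z) : 0 ≤ ∫ ξ, c.energyDensity Z ξ :=
  integral_nonneg fun ξ => h.valid.energyDensity_nonneg ξ

lemma Admissible.startBound (h : Admissible c M D Z) {M' : ℝ} {D' : ℝ → ℝ} (hc : c.Valid M')
    (hX : SolvesUpTo c M' T X) (h0 : X 0 = Z) (hD : Dominates c D' X) (hTT : T ≤ T') (t : ℝ) :
    StartBound c (aprioriBound (∫ ξ, c.energyDensity Z ξ) M T') (X t) := by
  have hE := h.energy_nonneg
  have hM := h.valid.M_nonneg
  have hT := hX.nonneg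
  have h1 : (1 / 2 + 3 / 2 * ∫ ξ, c.energyDensity Z ξ) * T ≤
      (1 / 2 + 3 / 2 * ∫ ξ, c.energyDensity Z ξ) * T' := by gcongr
  have h2 : 2 * Real.sqrt (∫ ξ, c.energyDensity Z ξ) * T ≤
      2 * Real.sqrt (∫ ξ, c.energyDensity Z ξ) * T' := by gcongr
  have h3 : 0 ≤ (1 / 2 + 3 / 2 * ∫ ξ, c.energyDensity Z ξ) * T := by positivity
  have h4 : 0 ≤ 2 * Real.sqrt (∫ ξ, c.energyDensity Z ξ) * T := by positivity
  have h5 := Real.sqrt_nonneg (∫ ξ, c.energyDensity Z ξ)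
  refine hX.startBound hc hD (by rw [h0]; exact h.cons) (K₀ := M) (C₀ := M) (by rw [h0])
    (by rw [h0]; exact h.κ) (by rw [h0]; exact h.kernel) ?_ ?_ ?_ t <;>
  unfold aprioriBound <;> linarith

lemma Admissible.le_aprioriBound (h : Admissible c M D Z) (hT : 0 ≤ T) :
    M ≤ aprioriBound (∫ ξ, c.energyDensity Z ξ) M T := by
  have hE := h.energy_nonneg
  have : 0 ≤ Real.sqrt (∫ ξ, c.energyDensity Z ξ) + (1 / 2 + 3 / 2 * ∫ ξ, c.energyDensity Z ξ) * T +
    2 * Real.sqrt (∫ ξ, c.energyDensity Z ξ) * T := by positivity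
  unfold aprioriBound
  linarith

lemma Admissible.solvesUpTo_zero (h : Admissible c M D Z) {M' : ℝ} (hM : M ≤ M') :
    SolvesUpTo c M' 0 fun _ => Z := by
  have hb := h.toStartBound.mono hM
  have hc := h.valid.mono hM
  refine ⟨le_rfl, ⟨fun _ => h.meas, fun _ => continuous_const, fun _ _ => continuous_const,
    fun _ _ => continuous_const⟩, fun _ => rfl, fun t => ⟨h.meas, fun ξ => ?_, fun ξ i => ?_, ?_, ?_⟩,
    fun t ht ξ => ?_, fun t ht ξ i => ?_, fun t ht ξ i => ?_⟩
  · linarith [hb.U ξ]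
  · linarith [hb.κ ξ i]
  · refine intervalIntegrable_of_measurable (C := densBound M') (hc.measurable_q h.meas) fun ξ => ?_
    rw [abs_of_nonneg (hc.q_nonneg ξ)]
    have h1 := (hc.bound ξ).labQ_add_labH_le (θ := Z.θ ξ) (κ := Z.κ ξ)
      fun i => by linarith [hb.κ ξ i]
    have h2 := hc.hb_nonneg (Z := Z) ξ
    unfold Weights.hb at h2
    unfold Weights.q
    linarith
  · intro η ξ hle
    linarith [hb.kernel η ξ hle]
  all_goals
    have : t = 0 := le_antisymm ht.2 ht.1
    simp [this]

theorem Admissible.exists_solvesUpTo (h : Admissible c M D Z) (hT : 0 ≤ T) :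
    ∃ X M' D', c.Valid M' ∧ SolvesUpTo c M' T X ∧ X 0 = Z ∧ (∀ t, StartBound c M' (X t)) ∧
      Dominates c D' X := by
  set E := ∫ ξ, c.energyDensity Z ξ with hEdef
  set M₁ := aprioriBound E M (T + 1) with hM₁
  have hMM : M ≤ M₁ := h.le_aprioriBound (by linarith)
  have hc := h.valid.mono hMM
  obtain ⟨δ, ε, hs⟩ := exists_smallStep hc.M_nonneg
  have key : ∀ n : ℕ, n * δ ≤ T + 1 → ∃ X D', SolvesUpTo c M₁ (n * δ) X ∧ X 0 = Z ∧
      (∀ t, StartBound c M₁ (X t)) ∧ Dominates c D' X := by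
    intro n
    induction n with
    | zero =>
      intro _
      refine ⟨fun _ => Z, D, ?_, rfl, fun _ => h.toStartBound.mono hMM, h.dom⟩
      simpa using h.solvesUpTo_zero hMM
    | succ n ih =>
      intro hn
      push_cast at hn
      obtain ⟨X, D', hX, h0, hb, hD⟩ := ih (by linarith [hs.pos])
      obtain ⟨Y, D'', hY, hY0, hYD⟩ := hX.extend hc (hb _) hD hs
      have e : (n : ℝ) * δ + δ = (n + 1 : ℕ) * δ := by push_cast; ring
      rw [e] at hY
      exact ⟨Y, D'', hY, hY0.trans h0, h.startBound hc hY (hY0.trans h0) hYD (by push_cast; linarith),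
        hYD⟩
  have hceil := Nat.ceil_lt_add_one (div_nonneg hT hs.pos.le)
  have hceil2 := Nat.le_ceil (T / δ)
  have h1 : (⌈T / δ⌉₊ : ℝ) * δ ≤ T + 1 := by
    have : (⌈T / δ⌉₊ : ℝ) * δ ≤ (T / δ + 1) * δ := by gcongr; exact hs.pos.le
    rw [add_mul, div_mul_cancel₀ _ hs.pos.ne'] at this
    linarith [hs.le_one]
  obtain ⟨X, D', hX, h0, hb, hD⟩ := key _ h1
  refine ⟨_, M₁, D', hc, hX.restrict hT ?_, ?_, fun t => hb _, hD.comp _⟩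
  · rwa [div_le_iff₀ hs.pos] at hceil2
  · rw [timeClamp_zero hT, h0]

theorem Admissible.exists_flow (h : Admissible c M D Z) : ∃ X, X 0 = Z ∧ IsFlow c X := by
  have hex : ∀ T : ℝ, ∃ X : ℝ → AngState, ∃ M' D', 0 ≤ T → c.Valid M' ∧ SolvesUpTo c M' T X ∧ X 0 = Z ∧
      (∀ t, StartBound c M' (X t)) ∧ Dominates c D' X := fun T => by
    by_cases hT : 0 ≤ T
    · obtain ⟨X, M', D', hX⟩ := h.exists_solvesUpTo hT
      exact ⟨X, M', D', fun _ => hX⟩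
    · exact ⟨fun _ => Z, 0, D, fun h => absurd h hT⟩
  choose F B D' hF using hex
  refine ⟨fun t => F t t, (hF 0 le_rfl).2.2.1, fun T hT => ?_⟩
  obtain ⟨hc, hX, h0, hb, hD⟩ := hF T hT
  have heq : (fun t => F (timeClamp 0 T t) (timeClamp 0 T t)) = F T := by
    funext t
    have hm := timeClamp_mem' hT t
    rw [hX.clamp t]
    set s := timeClamp 0 T t
    obtain ⟨hc', hX', h0', hb', hD'⟩ := hF s hm.1
    have := congrFun (SolvesUpTo.unique' hc' hX' (hX.restrict hm.1 hm.2) hb' (fun t => hb _)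
      (by rw [timeClamp_zero hm.1, h0, h0'])) s
    simp only [timeClamp_self hm.1] at this
    exact this
  refine ⟨B T, D' T, hc, ?_, ?_, ?_⟩
  · exact heq ▸ hX
  · intro t
    have := hb t
    rw [← congrFun heq t] at this
    exact this
  · exact heq ▸ hD

end

/-! ### Breaking times -/

lemma nextBreak_eq_of_pos {p : ℝ → ℝ} {a b : ℝ} (hab : a < b) (hpos : ∀ s ∈ Ioo a b, 0 < p s)
    (hb : p b = 0) : nextBreak p a = b := by
  have hset : {t | a < t ∧ ∀ s ∈ Ioo a t, 0 < p s} = Ioc a b := by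
    ext t
    refine ⟨fun ⟨h1, h2⟩ => ⟨h1, ?_⟩, fun h => ⟨h.1, fun s hs => hpos s ⟨hs.1, hs.2.trans_le h.2⟩⟩⟩
    by_contra hlt
    exact (h2 b ⟨hab, not_le.1 hlt⟩).ne' hb
  unfold nextBreak
  rw [if_pos ⟨b, hab, hpos, hb⟩, hset, csSup_Ioc hab]

lemma nextBreak_eq_top_of_pos {p : ℝ → ℝ} {a : ℝ} (h : ∀ t, a < t → 0 < p t) :
    nextBreak p a = ⊤ := by
  unfold nextBreak
  rw [if_neg]
  rintro ⟨t, h1, -, h2⟩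
  exact (h t h1).ne' h2

lemma nextBreak_eq_top_of_zero {p : ℝ → ℝ} {a : ℝ} (h : ∀ t, a < t → p t = 0) :
    nextBreak p a = ⊤ := by
  unfold nextBreak
  rw [if_neg]
  rintro ⟨t, h1, h2, -⟩
  have hm : (a + t) / 2 ∈ Ioo a t := ⟨by linarith, by linarith⟩
  exact (h2 _ hm).ne' (h _ hm.1)

lemma breakTime_zero (p : ℝ → ℝ) : breakTime p 0 = ((0 : ℝ) : EReal) := by simp [breakTime]

lemma breakTime_succ {p : ℝ → ℝ} {n : ℕ} {a : ℝ} (h : breakTime p n = a) :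
    breakTime p (n + 1) = nextBreak p a := by
  rw [breakTime, h, if_neg (EReal.coe_ne_top a), EReal.toReal_coe]

lemma breakTime_succ_of_top {p : ℝ → ℝ} {n : ℕ} (h : breakTime p n = ⊤) :
    breakTime p (n + 1) = ⊤ := by
  rw [breakTime, if_pos h]

lemma breakTime_eq_top_of_le {p : ℝ → ℝ} {m n : ℕ} (hmn : m ≤ n) (h : breakTime p m = ⊤) :
    breakTime p n = ⊤ := by
  induction n, hmn using Nat.le_induction with
  | base => exact h
  | succ n _ ih => exact breakTime_succ_of_top ih

lemma nextBreak_congr {p p' : ℝ → ℝ} {a : ℝ} (h : ∀ t, a < t → (0 < p t ↔ 0 < p' t))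
    (h0 : ∀ t, a < t → (p t = 0 ↔ p' t = 0)) : nextBreak p a = nextBreak p' a := by
  have e1 : (∃ t, a < t ∧ (∀ s ∈ Ioo a t, 0 < p s) ∧ p t = 0) ↔
      ∃ t, a < t ∧ (∀ s ∈ Ioo a t, 0 < p' s) ∧ p' t = 0 := by
    refine exists_congr fun t => and_congr_right fun ht => ?_
    rw [h0 t ht]
    exact and_congr_left fun _ => forall₂_congr fun s hs => h s hs.1
  have e2 : {t | a < t ∧ ∀ s ∈ Ioo a t, 0 < p s} = {t | a < t ∧ ∀ s ∈ Ioo a t, 0 < p' s} := by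
    ext t
    exact and_congr_right fun _ => forall₂_congr fun s hs => h s hs.1
  classical
  unfold nextBreak
  rw [e2]
  exact if_congr e1 rfl rfl

lemma le_nextBreak {p : ℝ → ℝ} {a : ℝ} : (a : EReal) ≤ nextBreak p a := by
  unfold nextBreak
  split_ifs with h
  · obtain ⟨t, h1, h2, h3⟩ := h
    have hset : BddAbove {t | a < t ∧ ∀ s ∈ Ioo a t, 0 < p s} := ⟨t, fun x ⟨_, hx⟩ => by
      by_contra hlt
      exact (hx t ⟨h1, not_le.1 hlt⟩).ne' h3⟩
    exact_mod_cast h1.le.trans (le_csSup hset ⟨h1, h2⟩)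
  · exact le_top

lemma breakTime_nonneg (p : ℝ → ℝ) (n : ℕ) : 0 ≤ breakTime p n := by
  induction n with
  | zero => simp [breakTime]
  | succ n ih =>
    rw [breakTime]
    split_ifs with h
    · exact le_top
    · refine le_trans ?_ le_nextBreak
      exact_mod_cast EReal.toReal_nonneg ih

/-- Breaking times only depend on the sign of `p` at positive times. -/
lemma breakTime_congr {p p' : ℝ → ℝ} (h : ∀ t, 0 < t → (0 < p t ↔ 0 < p' t))
    (h0 : ∀ t, 0 < t → (p t = 0 ↔ p' t = 0)) (n : ℕ) : breakTime p n = breakTime p' n := by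
  induction n with
  | zero => rfl
  | succ n ih =>
    have hn := EReal.toReal_nonneg (breakTime_nonneg p n)
    rw [breakTime, breakTime, ← ih,
      nextBreak_congr (fun t ht => h t (hn.trans_lt ht)) (fun t ht => h0 t (hn.trans_lt ht))]

/-- Breaking times of a function that vanishes when an angle reaches a multiple of `π`. -/
lemma breakTime_of_angle {p θ : ℝ → ℝ} (hθ : ContinuousOn θ (Ici 0)) (h0 : 0 ≤ θ 0)
    (hcross : ∀ r, 0 ≤ r → ∀ r', r < r' → ∀ k : ℕ, k * Real.pi ≤ θ r → k * Real.pi < θ r')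
    {B : ℕ∞}
    (hpos : ∀ t, 0 < t → (∀ k : ℕ, θ t ≠ k * Real.pi) →
      (⌊θ t / Real.pi⌋₊ : ℕ∞) < B → 0 < p t)
    (hzero : ∀ t, 0 < t → ∀ k : ℕ, θ t = k * Real.pi → p t = 0) (n : ℕ)
    (hB : ((⌊θ 0 / Real.pi⌋₊ + n : ℕ) : ℕ∞) ≤ B) :
    (breakTime p n = ⊤ ∧ ∀ t, 0 ≤ t → θ t < (⌊θ 0 / Real.pi⌋₊ + n : ℕ) * Real.pi) ∨
    ∃ a : ℝ, 0 ≤ a ∧ breakTime p n = a ∧ (∀ t, 0 ≤ t → t < a →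
        θ t < (⌊θ 0 / Real.pi⌋₊ + n : ℕ) * Real.pi) ∧
      (⌊θ 0 / Real.pi⌋₊ + n : ℕ) * Real.pi ≤ θ a ∧ (0 < n → 0 < a) ∧
      θ a < (⌊θ 0 / Real.pi⌋₊ + n + 1 : ℕ) * Real.pi := by
  set m := ⌊θ 0 / Real.pi⌋₊ with hm
  have hpi := Real.pi_pos
  induction n with
  | zero =>
    refine Or.inr ⟨0, le_rfl, breakTime_zero p, fun t h1 h2 => absurd h2 (not_lt.2 h1), ?_,
      fun h => absurd h (lt_irrefl 0), ?_⟩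
    · have := Nat.floor_le (div_nonneg h0 hpi.le)
      rw [le_div_iff₀ hpi] at this
      simpa using this
    · have := Nat.lt_floor_add_one (θ 0 / Real.pi)
      rw [div_lt_iff₀ hpi] at this
      push_cast; simpa using this
  | succ n ih =>
    have hB' : ((m + n : ℕ) : ℕ∞) < B := lt_of_lt_of_le (by exact_mod_cast (by omega)) hB
    rcases ih hB'.le with ⟨h1, h2⟩ | ⟨a, ha0, hba, hlt, hle, -, hlt'⟩
    · exact Or.inl ⟨breakTime_succ_of_top h1, fun t ht => (h2 t ht).trans_le (by gcongr; omega)⟩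
    have hposa : ∀ t, a < t → θ t < (m + n + 1 : ℕ) * Real.pi → 0 < p t := fun t ht hlt => by
      have h3 := hcross a ha0 t ht _ hle
      have hfl : ⌊θ t / Real.pi⌋₊ = m + n := floor_div_pi_eq h3.le (by push_cast at hlt ⊢; linarith)
      refine hpos t (ha0.trans_lt ht) (fun k hk => ?_) (by rw [hfl]; exact hB')
      rw [hk] at h3 hlt
      have a1 : ((m + n : ℕ) : ℝ) < k := lt_of_mul_lt_mul_right h3 hpi.le
      have a2 : (k : ℝ) < ((m + n + 1 : ℕ) : ℝ) := lt_of_mul_lt_mul_right hlt hpi.le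
      have b1 : m + n < k := by exact_mod_cast a1
      have b2 : k < m + n + 1 := by exact_mod_cast a2
      omega
    by_cases hex : ∃ t, 0 ≤ t ∧ (m + n + 1 : ℕ) * Real.pi ≤ θ t
    · obtain ⟨t, ht0, ht⟩ := hex
      have hat : a < t := by
        by_contra hta
        rcases (not_lt.1 hta).eq_or_lt with rfl | h
        · linarith
        · have := hlt t ht0 h
          have : ((m + n : ℕ) : ℝ) * Real.pi ≤ (m + n + 1 : ℕ) * Real.pi :=
            mul_le_mul_of_nonneg_right (by exact_mod_cast (by omega)) hpi.le
          linarith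
      have hcont : ContinuousOn θ (Icc a t) := hθ.mono fun x hx => ha0.trans hx.1
      obtain ⟨b, hb, hbe⟩ := intermediate_value_Icc hat.le hcont
        (show ((m + n + 1 : ℕ) : ℝ) * Real.pi ∈ Icc (θ a) (θ t) from ⟨hlt'.le, ht⟩)
      have hab : a < b := by
        rcases hb.1.eq_or_lt with rfl | h
        · linarith
        · exact h
      have hbefore : ∀ s, 0 ≤ s → s < b → θ s < (m + n + 1 : ℕ) * Real.pi := fun s hs hsb => by
        by_contra hcon
        have := hcross s hs b hsb _ (not_lt.1 hcon)
        linarith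
      refine Or.inr ⟨b, ha0.trans hab.le, ?_, hbefore, hbe.ge, fun _ => ha0.trans_lt hab, ?_⟩
      · rw [breakTime_succ hba]
        exact nextBreak_eq_of_pos hab (fun s hs => hposa s hs.1 (hbefore s (ha0.trans hs.1.le) hs.2))
          (hzero b (ha0.trans_lt hab) _ hbe)
      · rw [hbe]
        gcongr
        omega
    · push Not at hex
      refine Or.inl ⟨?_, hex⟩
      rw [breakTime_succ hba]
      exact nextBreak_eq_top_of_pos fun t ht => hposa t ht (hex t (ha0.trans ht.le))

/-! ### The evolution at one label -/

lemma IsPrimitiveOn.shift {f f' : ℝ → ℝ} {s T : ℝ} (h : IsPrimitiveOn f f' 0 (s + T)) (hs : 0 ≤ s)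
    (hT : 0 ≤ T) : IsPrimitiveOn (fun t => f (s + t)) (fun t => f' (s + t)) 0 T := by
  have h1 := h.mono (c := s) (d := s + T) (by rw [uIcc_of_le (by linarith)]; exact ⟨hs, by linarith⟩)
    (by simp)
  refine ⟨?_, fun t ht => ?_⟩
  · have := h1.1.comp_add_left s
    simpa using this
  · rw [uIcc_of_le hT] at ht
    beta_reduce
    rw [h1.2 (s + t) (by rw [uIcc_of_le (by linarith)]; exact ⟨by linarith [ht.1], by linarith [ht.2]⟩),
      intervalIntegral.integral_comp_add_left (fun x => f' x) s]
    simp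

/-- The angle variables at one label solve the system for a given coefficient `a = U² - P`. -/
structure LabelFlow (N β : Fin 2 → ℝ) (a : ℝ → ℝ) (θ κ : ℝ → Fin 2 → ℝ) : Prop where
  N_nonneg : ∀ i, 0 ≤ N i
  beta : ∀ i, β i ∈ Icc (0 : ℝ) 1
  meas_a : ∀ T, AEMeasurable a (volume.restrict (Ioc 0 T))
  bound_a : ∀ T, ∃ A, ∀ t ∈ Icc 0 T, |a t| ≤ A
  θ_prim : ∀ T, 0 ≤ T → ∀ i, IsPrimitiveOn (fun t => θ t i) (fun t => angF (a t) (θ t i)) 0 T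
  κ_prim : ∀ T, 0 ≤ T → ∀ i, IsPrimitiveOn (fun t => κ t i) (fun t => angG (a t) (θ t i)) 0 T
  θ_nonneg : ∀ i, 0 ≤ θ 0 i

namespace LabelFlow

variable {N β : Fin 2 → ℝ} {a : ℝ → ℝ} {θ κ : ℝ → Fin 2 → ℝ} (h : LabelFlow N β a θ κ)

lemma mem_uIcc {s t T : ℝ} (hs : 0 ≤ s) (hst : s ≤ t) (ht : t ≤ T) :
    s ∈ uIcc 0 T ∧ t ∈ uIcc 0 T := by
  rw [uIcc_of_le (hs.trans (hst.trans ht))]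
  exact ⟨⟨hs, hst.trans ht⟩, ⟨hs.trans hst, ht⟩⟩

include h

lemma cross (i : Fin 2) {r r' : ℝ} (hr : 0 ≤ r) (hrr : r < r') {k : ℕ} (hk : k * Real.pi ≤ θ r i) :
    k * Real.pi < θ r' i := by
  obtain ⟨A, hA⟩ := h.bound_a r'
  exact angle_lt_of_le' (h.θ_prim r' (hr.trans hrr.le) i) hA ⟨hr, hrr.le⟩ ⟨hr.trans hrr.le, le_rfl⟩
    hrr hk

lemma θ_pos (i : Fin 2) {t : ℝ} (ht : 0 < t) : 0 < θ t i := by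
  have := h.cross i le_rfl ht (k := 0) (by simpa using h.θ_nonneg i)
  simpa using this

lemma continuousOn_θ (i : Fin 2) : ContinuousOn (fun t => θ t i) (Ici 0) := by
  intro t ht
  have h1 := (h.θ_prim (t + 1) (by linarith [mem_Ici.1 ht]) i).continuousOn
  rw [uIcc_of_le (by linarith [mem_Ici.1 ht])] at h1
  refine (h1 t ⟨ht, by linarith⟩).mono_of_mem_nhdsWithin ?_
  exact Filter.mem_of_superset (inter_mem_nhdsWithin _ (Iio_mem_nhds (show t < t + 1 by linarith)))
    fun x hx => ⟨hx.1, hx.2.le⟩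

lemma continuousOn_κ (i : Fin 2) : ContinuousOn (fun t => κ t i) (Ici 0) := by
  intro t ht
  have h1 := (h.κ_prim (t + 1) (by linarith [mem_Ici.1 ht]) i).continuousOn
  rw [uIcc_of_le (by linarith [mem_Ici.1 ht])] at h1
  refine (h1 t ⟨ht, by linarith⟩).mono_of_mem_nhdsWithin ?_
  exact Filter.mem_of_superset (inter_mem_nhdsWithin _ (Iio_mem_nhds (show t < t + 1 by linarith)))
    fun x hx => ⟨hx.1, hx.2.le⟩

lemma shift {s : ℝ} (hs : 0 ≤ s) : LabelFlow N β (fun t => a (s + t)) (fun t => θ (s + t))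
    fun t => κ (s + t) := by
  refine ⟨h.N_nonneg, h.beta, fun T => ?_, fun T => ?_, fun T hT i => ?_, fun T hT i => ?_, fun i => ?_⟩
  · have h1 : AEMeasurable a (volume.restrict (Ioc s (s + T))) :=
      (h.meas_a (s + T)).mono_measure (Measure.restrict_mono (Ioc_subset_Ioc_left hs) le_rfl)
    have h2 : MeasurePreserving (fun t => s + t) (volume.restrict (Ioc 0 T))
        (volume.restrict (Ioc s (s + T))) := by
      have := (measurePreserving_add_left volume s).restrict_preimage
        (measurableSet_Ioc (a := s) (b := s + T))
      simpa using this
    exact AEMeasurable.comp_quasiMeasurePreserving h1 h2.quasiMeasurePreserving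
  · obtain ⟨A, hA⟩ := h.bound_a (s + T)
    exact ⟨A, fun t ht => hA _ ⟨by linarith [ht.1], by linarith [ht.2]⟩⟩
  · exact (h.θ_prim (s + T) (by linarith) i).shift hs hT
  · exact (h.κ_prim (s + T) (by linarith) i).shift hs hT
  · rcases hs.eq_or_lt with rfl | hs
    · simpa using h.θ_nonneg i
    · simpa using (h.θ_pos i hs).le

lemma isPrimitiveOn_q {T : ℝ} (hT : 0 ≤ T) : IsPrimitiveOn (fun t => labQ N β (θ t) (κ t))
    (fun t => labW N β (θ t) (κ t)) 0 T := by
  obtain ⟨A, hA⟩ := h.bound_a T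
  exact IsPrimitiveOn.sum Finset.univ fun i _ => (isPrimitiveOn_angQ hT (h.θ_prim T hT i)
    (h.κ_prim T hT i) hA (h.beta i)).const_mul _

lemma isPrimitiveOn_w {T : ℝ} (hT : 0 ≤ T) : IsPrimitiveOn (fun t => labW N β (θ t) (κ t))
    (fun t => 1 / 2 * labH N β (θ t) (κ t) + a t * labQ N β (θ t) (κ t)) 0 T := by
  obtain ⟨A, hA⟩ := h.bound_a T
  refine (IsPrimitiveOn.sum Finset.univ fun i _ => (isPrimitiveOn_angW hT (h.θ_prim T hT i)
    (h.κ_prim T hT i) hA (h.beta i)).const_mul (N i)).congr_deriv (.of_forall fun t _ => ?_)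
  simp only [labH, labQ, Fin.sum_univ_two]
  ring

lemma isPrimitiveOn_hb {s t : ℝ} (hs : 0 ≤ s) (hst : s ≤ t)
    (hc : ∀ i, N i = 0 ∨ ∃ k, ∀ r ∈ Icc s t, crossFactor (β i) (θ r i) = k) :
    IsPrimitiveOn (fun t => labH N β (θ t) (κ t)) (fun t => 2 * a t * labW N β (θ t) (κ t)) s t := by
  have hm := mem_uIcc hs hst le_rfl
  refine (IsPrimitiveOn.sum (F := fun i t => N i * angH (β i) (θ t i) (κ t i))
    (F' := fun i t => N i * (2 * (a t * angW (β i) (θ t i) (κ t i)))) Finset.univ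
    fun i _ => ?_).congr_deriv (.of_forall fun r _ => ?_)
  · rcases hc i with h0 | ⟨k, hk⟩
    · simpa [h0] using IsPrimitiveOn.const 0
    · rw [← uIcc_of_le hst] at hk
      exact (isPrimitiveOn_angH ((h.θ_prim t (hs.trans hst) i).mono hm.1 hm.2)
        ((h.κ_prim t (hs.trans hst) i).mono hm.1 hm.2) hk).const_mul _
  · simp only [labW, Fin.sum_univ_two]
    ring

lemma q_nonneg (t : ℝ) : 0 ≤ labQ N β (θ t) (κ t) :=
  Finset.sum_nonneg fun i _ => mul_nonneg (h.N_nonneg i) (angQ_nonneg (h.beta i))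

end LabelFlow

/-- The weights and jump factors that belong to the value `r` of the density. -/
structure LabelNormal (α r : ℝ) (N β θ κ : Fin 2 → ℝ) : Prop where
  zero : r = 0 → N 1 = 0 ∧ β 0 = 1 - α
  ne_zero : r ≠ 0 → β 0 = 1 ∧ β 1 = 1 ∧ labQ N β θ κ * labH N β θ κ = labW N β θ κ ^ 2 + r ^ 2

namespace LabelFlow

variable {α r : ℝ} {N β : Fin 2 → ℝ} {a : ℝ → ℝ} {θ κ : ℝ → Fin 2 → ℝ} (h : LabelFlow N β a θ κ)
  (hn : LabelNormal α r N β (θ 0) (κ 0))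
include h hn

lemma normal {t : ℝ} (ht : 0 ≤ t) : LabelNormal α r N β (θ t) (κ t) := by
  refine ⟨hn.zero, fun hr => ?_⟩
  obtain ⟨h0, h1, h2⟩ := hn.ne_zero hr
  refine ⟨h0, h1, ?_⟩
  have hβ : ∀ i, β i = 1 := fun i => by fin_cases i <;> simp [h0, h1]
  have hH := h.isPrimitiveOn_hb le_rfl ht fun i => Or.inr ⟨1, fun r _ => by
    rw [hβ i, crossFactor_one]⟩
  have hW := h.isPrimitiveOn_w ht
  have hc := (((h.isPrimitiveOn_q ht).mul hH).sub (hW.mul hW)).congr_deriv (g' := fun _ => 0)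
    (.of_forall fun s _ => by ring)
  have := hc.eq_add
  simp only [intervalIntegral.integral_zero, add_zero] at this
  nlinarith

lemma relation {t : ℝ} (ht : 0 ≤ t) : labQ N β (θ t) (κ t) * labH N β (θ t) (κ t) =
    labW N β (θ t) (κ t) ^ 2 + r ^ 2 := by
  by_cases hr : r = 0
  · obtain ⟨h1, -⟩ := hn.zero hr
    simp only [labQ, labH, labW, Fin.sum_univ_two, h1, zero_mul, add_zero, mul_pow, angW_sq, hr]
    ring
  · exact ((h.normal hn ht).ne_zero hr).2.2

lemma q_pos {t : ℝ} (ht : 0 ≤ t) (hr : r ≠ 0) : 0 < labQ N β (θ t) (κ t) := by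
  have h1 := h.relation hn ht
  have h2 : 0 < r ^ 2 := by positivity
  rcases (h.q_nonneg t).eq_or_lt with h3 | h3
  · rw [← h3] at h1; nlinarith [sq_nonneg (labW N β (θ t) (κ t))]
  · exact h3

end LabelFlow

/-- The number of breaking times between the initial state and the state `θ`. -/
def crossCount (r : ℝ) (N β θ₀ θ : Fin 2 → ℝ) : ℕ :=
  if r = 0 ∧ N 0 ≠ 0 then
    if β 0 = 0 then min ⌊θ 0 / Real.pi⌋₊ 1 - min ⌊θ₀ 0 / Real.pi⌋₊ 1
    else ⌊θ 0 / Real.pi⌋₊ - ⌊θ₀ 0 / Real.pi⌋₊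
  else 0

/-- Description of the breaking times at a label. -/
structure BreakInfo (r : ℝ) (N β : Fin 2 → ℝ) (θ : ℝ → Fin 2 → ℝ) (p : ℝ → ℝ) : Prop where
  le_iff : ∀ (n : ℕ) (t : ℝ), 1 ≤ n → 0 ≤ t → (breakTime p n ≤ (t : EReal) ↔ n ≤ crossCount r N β (θ 0) (θ t))
  const : ∀ (n : ℕ) (a t : ℝ), breakTime p n = a → a ≤ t → (t : EReal) < breakTime p (n + 1) →
    ∀ i, N i = 0 ∨ ∃ k, ∀ x ∈ Icc a t, crossFactor (β i) (θ x i) = k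
  jump : ∀ (n : ℕ) (a : ℝ), breakTime p (n + 1) = a → 0 < a ∧ r = 0 ∧ ∃ k,
    (∀ᶠ x in 𝓝[<] a, crossFactor (β 0) (θ x 0) = k) ∧ crossFactor (β 0) (θ a 0) = β 0 * k

/-- There is no breaking at a label if `breakTime p 1 = ⊤`. -/
lemma BreakInfo.of_top {r : ℝ} {N β : Fin 2 → ℝ} {θ : ℝ → Fin 2 → ℝ} {p : ℝ → ℝ}
    (htop : breakTime p 1 = ⊤) (hcount : ∀ t, 0 ≤ t → crossCount r N β (θ 0) (θ t) = 0)
    (hconst : ∀ i, N i = 0 ∨ ∃ k, ∀ x, 0 ≤ x → crossFactor (β i) (θ x i) = k) :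
    BreakInfo r N β θ p := by
  have ht : ∀ n, 1 ≤ n → breakTime p n = ⊤ := fun n hn => breakTime_eq_top_of_le hn htop
  refine ⟨fun n t hn h0 => ?_, fun n a t ha hat _ i => ?_, fun n a ha => ?_⟩
  · rw [ht n hn, hcount t h0]
    simp; omega
  · have ha0 : 0 ≤ a := by
      have := breakTime_nonneg p n
      rw [ha] at this; exact_mod_cast this
    rcases hconst i with h | ⟨k, hk⟩
    · exact Or.inl h
    · exact Or.inr ⟨k, fun x hx => hk x (ha0.trans hx.1)⟩
  · rw [ht (n + 1) (by omega)] at ha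
    exact absurd ha.symm (EReal.coe_ne_top a)

section BreakInfo

variable {α r : ℝ} {N β : Fin 2 → ℝ} {a : ℝ → ℝ} {θ κ : ℝ → Fin 2 → ℝ} (h : LabelFlow N β a θ κ)
include h

lemma LabelFlow.le_floor_iff (i : Fin 2) {t : ℝ} {k : ℕ} (ht : 0 ≤ t) :
    k * Real.pi ≤ θ t i ↔ k ≤ ⌊θ t i / Real.pi⌋₊ := by
  have h0 : 0 ≤ θ t i := by
    rcases ht.eq_or_lt with rfl | h1
    · exact h.θ_nonneg i
    · exact (h.θ_pos i h1).le
  rw [Nat.le_floor_iff (div_nonneg h0 Real.pi_pos.le), le_div_iff₀ Real.pi_pos]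

lemma LabelFlow.floor_mono (i : Fin 2) {s t : ℝ} (hs : 0 ≤ s) (hst : s ≤ t) :
    ⌊θ s i / Real.pi⌋₊ ≤ ⌊θ t i / Real.pi⌋₊ := by
  rcases hst.eq_or_lt with rfl | h1
  · exact le_rfl
  · rw [← h.le_floor_iff i (hs.trans hst)]
    exact (h.cross i hs h1 ((h.le_floor_iff i hs).2 le_rfl)).le

/-- Breaking times at a label where only one component is present. -/
lemma LabelFlow.breakInfo_of_single (hr : r = 0) (hN1 : N 1 = 0) (hN0 : N 0 ≠ 0) :
    BreakInfo r N β θ fun t => labQ N β (θ t) (κ t) := by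
  set p : ℝ → ℝ := fun t => labQ N β (θ t) (κ t) with hp
  have hpi := Real.pi_pos
  have hN : 0 < N 0 := lt_of_le_of_ne (h.N_nonneg 0) hN0.symm
  have hpe : ∀ t, p t = N 0 * angQ (β 0) (θ t 0) (κ t 0) := fun t => by
    simp [hp, labQ, Fin.sum_univ_two, hN1]
  set B : ℕ∞ := if β 0 = 0 then 1 else ⊤ with hB
  have hcross : ∀ x, 0 ≤ x → ∀ x', x < x' → ∀ k : ℕ, k * Real.pi ≤ θ x 0 → k * Real.pi < θ x' 0 :=
    fun x hx x' hxx k => h.cross 0 hx hxx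
  have hpos : ∀ t, 0 < t → (∀ k : ℕ, θ t 0 ≠ k * Real.pi) → (⌊θ t 0 / Real.pi⌋₊ : ℕ∞) < B →
      0 < p t := fun t ht hne hlt => by
    rw [hpe]
    refine mul_pos hN (mul_pos (Real.exp_pos _) (mul_pos ?_ ?_))
    · by_cases hβ : β 0 = 0
      · rw [hB, if_pos hβ] at hlt
        have : ⌊θ t 0 / Real.pi⌋₊ = 0 := by
          have : ⌊θ t 0 / Real.pi⌋₊ < 1 := by exact_mod_cast hlt
          omega
        simp [crossFactor, this]
      · exact pow_pos (lt_of_le_of_ne (h.beta 0).1 (Ne.symm hβ)) _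
    · have : Real.sin (θ t 0) ≠ 0 := fun hs => by
        obtain ⟨k, hk⟩ := Real.sin_eq_zero_iff.1 hs
        have h1 := h.θ_pos 0 ht
        rw [← hk] at h1
        have h2 : (0 : ℝ) < k := by
          by_contra hcon
          nlinarith [not_lt.1 hcon]
        have h3 : 0 ≤ k := by exact_mod_cast h2.le
        refine hne k.toNat ?_
        rw [← hk]
        congr 1
        exact_mod_cast (Int.toNat_of_nonneg h3).symm
      positivity
  have hzero : ∀ t, 0 < t → ∀ k : ℕ, θ t 0 = k * Real.pi → p t = 0 := fun t _ k hk => by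
    rw [hpe, hk]; simp [angQ]
  have hzero' : β 0 = 0 → ∀ s, 0 ≤ s → 1 ≤ ⌊θ s 0 / Real.pi⌋₊ → ∀ t, s < t → p t = 0 := by
    intro hβ s hs h1 t hst
    have := h.floor_mono 0 hs hst.le
    rw [hpe, angQ, crossFactor, hβ, zero_pow (by omega)]
    simp
  have hbt := fun n hn => breakTime_of_angle (p := p) (h.continuousOn_θ 0) (h.θ_nonneg 0) hcross hpos hzero
    (B := B) n hn
  set m := ⌊θ 0 0 / Real.pi⌋₊ with hm
  have htop : ∀ n, 1 ≤ n → ¬ ((m + n : ℕ) : ℕ∞) ≤ B → β 0 = 0 ∧ breakTime p n = ⊤ := by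
    intro n hn hnB
    have hβ : β 0 = 0 := by
      by_contra hne
      rw [hB, if_neg hne] at hnB
      exact hnB le_top
    refine ⟨hβ, ?_⟩
    rw [hB, if_pos hβ] at hnB hbt
    have hmn : 1 < m + n := by
      have : ¬ (m + n ≤ 1) := fun hle => hnB (by exact_mod_cast hle)
      omega
    by_cases hm0 : 1 ≤ m
    · refine breakTime_eq_top_of_le hn ?_
      rw [breakTime_succ (breakTime_zero p)]
      exact nextBreak_eq_top_of_zero (hzero' hβ 0 le_rfl hm0)
    · have hm1 : m = 0 := by omega
      have h2 : breakTime p 2 = ⊤ := by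
        rcases hbt 1 (by rw [hm1]; norm_num) with ⟨e, -⟩ | ⟨b, hb0, hb, -, hle, -⟩
        · exact breakTime_succ_of_top e
        · rw [breakTime_succ hb]
          refine nextBreak_eq_top_of_zero (hzero' hβ b hb0 ?_)
          have := (h.le_floor_iff 0 hb0).1 hle
          omega
      exact breakTime_eq_top_of_le (by omega) h2
  have hbn : ∀ (n : ℕ) (t : ℝ), 0 ≤ t → ((m + n : ℕ) : ℕ∞) ≤ B →
      (breakTime p n ≤ (t : EReal) ↔ m + n ≤ ⌊θ t 0 / Real.pi⌋₊) := by
    intro n t ht hnB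
    rw [← h.le_floor_iff 0 ht]
    rcases hbt n hnB with ⟨e, hlt⟩ | ⟨b, hb0, hb, hlt, hle, -⟩
    · rw [e]
      simpa using hlt t ht
    · rw [hb, EReal.coe_le_coe_iff]
      refine ⟨fun hbt => ?_, fun hge => ?_⟩
      · rcases hbt.eq_or_lt with rfl | hbt
        · exact hle
        · exact (hcross b hb0 t hbt _ hle).le
      · by_contra hcon
        exact absurd hge (not_le.2 (hlt t ht (not_le.1 hcon)))
  refine ⟨fun n t hn ht => ?_, fun n b t hb hbtt hlt i => ?_, fun n b hb => ?_⟩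
  · have hfm := h.floor_mono 0 le_rfl ht
    unfold crossCount
    rw [if_pos ⟨hr, hN0⟩]
    by_cases hnB : ((m + n : ℕ) : ℕ∞) ≤ B
    · rw [hbn n t ht hnB]
      split_ifs with hβ
      · rw [hB, if_pos hβ] at hnB
        have : m + n ≤ 1 := by exact_mod_cast hnB
        omega
      · omega
    · obtain ⟨hβ, e⟩ := htop n hn hnB
      rw [hB, if_pos hβ] at hnB
      have hmn : ¬ (m + n ≤ 1) := fun hle => hnB (by exact_mod_cast hle)
      rw [e, if_pos hβ]
      simp only [top_le_iff, EReal.coe_ne_top, false_iff, not_le]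
      omega
  · have hb0 : 0 ≤ b := by
      have := breakTime_nonneg p n
      rw [hb] at this; exact_mod_cast this
    revert i
    refine Fin.forall_fin_two.2 ⟨Or.inr ?_, Or.inl hN1⟩
    have hlow : ((m + n : ℕ) : ℕ∞) ≤ B → ∀ x ∈ Icc b t, m + n ≤ ⌊θ x 0 / Real.pi⌋₊ :=
      fun hnB x hx => (hbn n x (hb0.trans hx.1) hnB).1 (by rw [hb]; exact_mod_cast hx.1)
    by_cases hnB : ((m + (n + 1) : ℕ) : ℕ∞) ≤ B
    · refine ⟨β 0 ^ (m + n), fun x hx => ?_⟩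
      have h1 := hlow (le_trans (by exact_mod_cast (by omega)) hnB) x hx
      have h2 : ¬ (m + (n + 1) ≤ ⌊θ x 0 / Real.pi⌋₊) := by
        rw [← hbn (n + 1) x (hb0.trans hx.1) hnB, not_le]
        exact lt_of_le_of_lt (by exact_mod_cast hx.2) hlt
      have h3 : ⌊θ x 0 / Real.pi⌋₊ = m + n := by omega
      rw [crossFactor, h3]
    · obtain ⟨hβ, -⟩ := htop (n + 1) (by omega) hnB
      refine ⟨0, fun x hx => ?_⟩
      have hB1 : B = 1 := by rw [hB, if_pos hβ]
      have hmn : ¬ (m + (n + 1) ≤ 1) := fun hle => hnB (by rw [hB1]; exact_mod_cast hle)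
      have h1 : 1 ≤ ⌊θ x 0 / Real.pi⌋₊ := by
        by_cases hn1 : m + n ≤ 1
        · have := hlow (by rw [hB1]; exact_mod_cast hn1) x hx
          omega
        · rcases Nat.eq_zero_or_pos n with hn0 | hn0
          · have := h.floor_mono 0 le_rfl (hb0.trans hx.1)
            omega
          · have := (htop n hn0 (by rw [hB1]; exact_mod_cast hn1)).2
            rw [hb] at this
            exact absurd this (EReal.coe_ne_top b)
      rw [crossFactor, hβ, zero_pow (by omega)]
  · have hnB : ((m + (n + 1) : ℕ) : ℕ∞) ≤ B := by
      by_contra hcon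
      have := (htop (n + 1) (by omega) hcon).2
      rw [hb] at this
      exact absurd this (EReal.coe_ne_top b)
    rcases hbt (n + 1) hnB with ⟨e, -⟩ | ⟨b', hb0, hb', hlt, hle, hbpos, hlt'⟩
    · rw [hb] at e; exact absurd e (EReal.coe_ne_top b)
    rw [hb, EReal.coe_eq_coe_iff] at hb'
    subst hb'
    have hb1 := hbpos (by omega)
    refine ⟨hb1, hr, β 0 ^ (m + n), ?_, ?_⟩
    · have hc : Tendsto (fun x => θ x 0) (𝓝[<] b) (𝓝 (θ b 0)) := by
        have h1 : ContinuousAt (fun x => θ x 0) b := (h.continuousOn_θ 0).continuousAt (Ici_mem_nhds hb1)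
        exact h1.tendsto.mono_left nhdsWithin_le_nhds
      have hgt : ((m + n : ℕ) : ℝ) * Real.pi < θ b 0 := by
        refine lt_of_lt_of_le ?_ hle
        push_cast
        nlinarith
      filter_upwards [hc.eventually (lt_mem_nhds hgt), self_mem_nhdsWithin,
        (lt_mem_nhds hb1).filter_mono nhdsWithin_le_nhds] with x h1 h2 h3
      have h4 := hlt x h3.le h2
      rw [crossFactor, floor_div_pi_eq h1.le (by push_cast at h4 ⊢; linarith)]
    · rw [crossFactor, floor_div_pi_eq (n := m + (n + 1)) hle (by push_cast at hlt' ⊢; linarith),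
        ← pow_succ', add_assoc]

lemma LabelFlow.breakInfo (hn : LabelNormal α r N β (θ 0) (κ 0)) :
    BreakInfo r N β θ fun t => labQ N β (θ t) (κ t) := by
  by_cases hr : r = 0
  · obtain ⟨hN1, -⟩ := hn.zero hr
    by_cases hN0 : N 0 = 0
    · have hN : ∀ i, N i = 0 := Fin.forall_fin_two.2 ⟨hN0, hN1⟩
      refine BreakInfo.of_top ?_ (fun t _ => by simp [crossCount, hN0]) fun i => Or.inl (hN i)
      rw [breakTime_succ (breakTime_zero _)]
      exact nextBreak_eq_top_of_zero fun t _ => by simp [labQ, hN]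
    · exact h.breakInfo_of_single hr hN1 hN0
  · obtain ⟨h0, h1, -⟩ := hn.ne_zero hr
    have hβ : ∀ i, β i = 1 := Fin.forall_fin_two.2 ⟨h0, h1⟩
    refine BreakInfo.of_top ?_ (fun t _ => by simp [crossCount, hr]) fun i =>
      Or.inr ⟨1, fun x _ => by rw [hβ, crossFactor_one]⟩
    rw [breakTime_succ (breakTime_zero _)]
    exact nextBreak_eq_top_of_pos fun t ht => h.q_pos hn ht.le hr

omit h in
lemma BreakInfo.tendsto {p : ℝ → ℝ} (hb : BreakInfo r N β θ p) : Tendsto (breakTime p) atTop (𝓝 ⊤) := by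
  rw [EReal.tendsto_nhds_top_iff_real]
  intro x
  have h0 : 0 ≤ max x 0 := le_max_right _ _
  filter_upwards [eventually_gt_atTop (max 1 (crossCount r N β (θ 0) (θ (max x 0))))] with n hn
  have h1 : ¬ breakTime p n ≤ ((max x 0 : ℝ) : EReal) := by
    rw [hb.le_iff n _ (by omega) h0]; omega
  exact lt_of_le_of_lt (by exact_mod_cast le_max_left x 0) (not_le.1 h1)

end BreakInfo

/-! ### The dissipative solution that belongs to a flow -/

open Classical in
/-- The class of an almost everywhere strongly measurable function. -/
def toClass (f : ℝ → ℝ) : ℝ →ₘ[volume] ℝ :=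
  if h : AEStronglyMeasurable f volume then AEEqFun.mk f h else 0

lemma toClass_ae {f : ℝ → ℝ} (h : AEStronglyMeasurable f volume) : toClass f =ᵐ[volume] f := by
  rw [toClass, dif_pos h]
  exact AEEqFun.coeFn_mk f h

/-- The density `h` along a flow. -/
def densPath (c : Weights) (X : ℝ → AngState) (h₀ : ℝ → ℝ) (t ξ : ℝ) : ℝ :=
  h₀ ξ + ∫ r in (0 : ℝ)..t, 2 * c.a (X r) ξ * c.w (X r) ξ

/-- The positions along a flow. -/
def posPath (X : ℝ → AngState) (y₀ : ℝ → ℝ) (t ξ : ℝ) : ℝ := y₀ ξ + ∫ r in (0 : ℝ)..t, (X r).U ξ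

/-- The tuple of Lagrangian coordinates along a flow. -/
def flowState (c : Weights) (X : ℝ → AngState) (y₀ h₀ r₀ : ℝ → ℝ) (t : ℝ) : LagState where
  y := posPath X y₀ t
  U := (X t).U
  q := toClass (c.q (X t))
  w := toClass (c.w (X t))
  hb := toClass (c.hb (X t))
  h := toClass (densPath c X h₀ t)
  r := toClass r₀

/-- A flow together with initial values of `y`, `h` and `r`. -/
structure FlowData (α : ℝ) (c : Weights) (X : ℝ → AngState) (y₀ h₀ r₀ : ℝ → ℝ) : Prop where
  flow : IsFlow c X
  cons : ∀ a b, (X 0).U b - (X 0).U a = ∫ x in a..b, c.w (X 0) x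
  y_cons : ∀ a b, y₀ b - y₀ a = ∫ x in a..b, c.q (X 0) x
  y_bdd : ∃ C, ∀ ξ, |y₀ ξ - ξ| ≤ C
  y_lim : Tendsto (fun ξ => y₀ ξ - ξ) atBot (𝓝 0)
  q_mem : MemE fun ξ => c.q (X 0) ξ - 1
  h_meas : Measurable h₀
  h_integrable : Integrable h₀
  h_bdd : ∃ C, ∀ ξ, |h₀ ξ| ≤ C
  hb_le : ∀ ξ, c.hb (X 0) ξ ≤ h₀ ξ
  r_meas : Measurable r₀
  r_mem : MemE r₀
  θ_nonneg : ∀ ξ i, 0 ≤ (X 0).θ ξ i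
  normal : ∀ ξ, LabelNormal α (r₀ ξ) (c.N ξ) (c.β ξ) ((X 0).θ ξ) ((X 0).κ ξ)
  lower : ∃ ε, 0 < ε ∧ ∀ᵐ ξ, ε ≤ c.q (X 0) ξ + h₀ ξ

section Evolves

lemma Evolves.isPrimitiveOn {x F : ℝ → ℝ} (h : Evolves x F) {T : ℝ} (hT : 0 ≤ T) :
    IsPrimitiveOn x F 0 T :=
  ⟨(h T hT).1, fun t ht => (h t (by rw [uIcc_of_le hT] at ht; exact ht.1)).2⟩

lemma Evolves.of_isPrimitiveOn {x F : ℝ → ℝ} (h : ∀ T, 0 ≤ T → IsPrimitiveOn x F 0 T) :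
    Evolves x F := fun t ht => ⟨(h t ht).1, (h t ht).2 t (by simp)⟩

lemma Evolves.shift {x F : ℝ → ℝ} (h : Evolves x F) {s : ℝ} (hs : 0 ≤ s) :
    Evolves (fun t => x (s + t)) fun t => F (s + t) :=
  .of_isPrimitiveOn fun _ hT => (h.isPrimitiveOn (add_nonneg hs hT)).shift hs hT

lemma Evolves.congr_deriv {x F F' : ℝ → ℝ} (h : Evolves x F) (he : ∀ t, 0 ≤ t → F t = F' t) :
    Evolves x F' :=
  .of_isPrimitiveOn fun _ hT => (h.isPrimitiveOn hT).congr_deriv (.of_forall fun t ht =>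
    he t (by rw [uIcc_of_le hT] at ht; exact ht.1))

lemma Evolves.sub_eq {x F : ℝ → ℝ} (h : Evolves x F) {s t : ℝ} (hs : 0 ≤ s) (hst : s ≤ t) :
    x t - x s = ∫ r in s..t, F r := by
  have := ((h.isPrimitiveOn (hs.trans hst)).mono (c := s) (d := t)
    (by rw [uIcc_of_le (hs.trans hst)]; exact ⟨hs, hst⟩) (by simp)).eq_add
  rw [this, add_sub_cancel_left]

end Evolves

/-- The evolution of `q = y_ξ`, `w = U_ξ` and `h̄` at one label, for a given coefficient
`a = U² - P`. -/
structure LabelSolution (α : ℝ) (a q w hb : ℝ → ℝ) : Prop where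
  tendsto : Tendsto (breakTime q) atTop (𝓝 ⊤)
  q_eq : Evolves q w
  w_eq : Evolves w fun t => 1 / 2 * hb t + a t * q t
  hb_eq : ∀ (n : ℕ) (τ t : ℝ), breakTime q n = τ → τ ≤ t → (t : EReal) < breakTime q (n + 1) →
    IsPrimitiveOn hb (fun s => 2 * a s * w s) τ t
  hb_jump : ∀ (n : ℕ) (τ : ℝ), breakTime q (n + 1) = τ →
    ∃ l : ℝ, Tendsto hb (𝓝[<] τ) (𝓝 l) ∧ hb τ = (1 - α) * l

lemma breakTime_coe_nonneg {p : ℝ → ℝ} {n : ℕ} {τ : ℝ} (h : breakTime p n = τ) : 0 ≤ τ := by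
  have := breakTime_nonneg p n
  rw [h] at this
  exact_mod_cast this

lemma LabelFlow.labelSolution {α r : ℝ} {N β : Fin 2 → ℝ} {a : ℝ → ℝ} {θ κ : ℝ → Fin 2 → ℝ}
    (hL : LabelFlow N β a θ κ) (hn : LabelNormal α r N β (θ 0) (κ 0)) :
    LabelSolution α a (fun t => labQ N β (θ t) (κ t)) (fun t => labW N β (θ t) (κ t))
      fun t => labH N β (θ t) (κ t) := by
  have hB := hL.breakInfo hn
  refine ⟨hB.tendsto, .of_isPrimitiveOn fun _ hT => hL.isPrimitiveOn_q hT,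
    .of_isPrimitiveOn fun _ hT => hL.isPrimitiveOn_w hT, fun n τ t hτ hle ht =>
    hL.isPrimitiveOn_hb (breakTime_coe_nonneg hτ) hle (hB.const n τ t hτ hle ht), fun n τ hτ => ?_⟩
  obtain ⟨h0, hr, k, hk, hkτ⟩ := hB.jump n τ hτ
  obtain ⟨hN, hβ⟩ := hn.zero hr
  have e : ∀ t, labH N β (θ t) (κ t) = N 0 * angH (β 0) (θ t 0) (κ t 0) := fun t => by
    simp [labH, Fin.sum_univ_two, hN]
  refine ⟨N 0 * (Real.exp (κ τ 0) * (k * Real.cos (θ τ 0) ^ 2)), ?_, ?_⟩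
  · have hsub : 𝓝[<] τ ≤ 𝓝[Ici 0] τ := (nhdsWithin_le_nhds (a := τ)).trans_eq
      (nhdsWithin_eq_nhds.2 (Ici_mem_nhds h0)).symm
    have hθ := (hL.continuousOn_θ 0 τ h0.le).mono_left hsub
    have hκ := (hL.continuousOn_κ 0 τ h0.le).mono_left hsub
    refine ((hκ.rexp.mul (((Real.continuous_cos.tendsto _).comp hθ).pow 2 |>.const_mul k)).const_mul
      (N 0)).congr' ?_
    filter_upwards [hk] with t ht
    rw [e, angH, ht]
    rfl
  · rw [e, angH, hkτ, hβ]
    ring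

/-- `P` and `Q` in terms of the convolution with the kernel. -/
lemma LagState.P_Q_eq {Θ : LagState} {q U hb : ℝ → ℝ} (hy : HasWeakDeriv Θ.y q)
    (hq : Θ.q =ᵐ[volume] q) (hU : Θ.U =ᵐ[volume] U) (hhb : Θ.hb =ᵐ[volume] hb) (ξ : ℝ) :
    Θ.P ξ = 1 / 4 * nonlocalTerm (fun _ => 1) q (fun η => 2 * U η ^ 2 * q η + hb η) ξ ∧
    Θ.Q ξ = -(1 / 4) * nonlocalTerm Real.sign q (fun η => 2 * U η ^ 2 * q η + hb η) ξ := by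
  unfold LagState.P LagState.Q nonlocalTerm
  refine ⟨congrArg _ (integral_congr_ae ?_), congrArg _ (integral_congr_ae ?_)⟩ <;>
  · filter_upwards [hq, hhb, hU] with η h1 h2 h3
    simp only [h1, h2, h3, (hy η ξ).2, one_mul]

namespace FlowData

variable {α : ℝ} {c : Weights} {X : ℝ → AngState} {y₀ h₀ r₀ : ℝ → ℝ}
  (d : FlowData α c X y₀ h₀ r₀)
include d

/-- The solution on `[0, T]`, extended by constants. -/
lemma upTo {T : ℝ} (hT : 0 ≤ T) : ∃ M D X', c.Valid M ∧ SolvesUpTo c M T X' ∧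
    (∀ t, StartBound c M (X' t)) ∧ Dominates c D X' ∧ ∀ t ∈ Icc 0 T, X t = X' t := by
  obtain ⟨M, D, hc, hX, hb, hD⟩ := d.flow T hT
  exact ⟨M, D, _, hc, hX, hb, hD, fun t ht => by rw [timeClamp_eq (by simpa using ht)]⟩

lemma labelFlow (ξ : ℝ) : LabelFlow (c.N ξ) (c.β ξ) (fun t => c.a (X t) ξ) (fun t => (X t).θ ξ)
    fun t => (X t).κ ξ := by
  obtain ⟨M, -, -, hc, -⟩ := d.upTo le_rfl
  refine ⟨(hc.bound ξ).nonneg, (hc.bound ξ).beta, fun T => ?_, fun T => ?_, fun T hT i => ?_,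
    fun T hT i => ?_, d.θ_nonneg ξ⟩
  · rcases le_total 0 T with hT | hT
    · obtain ⟨M, D, X', hc, hX, -, -, he⟩ := d.upTo hT
      refine (hX.measurable_a hc).of_uncurry_right.aemeasurable.congr (g := fun t => c.a (X t) ξ)
        (f := fun t => c.a (X' t) ξ) ?_
      filter_upwards [ae_restrict_mem measurableSet_Ioc] with t ht
      rw [he t ⟨ht.1.le, ht.2⟩]
    · simp [Ioc_eq_empty_of_le hT]
  · rcases le_total 0 T with hT | hT
    · obtain ⟨M, D, X', hc, hX, -, -, he⟩ := d.upTo hT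
      exact ⟨_, fun t ht => by rw [he t ht]; exact hX.abs_a_le hc t ξ⟩
    · obtain ⟨M, D, X', hc, hX, -, -, he⟩ := d.upTo le_rfl
      exact ⟨_, fun t ht => by rw [he t ⟨ht.1, ht.2.trans hT⟩]; exact hX.abs_a_le hc t ξ⟩
  all_goals
    obtain ⟨M, D, X', hc, hX, -, -, he⟩ := d.upTo hT
    have he' : ∀ t ∈ uIcc 0 T, X t = X' t := fun t ht => he t (uIcc_of_le hT ▸ ht)
  · refine ((hX.isPrimitiveOn_θ hc ξ i).congr fun t ht => ?_).congr_deriv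
      (.of_forall fun t ht => ?_) <;> simp only [he' t ht]
  · refine ((hX.isPrimitiveOn_κ hc ξ i).congr fun t ht => ?_).congr_deriv
      (.of_forall fun t ht => ?_) <;> simp only [he' t ht]

lemma evolves_q (ξ : ℝ) : Evolves (fun t => c.q (X t) ξ) fun t => c.w (X t) ξ :=
  .of_isPrimitiveOn fun _ hT => (d.labelFlow ξ).isPrimitiveOn_q hT

lemma evolves_w (ξ : ℝ) : Evolves (fun t => c.w (X t) ξ)
    fun t => 1 / 2 * c.hb (X t) ξ + c.a (X t) ξ * c.q (X t) ξ :=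
  .of_isPrimitiveOn fun _ hT => (d.labelFlow ξ).isPrimitiveOn_w hT

lemma evolves_U (ξ : ℝ) : Evolves (fun t => (X t).U ξ) fun t => -c.Q (X t) ξ := by
  refine .of_isPrimitiveOn fun T hT => ?_
  obtain ⟨M, D, X', hc, hX, -, -, he⟩ := d.upTo hT
  have he' : ∀ t ∈ uIcc 0 T, X t = X' t := fun t ht => he t (uIcc_of_le hT ▸ ht)
  refine ((hX.isPrimitiveOn_U hc ξ).congr fun t ht => ?_).congr_deriv
    (.of_forall fun t ht => ?_) <;> simp only [he' t ht]

lemma evolves_y (ξ : ℝ) : Evolves (fun t => posPath X y₀ t ξ) fun t => (X t).U ξ := by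
  intro T hT
  have := ((d.evolves_U ξ).isPrimitiveOn hT).continuousOn
  exact ⟨this.intervalIntegrable, by simp [posPath]⟩

lemma evolves_h (ξ : ℝ) : Evolves (fun t => densPath c X h₀ t ξ)
    fun t => 2 * c.a (X t) ξ * c.w (X t) ξ := by
  intro T hT
  obtain ⟨M, D, X', hc, hX, -, -, he⟩ := d.upTo hT
  refine ⟨(hX.intervalIntegrable_hb_deriv hc ξ 0 T).congr (fun t ht => ?_), by simp [densPath]⟩
  rw [uIoc_of_le hT] at ht
  simp only [he t ⟨ht.1.le, ht.2⟩]

lemma measurable_state {t : ℝ} (ht : 0 ≤ t) : (X t).Meas := by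
  obtain ⟨M, D, X', hc, hX, -, -, he⟩ := d.upTo ht
  rw [he t ⟨ht, le_rfl⟩]
  exact hX.reg.meas t

lemma valid : ∃ M, c.Valid M := by
  obtain ⟨M, -, -, hc, -⟩ := d.upTo le_rfl
  exact ⟨M, hc⟩

lemma measurable_q {t : ℝ} (ht : 0 ≤ t) : Measurable (c.q (X t)) :=
  d.valid.elim fun _ hc => hc.measurable_q (d.measurable_state ht)

lemma measurable_w {t : ℝ} (ht : 0 ≤ t) : Measurable (c.w (X t)) :=
  d.valid.elim fun _ hc => hc.measurable_w (d.measurable_state ht)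

lemma measurable_hb {t : ℝ} (ht : 0 ≤ t) : Measurable (c.hb (X t)) :=
  d.valid.elim fun _ hc => hc.measurable_hb (d.measurable_state ht)

lemma measurable_h {t : ℝ} (ht : 0 ≤ t) : Measurable (densPath c X h₀ t) := by
  obtain ⟨M, D, X', hc, hX, -, -, he⟩ := d.upTo ht
  have : densPath c X h₀ t = fun ξ => h₀ ξ + ∫ r in (0 : ℝ)..t, 2 * c.a (X' r) ξ * c.w (X' r) ξ := by
    funext ξ
    unfold densPath
    congr 1
    refine intervalIntegral.integral_congr fun r hr => ?_
    rw [uIcc_of_le ht] at hr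
    simp only [he r hr]
  rw [this]
  exact d.h_meas.add (measurable_intervalIntegral_left
    (f := fun r ξ => 2 * c.a (X' r) ξ * c.w (X' r) ξ)
    (((hX.measurable_a hc).const_mul 2).mul (hX.reg.measurable_w hc)) 0 t)

lemma represents : Represents (flowState c X y₀ h₀ r₀) (fun t => c.q (X t)) (fun t => c.w (X t))
    (fun t => c.hb (X t)) (densPath c X h₀) fun _ => r₀ := fun _ ht =>
  ⟨toClass_ae (d.measurable_q ht).aestronglyMeasurable,
    toClass_ae (d.measurable_w ht).aestronglyMeasurable,
    toClass_ae (d.measurable_hb ht).aestronglyMeasurable,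
    toClass_ae (d.measurable_h ht).aestronglyMeasurable,
    toClass_ae d.r_meas.aestronglyMeasurable⟩

lemma deriv_U {t : ℝ} (ht : 0 ≤ t) : HasWeakDeriv (X t).U (c.w (X t)) := by
  obtain ⟨M, D, X', hc, hX, -, -, he⟩ := d.upTo ht
  have h0 := d.cons
  rw [he 0 ⟨le_rfl, ht⟩] at h0
  rw [he t ⟨ht, le_rfl⟩]
  exact fun a b => ⟨intervalIntegrable_of_measurable (hc.measurable_w (hX.tube t).meas)
    (hX.abs_w_le hc t) a b, hX.U_sub_eq hc h0 ⟨ht, le_rfl⟩ a b⟩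

lemma deriv_y {t : ℝ} (ht : 0 ≤ t) : HasWeakDeriv (posPath X y₀ t) (c.q (X t)) := by
  intro a b
  have hy := d.y_cons a b
  have hU : ∀ ξ, IntervalIntegrable (fun r => (X r).U ξ) volume 0 t := fun ξ => (d.evolves_y ξ t ht).1
  obtain ⟨M, D, X', hc, hX, -, -, he⟩ := d.upTo ht
  have h0 := d.cons
  have e : ∫ r in (0 : ℝ)..t, ((X' r).U b - (X' r).U a) = ∫ r in (0 : ℝ)..t, ((X r).U b - (X r).U a) :=
    intervalIntegral.integral_congr fun r hr => by
      rw [uIcc_of_le ht] at hr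
      simp only [he r hr]
  have hq := hX.interval t a b
  rw [he 0 ⟨le_rfl, ht⟩] at h0 hy
  have h := hX.integral_q_eq hc h0 (t := t) ⟨ht, le_rfl⟩ a b
  rw [e, intervalIntegral.integral_sub (hU b) (hU a), ← hy] at h
  rw [he t ⟨ht, le_rfl⟩, h]
  refine ⟨hq, ?_⟩
  unfold posPath
  ring

lemma P_Q_eq {t : ℝ} (ht : 0 ≤ t) (ξ : ℝ) : (flowState c X y₀ h₀ r₀ t).P ξ = c.P (X t) ξ ∧
    (flowState c X y₀ h₀ r₀ t).Q ξ = c.Q (X t) ξ :=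
  LagState.P_Q_eq (d.deriv_y ht) (d.represents t ht).1 .rfl (d.represents t ht).2.2.1 ξ

/-- The equations at a label, from any time on. -/
lemma solvesAt {s : ℝ} (hs : 0 ≤ s) (ξ : ℝ) : SolvesAt α (fun t => flowState c X y₀ h₀ r₀ (s + t)) ξ
    (fun t => c.q (X (s + t)) ξ) (fun t => c.w (X (s + t)) ξ) (fun t => c.hb (X (s + t)) ξ)
    (fun t => densPath c X h₀ (s + t) ξ) fun _ => r₀ ξ := by
  have hS := ((d.labelFlow ξ).shift hs).labelSolution (α := α) (r := r₀ ξ)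
    (by simpa using (d.labelFlow ξ).normal (d.normal ξ) hs)
  refine ⟨hS.tendsto, (d.evolves_y ξ).shift hs, ?_, hS.q_eq, ?_, ?_,
    fun t _ => ⟨intervalIntegrable_const, by simp⟩, fun n τ t hτ hle ht => ?_, hS.hb_jump⟩
  · exact ((d.evolves_U ξ).shift hs).congr_deriv fun t ht => by
      rw [(d.P_Q_eq (by positivity) ξ).2]
  · exact hS.w_eq.congr_deriv fun t ht => by rw [(d.P_Q_eq (by positivity) ξ).1]; rfl
  · exact ((d.evolves_h ξ).shift hs).congr_deriv fun t ht => by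
      rw [(d.P_Q_eq (by positivity) ξ).1]; rfl
  · rw [((d.evolves_h ξ).shift hs).sub_eq (breakTime_coe_nonneg hτ) hle]
    exact sub_eq_of_eq_add' (hS.hb_eq n τ t hτ hle ht).eq_add

lemma measurable_breakTime {s : ℝ} (hs : 0 ≤ s) (n : ℕ) :
    Measurable fun ξ => breakTime (fun t => c.q (X (s + t)) ξ) n := by
  rcases n.eq_zero_or_pos with rfl | hn
  · simp only [breakTime_zero]
    exact measurable_const
  obtain ⟨M, hc⟩ := d.valid
  refine measurable_of_Iic fun x => ?_
  have h0 : ∀ ξ, 0 ≤ breakTime (fun t => c.q (X (s + t)) ξ) n := fun ξ => breakTime_nonneg _ n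
  induction x with
  | bot =>
    convert MeasurableSet.empty
    refine eq_empty_of_forall_notMem fun ξ hξ => ?_
    exact absurd (le_trans (h0 ξ) (mem_Iic.1 hξ)) (by simp)
  | top => convert MeasurableSet.univ; ext; simp
  | coe t =>
    by_cases ht : 0 ≤ t
    · have e : (fun ξ => breakTime (fun t => c.q (X (s + t)) ξ) n) ⁻¹' Iic (t : EReal) =
          {ξ | n ≤ crossCount (r₀ ξ) (c.N ξ) (c.β ξ) ((X s).θ ξ) ((X (s + t)).θ ξ)} := by
        ext ξ
        have hL := (d.labelFlow ξ).shift hs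
        have hn' := (d.labelFlow ξ).normal (d.normal ξ) hs
        have hB := hL.breakInfo (α := α) (r := r₀ ξ) (by simpa using hn')
        have := hB.le_iff n t hn ht
        simp only [add_zero] at this
        exact this
      rw [e]
      refine measurableSet_le measurable_const ?_
      have hm1 := (d.measurable_state hs).θ 0
      have hm2 := (d.measurable_state (t := s + t) (by positivity)).θ 0
      have hf : ∀ {Z : AngState}, (Measurable fun ξ => Z.θ ξ 0) →
          Measurable fun ξ => ⌊Z.θ ξ 0 / Real.pi⌋₊ := fun h =>
        Nat.measurable_floor.comp (h.div_const _)
      have hsub : ∀ f g : ℝ → ℕ, Measurable f → Measurable g → Measurable fun ξ => f ξ - g ξ :=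
        fun f g hf hg => (measurable_of_countable fun p : ℕ × ℕ => p.1 - p.2).comp (hf.prodMk hg)
      unfold crossCount
      refine Measurable.ite ?_ (Measurable.ite ?_ (hsub _ _ ((hf hm2).min measurable_const)
        ((hf hm1).min measurable_const)) (hsub _ _ (hf hm2) (hf hm1))) measurable_const
      · exact (measurableSet_eq_fun d.r_meas measurable_const).inter
          (measurableSet_eq_fun (hc.measN 0) measurable_const).compl
      · exact measurableSet_eq_fun (hc.measβ 0) measurable_const
    · convert MeasurableSet.empty
      refine eq_empty_of_forall_notMem fun ξ hξ => ?_
      have := le_trans (h0 ξ) (mem_Iic.1 hξ)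
      exact ht (by exact_mod_cast this)

end FlowData

/-! ### Regularity in time of the solution that belongs to a flow -/

/-- Bounds for a state in terms of a function `V` of the label. -/
structure MajorizedBy (c : Weights) (V : ℝ → ℝ) (B : ℝ) (Z : AngState) : Prop where
  U : ∀ ξ, |Z.U ξ| ≤ V ξ
  q : ∀ ξ, |c.q Z ξ| ≤ B
  w : ∀ ξ, |c.w Z ξ| ≤ B * V ξ
  hb : ∀ ξ, |c.hb Z ξ| ≤ B * V ξ
  P : ∀ ξ, |c.P Z ξ| ≤ V ξ ^ 2

lemma Dominates.exists_bounded {c : Weights} {M : ℝ} {D : ℝ → ℝ} {X : ℝ → AngState}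
    (hD : Dominates c D X) (hc : c.Valid M) (hU : ∀ t ξ, |(X t).U ξ| ≤ M + 1) :
    ∃ D' K, Dominates c D' X ∧ ∀ ξ, D' ξ ≤ K := by
  refine ⟨fun ξ => min (D ξ) ((M + 1) ^ 2), (M + 1) ^ 2, ⟨?_, fun t ξ => le_min (hD.U t ξ) ?_,
    fun t ξ i => le_min (hD.θ t ξ i) ?_⟩, fun ξ => min_le_right _ _⟩
  · refine hD.integrable.mono' (hD.integrable.aestronglyMeasurable.inf aestronglyMeasurable_const)
      (.of_forall fun ξ => ?_)
    change |min (D ξ) ((M + 1) ^ 2)| ≤ D ξ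
    rw [abs_of_nonneg (le_min (hD.nonneg ξ) (sq_nonneg _))]
    exact min_le_left _ _
  · exact sq_le_sq' (abs_le.1 (hU t ξ)).1 (abs_le.1 (hU t ξ)).2
  · have h1 := (hc.bound ξ).nonneg i
    have h2 := (hc.bound ξ).le i
    have h3 := Real.cos_sq_le_one ((X t).θ ξ i)
    have : c.N ξ i * Real.cos ((X t).θ ξ i) ^ 2 ≤ M := (mul_le_of_le_one_right h1 h3).trans h2
    nlinarith [sq_nonneg M]

lemma SolvesUpTo.exists_majorizedBy {c : Weights} {M T : ℝ} {D : ℝ → ℝ} {X : ℝ → AngState}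
    (hc : c.Valid M) (hX : SolvesUpTo c M T X) (hD : Dominates c D X) :
    ∃ V B, MemE V ∧ 0 ≤ B ∧ (∀ ξ, 0 ≤ V ξ ∧ V ξ ≤ B) ∧ ∀ t, MajorizedBy c V B (X t) := by
  obtain ⟨D', K, hD', hK⟩ := hD.exists_bounded hc fun t ξ => (hX.tube t).U ξ
  have hM := hc.M_nonneg
  set k := densBound M + 2 * Real.exp (M + 1) with hk
  have hd := densBound_nonneg hM
  have hk0 : 0 ≤ k := by positivity
  have hK0 : 0 ≤ K := (hD'.nonneg 0).trans (hK 0)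
  have hDm := hD'.integrable.aestronglyMeasurable
  set G : ℝ → ℝ := fun ξ => (k + 1) * D' ξ + Real.exp M * k * expConv (1 / 2) D' ξ with hG
  have hconv0 : ∀ ξ, 0 ≤ expConv (1 / 2) D' ξ := fun ξ => expConv_nonneg (.of_forall hD'.nonneg) ξ
  have hG0 : ∀ ξ, 0 ≤ G ξ := fun ξ => by
    have := hconv0 ξ
    have := hD'.nonneg ξ
    positivity
  have hGi : Integrable G :=
    (hD'.integrable.const_mul _).add ((integrable_expConv (by norm_num) hD'.integrable).const_mul _)
  set B₀ := (k + 1) * K + Real.exp M * k * (4 * K)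
  have hGB : ∀ ξ, G ξ ≤ B₀ := fun ξ => by
    have h1 := expConv_le_const (c := 1 / 2) (by norm_num) hDm (.of_forall hD'.nonneg)
      (.of_forall hK) ξ
    have h2 : expConv (1 / 2) D' ξ ≤ 4 * K := by norm_num at h1 ⊢; exact h1
    have h3 := hK ξ
    simp only [hG, B₀]
    gcongr
  set V : ℝ → ℝ := fun ξ => Real.sqrt (G ξ)
  have hV2 : ∀ ξ, V ξ ^ 2 = G ξ := fun ξ => Real.sq_sqrt (hG0 ξ)
  have hV0 : ∀ ξ, 0 ≤ V ξ := fun ξ => Real.sqrt_nonneg _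
  set B := Real.sqrt B₀ + Real.sqrt (densBound M) + densBound M with hB
  have hB1 := Real.sqrt_nonneg B₀
  have hB2 := Real.sqrt_nonneg (densBound M)
  have hVB : ∀ ξ, V ξ ≤ B := fun ξ => by
    have : V ξ ≤ Real.sqrt B₀ := Real.sqrt_le_sqrt (hGB ξ)
    linarith
  have hVm : AEStronglyMeasurable V := Real.continuous_sqrt.comp_aestronglyMeasurable hGi.1
  have hhb : ∀ t ξ, c.hb (X t) ξ ≤ V ξ ^ 2 := fun t ξ => by
    have h1 := hX.energyDensity_le hc hD' t ξ
    have h2 := hc.q_nonneg (Z := X t) ξ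
    have h3 : 0 ≤ (X t).U ξ ^ 2 * c.q (X t) ξ := by positivity
    rw [hV2]
    unfold Weights.energyDensity at h1
    have := hD'.nonneg ξ
    have : 0 ≤ Real.exp M * k * expConv (1 / 2) D' ξ := by have := hconv0 ξ; positivity
    simp only [hG]
    linarith
  have hrho : ∀ t ξ, |c.rho (X t) ξ| ≤ 2 * k * D' ξ := fun t ξ => by
    have h1 := hX.energyDensity_le hc hD' t ξ
    have h2 := hc.hb_nonneg (Z := X t) ξ
    rw [abs_of_nonneg (hc.rho_nonneg ξ), c.rho_eq]
    unfold Weights.energyDensity at h1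
    linarith
  have hnl : ∀ t ξ, |nonlocalTerm (fun _ => 1) (c.q (X t)) (c.rho (X t)) ξ| ≤ 2 * V ξ ^ 2 :=
      fun t ξ => by
    have hm := (hc.measurable_rho (hX.tube t).meas).aestronglyMeasurable (μ := volume)
    have h1 := (hX.tube t).kernel.abs_nonlocalTerm_le (σ := fun _ => 1) (by simp) hm
      (.of_forall ((hX.tube t).rho_abs hc)) ξ
    have h2 := expConv_mono (c := 1 / 2) (R := 2 * k * K) (by norm_num)
      (f := fun η => |c.rho (X t) η|) (g := fun η => 2 * k * D' η) hm.norm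
      (hDm.const_mul (2 * k)) (.of_forall fun η => ?_) (.of_forall fun η => abs_nonneg _)
      (.of_forall (hrho t)) ξ
    · rw [expConv_const_mul] at h2
      refine h1.trans ((mul_le_mul_of_nonneg_left h2 (Real.exp_pos M).le).trans ?_)
      rw [hV2]
      have := hD'.nonneg ξ
      have : 0 ≤ (k + 1) * D' ξ := by positivity
      simp only [hG]
      linarith
    · have := hD'.nonneg η
      rw [abs_of_nonneg (by positivity)]
      have := hK η
      gcongr
  refine ⟨V, B, ⟨?_, ?_⟩, by positivity, fun ξ => ⟨hV0 ξ, hVB ξ⟩, fun t => ⟨fun ξ => ?_, fun ξ => ?_,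
    fun ξ => ?_, fun ξ => ?_, fun ξ => ?_⟩⟩
  · rw [memLp_two_iff_integrable_sq hVm]
    exact hGi.congr (.of_forall fun ξ => (hV2 ξ).symm)
  · exact memLp_top_of_bound hVm B (.of_forall fun ξ => by
      rw [Real.norm_eq_abs, abs_of_nonneg (hV0 ξ)]; exact hVB ξ)
  · refine abs_le_of_sq_le_sq ?_ (hV0 ξ)
    rw [hV2]
    have := hD'.U t ξ
    have h2 := hD'.nonneg ξ
    have : 0 ≤ Real.exp M * k * expConv (1 / 2) D' ξ := by have := hconv0 ξ; positivity
    simp only [hG]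
    nlinarith
  · have := hX.abs_q_le hc t ξ
    linarith
  · refine abs_le_of_sq_le_sq ?_ (mul_nonneg (by positivity) (hV0 ξ))
    have h1 := hc.w_sq_le (Z := X t) ξ
    have h2 := (le_abs_self _).trans (hX.abs_q_le hc t ξ)
    have h3 := hc.hb_nonneg (Z := X t) ξ
    have h4 : densBound M ≤ B ^ 2 := by
      rw [← Real.sq_sqrt hd]
      exact pow_le_pow_left₀ hB2 (by linarith) 2
    calc c.w (X t) ξ ^ 2 ≤ c.q (X t) ξ * c.hb (X t) ξ := h1
      _ ≤ densBound M * V ξ ^ 2 := mul_le_mul h2 (hhb t ξ) h3 hd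
      _ ≤ B ^ 2 * V ξ ^ 2 := by gcongr
      _ = (B * V ξ) ^ 2 := by ring
  · rw [abs_of_nonneg (hc.hb_nonneg ξ)]
    refine (hhb t ξ).trans ?_
    rw [sq]
    exact mul_le_mul_of_nonneg_right (hVB ξ) (hV0 ξ)
  · have := hnl t ξ
    unfold Weights.P
    rw [abs_mul, abs_of_pos (by norm_num : (0 : ℝ) < 1 / 4)]
    nlinarith [sq_nonneg (V ξ)]

lemma Evolves.abs_sub_le {x F : ℝ → ℝ} (h : Evolves x F) {T C : ℝ}
    (hF : ∀ r ∈ Icc 0 T, |F r| ≤ C) {s t : ℝ} (hs : s ∈ Icc 0 T) (ht : t ∈ Icc 0 T) :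
    |x t - x s| ≤ C * |t - s| := by
  wlog hst : s ≤ t generalizing s t
  · rw [abs_sub_comm, abs_sub_comm t]
    exact this ht hs (not_le.1 hst).le
  rw [h.sub_eq hs.1 hst, ← Real.norm_eq_abs]
  refine intervalIntegral.norm_integral_le_of_norm_le_const (f := F) (C := C) fun r hr => ?_
  rw [uIoc_of_le hst] at hr
  exact hF r ⟨hs.1.trans hr.1.le, hr.2.trans ht.2⟩

section Norms

lemma eLpNorm_add_top_le_of_abs_le {u v : ℝ → ℝ} {k : ℝ} (p : ℝ≥0∞)
    (h : ∀ᵐ ξ, |u ξ| ≤ k * |v ξ|) : eLpNorm u p volume + eLpNorm u ∞ volume ≤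
      ENNReal.ofReal k * (eLpNorm v p volume + eLpNorm v ∞ volume) := by
  rw [mul_add]
  exact add_le_add (eLpNorm_le_mul_eLpNorm_of_ae_le_mul h p)
    (eLpNorm_le_mul_eLpNorm_of_ae_le_mul h ∞)

/-- A function with bounded rate of change in `L^p ∩ L^∞` is bounded and Lipschitz in time. -/
lemma lipschitzInTime_of_rate {p : ℝ≥0∞} {u : ℝ → ℝ → ℝ} (h0 : MemLp (u 0) p volume)
    (h0' : MemLp (u 0) ∞ volume) (h : ∀ T, 0 ≤ T → ∃ V C, MemLp V p volume ∧ MemLp V ∞ volume ∧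
      0 ≤ C ∧ ∀ s ∈ Icc 0 T, ∀ t ∈ Icc 0 T, ∀ᵐ ξ, |u t ξ - u s ξ| ≤ C * |t - s| * |V ξ|) :
    LipschitzInTime (fun u => eLpNorm u p volume + eLpNorm u ∞ volume) u := by
  have hfin : ∀ {v : ℝ → ℝ}, MemLp v p volume → MemLp v ∞ volume →
      eLpNorm v p volume + eLpNorm v ∞ volume ≠ ∞ := fun h1 h2 =>
    ENNReal.add_ne_top.2 ⟨h1.eLpNorm_ne_top, h2.eLpNorm_ne_top⟩
  refine ⟨fun T => ?_, fun T => ?_⟩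
  · rcases lt_or_ge T 0 with hT | hT
    · exact ⟨0, fun t ht => absurd (ht.1.trans ht.2) (not_le.2 hT)⟩
    obtain ⟨V, C, hV, hV', hC, hr⟩ := h T hT
    have hw : MemLp (fun ξ => |u 0 ξ| + C * T * |V ξ|) p volume := h0.abs.add (hV.abs.const_mul _)
    have hw' : MemLp (fun ξ => |u 0 ξ| + C * T * |V ξ|) ∞ volume := h0'.abs.add (hV'.abs.const_mul _)
    refine ⟨ENNReal.toNNReal (eLpNorm (fun ξ => |u 0 ξ| + C * T * |V ξ|) p volume +
        eLpNorm (fun ξ => |u 0 ξ| + C * T * |V ξ|) ∞ volume),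
      fun t ht => (eLpNorm_add_top_le_of_abs_le (k := 1)
      (v := fun ξ => |u 0 ξ| + C * T * |V ξ|) p ?_).trans ?_⟩
    · filter_upwards [hr 0 ⟨le_rfl, hT⟩ t ht] with ξ hξ
      rw [sub_zero, abs_of_nonneg ht.1] at hξ
      have h1 : |u t ξ| ≤ |u t ξ - u 0 ξ| + |u 0 ξ| := by
        simpa using abs_add_le (u t ξ - u 0 ξ) (u 0 ξ)
      have h2 : C * t * |V ξ| ≤ C * T * |V ξ| := by
        have := ht.2
        gcongr
      rw [one_mul]
      exact (by linarith : |u t ξ| ≤ _).trans (le_abs_self _)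
    · rw [ENNReal.ofReal_one, one_mul, ENNReal.coe_toNNReal (hfin hw hw')]
  · rcases lt_or_ge T 0 with hT | hT
    · exact ⟨0, fun t ht => absurd (ht.1.trans ht.2) (not_le.2 hT)⟩
    obtain ⟨V, C, hV, hV', hC, hr⟩ := h T hT
    refine ⟨C.toNNReal * ENNReal.toNNReal (eLpNorm V p volume + eLpNorm V ∞ volume),
      fun s hs t ht => (eLpNorm_add_top_le_of_abs_le (k := C * |t - s|) (v := V) p
      (hr s hs t ht)).trans ?_⟩
    rw [ENNReal.coe_mul, ENNReal.coe_toNNReal (hfin hV hV'), ENNReal.ofReal_mul hC]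
    exact le_of_eq (by rw [mul_right_comm]; rfl)

lemma BoundedInTime.shift {N : (ℝ → ℝ) → ℝ≥0∞} {u : ℝ → ℝ → ℝ} (h : BoundedInTime N u) {s : ℝ}
    (hs : 0 ≤ s) : BoundedInTime N fun t => u (s + t) := fun T => by
  obtain ⟨C, hC⟩ := h (s + T)
  exact ⟨C, fun t ht => hC _ ⟨by linarith [ht.1], by linarith [ht.2]⟩⟩

lemma LipschitzInTime.shift {N : (ℝ → ℝ) → ℝ≥0∞} {u : ℝ → ℝ → ℝ} (h : LipschitzInTime N u) {s : ℝ}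
    (hs : 0 ≤ s) : LipschitzInTime N fun t => u (s + t) := by
  refine ⟨h.1.shift hs, fun T => ?_⟩
  obtain ⟨C, hC⟩ := h.2 (s + T)
  refine ⟨C, fun r hr t ht => ?_⟩
  have := hC (s + r) ⟨by linarith [hr.1], by linarith [hr.2]⟩ (s + t)
    ⟨by linarith [ht.1], by linarith [ht.2]⟩
  rwa [add_sub_add_left_eq_sub] at this

lemma SolutionRegularity.shift {Θ : ℝ → LagState} (h : SolutionRegularity Θ) {s : ℝ} (hs : 0 ≤ s) :
    SolutionRegularity fun t => Θ (s + t) :=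
  ⟨fun _ ht => h.deriv_y _ (add_nonneg hs ht), fun _ ht => h.deriv_U _ (add_nonneg hs ht),
    h.zeta.shift hs, h.U.shift hs, h.zetaXi.shift hs, h.w.shift hs, h.r.shift hs, h.hb.shift hs,
    h.h.shift hs⟩

end Norms

namespace FlowData

variable {α : ℝ} {c : Weights} {X : ℝ → AngState} {y₀ h₀ r₀ : ℝ → ℝ}
  (d : FlowData α c X y₀ h₀ r₀)
include d

lemma exists_majorizedBy {T : ℝ} (hT : 0 ≤ T) : ∃ V B, MemE V ∧ 0 ≤ B ∧
    (∀ ξ, 0 ≤ V ξ ∧ V ξ ≤ B) ∧ ∀ t ∈ Icc 0 T, MajorizedBy c V B (X t) := by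
  obtain ⟨M, D, X', hc, hX, -, hD, he⟩ := d.upTo hT
  obtain ⟨V, B, h1, h2, h3, h4⟩ := hX.exists_majorizedBy hc hD
  exact ⟨V, B, h1, h2, h3, fun t ht => he t ht ▸ h4 t⟩

omit d in
lemma _root_.MajorizedBy.abs_a_le {V : ℝ → ℝ} {B : ℝ} {Z : AngState} (h : MajorizedBy c V B Z)
    (ξ : ℝ) : |c.a Z ξ| ≤ 2 * V ξ ^ 2 := by
  unfold Weights.a
  have h1 := h.P ξ
  have h2 : Z.U ξ ^ 2 ≤ V ξ ^ 2 := by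
    rw [← sq_abs]
    exact pow_le_pow_left₀ (abs_nonneg _) (h.U ξ) 2
  refine (abs_sub _ _).trans ?_
  rw [abs_of_nonneg (sq_nonneg _)]
  linarith

omit d in
lemma _root_.MajorizedBy.abs_h_rate_le {V : ℝ → ℝ} {B : ℝ} {Z : AngState} (h : MajorizedBy c V B Z)
    (hB : 0 ≤ B) (hV : ∀ ξ, 0 ≤ V ξ ∧ V ξ ≤ B) (ξ : ℝ) :
    |2 * c.a Z ξ * c.w Z ξ| ≤ 4 * B ^ 2 * |V ξ ^ 2| := by
  rw [abs_mul, abs_mul, abs_two, abs_of_nonneg (sq_nonneg (V ξ))]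
  have h1 := h.abs_a_le ξ
  have h2 := h.w ξ
  have h3 : B * V ξ ≤ B * B := by have := (hV ξ).2; gcongr
  calc 2 * |c.a Z ξ| * |c.w Z ξ| ≤ 2 * (2 * V ξ ^ 2) * (B * B) := by
        gcongr; exact h2.trans h3
    _ = 4 * B ^ 2 * V ξ ^ 2 := by ring

omit d in
lemma _root_.MajorizedBy.abs_w_rate_le {V : ℝ → ℝ} {B : ℝ} {Z : AngState} (h : MajorizedBy c V B Z)
    (hB : 0 ≤ B) (hV : ∀ ξ, 0 ≤ V ξ ∧ V ξ ≤ B) (ξ : ℝ) :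
    |1 / 2 * c.hb Z ξ + c.a Z ξ * c.q Z ξ| ≤ (B + 2 * B ^ 2) * |V ξ| := by
  rw [abs_of_nonneg (hV ξ).1]
  refine (abs_add_le _ _).trans ?_
  rw [abs_mul, abs_mul, abs_of_pos (by norm_num : (0 : ℝ) < 1 / 2)]
  have h1 := h.abs_a_le ξ
  have h2 := h.hb ξ
  have h4 := h.q ξ
  have h5 := (hV ξ).1
  have h6 : V ξ ^ 2 ≤ B * V ξ := by rw [sq]; exact mul_le_mul_of_nonneg_right (hV ξ).2 h5
  have h7 : |c.a Z ξ| * |c.q Z ξ| ≤ 2 * (B * V ξ) * B := by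
    refine mul_le_mul (by linarith) h4 (abs_nonneg _) (by positivity)
  have : 0 ≤ B * V ξ := by positivity
  nlinarith

lemma regularity : SolutionRegularity (flowState c X y₀ h₀ r₀) := by
  have hrep := d.represents
  have hmem : ∀ {V : ℝ → ℝ} {B : ℝ}, MemE V → (∀ ξ, 0 ≤ V ξ ∧ V ξ ≤ B) →
      MemLp (fun ξ => V ξ ^ 2) 1 volume ∧ MemLp (fun ξ => V ξ ^ 2) ∞ volume := fun {V B} hV hB => by
    refine ⟨memLp_one_iff_integrable.2 hV.1.integrable_sq, memLp_top_of_bound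
      (hV.1.1.pow 2) (B ^ 2) (.of_forall fun ξ => ?_)⟩
    rw [Real.norm_eq_abs, abs_of_nonneg (sq_nonneg _)]
    exact pow_le_pow_left₀ (hB ξ).1 (hB ξ).2 2
  have hbd : ∀ {p : ℝ≥0∞} {u : ℝ → ℝ → ℝ}, (∀ T, 0 ≤ T → ∃ V, MemLp V p volume ∧
      ∀ t ∈ Icc 0 T, ∀ᵐ ξ, |u t ξ| ≤ |V ξ|) → BoundedInTime (fun u => eLpNorm u p volume) u := by
    intro p u h T
    rcases lt_or_ge T 0 with hT | hT
    · exact ⟨0, fun t ht => absurd (ht.1.trans ht.2) (not_le.2 hT)⟩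
    obtain ⟨V, hV, h⟩ := h T hT
    refine ⟨(eLpNorm V p volume).toNNReal, fun t ht => ?_⟩
    rw [ENNReal.coe_toNNReal hV.eLpNorm_ne_top]
    exact eLpNorm_mono_ae (h t ht)
  have h00 := hrep 0 le_rfl
  have hd0 : densPath c X h₀ 0 = h₀ := by funext ξ; simp [densPath]
  refine ⟨fun t ht a b => ?_, fun t ht a b => ?_, hbd fun T hT => ?_, hbd fun T hT => ?_,
    lipschitzInTime_of_rate ?_ ?_ fun T hT => ?_,
    lipschitzInTime_of_rate ?_ ?_ fun T hT => ?_,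
    lipschitzInTime_of_rate ?_ ?_ fun T hT => ?_, hbd fun T hT => ?_,
    lipschitzInTime_of_rate ?_ ?_ fun T hT => ?_⟩
  · have := d.deriv_y ht a b
    refine ⟨this.1.congr_ae (ae_restrict_of_ae (hrep t ht).1.symm), this.2.trans ?_⟩
    exact intervalIntegral.integral_congr_ae ((hrep t ht).1.symm.mono fun _ h _ => h)
  · have := d.deriv_U ht a b
    refine ⟨this.1.congr_ae (ae_restrict_of_ae (hrep t ht).2.1.symm), this.2.trans ?_⟩
    exact intervalIntegral.integral_congr_ae ((hrep t ht).2.1.symm.mono fun _ h _ => h)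
  · obtain ⟨C, hC⟩ := d.y_bdd
    obtain ⟨V, B, hV, hB, hVB, hm⟩ := d.exists_majorizedBy hT
    refine ⟨fun _ => C + B * T, memLp_top_const _, fun t ht => .of_forall fun ξ => ?_⟩
    have h1 := (d.evolves_y ξ).abs_sub_le (C := B)
      (fun r hr => ((hm r hr).U ξ).trans (hVB ξ).2) (left_mem_Icc.2 hT) ht
    have h2 : posPath X y₀ 0 ξ = y₀ ξ := by simp [posPath]
    rw [h2, sub_zero, abs_of_nonneg ht.1] at h1
    have h3 := abs_add_le (posPath X y₀ t ξ - y₀ ξ) (y₀ ξ - ξ)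
    rw [sub_add_sub_cancel] at h3
    have h4 : B * t ≤ B * T := by have := ht.2; gcongr
    have h5 := hC ξ
    exact (by linarith : |posPath X y₀ t ξ - ξ| ≤ C + B * T).trans (le_abs_self _)
  · obtain ⟨V, B, hV, hB, hVB, hm⟩ := d.exists_majorizedBy hT
    exact ⟨V, hV.1, fun t ht => .of_forall fun ξ => ((hm t ht).U ξ).trans (le_abs_self _)⟩
  · exact (memLp_congr_ae (h00.1.mono fun ξ h => by rw [h])).2 d.q_mem.1
  · exact (memLp_congr_ae (h00.1.mono fun ξ h => by rw [h])).2 d.q_mem.2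
  · obtain ⟨V, B, hV, hB, hVB, hm⟩ := d.exists_majorizedBy hT
    refine ⟨V, B, hV.1, hV.2, hB, fun s hs t ht => ?_⟩
    filter_upwards [(hrep s hs.1).1, (hrep t ht.1).1] with ξ h1 h2
    rw [h1, h2, sub_sub_sub_cancel_right, mul_right_comm, abs_of_nonneg (hVB ξ).1]
    exact (d.evolves_q ξ).abs_sub_le (fun r hr => (hm r hr).w ξ) hs ht
  · obtain ⟨V, B, hV, hB, hVB, hm⟩ := d.exists_majorizedBy le_rfl
    refine (memLp_congr_ae h00.2.1).2 ((hV.1.const_mul B).mono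
      (d.measurable_w le_rfl).aestronglyMeasurable (.of_forall fun ξ => ?_))
    exact ((hm 0 (by simp)).w ξ).trans (le_abs_self _)
  · obtain ⟨V, B, hV, hB, hVB, hm⟩ := d.exists_majorizedBy le_rfl
    refine (memLp_congr_ae h00.2.1).2 ((hV.2.const_mul B).mono
      (d.measurable_w le_rfl).aestronglyMeasurable (.of_forall fun ξ => ?_))
    exact ((hm 0 (by simp)).w ξ).trans (le_abs_self _)
  · obtain ⟨V, B, hV, hB, hVB, hm⟩ := d.exists_majorizedBy hT
    refine ⟨V, B + 2 * B ^ 2, hV.1, hV.2, by positivity, fun s hs t ht => ?_⟩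
    filter_upwards [(hrep s hs.1).2.1, (hrep t ht.1).2.1] with ξ h1 h2
    rw [h1, h2, mul_right_comm]
    exact (d.evolves_w ξ).abs_sub_le (fun r hr => (hm r hr).abs_w_rate_le hB hVB ξ) hs ht
  · exact (memLp_congr_ae h00.2.2.2.2).2 d.r_mem.1
  · exact (memLp_congr_ae h00.2.2.2.2).2 d.r_mem.2
  · refine ⟨0, 0, MemLp.zero, MemLp.zero, le_rfl, fun s hs t ht => ?_⟩
    filter_upwards [(hrep s hs.1).2.2.2.2, (hrep t ht.1).2.2.2.2] with ξ h1 h2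
    simp [h1, h2]
  · obtain ⟨V, B, hV, hB, hVB, hm⟩ := d.exists_majorizedBy hT
    refine ⟨fun ξ => B * V ξ, hV.1.const_mul B, fun t ht => ?_⟩
    filter_upwards [(hrep t ht.1).2.2.1] with ξ h1
    rw [h1]
    exact ((hm t ht).hb ξ).trans (le_abs_self _)
  · refine (memLp_congr_ae h00.2.2.2.1).2 ?_
    rw [hd0]
    exact memLp_one_iff_integrable.2 d.h_integrable
  · refine (memLp_congr_ae h00.2.2.2.1).2 ?_
    obtain ⟨C, hC⟩ := d.h_bdd
    rw [hd0]
    exact memLp_top_of_bound d.h_meas.aestronglyMeasurable C (.of_forall hC)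
  · obtain ⟨V, B, hV, hB, hVB, hm⟩ := d.exists_majorizedBy hT
    have := hmem hV hVB
    refine ⟨fun ξ => V ξ ^ 2, 4 * B ^ 2, this.1, this.2, by positivity, fun s hs t ht => ?_⟩
    filter_upwards [(hrep s hs.1).2.2.2.1, (hrep t ht.1).2.2.2.1] with ξ h1 h2
    rw [h1, h2, mul_right_comm]
    exact (d.evolves_h ξ).abs_sub_le (fun r hr => (hm r hr).abs_h_rate_le hB hVB ξ) hs ht

/-- The solution that belongs to a flow, started at any time. -/
theorem isDissipativeSolution {s : ℝ} (hs : 0 ≤ s) :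
    IsDissipativeSolution α fun t => flowState c X y₀ h₀ r₀ (s + t) :=
  ⟨d.regularity.shift hs, fun t => c.q (X (s + t)), fun t => c.w (X (s + t)),
    fun t => c.hb (X (s + t)), fun t => densPath c X h₀ (s + t), fun _ => r₀,
    fun _ ht => d.represents _ (add_nonneg hs ht), fun n => (d.measurable_breakTime hs n).aemeasurable,
    .of_forall fun ξ => d.solvesAt hs ξ⟩

end FlowData

/-! ### Weak derivatives and relabelings -/

section WeakDerivative

variable {F g : ℝ → ℝ}

lemma HasWeakDeriv.isPrimitiveOn (h : HasWeakDeriv F g) (a b : ℝ) : IsPrimitiveOn F g a b :=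
  ⟨(h a b).1, fun t _ => by rw [← (h a t).2]; ring⟩

lemma HasWeakDeriv.congr_ae {g' : ℝ → ℝ} (h : HasWeakDeriv F g) (hg : g =ᵐ[volume] g') :
    HasWeakDeriv F g' := fun a b =>
  ⟨(h a b).1.congr_ae (ae_restrict_of_ae hg),
    (h a b).2.trans (intervalIntegral.integral_congr_ae (hg.mono fun _ h _ => h))⟩

lemma HasWeakDeriv.ae_hasDerivAt (h : HasWeakDeriv F g) : ∀ᵐ x, HasDerivAt F (g x) x := by
  have : ∀ᵐ x, ∀ n : ℕ, x ∈ uIcc (-n : ℝ) n → HasDerivAt F (g x) x :=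
    ae_all_iff.2 fun n => (h.isPrimitiveOn _ _).ae_hasDerivAt
  filter_upwards [this] with x hx
  obtain ⟨n, hn⟩ := exists_nat_ge |x|
  have := abs_le.1 hn
  exact hx n (by rw [uIcc_of_le (by linarith)]; exact this)

lemma HasWeakDeriv.continuous (h : HasWeakDeriv F g) : Continuous F := by
  have : F = fun x => F 0 + ∫ t in (0 : ℝ)..x, g t := by
    funext x
    rw [← (h 0 x).2]; ring
  rw [this]
  exact continuous_const.add (intervalIntegral.continuous_primitive (fun a b => (h a b).1) 0)

lemma HasWeakDeriv.add {F' g' : ℝ → ℝ} (h : HasWeakDeriv F g) (h' : HasWeakDeriv F' g') :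
    HasWeakDeriv (fun x => F x + F' x) fun x => g x + g' x := fun a b =>
  ⟨(h a b).1.add (h' a b).1, by
    rw [intervalIntegral.integral_add (h a b).1 (h' a b).1, ← (h a b).2, ← (h' a b).2]; ring⟩

lemma hasWeakDeriv_setIntegral_Iic (hg : Integrable g) :
    HasWeakDeriv (fun ξ => ∫ x in Iic ξ, g x) g := fun _ _ =>
  ⟨hg.intervalIntegrable, intervalIntegral.integral_Iic_sub_Iic hg.integrableOn hg.integrableOn⟩

lemma HasWeakDeriv.mul_sub_le (h : HasWeakDeriv F g) {c : ℝ} (hc : ∀ᵐ x, c ≤ g x) {a b : ℝ}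
    (hab : a ≤ b) : c * (b - a) ≤ F b - F a := by
  rw [(h a b).2]
  have := intervalIntegral.integral_mono_ae hab intervalIntegrable_const (h a b).1 hc
  rw [intervalIntegral.integral_const, smul_eq_mul] at this
  linarith

lemma HasWeakDeriv.sub_le_mul (h : HasWeakDeriv F g) {c : ℝ} (hc : ∀ᵐ x, g x ≤ c) {a b : ℝ}
    (hab : a ≤ b) : F b - F a ≤ c * (b - a) := by
  rw [(h a b).2]
  have := intervalIntegral.integral_mono_ae hab (h a b).1 intervalIntegrable_const hc
  rw [intervalIntegral.integral_const, smul_eq_mul] at this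
  linarith

/-- A function at bounded distance from the identity whose derivative is bounded from above and
from below is a relabeling function. -/
lemma exists_relabeling (h : HasWeakDeriv F g) {ε C K : ℝ} (hε : 0 < ε) (hl : ∀ᵐ x, ε ≤ g x)
    (hu : ∀ᵐ x, g x ≤ C) (hK : ∀ x, |F x - x| ≤ K) (h2 : MemLp (fun x => g x - 1) 2 volume) :
    ∃ f : RelabelingGroup, ∀ x, f.1 x = F x := by
  have hmono : StrictMono F := fun a b hab => by
    have := h.mul_sub_le hl hab.le
    have : 0 < ε * (b - a) := mul_pos hε (sub_pos.2 hab)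
    linarith
  have htop : Tendsto F atTop atTop :=
    tendsto_atTop_mono (fun x => by linarith [(abs_le.1 (hK x)).1] : ∀ x, x - K ≤ F x)
      (tendsto_atTop_add_const_right _ (-K) tendsto_id)
  have hbot : Tendsto F atBot atBot :=
    tendsto_atBot_mono (fun x => by linarith [(abs_le.1 (hK x)).2] : ∀ x, F x ≤ x + K)
      (tendsto_atBot_add_const_right _ K tendsto_id)
  set e := (hmono.orderIsoOfSurjective F (h.continuous.surjective htop hbot)).toHomeomorph
  have he : ∀ x, e x = F x := fun x => rfl
  have hes : ∀ x, F (e.symm x) = x := fun x => by rw [← he, e.apply_symm_apply]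
  have habs : ∀ a b, ε * |a - b| ≤ |F a - F b| ∧ |F a - F b| ≤ |C| * |a - b| := by
    have key : ∀ a b, b ≤ a → ε * |a - b| ≤ |F a - F b| ∧ |F a - F b| ≤ |C| * |a - b| := by
      intro a b hab
      have h1 := h.mul_sub_le hl hab
      have h3 := h.sub_le_mul hu hab
      have h4 : C * (a - b) ≤ |C| * (a - b) :=
        mul_le_mul_of_nonneg_right (le_abs_self C) (sub_nonneg.2 hab)
      rw [abs_of_nonneg (sub_nonneg.2 hab), abs_of_nonneg (sub_nonneg.2 (hmono.monotone hab))]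
      exact ⟨h1, h3.trans h4⟩
    intro a b
    rcases le_total b a with hab | hab
    · exact key a b hab
    · have := key b a hab
      rwa [abs_sub_comm b a, abs_sub_comm (F b)] at this
  have hlip : ∀ {u : ℝ → ℝ} {L : ℝ}, (∀ a b, |u a - u b| ≤ L * |a - b|) →
      ∃ K : ℝ≥0, LipschitzWith K fun x => u x - x := fun {u L} hu => by
    refine ⟨(|L| + 1).toNNReal, LipschitzWith.of_dist_le_mul fun a b => ?_⟩
    rw [Real.coe_toNNReal _ (by positivity), Real.dist_eq, Real.dist_eq]
    have h1 := abs_sub (u a - u b) (a - b)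
    have h3 : L * |a - b| ≤ |L| * |a - b| := mul_le_mul_of_nonneg_right (le_abs_self L) (abs_nonneg _)
    rw [show u a - a - (u b - b) = u a - u b - (a - b) by ring]
    linarith [hu a b]
  refine ⟨⟨e, ⟨⟨K, hK⟩, hlip fun a b => (habs a b).2⟩, ⟨⟨K, fun x => ?_⟩, hlip (L := ε⁻¹) fun a b => ?_⟩,
    h2.ae_eq ?_⟩, fun x => rfl⟩
  · have := hK (e.symm x)
    rwa [hes, abs_sub_comm] at this
  · have := (habs (e.symm a) (e.symm b)).1
    rw [hes, hes] at this
    rwa [inv_mul_eq_div, le_div_iff₀' hε]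
  · filter_upwards [h.ae_hasDerivAt] with x hx
    have : deriv e x = g x := hx.deriv
    rw [this]

lemma memLp_two_of_integrable_of_bounded (hg : Integrable g) {C : ℝ} (hC : ∀ᵐ x, |g x| ≤ C) :
    MemE g := by
  refine ⟨?_, memLp_top_of_bound hg.1 C hC⟩
  rw [memLp_two_iff_integrable_sq hg.1]
  refine (hg.norm.const_mul C).mono' (hg.1.pow 2) ?_
  filter_upwards [hC] with x hx
  rw [Real.norm_eq_abs, abs_of_nonneg (sq_nonneg _), ← sq_abs, sq, Real.norm_eq_abs]
  exact mul_le_mul_of_nonneg_right hx (abs_nonneg _)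

end WeakDerivative

section MemE

variable {u v : ℝ → ℝ}

lemma MemE.congr_ae (hu : MemE u) (h : u =ᵐ[volume] v) : MemE v := ⟨hu.1.ae_eq h, hu.2.ae_eq h⟩

lemma MemE.add (hu : MemE u) (hv : MemE v) : MemE fun x => u x + v x :=
  ⟨hu.1.add hv.1, hu.2.add hv.2⟩

lemma MemE.const_mul (hu : MemE u) (k : ℝ) : MemE fun x => k * u x :=
  ⟨hu.1.const_mul k, hu.2.const_mul k⟩

lemma MemE.abs (hu : MemE u) : MemE fun x => |u x| := ⟨hu.1.abs, hu.2.abs⟩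

lemma MemE.mono (hv : MemE v) (hu : AEStronglyMeasurable u volume) (h : ∀ᵐ x, |u x| ≤ |v x|) :
    MemE u := ⟨hv.1.mono hu h, hv.2.mono hu h⟩

lemma ae_abs_le_of_eLpNorm_top_le {C : ℝ≥0} (h : eLpNorm u ∞ volume ≤ C) : ∀ᵐ x, |u x| ≤ C := by
  rw [eLpNorm_exponent_top] at h
  filter_upwards [ae_le_eLpNormEssSup (f := u) (μ := volume)] with x hx
  have := ENNReal.toReal_mono ENNReal.coe_ne_top (hx.trans h)
  simpa using this

lemma exists_ae_abs_le_of_memLp_top (h : MemLp u ∞ volume) : ∃ C, ∀ᵐ x, |u x| ≤ C :=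
  ⟨_, ae_abs_le_of_eLpNorm_top_le (ENNReal.coe_toNNReal h.eLpNorm_ne_top).ge⟩

lemma MemE.exists_bound (hu : MemE u) : ∃ C, ∀ᵐ x, |u x| ≤ C := exists_ae_abs_le_of_memLp_top hu.2

end MemE

lemma measurable_gFun (α : ℝ) : Measurable (gFun α) := by
  have hc : ∀ i : Fin 7, Measurable fun x : Fin 7 → ℝ => x i := fun i => measurable_pi_apply i
  have h1 : Measurable gOne := ((hc 3).abs).add ((hc 2).const_mul 2)
  have h2 : Measurable gTwo := (hc 2).add (hc 4)
  refine Measurable.ite ?_ ((h1.const_mul α).add (h2.const_mul (1 - α))) h2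
  exact (measurableSet_le h1 h2).inter ((measurableSet_le (hc 3) measurable_const).inter
    (measurableSet_eq_fun (hc 6) measurable_const))

/-- `g(Θ) - 1` belongs to `E` as soon as the other functions do. -/
lemma LagState.gFun_mem {α : ℝ} (hα : α ∈ Icc (0 : ℝ) 1) {Θ : LagState} (hy : Continuous Θ.y)
    (hU : Continuous Θ.U) (hq : MemE fun ξ => Θ.q ξ - 1) (hw : MemE Θ.w) (hhb : MemE Θ.hb)
    (hhb0 : ∀ᵐ ξ, 0 ≤ Θ.hb ξ) : MemE fun ξ => gFun α (Θ.toVec ξ) - 1 := by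
  refine ((hw.abs.add (hq.abs.const_mul 5)).add (hhb.abs.const_mul 3)).mono ?_ ?_
  · refine AEMeasurable.aestronglyMeasurable (((measurable_gFun α).comp_aemeasurable ?_).sub
      aemeasurable_const)
    refine aemeasurable_pi_iff.2 fun i => ?_
    fin_cases i
    exacts [hy.aemeasurable, hU.aemeasurable, Θ.q.aemeasurable, Θ.w.aemeasurable,
      Θ.hb.aemeasurable, Θ.h.aemeasurable, Θ.r.aemeasurable]
  · filter_upwards [hhb0] with ξ h0
    refine le_trans ?_ (le_abs_self _)
    have e1 : gOne (Θ.toVec ξ) = |Θ.w ξ| + 2 * Θ.q ξ := rfl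
    have e2 : gTwo (Θ.toVec ξ) = Θ.q ξ + Θ.hb ξ := rfl
    have hw0 := abs_nonneg (Θ.w ξ)
    have hq0 := abs_nonneg (Θ.q ξ - 1)
    have hq1 := abs_le.1 (le_refl |Θ.q ξ - 1|)
    rw [abs_of_nonneg h0]
    unfold gFun
    split_ifs with h
    · have h1 : gOne (Θ.toVec ξ) ≤ gTwo (Θ.toVec ξ) := h.1
      rw [e1, e2] at h1 ⊢
      obtain ⟨ha0, ha1⟩ := hα
      rw [abs_le]
      constructor <;> nlinarith
    · rw [e2, abs_le]
      constructor <;> linarith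

/-! ### The solution that belongs to a flow stays in `ℱ` -/

/-- From `𝒢` to `ℱ`: the condition on `y + H` is automatic. -/
lemma MemG.memF {α : ℝ} {Θ : LagState} (h : MemG α Θ) {K : ℝ} (hy : ∀ ξ, |Θ.y ξ - ξ| ≤ K) :
    MemF α Θ := by
  refine ⟨h, ?_⟩
  obtain ⟨C, hC⟩ := h.inv_bdd
  obtain ⟨A, hA⟩ := h.zetaXi_mem.exists_bound
  obtain ⟨B, hB⟩ := h.h_mem.exists_bound
  have hC0 : 0 < C := by
    obtain ⟨ξ, h1, h2⟩ := hC.exists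
    exact (one_div_pos.2 h1).trans_le h2
  refine exists_relabeling (h.deriv_y.add (hasWeakDeriv_setIntegral_Iic h.h_integrable))
    (ε := C⁻¹) (C := 1 + A + B) (K := K + ∫ x, |Θ.h x|) (inv_pos.2 hC0) ?_ ?_ (fun ξ => ?_) ?_
  · filter_upwards [hC] with ξ h1
    have := h1.2
    rw [div_le_iff₀ h1.1] at this
    rwa [inv_le_iff_one_le_mul₀ hC0, mul_comm]
  · filter_upwards [hA, hB] with ξ h1 h2
    have := (abs_le.1 h1).2
    have := (abs_le.1 h2).2
    linarith
  · have h1 : |∫ x in Iic ξ, Θ.h x| ≤ ∫ x, |Θ.h x| :=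
      (norm_integral_le_integral_norm _).trans
        (setIntegral_le_integral h.h_integrable.norm (.of_forall fun _ => norm_nonneg _))
    have h2 := abs_add_le (Θ.y ξ - ξ) (∫ x in Iic ξ, Θ.h x)
    rw [show Θ.y ξ + (∫ x in Iic ξ, Θ.h x) - ξ = Θ.y ξ - ξ + ∫ x in Iic ξ, Θ.h x by ring]
    linarith [hy ξ]
  · exact (h.zetaXi_mem.1.add h.h_mem.1).ae_eq (.of_forall fun ξ => by simp only [Pi.add_apply]; ring)

namespace FlowData

variable {α : ℝ} {c : Weights} {X : ℝ → AngState} {y₀ h₀ r₀ : ℝ → ℝ}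
  (d : FlowData α c X y₀ h₀ r₀)
include d

lemma hb_le_h {t : ℝ} (ht : 0 ≤ t) (ξ : ℝ) : c.hb (X t) ξ ≤ densPath c X h₀ t ξ := by
  obtain ⟨M, D, X', hc, hX, -, -, he⟩ := d.upTo ht
  have h := hX.hb_le hc le_rfl ht le_rfl ξ
  rw [← he 0 ⟨le_rfl, ht⟩, ← he t ⟨ht, le_rfl⟩, intervalIntegral.integral_congr (g := fun r =>
    2 * c.a (X r) ξ * c.w (X r) ξ) fun r hr => by
      rw [uIcc_of_le ht] at hr
      simp only [he r hr]] at h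
  have := d.hb_le ξ
  unfold densPath
  linarith

lemma q_nonneg (t ξ : ℝ) : 0 ≤ c.q (X t) ξ := d.valid.elim fun _ hc => hc.q_nonneg ξ

lemma hb_nonneg (t ξ : ℝ) : 0 ≤ c.hb (X t) ξ := d.valid.elim fun _ hc => hc.hb_nonneg ξ

lemma relation {t : ℝ} (ht : 0 ≤ t) (ξ : ℝ) :
    c.q (X t) ξ * c.hb (X t) ξ = c.w (X t) ξ ^ 2 + r₀ ξ ^ 2 :=
  (d.labelFlow ξ).relation (d.normal ξ) ht

/-- `y_ξ + h` stays bounded from below. -/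
lemma lower_at {T : ℝ} (hT : 0 ≤ T) :
    ∃ ε, 0 < ε ∧ ∀ᵐ ξ, ε ≤ c.q (X T) ξ + densPath c X h₀ T ξ := by
  obtain ⟨ε, hε, hl⟩ := d.lower
  obtain ⟨M, D, X', hc, hX, -, -, he⟩ := d.upTo hT
  set A := (M + 1) ^ 2 + nonlocalBound M
  have hA : ∀ t ∈ Icc 0 T, ∀ ξ, |c.a (X t) ξ| ≤ A := fun t ht ξ => he t ht ▸ hX.abs_a_le hc t ξ
  refine ⟨ε * Real.exp (-((1 + 2 * A) * T)), by positivity, hl.mono fun ξ hξ => ?_⟩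
  have hq := (d.evolves_q ξ).isPrimitiveOn hT
  have hh := (d.evolves_h ξ).isPrimitiveOn hT
  have hlin : IsPrimitiveOn (fun t => (1 + 2 * A) * t) (fun _ => (1 + 2 * A) * 1) 0 T := by
    have : IsPrimitiveOn (fun t => t) (fun _ => (1 : ℝ)) 0 T :=
      ⟨intervalIntegrable_const, fun t _ => by simp⟩
    exact this.const_mul _
  have hp := (hlin.exp).mul (hq.add hh)
  have hmono := hp.le_of_deriv_nonneg hT (.of_forall fun t ht => ?_)
  · simp only [mul_zero, Real.exp_zero, one_mul] at hmono
    have h0 : densPath c X h₀ 0 ξ = h₀ ξ := by simp [densPath]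
    rw [h0] at hmono
    rw [Real.exp_neg, ← div_eq_mul_inv, div_le_iff₀ (Real.exp_pos _)]
    linarith
  · have h1 := (hc.bound ξ).abs_labW_le (θ := (X t).θ ξ) (κ := (X t).κ ξ)
    have h2 := d.hb_le_h ht.1 ξ
    have h3 := d.q_nonneg t ξ
    have h4 := d.hb_nonneg t ξ
    have h5 := hA t ht ξ
    have h6 : |c.w (X t) ξ| ≤ (c.q (X t) ξ + densPath c X h₀ t ξ) / 2 := by
      refine h1.trans ?_
      change (c.q (X t) ξ + c.hb (X t) ξ) / 2 ≤ _
      linarith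
    have hA0 : 0 ≤ A := (abs_nonneg _).trans h5
    have h7 : |c.a (X t) ξ * c.w (X t) ξ| ≤ A * ((c.q (X t) ξ + densPath c X h₀ t ξ) / 2) := by
      rw [abs_mul]
      exact mul_le_mul h5 h6 (abs_nonneg _) hA0
    have h8 := (abs_le.1 h6).1
    have h9 := (abs_le.1 h7).1
    have h10 : 0 ≤ (1 + 2 * A) * (c.q (X t) ξ + densPath c X h₀ t ξ) +
        (c.w (X t) ξ + 2 * c.a (X t) ξ * c.w (X t) ξ) := by nlinarith
    have := mul_nonneg (Real.exp_pos ((1 + 2 * A) * t)).le h10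
    linarith

lemma tendsto_y {T : ℝ} (hT : 0 ≤ T) : Tendsto (fun ξ => posPath X y₀ T ξ - ξ) atBot (𝓝 0) := by
  obtain ⟨V, B, hV, hB, hVB, hm⟩ := d.exists_majorizedBy hT
  have hVi := hV.1.integrable_sq
  have hU : ∀ t ∈ Icc 0 T, ∀ ξ, |(X t).U ξ| ≤ Real.sqrt (2 * B * ∫ x in Iic ξ, V x ^ 2) := by
    intro t ht ξ
    refine Real.abs_le_sqrt ?_
    obtain ⟨R, hR, -, hlim⟩ := exists_seq_small_of_integrable hVi fun x => sq_nonneg (V x)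
    have hRt : Tendsto R atTop atTop := tendsto_atTop_mono hR tendsto_natCast_atTop_atTop
    have hlim2 : Tendsto (fun n => V (-R n) ^ 2 + 2 * B * ∫ x in Iic ξ, V x ^ 2) atTop
        (𝓝 (0 + 2 * B * ∫ x in Iic ξ, V x ^ 2)) := hlim.add_const _
    rw [zero_add] at hlim2
    refine ge_of_tendsto hlim2 ?_
    filter_upwards [hRt.eventually_ge_atTop (-ξ)] with n hn
    have hle : -R n ≤ ξ := by linarith
    have hp := (d.deriv_U ht.1).isPrimitiveOn (-R n) ξ
    have hsq := (hp.mul hp).eq_add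
    have h1 : ∫ x in (-R n)..ξ, (c.w (X t) x * (X t).U x + (X t).U x * c.w (X t) x) ≤
        ∫ x in (-R n)..ξ, 2 * B * V x ^ 2 := by
      refine intervalIntegral.integral_mono_on hle (hp.mul hp).1
        (hVi.const_mul _).intervalIntegrable fun x _ => ?_
      have h2 := (hm t ht).U x
      have h3 := (hm t ht).w x
      have h4 : |c.w (X t) x * (X t).U x| ≤ B * V x * V x := by
        rw [abs_mul]
        exact mul_le_mul h3 h2 (abs_nonneg _) (mul_nonneg hB (hVB x).1)
      have := (abs_le.1 h4).2
      linarith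
    have h2 : ∫ x in (-R n)..ξ, 2 * B * V x ^ 2 ≤ 2 * B * ∫ x in Iic ξ, V x ^ 2 := by
      rw [intervalIntegral.integral_const_mul, intervalIntegral.integral_of_le hle]
      refine mul_le_mul_of_nonneg_left ?_ (by positivity)
      exact setIntegral_mono_set hVi.integrableOn (.of_forall fun x => sq_nonneg _)
        (.of_forall fun x hx => hx.2)
    have h3 : (X t).U (-R n) * (X t).U (-R n) ≤ V (-R n) ^ 2 := by
      rw [← sq, ← sq_abs]
      exact pow_le_pow_left₀ (abs_nonneg _) ((hm t ht).U _) 2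
    rw [sq]
    linarith
  have hz : Tendsto (fun ξ => Real.sqrt (2 * B * ∫ x in Iic ξ, V x ^ 2) * T) atBot (𝓝 0) := by
    have h1 : Tendsto (fun ξ => ∫ x in Iic ξ, V x ^ 2) atBot (𝓝 0) :=
      tendsto_integral_Iic_zero tendsto_id
    have := ((Real.continuous_sqrt.tendsto _).comp (h1.const_mul (2 * B))).mul_const T
    simpa using this
  have hd : Tendsto (fun ξ => posPath X y₀ T ξ - y₀ ξ) atBot (𝓝 0) := by
    refine squeeze_zero_norm (fun ξ => ?_) hz
    have := (d.evolves_y ξ).abs_sub_le (fun r hr => hU r hr ξ) (left_mem_Icc.2 hT) (right_mem_Icc.2 hT)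
    have h0 : posPath X y₀ 0 ξ = y₀ ξ := by simp [posPath]
    rw [h0, sub_zero, abs_of_nonneg hT] at this
    exact this
  simpa using hd.add d.y_lim

/-- The solution that belongs to a flow takes values in `ℱ`. -/
theorem memF (hα : α ∈ Icc (0 : ℝ) 1) {t : ℝ} (ht : 0 ≤ t) :
    MemF α (flowState c X y₀ h₀ r₀ t) := by
  have hreg := d.regularity
  have hrep := d.represents t ht
  obtain ⟨hq, hw, hhb, hh, hr⟩ := hrep
  obtain ⟨V, B, hV, hB, hVB, hm⟩ := d.exists_majorizedBy ht
  have hmt := hm t ⟨ht, le_rfl⟩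
  have hfin : ∀ {u : ℝ → ℝ} {p : ℝ≥0∞} {C : ℝ≥0}, AEStronglyMeasurable u volume →
      eLpNorm u p volume + eLpNorm u ∞ volume ≤ C → MemLp u p volume ∧ MemLp u ∞ volume :=
    fun hu h => ⟨⟨hu, (le_self_add.trans h).trans_lt ENNReal.coe_lt_top⟩,
      ⟨hu, (le_add_self.trans h).trans_lt ENNReal.coe_lt_top⟩⟩
  obtain ⟨C₁, hC₁⟩ := hreg.zetaXi.1 t
  obtain ⟨C₂, hC₂⟩ := hreg.w.1 t
  obtain ⟨C₃, hC₃⟩ := hreg.r.1 t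
  obtain ⟨C₄, hC₄⟩ := hreg.h.1 t
  obtain ⟨K, hK⟩ : ∃ K, ∀ ξ, |posPath X y₀ t ξ - ξ| ≤ K := by
    obtain ⟨C, hC⟩ := d.y_bdd
    refine ⟨C + B * t, fun ξ => ?_⟩
    have h1 := (d.evolves_y ξ).abs_sub_le (C := B)
      (fun r hr => ((hm r hr).U ξ).trans (hVB ξ).2) (left_mem_Icc.2 ht) (right_mem_Icc.2 ht)
    have h2 : posPath X y₀ 0 ξ = y₀ ξ := by simp [posPath]
    rw [h2, sub_zero, abs_of_nonneg ht] at h1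
    have h3 := abs_add_le (posPath X y₀ t ξ - y₀ ξ) (y₀ ξ - ξ)
    rw [sub_add_sub_cancel] at h3
    linarith [hC ξ]
  have htt : t ∈ Icc 0 t := ⟨ht, le_rfl⟩
  have hyc := (hreg.deriv_y t ht).continuous
  have hUc := (hreg.deriv_U t ht).continuous
  have hqE : MemE fun ξ => (flowState c X y₀ h₀ r₀ t).q ξ - 1 :=
    hfin ((flowState c X y₀ h₀ r₀ t).q.aestronglyMeasurable.sub aestronglyMeasurable_const) (hC₁ t htt)
  have hwE : MemE (flowState c X y₀ h₀ r₀ t).w :=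
    hfin (flowState c X y₀ h₀ r₀ t).w.aestronglyMeasurable (hC₂ t htt)
  have hrE : MemE (flowState c X y₀ h₀ r₀ t).r :=
    hfin (flowState c X y₀ h₀ r₀ t).r.aestronglyMeasurable (hC₃ t htt)
  have hh1 := hfin (flowState c X y₀ h₀ r₀ t).h.aestronglyMeasurable (hC₄ t htt)
  have hhi := memLp_one_iff_integrable.1 hh1.1
  have hhbE : MemE (flowState c X y₀ h₀ r₀ t).hb :=
    (MemE.const_mul hV B).mono (flowState c X y₀ h₀ r₀ t).hb.aestronglyMeasurable
      (hhb.mono fun ξ h => by rw [h]; exact (hmt.hb ξ).trans (le_abs_self _))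
  have hhb0 : ∀ᵐ ξ, 0 ≤ (flowState c X y₀ h₀ r₀ t).hb ξ :=
    hhb.mono fun ξ h => h ▸ d.hb_nonneg t ξ
  refine MemG.memF (K := K) ⟨hreg.deriv_y t ht, hreg.deriv_U t ht, ?_, ?_, hqE, hwE, ?_, hrE,
    LagState.gFun_mem hα hyc hUc hqE hwE hhbE hhb0, hhi, ?_, d.tendsto_y ht, ?_, ?_, ?_⟩ hK
  · exact memLp_top_of_bound (hyc.sub continuous_id).aestronglyMeasurable K (.of_forall hK)
  · exact hV.mono hUc.aestronglyMeasurable (.of_forall fun ξ => (hmt.U ξ).trans (le_abs_self _))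
  · obtain ⟨C, hC⟩ := exists_ae_abs_le_of_memLp_top hh1.2
    exact memLp_two_of_integrable_of_bounded hhi hC
  · filter_upwards [hq, hhb, hh] with ξ h1 h2 h3
    rw [h1, h2, h3]
    exact ⟨d.q_nonneg t ξ, (d.hb_nonneg t ξ).trans (d.hb_le_h ht ξ), d.hb_nonneg t ξ⟩
  · obtain ⟨ε, hε, hl⟩ := d.lower_at ht
    refine ⟨ε⁻¹, ?_⟩
    filter_upwards [hl, hq, hh] with ξ h1 h2 h3
    rw [h2, h3, one_div]
    exact ⟨hε.trans_le h1, inv_anti₀ hε h1⟩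
  · filter_upwards [hq, hhb, hw, hr] with ξ h1 h2 h3 h4
    rw [h1, h2, h3, h4]
    exact d.relation ht ξ
  · filter_upwards [hhb, hh] with ξ h1 h2
    rw [h1, h2]
    exact d.hb_le_h ht ξ

end FlowData

/-! ### Angle variables for initial data -/

/-- Weights of the two components at a label. -/
def startN (q hb r : ℝ) : Fin 2 → ℝ := ![q + hb - r ^ 2 / q, r ^ 2 / q]

/-- Angles of the two components at a label. -/
def startθ (q w : ℝ) : Fin 2 → ℝ :=
  ![if 0 < q then Real.arccos (w / Real.sqrt (q ^ 2 + w ^ 2)) else 0, 0]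

/-- Jump factors at a label. -/
def startβ (α r : ℝ) : Fin 2 → ℝ := ![if r = 0 then 1 - α else 1, 1]

lemma startθ_nonneg (q w : ℝ) (i : Fin 2) : 0 ≤ startθ q w i := by
  fin_cases i
  · simp only [startθ, Fin.zero_eta, Matrix.cons_val_zero]
    split_ifs
    exacts [Real.arccos_nonneg _, le_rfl]
  · simp [startθ]

lemma startθ_lt_pi (q w : ℝ) (i : Fin 2) : startθ q w i < Real.pi := by
  fin_cases i
  · simp only [startθ, Fin.zero_eta, Matrix.cons_val_zero]
    split_ifs with hq
    · have hs0 : 0 < Real.sqrt (q ^ 2 + w ^ 2) := Real.sqrt_pos.2 (by positivity)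
      have hws : |w| < Real.sqrt (q ^ 2 + w ^ 2) := by
        rw [← Real.sqrt_sq_eq_abs]
        exact Real.sqrt_lt_sqrt (sq_nonneg _) (by nlinarith)
      refine lt_of_le_of_ne (Real.arccos_le_pi _) fun he => ?_
      rw [Real.arccos_eq_pi, div_le_iff₀ hs0] at he
      linarith [(abs_lt.1 hws).1]
    · exact Real.pi_pos
  · simpa [startθ] using Real.pi_pos

lemma crossFactor_startθ (β q w : ℝ) (i : Fin 2) : crossFactor β (startθ q w i) = 1 := by
  rw [crossFactor, Nat.floor_eq_zero.2 (by rw [div_lt_one Real.pi_pos]; exact startθ_lt_pi q w i),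
    pow_zero]

lemma startβ_mem {α : ℝ} (hα : α ∈ Icc (0 : ℝ) 1) (r : ℝ) (i : Fin 2) :
    startβ α r i ∈ Icc (0 : ℝ) 1 := by
  obtain ⟨h0, h1⟩ := hα
  fin_cases i
  · simp only [startβ, Fin.zero_eta, Matrix.cons_val_zero]
    split_ifs
    · exact ⟨by linarith, by linarith⟩
    · simp
  · simp [startβ]

section Label

variable {q w hb r : ℝ} (hq : 0 ≤ q) (hb0 : 0 ≤ hb) (h : q * hb = w ^ 2 + r ^ 2)
include hq hb0 h

lemma startN_nonneg (i : Fin 2) : 0 ≤ startN q hb r i ∧ startN q hb r i ≤ q + hb := by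
  have h1 : 0 ≤ r ^ 2 / q := by positivity
  have h2 : r ^ 2 / q ≤ hb := by
    rcases hq.eq_or_lt with rfl | hq
    · simpa using hb0
    · rw [div_le_iff₀ hq]; nlinarith [sq_nonneg w]
  fin_cases i <;> simp only [startN, Fin.zero_eta, Fin.mk_one, Matrix.cons_val_zero,
    Matrix.cons_val_one] <;> constructor <;> linarith

omit hb0 in
lemma lab_start (α : ℝ) : labQ (startN q hb r) (startβ α r) (startθ q w) 0 = q ∧
    labW (startN q hb r) (startβ α r) (startθ q w) 0 = w ∧
    labH (startN q hb r) (startβ α r) (startθ q w) 0 = hb := by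
  rcases hq.eq_or_lt with rfl | hq
  · have hw : w = 0 := by nlinarith [sq_nonneg w, sq_nonneg r]
    have hr : r = 0 := by nlinarith [sq_nonneg w, sq_nonneg r]
    simp [labQ, labW, labH, Fin.sum_univ_two, startN, startθ, angQ, angW, angH, hw, hr, crossFactor]
  · set s := Real.sqrt (q ^ 2 + w ^ 2) with hs
    have hs2 : s ^ 2 = q ^ 2 + w ^ 2 := Real.sq_sqrt (by positivity)
    have hs0 : 0 < s := Real.sqrt_pos.2 (by positivity)
    have hws : |w| < s := by
      rw [← Real.sqrt_sq_eq_abs]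
      exact Real.sqrt_lt_sqrt (sq_nonneg _) (by nlinarith)
    have hlt := abs_lt.1 hws
    set θ := Real.arccos (w / s) with hθ
    have hcos : Real.cos θ = w / s := by
      refine Real.cos_arccos ?_ ?_
      · rw [le_div_iff₀ hs0]; linarith
      · rw [div_le_iff₀ hs0]; linarith
    have hθ0 : 0 ≤ θ := Real.arccos_nonneg _
    have hsin : Real.sin θ = q / s := by
      have h1 : Real.sin θ ^ 2 = (q / s) ^ 2 := by
        rw [Real.sin_sq, hcos, div_pow, div_pow, hs2]
        field_simp
        ring
      exact (pow_left_inj₀ (Real.sin_nonneg_of_nonneg_of_le_pi hθ0 (Real.arccos_le_pi _)) (by positivity)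
        two_ne_zero).1 h1
    have e0 : startθ q w 0 = θ := by simp [startθ, hq, hθ, hs]
    have e1 : startθ q w 1 = 0 := by simp [startθ]
    have hN0 : startN q hb r 0 = s ^ 2 / q := by
      have : hb = (w ^ 2 + r ^ 2) / q := by rw [← h]; field_simp
      simp only [startN, Matrix.cons_val_zero, hs2, this]
      field_simp
      ring
    have hN1 : startN q hb r 1 = r ^ 2 / q := by simp [startN]
    have hhb : hb = (w ^ 2 + r ^ 2) / q := by rw [← h]; field_simp
    simp only [labQ, labW, labH, Fin.sum_univ_two, angQ, angW, angH, crossFactor_startθ,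
      e0, e1, hN0, hN1, hcos, hsin, Real.sin_zero, Real.cos_zero, Pi.zero_apply, Real.exp_zero]
    refine ⟨by field_simp; ring, by field_simp; ring, ?_⟩
    rw [hhb]
    field_simp

end Label

lemma startNormal {α q w hb r : ℝ} (hq : 0 ≤ q) (h : q * hb = w ^ 2 + r ^ 2) :
    LabelNormal α r (startN q hb r) (startβ α r) (startθ q w) 0 := by
  refine ⟨fun hr => by simp [startN, startβ, hr], fun hr => ⟨by simp [startβ, hr], by simp [startβ], ?_⟩⟩
  obtain ⟨h1, h2, h3⟩ := lab_start hq h α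
  rw [h1, h2, h3, h]

lemma measurable_startN {q hb r : ℝ → ℝ} (hq : Measurable q) (hhb : Measurable hb)
    (hr : Measurable r) (i : Fin 2) : Measurable fun ξ => startN (q ξ) (hb ξ) (r ξ) i := by
  fin_cases i
  · exact (hq.add hhb).sub ((hr.pow_const 2).div hq)
  · exact (hr.pow_const 2).div hq

lemma measurable_startθ {q w : ℝ → ℝ} (hq : Measurable q) (hw : Measurable w) (i : Fin 2) :
    Measurable fun ξ => startθ (q ξ) (w ξ) i := by
  fin_cases i
  · exact Measurable.ite (measurableSet_lt measurable_const hq) (Real.measurable_arccos.comp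
      (hw.div (Real.continuous_sqrt.measurable.comp ((hq.pow_const 2).add (hw.pow_const 2)))))
      measurable_const
  · exact measurable_const

lemma measurable_startβ {α : ℝ} {r : ℝ → ℝ} (hr : Measurable r) (i : Fin 2) :
    Measurable fun ξ => startβ α (r ξ) i := by
  fin_cases i
  · exact Measurable.ite (measurableSet_eq_fun hr measurable_const) measurable_const measurable_const
  · exact measurable_const

lemma Continuous.abs_le_of_ae {f : ℝ → ℝ} (hf : Continuous f) {C : ℝ} (h : ∀ᵐ x, |f x| ≤ C) (x : ℝ) :
    |f x| ≤ C := by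
  by_contra hx
  have ho : IsOpen {x | C < |f x|} := isOpen_lt continuous_const hf.abs
  have h0 : volume {x | C < |f x|} = 0 := by
    have := ae_iff.1 h
    simpa using this
  have := ho.measure_eq_zero_iff volume |>.1 h0
  exact absurd (this ▸ (not_le.1 hx : x ∈ {x | C < |f x|})) (notMem_empty x)

lemma MemLp.exists_forall_abs_le {f : ℝ → ℝ} (hf : Continuous f) (h : MemLp f ∞ volume) :
    ∃ C, ∀ x, |f x| ≤ C :=
  (exists_ae_abs_le_of_memLp_top h).imp fun _ hC => hf.abs_le_of_ae hC

/-- Every element of `𝒢` is the initial value of a flow. -/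
theorem MemG.exists_flowData {α : ℝ} (hα : α ∈ Icc (0 : ℝ) 1) {Θ : LagState} (h : MemG α Θ) :
    ∃ c X y₀ h₀ r₀, FlowData α c X y₀ h₀ r₀ ∧ flowState c X y₀ h₀ r₀ 0 = Θ := by
  obtain ⟨C, hC⟩ := h.inv_bdd
  obtain ⟨A, hA⟩ := h.zetaXi_mem.exists_bound
  obtain ⟨B, hB⟩ := h.h_mem.exists_bound
  obtain ⟨K, hK⟩ := MemLp.exists_forall_abs_le (h.deriv_y.continuous.sub continuous_id) h.zeta_mem
  obtain ⟨L, hL⟩ := MemLp.exists_forall_abs_le h.deriv_U.continuous h.U_mem.2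
  have hC0 : 0 < C := by
    obtain ⟨ξ, h1, h2⟩ := hC.exists
    exact (one_div_pos.2 h1).trans_le h2
  set S : Set ℝ := {ξ | (0 ≤ Θ.q ξ ∧ 0 ≤ Θ.hb ξ) ∧ Θ.q ξ * Θ.hb ξ = Θ.w ξ ^ 2 + Θ.r ξ ^ 2 ∧
    Θ.hb ξ ≤ Θ.h ξ ∧ Θ.q ξ ≤ 1 + A ∧ |Θ.h ξ| ≤ B} with hS
  have hSm : MeasurableSet S :=
    ((measurableSet_le measurable_const Θ.q.measurable).inter
      (measurableSet_le measurable_const Θ.hb.measurable)).inter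
    ((measurableSet_eq_fun (Θ.q.measurable.mul Θ.hb.measurable)
      ((Θ.w.measurable.pow_const 2).add (Θ.r.measurable.pow_const 2))).inter
    ((measurableSet_le Θ.hb.measurable Θ.h.measurable).inter
    ((measurableSet_le Θ.q.measurable measurable_const).inter
      (measurableSet_le Θ.h.measurable.abs measurable_const))))
  have hSae : ∀ᵐ ξ, ξ ∈ S := by
    filter_upwards [h.nonneg, h.relation, h.hb_le, hA, hB] with ξ h1 h2 h3 h4 h5
    exact ⟨⟨h1.1, h1.2.2⟩, h2, h3, by linarith [(abs_le.1 h4).2], h5⟩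
  have hind : ∀ u : ℝ → ℝ, S.indicator u =ᵐ[volume] u := fun u => by
    filter_upwards [hSae] with ξ hξ
    exact indicator_of_mem hξ u
  set q := S.indicator Θ.q with hq
  set w := S.indicator Θ.w with hw
  set hb := S.indicator Θ.hb with hhb
  set hh := S.indicator Θ.h with hhh
  set r := S.indicator Θ.r with hr
  have hqm : Measurable q := Θ.q.measurable.indicator hSm
  have hwm : Measurable w := Θ.w.measurable.indicator hSm
  have hhbm : Measurable hb := Θ.hb.measurable.indicator hSm
  have hhm : Measurable hh := Θ.h.measurable.indicator hSm
  have hrm : Measurable r := Θ.r.measurable.indicator hSm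
  have hA0 : 0 ≤ 1 + A := by
    obtain ⟨ξ, h1⟩ := hSae.exists
    exact h1.1.1.trans h1.2.2.2.1
  have hB0 : 0 ≤ B := by
    obtain ⟨ξ, h1⟩ := hSae.exists
    exact (abs_nonneg _).trans h1.2.2.2.2
  have hall : ∀ ξ, 0 ≤ q ξ ∧ 0 ≤ hb ξ ∧ q ξ * hb ξ = w ξ ^ 2 + r ξ ^ 2 ∧ hb ξ ≤ hh ξ ∧
      q ξ ≤ 1 + A ∧ |hh ξ| ≤ B := fun ξ => by
    by_cases hξ : ξ ∈ S
    · simp only [hq, hw, hhb, hhh, hr, indicator_of_mem hξ]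
      exact ⟨hξ.1.1, hξ.1.2, hξ.2⟩
    · simp only [hq, hw, hhb, hhh, hr, indicator_of_notMem hξ]
      simp [hA0, hB0]
  set c : Weights := ⟨fun ξ => startN (q ξ) (hb ξ) (r ξ), fun ξ => startβ α (r ξ)⟩ with hc
  set Z : AngState := ⟨Θ.U, fun ξ => startθ (q ξ) (w ξ), fun _ => 0⟩ with hZ
  have hlab := fun ξ => lab_start (hall ξ).1 (hall ξ).2.2.1 α
  have hcq : c.q Z = q := funext fun ξ => (hlab ξ).1
  have hcw : c.w Z = w := funext fun ξ => (hlab ξ).2.1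
  have hch : c.hb Z = hb := funext fun ξ => (hlab ξ).2.2
  have hqE : q =ᵐ[volume] Θ.q := hind _
  have hwE : w =ᵐ[volume] Θ.w := hind _
  have hhbE : hb =ᵐ[volume] Θ.hb := hind _
  have hhE : hh =ᵐ[volume] Θ.h := hind _
  have hrE : r =ᵐ[volume] Θ.r := hind _
  have hyd := h.deriv_y.congr_ae hqE.symm
  have hUd := h.deriv_U.congr_ae hwE.symm
  set M := 1 + A + B + L + 2 * K
  have hL0 : 0 ≤ L := (abs_nonneg _).trans (hL 0)
  have hK0 : 0 ≤ K := (abs_nonneg _).trans (hK 0)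
  have hMU : L ≤ M := by simp only [M]; linarith
  have hhbi : Integrable hb := by
    refine (h.h_integrable.norm).mono' hhbm.aestronglyMeasurable ?_
    filter_upwards [hhE] with ξ hξ
    rw [Real.norm_eq_abs, Real.norm_eq_abs, abs_of_nonneg (hall ξ).2.1, ← hξ]
    exact (hall ξ).2.2.2.1.trans (le_abs_self _)
  have hadm : Admissible c M (fun ξ => Θ.U ξ ^ 2 + hb ξ) Z := by
    refine ⟨⟨⟨h.deriv_U.continuous.measurable, measurable_startθ hqm hwm, fun _ => measurable_const⟩,
      fun ξ => (hL ξ).trans hMU, fun ξ i => ?_, fun η ξ _ => ?_⟩,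
      ⟨measurable_startN hqm hhbm hrm, measurable_startβ hrm, fun ξ => ⟨fun i => ?_, fun i => ?_,
        startβ_mem hα _⟩⟩, fun a b => ?_, ⟨h.U_mem.1.integrable_sq.add hhbi, fun _ ξ => ?_,
        fun _ ξ i => ?_⟩⟩
    · change |(0 : ℝ)| ≤ M
      rw [abs_zero]
      exact hL0.trans hMU
    · rw [hcq, ← (hyd η ξ).2]
      have h1 : Θ.y η - η ≤ K := (abs_le.1 (hK η)).2
      have h2 : -K ≤ Θ.y ξ - ξ := (abs_le.1 (hK ξ)).1
      simp only [M]
      linarith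
    · exact (startN_nonneg (hall ξ).1 (hall ξ).2.1 (hall ξ).2.2.1 i).1
    · refine (startN_nonneg (hall ξ).1 (hall ξ).2.1 (hall ξ).2.2.1 i).2.trans ?_
      have h1 := (hall ξ).2.2.2.1.trans ((le_abs_self _).trans (hall ξ).2.2.2.2.2)
      have h2 := (hall ξ).2.2.2.2.1
      simp only [M]
      linarith
    · rw [hcw]
      exact (hUd a b).2
    · exact le_add_of_nonneg_right (hall ξ).2.1
    · refine le_trans ?_ (le_add_of_nonneg_left (sq_nonneg _))
      have hN := fun i => (startN_nonneg (hall ξ).1 (hall ξ).2.1 (hall ξ).2.2.1 i).1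
      have hi : startN (q ξ) (hb ξ) (r ξ) i * angH (startβ α (r ξ) i) (startθ (q ξ) (w ξ) i) 0 ≤ hb ξ := by
        conv_rhs => rw [← (hlab ξ).2.2]
        exact Finset.single_le_sum (f := fun i => startN (q ξ) (hb ξ) (r ξ) i *
          angH (startβ α (r ξ) i) (startθ (q ξ) (w ξ) i) ((0 : Fin 2 → ℝ) i))
          (fun j _ => mul_nonneg (hN j) (angH_nonneg (startβ_mem hα _ _))) (Finset.mem_univ i)
      rw [angH, crossFactor_startθ, Real.exp_zero, one_mul, one_mul] at hi
      exact hi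
  obtain ⟨X, hX0, hX⟩ := hadm.exists_flow
  have hqC : MemE fun ξ => q ξ - 1 := h.zetaXi_mem.congr_ae (hqE.mono fun ξ hξ => by simp only [hξ])
  refine ⟨c, X, Θ.y, hh, r, ⟨hX, ?_, ?_, ⟨K, hK⟩, h.zeta_lim, ?_, hhm, h.h_integrable.congr hhE.symm,
    ⟨B, fun ξ => (hall ξ).2.2.2.2.2⟩, fun ξ => ?_, hrm, h.r_mem.congr_ae hrE.symm, ?_, ?_,
    ⟨C⁻¹, inv_pos.2 hC0, ?_⟩⟩, ?_⟩
  · rw [hX0, hcw]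
    exact fun a b => (hUd a b).2
  · rw [hX0, hcq]
    exact fun a b => (hyd a b).2
  · rw [hX0, hcq]
    exact hqC
  · rw [hX0, hch]
    exact (hall ξ).2.2.2.1
  · rw [hX0]
    exact fun ξ i => startθ_nonneg _ _ i
  · rw [hX0]
    exact fun ξ => startNormal (hall ξ).1 (hall ξ).2.2.1
  · rw [hX0, hcq]
    filter_upwards [hC, hqE, hhE] with ξ h1 h2 h3
    rw [h2, h3]
    have := h1.2
    rw [div_le_iff₀ h1.1] at this
    rwa [inv_le_iff_one_le_mul₀ hC0, mul_comm]
  · have hcl : ∀ {f : ℝ → ℝ} {u : ℝ →ₘ[volume] ℝ}, Measurable f → f =ᵐ[volume] u →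
        toClass f = u := fun hf hu => AEEqFun.ext ((toClass_ae hf.aestronglyMeasurable).trans hu)
    have hd0 : densPath c X hh 0 = hh := by funext ξ; simp [densPath]
    unfold flowState
    rw [hX0, hcq, hcw, hch, hd0, hcl hqm hqE, hcl hwm hwE, hcl hhbm hhbE, hcl hhm hhE, hcl hrm hrE]
    have : posPath X Θ.y 0 = Θ.y := by funext ξ; simp [posPath]
    rw [this]

/-! ### Uniqueness at one label -/

lemma nextBreak_spec {p : ℝ → ℝ} {a b : ℝ} (h : nextBreak p a = b) :
    a < b ∧ (∀ s ∈ Ioo a b, 0 < p s) ∧ p b = 0 := by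
  by_cases hex : ∃ t, a < t ∧ (∀ s ∈ Ioo a t, 0 < p s) ∧ p t = 0
  · obtain ⟨t, h1, h2, h3⟩ := hex
    rw [nextBreak_eq_of_pos h1 h2 h3, EReal.coe_eq_coe_iff] at h
    exact h ▸ ⟨h1, h2, h3⟩
  · rw [nextBreak, if_neg hex] at h
    exact absurd h.symm (EReal.coe_ne_top b)

/-- Uniqueness for the linear system between breaking times. -/
lemma linear_system_unique {a q w g q' w' g' : ℝ → ℝ} {s t A : ℝ} (hst : s ≤ t)
    (hA : ∀ r ∈ Icc s t, |a r| ≤ A) (hq : IsPrimitiveOn q w s t)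
    (hw : IsPrimitiveOn w (fun r => 1 / 2 * g r + a r * q r) s t)
    (hg : IsPrimitiveOn g (fun r => 2 * a r * w r) s t) (hq' : IsPrimitiveOn q' w' s t)
    (hw' : IsPrimitiveOn w' (fun r => 1 / 2 * g' r + a r * q' r) s t)
    (hg' : IsPrimitiveOn g' (fun r => 2 * a r * w' r) s t)
    (h0 : q s = q' s ∧ w s = w' s ∧ g s = g' s) : q t = q' t ∧ w t = w' t ∧ g t = g' t := by
  have hlin : IsPrimitiveOn (fun r => -(2 + 3 * A) * r) (fun _ => -(2 + 3 * A) * 1) s t := by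
    have : IsPrimitiveOn (fun r => r) (fun _ => (1 : ℝ)) s t :=
      ⟨intervalIntegrable_const, fun t _ => by simp⟩
    exact this.const_mul _
  have dq := hq.sub hq'
  have dw := hw.sub hw'
  have dg := hg.sub hg'
  have hE := ((dq.mul dq).add (dw.mul dw)).add (dg.mul dg)
  have hmono := (hlin.exp.mul hE.neg).le_of_deriv_nonneg hst (.of_forall fun r hr => ?_)
  · simp only [h0.1, h0.2.1, h0.2.2, sub_self, mul_zero, add_zero, neg_zero] at hmono
    have h1 : (q t - q' t) * (q t - q' t) + (w t - w' t) * (w t - w' t) +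
        (g t - g' t) * (g t - g' t) ≤ 0 := by
      by_contra! hlt
      have := mul_pos (Real.exp_pos (-(2 + 3 * A) * t)) hlt
      linarith
    have h2 := mul_self_nonneg (q t - q' t)
    have h3 := mul_self_nonneg (w t - w' t)
    have h4 := mul_self_nonneg (g t - g' t)
    exact ⟨sub_eq_zero.1 (mul_self_eq_zero.1 (by linarith)),
      sub_eq_zero.1 (mul_self_eq_zero.1 (by linarith)), sub_eq_zero.1 (mul_self_eq_zero.1 (by linarith))⟩
  · have ha := abs_le.1 (hA r hr)
    set x := q r - q' r
    set y := w r - w' r with hy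
    set z := g r - g' r
    have h1 : 1 / 2 * g r + a r * q r - (1 / 2 * g' r + a r * q' r) = 1 / 2 * z + a r * x := by
      simp only [x, z]; ring
    have h2 : 2 * a r * w r - 2 * a r * w' r = 2 * a r * y := by simp only [y]; ring
    rw [h1, h2]
    have h3 : a r * (2 * (x * y)) ≤ A * (x ^ 2 + y ^ 2) := by
      nlinarith [sq_nonneg (x - y), sq_nonneg (x + y)]
    have h4 : a r * (4 * (y * z)) ≤ A * (2 * (y ^ 2 + z ^ 2)) := by
      nlinarith [sq_nonneg (y - z), sq_nonneg (y + z)]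
    have hA0 : 0 ≤ A := by linarith
    have h5 : 0 ≤ (2 + 3 * A) * (x * x + y * y + z * z) - (y * x + x * y +
        ((1 / 2 * z + a r * x) * y + y * (1 / 2 * z + a r * x)) + (2 * a r * y * z + z * (2 * a r * y))) := by
      nlinarith [sq_nonneg (x - y), sq_nonneg (y - z), mul_nonneg hA0 (sq_nonneg x),
        mul_nonneg hA0 (sq_nonneg z)]
    have := mul_nonneg (Real.exp_pos (-(2 + 3 * A) * r)).le h5
    linarith

/-- The value at a point is determined by the values at nearby earlier points. -/
lemma eq_of_eqOn_left {f g : ℝ → ℝ} {F G : ℝ → ℝ} {τ b : ℝ} (hf : Evolves f F) (hg : Evolves g G)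
    (h0 : 0 ≤ τ) (hb : τ < b) (h : ∀ t, τ ≤ t → t < b → f t = g t) : f b = g b := by
  have hc : ∀ {f F : ℝ → ℝ}, Evolves f F → Tendsto f (𝓝[<] b) (𝓝 (f b)) := fun hf => by
    have h1 := (hf.isPrimitiveOn (h0.trans hb.le)).continuousOn
    rw [uIcc_of_le (h0.trans hb.le)] at h1
    refine (h1 b ⟨h0.trans hb.le, le_rfl⟩).mono_left (le_inf nhdsWithin_le_nhds ?_)
    exact le_principal_iff.2 (mem_of_superset (Ioo_mem_nhdsLT hb) fun x hx => ⟨h0.trans hx.1.le, hx.2.le⟩)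
  refine tendsto_nhds_unique (hc hf) ((hc hg).congr' ?_)
  filter_upwards [Ioo_mem_nhdsLT hb] with x hx
  exact (h x hx.1.le hx.2).symm

namespace LabelSolution

variable {α T A : ℝ} {a q w g a' q' w' g' : ℝ → ℝ} (h : LabelSolution α a q w g)
  (h' : LabelSolution α a' q' w' g') (hA : ∀ t ∈ Icc 0 T, |a t| ≤ A)
  (haa : ∀ t ∈ Icc 0 T, a t = a' t)
include h h' hA haa

lemma eq_between {n : ℕ} {τ t : ℝ} (hτ : breakTime q n = τ) (hτ' : breakTime q' n = τ)
    (he : q τ = q' τ ∧ w τ = w' τ ∧ g τ = g' τ) (hle : τ ≤ t) (htT : t ≤ T)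
    (ht : (t : EReal) < breakTime q (n + 1)) :
    (t : EReal) < breakTime q' (n + 1) ∧ q t = q' t ∧ w t = w' t ∧ g t = g' t := by
  have h0 := breakTime_coe_nonneg hτ
  have key : ∀ t, τ ≤ t → t ≤ T → (t : EReal) < breakTime q (n + 1) →
      (t : EReal) < breakTime q' (n + 1) → q t = q' t ∧ w t = w' t ∧ g t = g' t := by
    intro t hle htT ht ht'
    have hmem : τ ∈ uIcc 0 t ∧ t ∈ uIcc 0 t := LabelFlow.mem_uIcc h0 hle le_rfl
    have haa' : ∀ r ∈ uIcc τ t, a' r = a r := fun r hr => by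
      rw [uIcc_of_le hle] at hr
      exact (haa r ⟨h0.trans hr.1, hr.2.trans htT⟩).symm
    have hp := fun {f F : ℝ → ℝ} (hf : Evolves f F) =>
      (hf.isPrimitiveOn (h0.trans hle)).mono hmem.1 hmem.2
    exact linear_system_unique hle (fun r hr => hA r ⟨h0.trans hr.1, hr.2.trans htT⟩) (hp h.q_eq)
      (hp h.w_eq) (h.hb_eq n τ t hτ hle ht) (hp h'.q_eq)
      ((hp h'.w_eq).congr_deriv (.of_forall fun r hr => by rw [haa' r hr]))
      ((h'.hb_eq n τ t hτ' hle ht').congr_deriv (.of_forall fun r hr => by rw [haa' r hr])) he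
  have hlt : (t : EReal) < breakTime q' (n + 1) := by
    by_contra hge
    have hge := not_lt.1 hge
    have hnt : breakTime q' (n + 1) ≠ ⊤ := fun h => by simp [h] at hge
    have hnb : breakTime q' (n + 1) ≠ ⊥ := fun h => by
      have := breakTime_nonneg q' (n + 1)
      simp [h] at this
    obtain ⟨b, hb⟩ : ∃ b : ℝ, breakTime q' (n + 1) = b := ⟨_, (EReal.coe_toReal hnt hnb).symm⟩
    rw [hb, EReal.coe_le_coe_iff] at hge
    obtain ⟨h1, h2, h3⟩ := nextBreak_spec (breakTime_succ hτ' ▸ hb)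
    have hlt : ∀ x, x < b → (x : EReal) < breakTime q (n + 1) ∧ (x : EReal) < breakTime q' (n + 1) :=
      fun x hx => ⟨lt_of_le_of_lt (EReal.coe_le_coe_iff.2 (hx.le.trans hge)) ht,
        hb ▸ EReal.coe_lt_coe_iff.2 hx⟩
    have hag : ∀ x, τ ≤ x → x < b → q x = q' x := fun x hx hxb =>
      (key x hx (by linarith) (hlt x hxb).1 (hlt x hxb).2).1
    have hqb := eq_of_eqOn_left h.q_eq h'.q_eq h0 h1 hag
    have := nextBreak_eq_of_pos h1 (fun s hs => hag s hs.1.le hs.2 ▸ h2 s hs) (hqb.trans h3)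
    rw [breakTime_succ hτ, this, EReal.coe_lt_coe_iff] at ht
    exact absurd ht (not_lt.2 hge)
  exact ⟨hlt, key t hle htT ht hlt⟩

lemma eq_at_break (he : q 0 = q' 0 ∧ w 0 = w' 0 ∧ g 0 = g' 0) (n : ℕ) : ∀ τ : ℝ, τ ≤ T →
    breakTime q n = τ → breakTime q' n = τ ∧ q τ = q' τ ∧ w τ = w' τ ∧ g τ = g' τ := by
  induction n with
  | zero =>
    intro τ _ hτ
    rw [breakTime_zero, EReal.coe_eq_coe_iff] at hτ
    rw [← hτ]
    exact ⟨breakTime_zero _, he⟩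
  | succ n ih =>
    intro b hbT hb
    have hnt : breakTime q n ≠ ⊤ := fun h => by
      rw [breakTime_succ_of_top h] at hb
      exact EReal.coe_ne_top b hb.symm
    have hnb : breakTime q n ≠ ⊥ := fun h => by
      have := breakTime_nonneg q n
      simp [h] at this
    obtain ⟨τ, hτ⟩ : ∃ τ : ℝ, breakTime q n = τ := ⟨_, (EReal.coe_toReal hnt hnb).symm⟩
    obtain ⟨h1, h2, h3⟩ := nextBreak_spec (breakTime_succ hτ ▸ hb)
    have h0 := breakTime_coe_nonneg hτ
    obtain ⟨hτ', heτ⟩ := ih τ (h1.le.trans hbT) hτ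
    have hag := fun x (hx : τ ≤ x) (hxb : x < b) => (h.eq_between h' hA haa hτ hτ' heτ hx
      (hxb.le.trans hbT) (hb ▸ EReal.coe_lt_coe_iff.2 hxb)).2
    have hqb := eq_of_eqOn_left h.q_eq h'.q_eq h0 h1 fun x hx hxb => (hag x hx hxb).1
    have hwb := eq_of_eqOn_left h.w_eq h'.w_eq h0 h1 fun x hx hxb => (hag x hx hxb).2.1
    have hb' : breakTime q' (n + 1) = b := by
      rw [breakTime_succ hτ']
      exact nextBreak_eq_of_pos h1 (fun s hs => (hag s hs.1.le hs.2).1 ▸ h2 s hs) (hqb ▸ h3)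
    obtain ⟨l, hl, hgl⟩ := h.hb_jump n b hb
    obtain ⟨l', hl', hgl'⟩ := h'.hb_jump n b hb'
    have hll : l = l' := tendsto_nhds_unique hl (hl'.congr' (by
      filter_upwards [Ioo_mem_nhdsLT h1] with x hx
      exact (hag x hx.1.le hx.2).2.2.symm))
    exact ⟨hb', hqb, hwb, by rw [hgl, hgl', hll]⟩

omit h' hA haa in
lemma exists_breakTime_le {t : ℝ} (ht : 0 ≤ t) :
    ∃ n, ∃ τ : ℝ, breakTime q n = τ ∧ τ ≤ t ∧ (t : EReal) < breakTime q (n + 1) := by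
  have hex : ∃ n, (t : EReal) < breakTime q n :=
    (h.tendsto.eventually (lt_mem_nhds (EReal.coe_lt_top t))).exists
  classical
  obtain ⟨n, hn⟩ : ∃ n, Nat.find hex = n + 1 := by
    refine Nat.exists_eq_succ_of_ne_zero fun h0 => ?_
    have := Nat.find_spec hex
    rw [h0, breakTime_zero, EReal.coe_lt_coe_iff] at this
    linarith
  have h1 := not_lt.1 (Nat.find_min hex (m := n) (by omega))
  have h2 := Nat.find_spec hex
  rw [hn] at h2
  have hnt : breakTime q n ≠ ⊤ := fun h => by simp [h] at h1
  have hnb : breakTime q n ≠ ⊥ := fun h => by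
    have := breakTime_nonneg q n
    simp [h] at this
  refine ⟨n, _, (EReal.coe_toReal hnt hnb).symm, ?_, h2⟩
  rwa [← EReal.coe_le_coe_iff, EReal.coe_toReal hnt hnb]

/-- The evolution at a label is determined by the initial values and the coefficient. -/
theorem unique (he : q 0 = q' 0 ∧ w 0 = w' 0 ∧ g 0 = g' 0) {t : ℝ} (ht : t ∈ Icc 0 T) :
    q t = q' t ∧ w t = w' t ∧ g t = g' t := by
  obtain ⟨n, τ, hτ, hle, hlt⟩ := h.exists_breakTime_le ht.1
  obtain ⟨hτ', heτ⟩ := h.eq_at_break h' hA haa he n τ (hle.trans ht.2) hτ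
  exact (h.eq_between h' hA haa hτ hτ' heτ hle ht.2 hlt).2

omit h' hA haa in
/-- `h̄` is continuous from the right. -/
lemma hb_tendsto {t : ℝ} (ht : 0 ≤ t) : Tendsto g (𝓝[>] t) (𝓝 (g t)) := by
  obtain ⟨n, τ, hτ, hle, hlt⟩ := h.exists_breakTime_le ht
  obtain ⟨b, h1, h2⟩ := EReal.lt_iff_exists_real_btwn.1 hlt
  have h1 : t < b := EReal.coe_lt_coe_iff.1 h1
  have hc := (h.hb_eq n τ b hτ (hle.trans h1.le) h2).continuousOn
  rw [uIcc_of_le (hle.trans h1.le)] at hc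
  refine (hc t ⟨hle, h1.le⟩).mono_left (le_inf nhdsWithin_le_nhds ?_)
  exact le_principal_iff.2 (mem_of_superset (Ioo_mem_nhdsGT h1) fun x hx => ⟨hle.trans hx.1.le, hx.2.le⟩)

end LabelSolution

/-- The part of the evolution at a label that does not involve `y`, `U`, `h` and `r`. -/
lemma SolvesAt.labelSolution {α ξ : ℝ} {Θ : ℝ → LagState} {q w hb h r : ℝ → ℝ}
    (hs : SolvesAt α Θ ξ q w hb h r) :
    LabelSolution α (fun t => (Θ t).U ξ ^ 2 - (Θ t).P ξ) q w hb := by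
  refine ⟨hs.tau_tendsto, hs.q_eq, hs.w_eq, fun n τ t hτ hle ht => ?_, hs.hb_jump⟩
  have h0 := breakTime_coe_nonneg hτ
  have hmem := LabelFlow.mem_uIcc h0 hle le_rfl
  have hp := (hs.h_eq.isPrimitiveOn (h0.trans hle)).mono hmem.1 hmem.2
  refine ⟨hp.1, fun x hx => ?_⟩
  have h1 := hp.2 x hx
  rw [uIcc_of_le hle] at hx
  have h2 := hs.hb_eq n τ x hτ hx.1 (lt_of_le_of_lt (EReal.coe_le_coe_iff.2 hx.2) ht)
  linarith

/-! ### Measurability and ordinary differential equations with parameters -/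

/-- A family of measurable functions that is continuous from the right in time has a jointly
measurable modification. -/
lemma exists_measurable_modification {u : ℝ → ℝ → ℝ} (hm : ∀ t, 0 ≤ t → AEMeasurable (u t) volume)
    (hr : ∀ᵐ ξ, ∀ t, 0 ≤ t → Tendsto (fun s => u s ξ) (𝓝[>] t) (𝓝 (u t ξ))) :
    ∃ v : ℝ → ℝ → ℝ, Measurable (Function.uncurry v) ∧ ∀ t, 0 ≤ t → v t =ᵐ[volume] u t := by
  obtain ⟨g, hg⟩ : ∃ g : ℕ → ℕ → ℝ, ∀ n k, g n k = ((k : ℝ) + 1) / ((n : ℝ) + 1) :=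
    ⟨_, fun _ _ => rfl⟩
  have hg0 : ∀ n k, 0 ≤ g n k := fun n k => by rw [hg]; positivity
  choose m hmm hmu using fun n k => hm _ (hg0 n k)
  obtain ⟨f, hfm⟩ : ∃ f : ℕ → ℝ × ℝ → ℝ, ∀ n p, f n p = m n ⌊p.1 * (n + 1)⌋₊ p.2 :=
    ⟨_, fun _ _ => rfl⟩
  have hf : ∀ n, Measurable (f n) := fun n => by
    have h1 : Measurable fun p : ℕ × ℝ => m n p.1 p.2 := measurable_from_prod_countable_right (hmm n)
    have h2 : Measurable fun p : ℝ × ℝ => (⌊p.1 * (n + 1)⌋₊, p.2) :=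
      (Nat.measurable_floor.comp (measurable_fst.mul_const _)).prodMk measurable_snd
    rw [show f n = _ from funext (hfm n)]
    exact h1.comp h2
  have hlm : Measurable fun p : ℝ × ℝ => limsup (fun n => f n p) atTop := .limsup hf
  refine ⟨fun t ξ => limsup (fun n => f n (t, ξ)) atTop, hlm, fun t ht => ?_⟩
  have hall : ∀ᵐ ξ, ∀ n k, u (g n k) ξ = m n k ξ :=
    ae_all_iff.2 fun n => ae_all_iff.2 fun k => hmu n k
  filter_upwards [hall, hr] with ξ h1 h2
  refine Tendsto.limsup_eq ?_
  have hfe : ∀ n : ℕ, f n (t, ξ) = u (g n ⌊t * (n + 1)⌋₊) ξ := fun n => by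
    rw [hfm, h1]
  simp only [hfe]
  refine (h2 t ht).comp (tendsto_nhdsWithin_iff.2 ⟨?_, .of_forall fun n => ?_⟩)
  · refine tendsto_of_tendsto_of_tendsto_of_le_of_le (g := fun _ => t)
      (h := fun n : ℕ => t + 1 / ((n : ℝ) + 1)) tendsto_const_nhds ?_ (fun n => ?_) fun n => ?_
    · simpa using tendsto_one_div_add_atTop_nhds_zero_nat.const_add t
    · have hn : (0 : ℝ) < (n : ℝ) + 1 := by positivity
      simp only [hg]
      rw [le_div_iff₀ hn]
      exact (Nat.lt_floor_add_one _).le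
    · have hn : (0 : ℝ) < (n : ℝ) + 1 := by positivity
      simp only [hg]
      rw [add_div]
      have := Nat.floor_le (mul_nonneg ht hn.le)
      have : (⌊t * (n + 1)⌋₊ : ℝ) / (n + 1) ≤ t := by rwa [div_le_iff₀ hn]
      linarith
  · have hn : (0 : ℝ) < (n : ℝ) + 1 := by positivity
    simp only [hg, mem_Ioi]
    rw [lt_div_iff₀ hn]
    exact Nat.lt_floor_add_one _

/-- Carathéodory solutions of `v_t = F(t, ξ, v)` that depend measurably on `ξ`. -/
lemma exists_caratheodory {F : ℝ → ℝ → ℝ → ℝ} {u₀ : ℝ → ℝ} {B L : ℝ} (hu₀ : Measurable u₀)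
    (hF : Measurable fun p : (ℝ × ℝ) × ℝ => F p.1.1 p.1.2 p.2) (hB : ∀ t ξ x, |F t ξ x| ≤ B)
    (hL0 : 0 < L) (hL : ∀ t ξ x x', |F t ξ x - F t ξ x'| ≤ L * |x - x'|) :
    ∃ v : ℝ → ℝ → ℝ, (∀ t, Measurable (v t)) ∧ (∀ ξ, Continuous fun t => v t ξ) ∧
      ∀ t, 0 ≤ t → ∀ ξ, v t ξ = u₀ ξ + ∫ r in (0 : ℝ)..t, F r ξ (v r ξ) := by
  have hB0 : 0 ≤ B := (abs_nonneg _).trans (hB 0 0 0)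
  set step : (ℝ → ℝ → ℝ) → ℝ → ℝ → ℝ := fun v t ξ =>
    u₀ ξ + ∫ r in (0 : ℝ)..max t 0, F r ξ (v r ξ)
  set s : ℕ → ℝ → ℝ → ℝ := fun n => step^[n] fun _ => u₀
  have hs : ∀ n, s (n + 1) = step (s n) := fun n => Function.iterate_succ_apply' _ _ _
  have hse : ∀ n t ξ, s (n + 1) t ξ = u₀ ξ + ∫ r in (0 : ℝ)..max t 0, F r ξ (s n r ξ) :=
    fun n t ξ => by rw [hs]
  have hgood : ∀ n, (∀ t, Measurable (s n t)) ∧ ∀ ξ, Continuous fun t => s n t ξ := by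
    intro n
    induction n with
    | zero => exact ⟨fun _ => hu₀, fun _ => continuous_const⟩
    | succ n ih =>
      have hj : Measurable (Function.uncurry fun r ξ => F r ξ (s n r ξ)) := hF.comp
        (measurable_id.prodMk (measurable_uncurry_of_continuous_of_measurable ih.2 ih.1))
      rw [hs]
      exact ⟨fun t => hu₀.add (measurable_intervalIntegral_left hj _ _), fun ξ => continuous_const.add
        ((intervalIntegral.continuous_primitive (fun a b => intervalIntegrable_of_measurable
          (hj.of_uncurry_right (y := ξ)) (fun _ => hB _ _ _) a b) 0).comp
          (continuous_id.max continuous_const))⟩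
  have hint : ∀ n ξ a b, IntervalIntegrable (fun r => F r ξ (s n r ξ)) volume a b := fun n ξ a b =>
    intervalIntegrable_of_measurable (hF.comp ((measurable_id.prodMk measurable_const).prodMk
      ((hgood n).2 ξ).measurable)) (fun _ => hB _ _ _) a b
  set C := B / L
  have hC0 : 0 ≤ C := by positivity
  have hdist : ∀ n t ξ, |s (n + 1) t ξ - s n t ξ| ≤ C * Real.exp (2 * L * max t 0) / 2 ^ n := by
    intro n
    induction n with
    | zero =>
      intro t ξ
      rw [hs]
      simp only [step, pow_zero, div_one]
      have h0 : s 0 t ξ = u₀ ξ := rfl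
      rw [h0, add_sub_cancel_left]
      have hm := le_max_right t 0
      have h1 := intervalIntegral.norm_integral_le_of_norm_le_const (a := 0) (b := max t 0)
        (f := fun r => F r ξ (s 0 r ξ)) (C := B) fun r _ => hB _ _ _
      rw [sub_zero, abs_of_nonneg hm] at h1
      refine h1.trans ?_
      have h2 := Real.add_one_le_exp (2 * L * max t 0)
      have h3 : 0 ≤ L * max t 0 := by positivity
      calc B * max t 0 = C * (L * max t 0) := by simp only [C]; field_simp
        _ ≤ C * Real.exp (2 * L * max t 0) := by gcongr; linarith
    | succ n ih =>
      intro t ξ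
      have e : s (n + 1 + 1) t ξ - s (n + 1) t ξ = (∫ r in (0 : ℝ)..max t 0, F r ξ (s (n + 1) r ξ)) -
          ∫ r in (0 : ℝ)..max t 0, F r ξ (s n r ξ) := by
        rw [hse (n + 1) t ξ, hse n t ξ, add_sub_add_left_eq_sub]
      rw [e, ← intervalIntegral.integral_sub (hint _ _ _ _) (hint _ _ _ _)]
      have hm := le_max_right t 0
      have hd : ∀ x, HasDerivAt (fun x => C / 2 ^ (n + 1) * Real.exp (2 * L * x))
          (L * (C * Real.exp (2 * L * x) / 2 ^ n)) x := fun x => by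
        have := (((hasDerivAt_id x).const_mul (2 * L)).exp).const_mul (C / 2 ^ (n + 1))
        refine this.congr_deriv ?_
        simp only [id, mul_one]
        rw [pow_succ]
        field_simp
      have hc : Continuous fun x => L * (C * Real.exp (2 * L * x) / 2 ^ n) := by fun_prop
      have h1 := intervalIntegral.norm_integral_le_of_norm_le (a := 0) (b := max t 0) hm
        (f := fun r => F r ξ (s (n + 1) r ξ) - F r ξ (s n r ξ))
        (g := fun x => L * (C * Real.exp (2 * L * x) / 2 ^ n)) (.of_forall fun r hr => by
          refine (hL _ _ _ _).trans ?_
          have := ih r ξ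
          rw [max_eq_left hr.1.le] at this
          gcongr) (hc.intervalIntegrable (μ := volume) _ _)
      rw [intervalIntegral.integral_eq_sub_of_hasDerivAt (fun x _ => hd x)
        (hc.intervalIntegrable _ _)] at h1
      refine h1.trans ?_
      simp only [mul_zero, Real.exp_zero, mul_one]
      have : 0 ≤ C / 2 ^ (n + 1) := by positivity
      rw [mul_div_right_comm]
      linarith
  have hlim : ∀ t ξ, ∃ x, Tendsto (fun n => s n t ξ) atTop (𝓝 x) := fun t ξ =>
    cauchySeq_tendsto_of_complete (cauchySeq_of_le_geometric_two
      (C := 2 * (C * Real.exp (2 * L * max t 0))) fun n => by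
      rw [dist_comm, Real.dist_eq, mul_div_cancel_left₀ _ two_ne_zero]
      exact hdist n t ξ)
  choose v hv using hlim
  have hvm : ∀ ξ, Measurable fun t => v t ξ := fun ξ =>
    measurable_of_tendsto_metrizable (fun n => ((hgood n).2 ξ).measurable)
      (tendsto_pi_nhds.2 fun t => hv t ξ)
  have heq : ∀ t ξ, v t ξ = u₀ ξ + ∫ r in (0 : ℝ)..max t 0, F r ξ (v r ξ) := fun t ξ => by
    refine tendsto_nhds_unique ((hv t ξ).comp (tendsto_add_atTop_nat 1)) ?_
    simp only [Function.comp_def, hse]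
    refine Tendsto.const_add _ (intervalIntegral.tendsto_integral_filter_of_dominated_convergence
      (fun _ => B) (.of_forall fun n => ?_) (.of_forall fun n => .of_forall fun r _ => hB _ _ _)
      intervalIntegrable_const (.of_forall fun r _ => ?_))
    · exact (hint n ξ 0 (max t 0)).aestronglyMeasurable_restrict_uIoc
    · have hcont : Continuous (F r ξ) := (LipschitzWith.of_dist_le_mul (K := L.toNNReal) fun x y => by
        rw [Real.coe_toNNReal _ hL0.le]; exact hL r ξ x y).continuous
      exact (hcont.tendsto _).comp (hv r ξ)
  refine ⟨v, fun t => measurable_of_tendsto_metrizable (fun n => (hgood n).1 t)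
    (tendsto_pi_nhds.2 fun ξ => hv t ξ), fun ξ => ?_, fun t ht ξ => ?_⟩
  · have : (fun t => v t ξ) = fun t => u₀ ξ + ∫ r in (0 : ℝ)..max t 0, F r ξ (v r ξ) :=
      funext fun t => heq t ξ
    rw [this]
    refine continuous_const.add ((intervalIntegral.continuous_primitive (fun a b =>
      intervalIntegrable_of_measurable (hF.comp ((measurable_id.prodMk measurable_const).prodMk
        (hvm ξ))) (fun _ => hB _ _ _) a b) 0).comp (continuous_id.max continuous_const))
  · have := heq t ξ
    rwa [max_eq_left ht] at this

/-! ### Bounds for solutions -/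

lemma integral_sq_le_of_eLpNorm_two_le {u : ℝ → ℝ} (hu : AEStronglyMeasurable u volume) {C : ℝ≥0}
    (h : eLpNorm u 2 volume ≤ C) : Integrable (fun x => u x ^ 2) ∧ ∫ x, u x ^ 2 ≤ C ^ 2 := by
  have hm : MemLp u 2 volume := ⟨hu, h.trans_lt ENNReal.coe_lt_top⟩
  refine ⟨hm.integrable_sq, ?_⟩
  rw [hm.eLpNorm_eq_integral_rpow_norm two_ne_zero ENNReal.ofNat_ne_top] at h
  have h1 := ENNReal.toReal_mono ENNReal.coe_ne_top h
  have e : ∀ x, ‖u x‖ ^ (2 : ℝ≥0∞).toReal = u x ^ 2 := fun x => by simp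
  simp only [e] at h1
  have h0 : 0 ≤ ∫ x, u x ^ 2 := integral_nonneg fun x => sq_nonneg _
  have e2 : (2 : ℝ≥0∞).toReal⁻¹ = 1 / 2 := by norm_num
  rw [e2, ← Real.sqrt_eq_rpow, ENNReal.toReal_ofReal (Real.sqrt_nonneg _), ENNReal.coe_toReal] at h1
  exact (Real.sqrt_le_left C.2).1 h1

/-- The nonlocal terms of a solution are bounded on bounded time intervals. -/
lemma SolutionRegularity.exists_bound {Θ : ℝ → LagState} (h : SolutionRegularity Θ) (T : ℝ) :
    ∃ K, ∀ t ∈ Icc 0 T, ∀ ξ, |(Θ t).y ξ - ξ| ≤ K ∧ |(Θ t).P ξ| ≤ K ∧ |(Θ t).Q ξ| ≤ K := by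
  obtain ⟨Cy, hCy⟩ := h.zeta T
  obtain ⟨CU, hCU⟩ := h.U T
  obtain ⟨Cq, hCq⟩ := h.zetaXi.1 T
  obtain ⟨Ch, hCh⟩ := h.hb T
  set I := 2 * (1 + Cq) * (CU : ℝ) ^ 2 + 1 / 2 * (Real.exp (2 * Cy) * 2) + 1 / 2 * (Ch : ℝ) ^ 2
  have hI0 : 0 ≤ I := by positivity
  refine ⟨Cy + I, fun t ht ξ => ?_⟩
  have hyc := (h.deriv_y t ht.1).continuous
  have hUc := (h.deriv_U t ht.1).continuous
  have hy : ∀ x, |(Θ t).y x - x| ≤ Cy :=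
    (hyc.sub continuous_id).abs_le_of_ae (ae_abs_le_of_eLpNorm_top_le (hCy t ht))
  have hq := ae_abs_le_of_eLpNorm_top_le (le_add_self.trans (hCq t ht))
  have hU := integral_sq_le_of_eLpNorm_two_le hUc.aestronglyMeasurable (hCU t ht)
  have hb := integral_sq_le_of_eLpNorm_two_le (Θ t).hb.aestronglyMeasurable (hCh t ht)
  have hker := integrable_expKernel (c := 1) one_pos ξ
  have hker2 := integral_expKernel (c := 1) one_pos ξ
  set G : ℝ → ℝ := fun η => 2 * (1 + Cq) * (Θ t).U η ^ 2 +
    1 / 2 * (Real.exp (2 * Cy) * Real.exp (-(1 * |ξ - η|))) + 1 / 2 * (Θ t).hb η ^ 2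
  have hi1 := hU.1.const_mul (2 * (1 + (Cq : ℝ)))
  have hi2 := (hker.const_mul (Real.exp (2 * Cy))).const_mul (1 / 2)
  have hi3 := hb.1.const_mul (1 / 2)
  have hG : ∫ η, G η ≤ I := by
    have e := integral_add (hi1.add hi2) hi3
    simp only [Pi.add_apply] at e
    simp only [G]
    rw [e, integral_add hi1 hi2]
    simp only [integral_const_mul, hker2]
    have h1 := hU.2
    have h2 := hb.2
    simp only [I]
    have : 0 ≤ 2 * (1 + (Cq : ℝ)) := by positivity
    have := mul_le_mul_of_nonneg_left h1 this
    linarith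
  have key : ∀ σ : ℝ → ℝ, (∀ x, |σ x| ≤ 1) → |∫ η, σ (ξ - η) * Real.exp (-|(Θ t).y ξ - (Θ t).y η|) *
      (2 * (Θ t).U η ^ 2 * (Θ t).q η + (Θ t).hb η)| ≤ I := fun σ hσ => by
    rw [← Real.norm_eq_abs]
    refine (norm_integral_le_of_norm_le (g := G) ((hi1.add hi2).add hi3) ?_).trans hG
    filter_upwards [hq] with η hqη
    simp only [G]
    rw [Real.norm_eq_abs, abs_mul, abs_mul, abs_of_pos (Real.exp_pos _)]
    set k := Real.exp (-|(Θ t).y ξ - (Θ t).y η|)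
    have hk0 : 0 < k := Real.exp_pos _
    have hk1 : k ≤ 1 := Real.exp_le_one_iff.2 (neg_nonpos.2 (abs_nonneg _))
    have hk2 : k ≤ Real.exp (2 * Cy) * Real.exp (-(1 * |ξ - η|)) := by
      rw [← Real.exp_add]
      refine Real.exp_le_exp.2 ?_
      have h1 := hy ξ
      have h2 := hy η
      have h3 := abs_sub ((Θ t).y ξ - ξ) ((Θ t).y η - η)
      have h4 := abs_sub ((Θ t).y ξ - (Θ t).y η) ((Θ t).y ξ - ξ - ((Θ t).y η - η))
      rw [show (Θ t).y ξ - (Θ t).y η - ((Θ t).y ξ - ξ - ((Θ t).y η - η)) = ξ - η by ring] at h4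
      linarith
    have h1 : |(Θ t).q η| ≤ 1 + Cq := by
      have := abs_add_le ((Θ t).q η - 1) 1
      rw [sub_add_cancel, abs_one] at this
      linarith
    have h2 : |2 * (Θ t).U η ^ 2 * (Θ t).q η + (Θ t).hb η| ≤
        2 * (1 + Cq) * (Θ t).U η ^ 2 + |(Θ t).hb η| := by
      refine (abs_add_le _ _).trans (add_le_add_left ?_ _)
      rw [abs_mul, abs_of_nonneg (by positivity)]
      nlinarith [sq_nonneg ((Θ t).U η)]
    have h3 : |σ (ξ - η)| * k ≤ k := mul_le_of_le_one_left hk0.le (hσ _)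
    refine (mul_le_mul h3 h2 (abs_nonneg _) hk0.le).trans ?_
    have h4 : k * (2 * (1 + Cq) * (Θ t).U η ^ 2) ≤ 2 * (1 + Cq) * (Θ t).U η ^ 2 :=
      mul_le_of_le_one_left (by positivity) hk1
    have h5 := sq_abs ((Θ t).hb η)
    nlinarith [sq_nonneg (k - |(Θ t).hb η|)]
  have hP := key (fun _ => 1) (by simp)
  have hQ := key Real.sign abs_sign_le_one
  refine ⟨(hy ξ).trans (by linarith), ?_, ?_⟩
  · simp only [one_mul] at hP
    unfold LagState.P
    rw [abs_mul, abs_of_pos (by norm_num : (0 : ℝ) < 1 / 4)]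
    have : (0 : ℝ) ≤ Cy := Cy.2
    linarith
  · unfold LagState.Q
    rw [abs_mul, abs_neg, abs_of_pos (by norm_num : (0 : ℝ) < 1 / 4)]
    have : (0 : ℝ) ≤ Cy := Cy.2
    linarith

/-! ### Uniqueness of dissipative solutions -/

lemma Evolves.tendsto_right {x F : ℝ → ℝ} (h : Evolves x F) {t : ℝ} (ht : 0 ≤ t) :
    Tendsto x (𝓝[>] t) (𝓝 (x t)) := by
  have hc := (h.isPrimitiveOn (add_nonneg ht zero_le_one)).continuousOn
  rw [uIcc_of_le (by linarith)] at hc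
  refine (hc t ⟨ht, by linarith⟩).mono_left (le_inf nhdsWithin_le_nhds (le_principal_iff.2 ?_))
  exact mem_of_superset (Ioo_mem_nhdsGT (lt_add_one t)) fun x hx => ⟨ht.trans hx.1.le, hx.2.le⟩

/-- The nonlocal terms of a solution are jointly measurable. -/
lemma IsDissipativeSolution.measurable_P_Q {α : ℝ} {Θ : ℝ → LagState}
    (hs : IsDissipativeSolution α Θ) :
    Measurable (Function.uncurry fun t ξ => (Θ (max t 0)).P ξ) ∧
      Measurable (Function.uncurry fun t ξ => (Θ (max t 0)).Q ξ) := by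
  obtain ⟨hreg, q, w, hb, h, r, hrep, -, hsol⟩ := hs
  obtain ⟨q₁, hq₁, hqe⟩ := exists_measurable_modification (u := q)
    (fun t ht => (Θ t).q.aestronglyMeasurable.aemeasurable.congr (hrep t ht).1)
    (hsol.mono fun ξ h t ht => h.q_eq.tendsto_right ht)
  obtain ⟨b₁, hb₁, hbe⟩ := exists_measurable_modification (u := hb)
    (fun t ht => (Θ t).hb.aestronglyMeasurable.aemeasurable.congr (hrep t ht).2.2.1)
    (hsol.mono fun ξ h t ht => h.labelSolution.hb_tendsto ht)
  obtain ⟨U₁, hU₁, hUe⟩ := exists_measurable_modification (u := fun t => (Θ t).U)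
    (fun t ht => (hreg.deriv_U t ht).continuous.aemeasurable)
    (hsol.mono fun ξ h t ht => h.U_eq.tendsto_right ht)
  have hm : ∀ {v : ℝ → ℝ → ℝ}, Measurable (Function.uncurry v) →
      Measurable (Function.uncurry fun t => v (max t 0)) := fun hv =>
    hv.comp ((measurable_fst.max measurable_const).prodMk measurable_snd)
  have ht : ∀ t : ℝ, 0 ≤ max t 0 := fun t => le_max_right _ _
  have hqa := fun t => (hrep _ (ht t)).1.trans (hqe _ (ht t)).symm
  have key := fun t => (Θ (max t 0)).P_Q_eq ((hreg.deriv_y _ (ht t)).congr_ae (hqa t)) (hqa t)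
    (hUe _ (ht t)).symm ((hrep _ (ht t)).2.2.1.trans (hbe _ (ht t)).symm)
  have hint : ∀ t a b, IntervalIntegrable (q₁ (max t 0)) volume a b := fun t a b =>
    (((hreg.deriv_y _ (ht t)).congr_ae (hqa t)) a b).1
  have hρ : Measurable (Function.uncurry fun t η => 2 * U₁ (max t 0) η ^ 2 * q₁ (max t 0) η +
      b₁ (max t 0) η) := ((((hm hU₁).pow_const 2).const_mul 2).mul (hm hq₁)).add (hm hb₁)
  have h1 := (measurable_nonlocalTerm (σ := fun _ => 1) measurable_const (hm hq₁) hρ hint).const_mul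
    (1 / 4)
  have h2 := (measurable_nonlocalTerm measurable_sign (hm hq₁) hρ hint).const_mul (-(1 / 4))
  refine ⟨?_, ?_⟩
  · convert h1 using 1
    exact funext fun p => (key p.1 p.2).1
  · convert h2 using 1
    exact funext fun p => (key p.1 p.2).2

/-- A label flow for a prescribed coefficient, depending measurably on the label. -/
lemma exists_labelFlow {c : Weights} {Z : AngState} {M A : ℝ} (hc : c.Valid M) (hZ : Z.Meas)
    (hθ : ∀ ξ i, 0 ≤ Z.θ ξ i) {a : ℝ → ℝ → ℝ} (ha : Measurable (Function.uncurry a))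
    (hA : ∀ t ξ, |a t ξ| ≤ A) :
    ∃ θ κ : ℝ → ℝ → Fin 2 → ℝ, (∀ t i, Measurable fun ξ => θ t ξ i) ∧
      (∀ t i, Measurable fun ξ => κ t ξ i) ∧ (∀ ξ i, Continuous fun t => θ t ξ i) ∧
      (∀ ξ i, Continuous fun t => κ t ξ i) ∧
      (∀ t, 0 ≤ t → ∀ ξ i, θ t ξ i = Z.θ ξ i + ∫ r in (0 : ℝ)..t, angF (a r ξ) (θ r ξ i)) ∧
      (∀ t ξ i, κ t ξ i = Z.κ ξ i + ∫ r in (0 : ℝ)..t, angG (a r ξ) (θ r ξ i)) ∧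
      ∀ ξ, LabelFlow (c.N ξ) (c.β ξ) (a · ξ) (θ · ξ) (κ · ξ) := by
  have hA0 := (abs_nonneg _).trans (hA 0 0)
  have hex := fun i => exists_caratheodory (F := fun t ξ x => angF (a t ξ) x) (B := 1 / 2 + A)
    (L := 1 + 2 * A) (hZ.θ i) (measurable_angF_comp (ha.comp measurable_fst) measurable_snd)
    (fun t ξ x => angF_bound (hA t ξ)) (by linarith)
    fun t ξ x x' => by simpa using abs_angF_sub_le (a' := a t ξ) (θ := x) (θ' := x') (hA t ξ)
  choose v hvm hvc hve using hex
  have hv : ∀ i, Measurable (Function.uncurry (v i)) := fun i =>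
    measurable_uncurry_of_continuous_of_measurable (hvc i) (hvm i)
  have hG : ∀ i, Measurable (Function.uncurry fun r ξ => angG (a r ξ) (v i r ξ)) := fun i =>
    measurable_angG_comp ha (hv i)
  have hGi := fun ξ i a' b => intervalIntegrable_of_measurable ((hG i).of_uncurry_right (y := ξ))
    (fun t => angG_bound (hA t ξ)) a' b
  have hFi := fun ξ i a' b => intervalIntegrable_of_measurable
    (measurable_angF_comp (ha.of_uncurry_right (y := ξ)) ((hv i).of_uncurry_right (y := ξ)))
    (fun t => angF_bound (hA t ξ)) a' b
  have h0 : ∀ ξ i, v i 0 ξ = Z.θ ξ i := fun ξ i => by simp [hve i 0 le_rfl ξ]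
  refine ⟨fun t ξ i => v i t ξ, fun t ξ i => Z.κ ξ i + ∫ r in (0 : ℝ)..t, angG (a r ξ) (v i r ξ),
    fun t i => hvm i t, fun t i => (hZ.κ i).add (measurable_intervalIntegral_left (hG i) 0 t),
    fun ξ i => hvc i ξ, fun ξ i => continuous_const.add
      (intervalIntegral.continuous_primitive (hGi ξ i) 0), fun t ht ξ i => hve i t ht ξ,
    fun _ _ _ => rfl, fun ξ => ⟨(hc.bound ξ).nonneg, (hc.bound ξ).beta,
      fun T => ha.of_uncurry_right.aemeasurable, fun T => ⟨A, fun t _ => hA t ξ⟩,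
      fun T hT i => ⟨hFi ξ i 0 T, fun t ht => ?_⟩, fun T hT i => ⟨hGi ξ i 0 T, fun t _ => ?_⟩,
      fun i => (hθ ξ i).trans_eq (h0 ξ i).symm⟩⟩
  · rw [uIcc_of_le hT] at ht
    simp only [h0]
    exact hve i t ht.1 ξ
  · simp

/-- A dissipative solution agrees with the flow that starts from the same state. -/
theorem FlowData.eq_of_isDissipativeSolution {α : ℝ} {c : Weights} {X : ℝ → AngState}
    {y₀ h₀ r₀ : ℝ → ℝ} (d : FlowData α c X y₀ h₀ r₀) {Θ : ℝ → LagState}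
    (hs : IsDissipativeSolution α Θ) (hΘ : Θ 0 = flowState c X y₀ h₀ r₀ 0) {T : ℝ} (hT : 0 ≤ T) :
    Θ T = flowState c X y₀ h₀ r₀ T := by
  obtain ⟨hPm, hQm⟩ := hs.measurable_P_Q
  obtain ⟨hreg, q, w, hb, h, r, hrep, -, hsol⟩ := hs
  obtain ⟨K, hK⟩ := hreg.exists_bound T
  obtain ⟨M, -, Y, hc, hY, hYb, -, hYe⟩ := d.upTo hT
  have hX0 := hYe 0 ⟨le_rfl, hT⟩
  have hX0m := d.measurable_state le_rfl
  have hU0 : ∀ ξ, |(X 0).U ξ| ≤ M := hX0 ▸ (hYb 0).U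
  have hκ0 : ∀ ξ i, |(X 0).κ ξ i| ≤ M := hX0 ▸ (hYb 0).κ
  have hM0 := hc.M_nonneg
  have hK0 : 0 ≤ K := (abs_nonneg _).trans (hK 0 ⟨le_rfl, hT⟩ 0).1
  set C := timeClamp 0 T
  have hC : ∀ t, C t ∈ Icc 0 T := timeClamp_mem' hT
  have hCe : ∀ t ∈ Icc 0 T, C t = t := fun t ht => timeClamp_eq (by simpa using ht)
  have hCm : Measurable fun p : ℝ × ℝ => (C p.1, p.2) :=
    ((continuous_timeClamp 0 T).measurable.comp measurable_fst).prodMk measurable_snd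
  obtain ⟨p, hp⟩ : ∃ p : ℝ → ℝ → ℝ, ∀ t ξ, p t ξ = (Θ (C t)).P ξ := ⟨_, fun _ _ => rfl⟩
  obtain ⟨k, hk⟩ : ∃ k : ℝ → ℝ → ℝ, ∀ t ξ, k t ξ = (Θ (C t)).Q ξ := ⟨_, fun _ _ => rfl⟩
  have hpm : Measurable (Function.uncurry p) := by
    convert hPm.comp hCm using 1
    exact funext fun x => by simp [Function.uncurry, hp, max_eq_left (hC x.1).1]
  have hkm : Measurable (Function.uncurry k) := by
    convert hQm.comp hCm using 1
    exact funext fun x => by simp [Function.uncurry, hk, max_eq_left (hC x.1).1]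
  have hpK : ∀ t ξ, |p t ξ| ≤ K := fun t ξ => hp t ξ ▸ (hK _ (hC t) ξ).2.1
  have hkK : ∀ t ξ, |k t ξ| ≤ K := fun t ξ => hk t ξ ▸ (hK _ (hC t) ξ).2.2
  obtain ⟨V, hV⟩ : ∃ V : ℝ → ℝ → ℝ, ∀ t ξ, V t ξ = (X 0).U ξ - ∫ r in (0 : ℝ)..C t, k r ξ :=
    ⟨_, fun _ _ => rfl⟩
  have hVm : ∀ t, Measurable (V t) := fun t => by
    rw [show V t = _ from funext (hV t)]
    exact hX0m.U.sub (measurable_intervalIntegral_left hkm _ _)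
  have hVc : ∀ ξ, Continuous fun t => V t ξ := fun ξ => by
    simp only [hV]
    exact continuous_const.sub (continuous_integral_timeClamp hkm.of_uncurry_right
      (fun t => hkK t ξ) 0 T)
  have hVb : ∀ t ξ, |V t ξ| ≤ M + K * T := fun t ξ => by
    rw [hV]
    exact (abs_sub _ _).trans (add_le_add (hU0 ξ) (abs_integral_timeClamp_le hT (fun r => hkK r ξ) t))
  obtain ⟨a, ha⟩ : ∃ a : ℝ → ℝ → ℝ, ∀ t ξ, a t ξ = V t ξ ^ 2 - p t ξ := ⟨_, fun _ _ => rfl⟩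
  have ham : Measurable (Function.uncurry a) := by
    convert ((measurable_uncurry_of_continuous_of_measurable hVc hVm).pow_const 2).sub hpm using 1
    exact funext fun x => ha x.1 x.2
  have haA : ∀ t ξ, |a t ξ| ≤ (M + K * T) ^ 2 + K := fun t ξ => by
    rw [ha]
    refine (abs_sub _ _).trans (add_le_add ?_ (hpK t ξ))
    rw [abs_pow]
    exact pow_le_pow_left₀ (abs_nonneg _) (hVb t ξ) 2
  set A := (M + K * T) ^ 2 + K
  have hA0 : 0 ≤ A := by positivity
  obtain ⟨θ, κ, hθm, hκm, hθc, hκc, hθe, hκe, hflow⟩ :=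
    exists_labelFlow hc hX0m d.θ_nonneg ham haA
  have hθ0 : ∀ ξ, θ 0 ξ = (X 0).θ ξ := fun ξ => funext fun i => by simp [hθe 0 le_rfl]
  have hκ0' : ∀ ξ, κ 0 ξ = (X 0).κ ξ := fun ξ => funext fun i => by simp [hκe 0]
  obtain ⟨Z, hZ⟩ : ∃ Z : ℝ → AngState, ∀ t, Z t = ⟨V t, θ (C t), κ (C t)⟩ := ⟨_, fun _ => rfl⟩
  have hC0 : C 0 = 0 := hCe 0 ⟨le_rfl, hT⟩
  have hZ0 : Z 0 = X 0 := by
    rw [hZ]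
    exact AngState.ext' (fun ξ => by simp [hV, hC0]) (fun ξ i => by simp [hC0, hθ0])
      fun ξ i => by simp [hC0, hκ0']
  have hZm : ∀ t, (Z t).Meas := fun t => by
    rw [hZ]
    exact ⟨hVm t, hθm _, hκm _⟩
  -- agreement with the given solution at almost every label
  have hrep0 := d.represents 0 le_rfl
  have hrep1 := hrep 0 le_rfl
  rw [hΘ] at hrep1
  have main : ∀ᵐ ξ, ∀ t ∈ Icc 0 T, (Θ t).U ξ = V t ξ ∧ q t ξ = c.q (Z t) ξ ∧ w t ξ = c.w (Z t) ξ ∧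
      hb t ξ = c.hb (Z t) ξ := by
    filter_upwards [hsol, hrep0.1, hrep1.1, hrep0.2.1, hrep1.2.1, hrep0.2.2.1, hrep1.2.2.1] with
      ξ hξ q0 q1 w0 w1 g0 g1
    have hU : ∀ t ∈ Icc 0 T, (Θ t).U ξ = V t ξ := fun t ht => by
      have e := (hξ.U_eq t ht.1).2
      simp only [hΘ] at e
      rw [e, hV, hCe t ht, intervalIntegral.integral_neg, ← sub_eq_add_neg]
      refine congrArg (_ - ·) (intervalIntegral.integral_congr fun s hs => ?_)
      rw [uIcc_of_le ht.1] at hs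
      simp only [hk, hCe s ⟨hs.1, hs.2.trans ht.2⟩]
    have hL := (hflow ξ).labelSolution (α := α) (r := r₀ ξ)
      (by rw [hθ0, hκ0']; exact d.normal ξ)
    have hA : ∀ t ∈ Icc 0 T, (Θ t).U ξ ^ 2 - (Θ t).P ξ = a t ξ := fun t ht => by
      rw [ha, hU t ht, hp, hCe t ht]
    intro t ht
    have huniq := hL.unique hξ.labelSolution (T := T) (A := A) (fun t _ => haA t ξ)
      (fun t ht => (hA t ht).symm) ⟨by rw [hθ0, hκ0']; exact q0.symm.trans q1,
        by rw [hθ0, hκ0']; exact w0.symm.trans w1, by rw [hθ0, hκ0']; exact g0.symm.trans g1⟩ ht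
    rw [hZ]
    simp only [Weights.q, Weights.w, Weights.hb, hCe t ht]
    exact ⟨hU t ht, huniq.1.symm, huniq.2.1.symm, huniq.2.2.symm⟩
  have hcls : ∀ t ∈ Icc 0 T, (Θ t).U =ᵐ[volume] (Z t).U ∧ (Θ t).q =ᵐ[volume] c.q (Z t) ∧
      (Θ t).w =ᵐ[volume] c.w (Z t) ∧ (Θ t).hb =ᵐ[volume] c.hb (Z t) := fun t ht => by
    obtain ⟨h1, h2, h3, -⟩ := hrep t ht.1
    refine ⟨?_, ?_, ?_, ?_⟩
    · rw [hZ]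
      exact main.mono fun ξ h => (h t ht).1
    · exact h1.trans (main.mono fun ξ h => (h t ht).2.1)
    · exact h2.trans (main.mono fun ξ h => (h t ht).2.2.1)
    · exact h3.trans (main.mono fun ξ h => (h t ht).2.2.2)
  have hder := fun t (ht : t ∈ Icc 0 T) => (hreg.deriv_y t ht.1).congr_ae (hcls t ht).2.1
  have hPQ : ∀ t ∈ Icc 0 T, ∀ ξ, (Θ t).P ξ = c.P (Z t) ξ ∧ (Θ t).Q ξ = c.Q (Z t) ξ :=
    fun t ht ξ => (Θ t).P_Q_eq (hder t ht) (hcls t ht).2.1 (hcls t ht).1 (hcls t ht).2.2.2 ξ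
  have haZ : ∀ t ∈ Icc 0 T, ∀ ξ, a t ξ = c.a (Z t) ξ := fun t ht ξ => by
    rw [ha, hp, hCe t ht, (hPQ t ht ξ).1, Weights.a, hZ]
  have hclamp : ∀ t, Z t = Z (C t) := fun t => by
    have : C (C t) = C t := hCe _ (hC t)
    rw [hZ, hZ, this, show V t = V (C t) from funext fun ξ => by rw [hV, hV, this]]
  set M' := max (M + K * T) (max (2 * K) (M + (1 / 2 + A) * T))
  have hZb : ∀ t, StartBound c M' (Z t) := fun t => by
    refine ⟨hZm t, fun ξ => ?_, fun ξ i => ?_, fun η ξ hηξ => ?_⟩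
    · rw [hZ]
      exact (hVb t ξ).trans (le_max_left _ _)
    · rw [hZ]
      simp only [hκe]
      refine (abs_add_le _ _).trans ((add_le_add (hκ0 ξ i) (abs_integral_timeClamp_le hT
        (fun r => angG_bound (haA r ξ)) t)).trans ((le_max_right _ _).trans (le_max_right _ _)))
    · rw [hclamp, ← (hder _ (hC t) η ξ).2]
      have h1 := abs_le.1 (hK _ (hC t) η).1
      have h2 := abs_le.1 (hK _ (hC t) ξ).1
      have : 2 * K ≤ M' := (le_max_left _ _).trans (le_max_right _ _)
      linarith
  have hsub : ∀ {t s : ℝ}, t ∈ Icc 0 T → s ∈ uIcc 0 t → s ∈ Icc 0 T := fun ht hs => by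
    rw [uIcc_of_le ht.1] at hs
    exact ⟨hs.1, hs.2.trans ht.2⟩
  have hCc := continuous_timeClamp 0 T
  have hZs : SolvesUpTo c M' T Z := by
    refine ⟨hT, ⟨hZm, fun ξ => ?_, fun ξ i => ?_, fun ξ i => ?_⟩, hclamp, fun t => ?_,
      fun t ht ξ => ?_, fun t ht ξ i => ?_, fun t ht ξ i => ?_⟩
    · simp only [hZ]; exact hVc ξ
    · simp only [hZ]; exact (hθc ξ i).comp hCc
    · simp only [hZ]; exact (hκc ξ i).comp hCc
    · refine ⟨hZm t, fun ξ => ((hZb t).U ξ).trans (by linarith),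
        fun ξ i => ((hZb t).κ ξ i).trans (by linarith), fun x y => ?_, fun η ξ hηξ => ?_⟩
      · rw [hclamp]
        exact (hder _ (hC t) x y).1
      · exact le_trans (by linarith) ((hZb t).kernel η ξ hηξ)
    · rw [hZ0]
      have : (Z t).U ξ = V t ξ := by rw [hZ]
      rw [this, hV, hCe t ht]
      refine congrArg _ (intervalIntegral.integral_congr fun s hs => ?_)
      simp only [hk, hCe s (hsub ht hs), (hPQ s (hsub ht hs) ξ).2]
    · rw [hZ0]
      have e : ∀ s ∈ Icc 0 T, (Z s).θ ξ i = θ s ξ i := fun s hs => by rw [hZ]; simp only [hCe s hs]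
      rw [e t ht, hθe t ht.1]
      refine congrArg _ (intervalIntegral.integral_congr fun s hs => ?_)
      simp only [e s (hsub ht hs), haZ s (hsub ht hs)]
    · rw [hZ0]
      have e : ∀ s ∈ Icc 0 T, (Z s).θ ξ i = θ s ξ i := fun s hs => by rw [hZ]; simp only [hCe s hs]
      have e' : (Z t).κ ξ i = κ t ξ i := by rw [hZ]; simp only [hCe t ht]
      rw [e', hκe t]
      refine congrArg _ (intervalIntegral.integral_congr fun s hs => ?_)
      simp only [e s (hsub ht hs), haZ s (hsub ht hs)]
  have hYZ : Y = Z := SolvesUpTo.unique' hc hY hZs hYb hZb (by rw [hZ0, hX0])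
  have hXZ : ∀ t ∈ Icc 0 T, X t = Z t := fun t ht => hYZ ▸ hYe t ht
  have hTT : T ∈ Icc 0 T := ⟨hT, le_rfl⟩
  obtain ⟨hcU, hcq, hcw, hcb⟩ := hcls T hTT
  obtain ⟨-, -, -, hch, hcr⟩ := hrep T hT
  obtain ⟨eq1, ew1, eb1, eh1, er1⟩ := d.represents T hT
  rw [← hXZ T hTT] at hcU hcq hcw hcb
  refine LagState.ext ?_ ?_ (AEEqFun.ext (hcq.trans eq1.symm)) (AEEqFun.ext (hcw.trans ew1.symm))
    (AEEqFun.ext (hcb.trans eb1.symm)) (AEEqFun.ext (hch.trans (EventuallyEq.trans ?_ eh1.symm)))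
    (AEEqFun.ext (hcr.trans (EventuallyEq.trans ?_ er1.symm)))
  · refine (Continuous.ae_eq_iff_eq volume (hreg.deriv_y T hT).continuous
      (d.deriv_y hT).continuous).1 ?_
    filter_upwards [main, hsol] with ξ h1 h2
    have e := (h2.y_eq T hT).2
    simp only [hΘ] at e
    rw [e]
    change posPath X y₀ 0 ξ + _ = _
    simp only [posPath, intervalIntegral.integral_same, add_zero]
    refine congrArg _ (intervalIntegral.integral_congr fun s hs => ?_)
    simp only [(h1 s (hsub hTT hs)).1, hXZ s (hsub hTT hs), hZ]
  · exact (Continuous.ae_eq_iff_eq volume (hreg.deriv_U T hT).continuous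
      (d.deriv_U hT).continuous).1 hcU
  · filter_upwards [main, hsol, hrep0.2.2.2.1, hrep1.2.2.2.1] with ξ h1 h2 h3 h4
    have e := (h2.h_eq T hT).2
    simp only at e
    rw [e, ← h4, h3]
    simp only [densPath, intervalIntegral.integral_same, add_zero]
    refine congrArg _ (intervalIntegral.integral_congr fun s hs => ?_)
    have hs' := hsub hTT hs
    have : (Z s).U ξ = V s ξ := by rw [hZ]
    simp only [hXZ s hs', (h1 s hs').2.2.1, (h1 s hs').1, (hPQ s hs' ξ).1, Weights.a, this]
  · filter_upwards [hsol, hrep0.2.2.2.2, hrep1.2.2.2.2] with ξ h2 h3 h4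
    have e := (h2.r_eq T hT).2
    simp only at e
    rw [e, ← h4, h3]
    simp

/-! ### Relabeling of solutions -/

namespace IsRelabeling

variable {f : ℝ ≃ₜ ℝ} (hf : IsRelabeling f)
include hf

lemma strictMono : StrictMono f := by
  obtain ⟨C, hC⟩ := hf.1.1
  refine (f.continuous.strictMono_of_inj f.injective).resolve_right fun h => ?_
  have h1 := abs_le.1 (hC (|f 0| + |C| + 1))
  have h2 := h (show 0 < |f 0| + |C| + 1 by positivity)
  have h3 := le_abs_self (f 0)
  have h4 := le_abs_self C
  linarith

lemma deriv_nonneg (ξ : ℝ) : 0 ≤ deriv f ξ := hf.strictMono.monotone.deriv_nonneg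

lemma exists_le_deriv : ∃ ε, 0 < ε ∧ ∀ᵐ ξ, ε ≤ deriv f ξ := by
  obtain ⟨L, hL⟩ := hf.2.1.lipschitz
  refine ⟨1 / (L + 1), by positivity, ?_⟩
  filter_upwards [hf.inv.deriv_comp hf] with ξ h
  have h1 : ((f⁻¹ * f : ℝ ≃ₜ ℝ) : ℝ → ℝ) = id := by rw [inv_mul_cancel]; rfl
  rw [h1, deriv_id] at h
  have h2 : |deriv (f⁻¹ : ℝ ≃ₜ ℝ) (f ξ)| ≤ L := norm_deriv_le_of_lipschitz hL
  rw [div_le_iff₀ (by positivity)]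
  have h3 := hf.deriv_nonneg ξ
  have h4 := mul_le_mul_of_nonneg_right ((le_abs_self _).trans h2) h3
  linarith

lemma ae_deriv_pos : ∀ᵐ ξ, 0 < deriv f ξ := by
  obtain ⟨ε, hε, h⟩ := hf.exists_le_deriv
  exact h.mono fun _ => hε.trans_le

/-- Change of variables. -/
lemma integral_comp (g : ℝ → ℝ) : ∫ ξ, g (f ξ) * deriv f ξ = ∫ ξ, g ξ := by
  set s := {x | DifferentiableAt ℝ f x}
  have hs : MeasurableSet s := measurableSet_of_differentiableAt ℝ f
  have h := integral_image_eq_integral_abs_deriv_smul hs (f' := deriv f)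
    (fun x hx => (show DifferentiableAt ℝ f x from hx).hasDerivAt.hasDerivWithinAt)
    f.injective.injOn g
  have h1 : ∀ᵐ x, x ∈ f '' s := by
    filter_upwards [hf.inv.quasi.ae hf.ae_differentiableAt] with x hx
    exact ⟨f.symm x, hx, f.apply_symm_apply x⟩
  rw [Measure.restrict_eq_self_of_ae_mem h1,
    Measure.restrict_eq_self_of_ae_mem (s := s) hf.ae_differentiableAt] at h
  rw [h]
  exact integral_congr_ae (.of_forall fun ξ => by
    simp only [abs_of_nonneg (hf.deriv_nonneg ξ), smul_eq_mul, mul_comm])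

lemma hasWeakDeriv_comp {F g : ℝ → ℝ} (h : HasWeakDeriv F g) :
    HasWeakDeriv (F ∘ f) fun ξ => g (f ξ) * deriv f ξ := by
  have key : ∀ a b, a ≤ b → IntervalIntegrable (fun ξ => g (f ξ) * deriv f ξ) volume a b ∧
      F (f b) - F (f a) = ∫ ξ in a..b, g (f ξ) * deriv f ξ := fun a b hab => by
    have hfab := hf.strictMono.monotone hab
    obtain ⟨h1, h2⟩ := h (f a) (f b)
    rw [intervalIntegrable_iff_integrableOn_Ioc_of_le hfab,
      ← integrable_indicator_iff measurableSet_Ioc, ← memLp_one_iff_integrable] at h1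
    have e : (fun ξ => (Ioc (f a) (f b)).indicator g (f ξ) * deriv f ξ) =
        (Ioc a b).indicator fun ξ => g (f ξ) * deriv f ξ := by
      funext ξ
      by_cases hξ : ξ ∈ Ioc a b
      · have hm : f ξ ∈ Ioc (f a) (f b) := ⟨hf.strictMono hξ.1, hf.strictMono.monotone hξ.2⟩
        rw [indicator_of_mem hξ, indicator_of_mem hm]
      · have hm : f ξ ∉ Ioc (f a) (f b) := fun hm => hξ
          ⟨hf.strictMono.lt_iff_lt.1 hm.1, hf.strictMono.le_iff_le.1 hm.2⟩
        rw [indicator_of_notMem hξ, indicator_of_notMem hm, zero_mul]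
    have h3 := hf.memLp_comp h1
    have h4 := hf.integral_comp ((Ioc (f a) (f b)).indicator g)
    rw [e, memLp_one_iff_integrable, integrable_indicator_iff measurableSet_Ioc] at h3
    rw [e, integral_indicator measurableSet_Ioc, integral_indicator measurableSet_Ioc] at h4
    rw [intervalIntegrable_iff_integrableOn_Ioc_of_le hab]
    exact ⟨h3, by rw [h2, intervalIntegral.integral_of_le hfab,
      intervalIntegral.integral_of_le hab, h4]⟩
  intro a b
  rcases le_total a b with hab | hab
  · exact key a b hab
  · obtain ⟨h1, h2⟩ := key b a hab
    refine ⟨h1.symm, ?_⟩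
    rw [intervalIntegral.integral_symm, ← h2]
    simp

lemma exists_eLpNorm_le (p : ℝ≥0∞) : ∃ C : ℝ≥0, ∀ u : ℝ → ℝ, AEStronglyMeasurable u volume →
    eLpNorm (fun ξ => u (f ξ)) p volume ≤ C * eLpNorm u p volume ∧
    eLpNorm (fun ξ => u (f ξ) * deriv f ξ) p volume ≤ C * eLpNorm u p volume := by
  obtain ⟨K, hK⟩ := hf.map_le
  obtain ⟨L, hL⟩ := hf.1.lipschitz
  set k : ℝ≥0 := (K + 1) ^ (1 / p).toReal
  have h1 : ∀ u : ℝ → ℝ, AEStronglyMeasurable u volume →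
      eLpNorm (fun ξ => u (f ξ)) p volume ≤ k * eLpNorm u p volume := fun u hu => by
    have e := eLpNorm_map_measure (p := p) (hu.mono_ac hf.quasi.absolutelyContinuous)
      f.continuous.aemeasurable
    have hle : Measure.map f volume ≤ ((K + 1 : ℝ≥0) : ℝ≥0∞) • (volume : Measure ℝ) :=
      hK.trans (Measure.le_iff.2 fun s _ => by
        simp only [Measure.smul_apply, smul_eq_mul]
        gcongr
        exact le_self_add)
    change eLpNorm (u ∘ f) p volume ≤ _
    rw [← e]
    refine (eLpNorm_mono_measure u hle).trans_eq ?_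
    rw [eLpNorm_smul_measure_of_ne_zero (by simp), smul_eq_mul,
      ENNReal.coe_rpow_of_nonneg _ ENNReal.toReal_nonneg]
  refine ⟨k + L * k, fun u hu => ⟨(h1 u hu).trans ?_, ?_⟩⟩
  · gcongr
    exact le_self_add
  · refine (eLpNorm_le_mul_eLpNorm_of_ae_le_mul' (c := L) (g := fun ξ => u (f ξ))
      (.of_forall fun ξ => ?_) p).trans ?_
    · rw [enorm_mul, mul_comm]
      gcongr
      have : ‖deriv f ξ‖₊ ≤ L := norm_deriv_le_of_lipschitz hL
      exact_mod_cast this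
    · calc (L : ℝ≥0∞) * eLpNorm (fun ξ => u (f ξ)) p volume ≤ L * (k * eLpNorm u p volume) := by
            gcongr; exact h1 u hu
        _ ≤ ((k + L * k : ℝ≥0) : ℝ≥0∞) * eLpNorm u p volume := by
            rw [← mul_assoc]; gcongr; push_cast; exact le_add_self

lemma memE_deriv : MemE fun ξ => deriv f ξ - 1 := by
  obtain ⟨L, hL⟩ := hf.1.lipschitz
  refine ⟨hf.2.2, (memLp_top_of_bound (measurable_deriv f).aestronglyMeasurable L
    (.of_forall fun ξ => norm_deriv_le_of_lipschitz hL)).sub (memLp_top_const 1)⟩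

lemma memE_comp {u : ℝ → ℝ} (hu : MemE u) : MemE fun ξ => u (f ξ) * deriv f ξ :=
  ⟨hf.memLp_comp hu.1, hf.memLp_comp hu.2⟩

lemma memE_comp_sub_one {u : ℝ → ℝ} (hu : MemE fun ξ => u ξ - 1) :
    MemE fun ξ => u (f ξ) * deriv f ξ - 1 :=
  ((hf.memE_comp hu).add hf.memE_deriv).congr_ae (.of_forall fun ξ => by ring)

lemma memLp_sub_id : MemLp (fun ξ => f ξ - ξ) ∞ volume := by
  obtain ⟨C, hC⟩ := hf.1.1
  exact memLp_top_of_bound (f.continuous.sub continuous_id).aestronglyMeasurable C (.of_forall hC)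

lemma tendsto_atBot : Tendsto f atBot atBot := by
  obtain ⟨C, hC⟩ := hf.1.1
  exact tendsto_atBot_mono (fun ξ => by linarith [(abs_le.1 (hC ξ)).2] : ∀ ξ, f ξ ≤ ξ + C)
    (tendsto_atBot_add_const_right _ C tendsto_id)

end IsRelabeling

lemma relabelDensity_ae (u : ℝ →ₘ[volume] ℝ) (f : ℝ ≃ₜ ℝ) :
    relabelDensity u f =ᵐ[volume] fun ξ => u (f ξ) * deriv f ξ := AEEqFun.coeFn_mk _ _

/-- `N` behaves like a norm, and relabeling densities by `f` is bounded with respect to `N`. -/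
structure RelabelNorm (f : ℝ ≃ₜ ℝ) (N : (ℝ → ℝ) → ℝ≥0∞) : Prop where
  comp_le : ∃ C : ℝ≥0, ∀ u : ℝ → ℝ, AEStronglyMeasurable u volume →
    N (fun ξ => u (f ξ) * deriv f ξ) ≤ C * N u
  congr : ∀ u v : ℝ → ℝ, u =ᵐ[volume] v → N u = N v
  add_le : ∀ u v : ℝ → ℝ, AEStronglyMeasurable u volume → AEStronglyMeasurable v volume →
    N (fun ξ => u ξ + v ξ) ≤ N u + N v

namespace RelabelNorm

variable {f : ℝ ≃ₜ ℝ} {N N' : (ℝ → ℝ) → ℝ≥0∞}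

lemma eLpNorm (hf : IsRelabeling f) {p : ℝ≥0∞} (hp : 1 ≤ p) :
    RelabelNorm f fun u => MeasureTheory.eLpNorm u p volume :=
  ⟨(hf.exists_eLpNorm_le p).imp fun _ h u hu => (h u hu).2, fun _ _ h => eLpNorm_congr_ae h,
    fun _ _ hu hv => eLpNorm_add_le hu hv hp⟩

lemma add (h : RelabelNorm f N) (h' : RelabelNorm f N') : RelabelNorm f fun u => N u + N' u := by
  obtain ⟨C, hC⟩ := h.comp_le
  obtain ⟨C', hC'⟩ := h'.comp_le
  refine ⟨⟨C + C', fun u hu => ?_⟩, fun u v huv => by rw [h.congr u v huv, h'.congr u v huv],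
    fun u v hu hv => (add_le_add (h.add_le u v hu hv) (h'.add_le u v hu hv)).trans_eq (by ring)⟩
  refine (add_le_add (hC u hu) (hC' u hu)).trans ?_
  push_cast
  rw [mul_add]
  gcongr <;> simp

variable {u : ℝ → ℝ →ₘ[volume] ℝ} {k : ℝ}

lemma boundedInTime (h : RelabelNorm f N) (hk : N (fun ξ => k * (deriv f ξ - 1)) ≠ ⊤)
    (hu : BoundedInTime N fun t ξ => u t ξ - k) :
    BoundedInTime N fun t ξ => relabelDensity (u t) f ξ - k := by
  obtain ⟨C, hC⟩ := h.comp_le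
  intro T
  obtain ⟨B, hB⟩ := hu T
  lift N (fun ξ => k * (deriv f ξ - 1)) to ℝ≥0 using hk with K hK
  refine ⟨C * B + K, fun t ht => ?_⟩
  have hm : AEStronglyMeasurable (fun ξ => u t ξ - k) volume :=
    (u t).aestronglyMeasurable.sub aestronglyMeasurable_const
  rw [h.congr _ (fun ξ => relabelDensity (u t) f ξ - deriv f ξ * k + k * (deriv f ξ - 1))
    (.of_forall fun ξ => by ring)]
  refine (h.add_le _ _ ((relabelDensity (u t) f).aestronglyMeasurable.sub
    ((measurable_deriv f).mul_const k).aestronglyMeasurable)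
    (((measurable_deriv f).sub_const 1).const_mul k).aestronglyMeasurable).trans ?_
  rw [← hK, ENNReal.coe_add, ENNReal.coe_mul]
  gcongr
  refine le_trans (le_of_eq (h.congr _ _ ?_)) ((hC _ hm).trans (by gcongr; exact hB t ht))
  filter_upwards [relabelDensity_ae (u t) f] with ξ h
  simp only [Pi.sub_apply, h]
  ring

lemma lipschitzInTime (h : RelabelNorm f N) (hk : N (fun ξ => k * (deriv f ξ - 1)) ≠ ⊤)
    (hu : LipschitzInTime N fun t ξ => u t ξ - k) :
    LipschitzInTime N fun t ξ => relabelDensity (u t) f ξ - k := by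
  refine ⟨h.boundedInTime hk hu.1, fun T => ?_⟩
  obtain ⟨C, hC⟩ := h.comp_le
  obtain ⟨B, hB⟩ := hu.2 T
  refine ⟨C * B, fun s hs t ht => ?_⟩
  rw [ENNReal.coe_mul, mul_assoc]
  refine le_trans (le_of_eq (h.congr _ _ ?_)) ((hC (fun ξ => u t ξ - k - (u s ξ - k))
    (((u t).aestronglyMeasurable.sub aestronglyMeasurable_const).sub
      ((u s).aestronglyMeasurable.sub aestronglyMeasurable_const))).trans
    (by gcongr; exact hB s hs t ht))
  filter_upwards [relabelDensity_ae (u t) f, relabelDensity_ae (u s) f] with ξ h1 h2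
  rw [h1, h2]
  ring

end RelabelNorm

lemma LagState.relabel_P_Q (Θ : LagState) (f : RelabelingGroup) (ξ : ℝ) :
    (Θ.relabel f).P ξ = Θ.P (f.1 ξ) ∧ (Θ.relabel f).Q ξ = Θ.Q (f.1 ξ) := by
  have hf : IsRelabeling f.1 := f.2
  have hs : ∀ η, Real.sign (f.1 ξ - f.1 η) = Real.sign (ξ - η) := fun η => by
    rcases lt_trichotomy ξ η with h | h | h
    · rw [Real.sign_of_neg (sub_neg.2 h), Real.sign_of_neg (sub_neg.2 (hf.strictMono h))]
    · simp [h]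
    · rw [Real.sign_of_pos (sub_pos.2 h), Real.sign_of_pos (sub_pos.2 (hf.strictMono h))]
  unfold LagState.P LagState.Q
  refine ⟨congrArg _ ?_, congrArg _ ?_⟩
  · refine (integral_congr_ae ?_).trans (hf.integral_comp fun η =>
      Real.exp (-|Θ.y (f.1 ξ) - Θ.y η|) * (2 * Θ.U η ^ 2 * Θ.q η + Θ.hb η))
    filter_upwards [relabelDensity_ae Θ.q f.1, relabelDensity_ae Θ.hb f.1] with η h1 h2
    simp only [LagState.relabel, h1, h2, Function.comp_apply]
    ring
  · refine (integral_congr_ae ?_).trans (hf.integral_comp fun η => Real.sign (f.1 ξ - η) *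
      Real.exp (-|Θ.y (f.1 ξ) - Θ.y η|) * (2 * Θ.U η ^ 2 * Θ.q η + Θ.hb η))
    filter_upwards [relabelDensity_ae Θ.q f.1, relabelDensity_ae Θ.hb f.1] with η h1 h2
    simp only [LagState.relabel, h1, h2, Function.comp_apply, hs]
    ring

lemma SolutionRegularity.relabel {Θ : ℝ → LagState} (h : SolutionRegularity Θ)
    (f : RelabelingGroup) : SolutionRegularity fun t => (Θ t).relabel f := by
  have hf : IsRelabeling f.1 := f.2
  have hE : RelabelNorm f.1 normE := (RelabelNorm.eLpNorm hf one_le_two).add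
    (RelabelNorm.eLpNorm hf le_top)
  have hL : RelabelNorm f.1 normL1Linf := (RelabelNorm.eLpNorm hf le_rfl).add
    (RelabelNorm.eLpNorm hf le_top)
  have h1 : normE (fun ξ => 1 * (deriv f.1 ξ - 1)) ≠ ⊤ := by
    simpa [normE] using ⟨hf.memE_deriv.1.eLpNorm_ne_top, hf.memE_deriv.2.eLpNorm_ne_top⟩
  refine ⟨fun t ht => (hf.hasWeakDeriv_comp (h.deriv_y t ht)).congr_ae (relabelDensity_ae _ _).symm,
    fun t ht => (hf.hasWeakDeriv_comp (h.deriv_U t ht)).congr_ae (relabelDensity_ae _ _).symm,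
    fun T => ?_, fun T => ?_, hE.lipschitzInTime h1 h.zetaXi, ?_, ?_, ?_, ?_⟩
  · obtain ⟨C, hC⟩ := hf.exists_eLpNorm_le ∞
    obtain ⟨B, hB⟩ := h.zeta T
    obtain ⟨K, hK⟩ := WithTop.ne_top_iff_exists.1 hf.memLp_sub_id.eLpNorm_ne_top
    change (K : ℝ≥0∞) = _ at hK
    refine ⟨C * B + K, fun t ht => ?_⟩
    have hm : Continuous fun ξ => (Θ t).y ξ - ξ :=
      (h.deriv_y t ht.1).continuous.sub continuous_id
    have e : (fun ξ => ((Θ t).relabel f).y ξ - ξ) =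
        (fun ξ => (Θ t).y (f.1 ξ) - f.1 ξ) + fun ξ => f.1 ξ - ξ := by
      funext ξ; simp [LagState.relabel]
    simp only [e]
    refine (eLpNorm_add_le (hm.comp f.1.continuous).aestronglyMeasurable
      hf.memLp_sub_id.aestronglyMeasurable le_top).trans ?_
    rw [← hK, ENNReal.coe_add, ENNReal.coe_mul]
    gcongr
    exact (hC _ hm.aestronglyMeasurable).1.trans (by gcongr; exact hB t ht)
  · obtain ⟨C, hC⟩ := hf.exists_eLpNorm_le 2
    obtain ⟨B, hB⟩ := h.U T
    exact ⟨C * B, fun t ht => ((hC _ (h.deriv_U t ht.1).continuous.aestronglyMeasurable).1).trans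
      (by rw [ENNReal.coe_mul]; gcongr; exact hB t ht)⟩
  · simpa [LagState.relabel] using hE.lipschitzInTime (k := 0) (u := fun t => (Θ t).w)
      (by simp [normE, -eLpNorm_exponent_top])
      (by simpa using h.w)
  · simpa [LagState.relabel] using hE.lipschitzInTime (k := 0) (u := fun t => (Θ t).r)
      (by simp [normE, -eLpNorm_exponent_top])
      (by simpa using h.r)
  · simpa [LagState.relabel] using (RelabelNorm.eLpNorm hf one_le_two).boundedInTime (k := 0) (u := fun t => (Θ t).hb)
      (by simp) (by simpa using h.hb)
  · simpa [LagState.relabel] using hL.lipschitzInTime (k := 0) (u := fun t => (Θ t).h)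
      (by simp [normL1Linf, -eLpNorm_exponent_top])
      (by simpa using h.h)

lemma Evolves.mul_const {x F : ℝ → ℝ} (h : Evolves x F) (k : ℝ) :
    Evolves (fun t => x t * k) fun t => F t * k := fun t ht =>
  ⟨(h t ht).1.mul_const k, by
    simp only [(h t ht).2, intervalIntegral.integral_mul_const, add_mul]⟩

lemma breakTime_mul_const (p : ℝ → ℝ) {k : ℝ} (hk : 0 < k) (n : ℕ) :
    breakTime (fun t => p t * k) n = breakTime p n :=
  breakTime_congr (fun t _ => by simp [hk]) (fun t _ => by simp [hk.ne']) n

/-- Relabelings of dissipative solutions are dissipative solutions. -/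
theorem IsDissipativeSolution.relabel {α : ℝ} {Θ : ℝ → LagState} (hΘ : IsDissipativeSolution α Θ)
    (f : RelabelingGroup) : IsDissipativeSolution α fun t => (Θ t).relabel f := by
  obtain ⟨hreg, q, w, hb, h, r, hrep, hmeas, hsol⟩ := hΘ
  have hf : IsRelabeling f.1 := f.2
  have hd := fun (u : ℝ →ₘ[volume] ℝ) (v : ℝ → ℝ) (huv : u =ᵐ[volume] v) =>
    show relabelDensity u f.1 =ᵐ[volume] fun ξ => v (f.1 ξ) * deriv f.1 ξ from
    (relabelDensity_ae u f.1).trans ((hf.quasi.ae huv).mono fun ξ h => by simp only [h])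
  refine ⟨hreg.relabel f, fun t ξ => q t (f.1 ξ) * deriv f.1 ξ,
    fun t ξ => w t (f.1 ξ) * deriv f.1 ξ, fun t ξ => hb t (f.1 ξ) * deriv f.1 ξ,
    fun t ξ => h t (f.1 ξ) * deriv f.1 ξ, fun t ξ => r t (f.1 ξ) * deriv f.1 ξ,
    fun t ht => ?_, fun n => ?_, ?_⟩
  · obtain ⟨h1, h2, h3, h4, h5⟩ := hrep t ht
    exact ⟨hd _ _ h1, hd _ _ h2, hd _ _ h3, hd _ _ h4, hd _ _ h5⟩
  · refine ((hmeas n).comp_quasiMeasurePreserving hf.quasi).congr ?_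
    filter_upwards [hf.ae_deriv_pos] with ξ hξ
    exact (breakTime_mul_const (fun t => q t (f.1 ξ)) hξ n).symm
  · filter_upwards [hf.quasi.ae hsol, hf.ae_deriv_pos] with ξ hs hξ
    have hbt := breakTime_mul_const (fun t => q t (f.1 ξ)) hξ
    have hPQ := fun t => (Θ t).relabel_P_Q f ξ
    refine ⟨by rw [funext hbt]; exact hs.tau_tendsto, hs.y_eq, ?_, hs.q_eq.mul_const _, ?_, ?_, ?_,
      fun n a t h1 h2 h3 => ?_, fun n a h1 => ?_⟩
    · simp only [(hPQ _).2]
      exact hs.U_eq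
    · refine (hs.w_eq.mul_const _).congr_deriv fun t _ => ?_
      rw [(hPQ t).1]
      simp only [LagState.relabel, Function.comp_apply]
      ring
    · refine (hs.h_eq.mul_const _).congr_deriv fun t _ => ?_
      rw [(hPQ t).1]
      simp only [LagState.relabel, Function.comp_apply]
      ring
    · simpa using hs.r_eq.mul_const (deriv f.1 ξ)
    · rw [hbt] at h1 h3
      have := hs.hb_eq n a t h1 h2 h3
      simp only [← sub_mul, this]
    · rw [hbt] at h1
      obtain ⟨l, h2, h3⟩ := hs.hb_jump n a h1
      exact ⟨_, h2.mul_const _, by rw [h3, mul_assoc]⟩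

lemma gFun_mul {α : ℝ} {x x' : Fin 7 → ℝ} {k : ℝ} (hk : 0 < k)
    (h : ∀ i : Fin 7, 2 ≤ i → x' i = x i * k) : gFun α x' = gFun α x * k := by
  have h2 := h 2 (by decide)
  have h3 := h 3 (by decide)
  have h4 := h 4 (by decide)
  have h6 := h 6 (by decide)
  have e1 : gOne x' = gOne x * k := by
    simp only [gOne, h2, h3, abs_mul, abs_of_pos hk]; ring
  have e2 : gTwo x' = gTwo x * k := by simp only [gTwo, h2, h4]; ring
  have e : x' ∈ OmegaOne ↔ x ∈ OmegaOne := by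
    have e3 : x 3 * k ≤ 0 ↔ x 3 ≤ 0 := by
      constructor <;> intro _ <;> nlinarith
    change gOne x' ≤ gTwo x' ∧ x' 3 ≤ 0 ∧ x' 6 = 0 ↔ gOne x ≤ gTwo x ∧ x 3 ≤ 0 ∧ x 6 = 0
    rw [e1, e2, h3, h6, e3, mul_le_mul_iff_left₀ hk, mul_eq_zero_iff_right hk.ne']
  unfold gFun
  by_cases hx : x ∈ OmegaOne
  · rw [if_pos hx, if_pos (e.2 hx), e1, e2]
    ring
  · rw [if_neg hx, if_neg (e.not.2 hx), e2]

/-- The relabelings of elements of `ℱ` that lie in `ℱ`. -/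
theorem MemF.relabel_iff {α : ℝ} {Θ : LagState} (hΘ : MemF α Θ) (f : RelabelingGroup) :
    MemF α (Θ.relabel f) ↔ Tendsto (fun ξ => f.1 ξ - ξ) atBot (𝓝 0) := by
  have hf : IsRelabeling f.1 := f.2
  have h := hΘ.1
  have hy0 := h.zeta_lim.comp hf.tendsto_atBot
  refine ⟨fun h' => ?_, fun hlim => ?_⟩
  · have := h'.1.zeta_lim.sub hy0
    simpa [LagState.relabel, Function.comp_def] using this
  obtain ⟨K, hK⟩ := MemLp.exists_forall_abs_le (h.deriv_y.continuous.sub continuous_id) h.zeta_mem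
  obtain ⟨B, hB⟩ := hf.1.1
  obtain ⟨ε, hε, hd⟩ := hf.exists_le_deriv
  obtain ⟨C, hC⟩ := h.inv_bdd
  have hyB : ∀ ξ, |(Θ.relabel f).y ξ - ξ| ≤ K + B := fun ξ => by
    have := abs_add_le (Θ.y (f.1 ξ) - f.1 ξ) (f.1 ξ - ξ)
    rw [sub_add_sub_cancel] at this
    exact this.trans (add_le_add (hK _) (hB ξ))
  have hq := relabelDensity_ae Θ.q f.1
  have hw := relabelDensity_ae Θ.w f.1
  have hb := relabelDensity_ae Θ.hb f.1
  have hh := relabelDensity_ae Θ.h f.1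
  have hr := relabelDensity_ae Θ.r f.1
  have hdy := (hf.hasWeakDeriv_comp h.deriv_y).congr_ae hq.symm
  have hdU := (hf.hasWeakDeriv_comp h.deriv_U).congr_ae hw.symm
  refine MemG.memF (K := K + B) ⟨hdy, hdU, ?_, ?_, ?_, (hf.memE_comp h.w_mem).congr_ae hw.symm,
    (hf.memE_comp h.h_mem).congr_ae hh.symm, (hf.memE_comp h.r_mem).congr_ae hr.symm, ?_, ?_, ?_, ?_,
    ⟨C / ε, ?_⟩, ?_, ?_⟩ hyB
  · exact memLp_top_of_bound (hdy.continuous.sub continuous_id).aestronglyMeasurable _ (.of_forall hyB)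
  · have key : ∀ p, MemLp Θ.U p volume → MemLp (Θ.U ∘ f.1) p volume := fun p hp => by
      obtain ⟨C, hC⟩ := hf.exists_eLpNorm_le p
      exact ⟨hdU.continuous.aestronglyMeasurable, (hC _ hp.1).1.trans_lt
        (ENNReal.mul_lt_top ENNReal.coe_lt_top hp.2)⟩
    exact ⟨key _ h.U_mem.1, key _ h.U_mem.2⟩
  · exact (hf.memE_comp_sub_one h.zetaXi_mem).congr_ae (hq.mono fun ξ h => by
      simp only [LagState.relabel, h])
  · refine (hf.memE_comp_sub_one h.g_mem).congr_ae ?_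
    filter_upwards [hq, hw, hb, hh, hr, hf.ae_deriv_pos] with ξ h1 h2 h3 h4 h5 hpos
    rw [gFun_mul (x' := (Θ.relabel f).toVec ξ) hpos fun i hi => ?_]
    fin_cases i <;> simp [LagState.toVec, LagState.relabel, h1, h2, h3, h4, h5] at hi ⊢
  · exact memLp_one_iff_integrable.1
      ((hf.memLp_comp (memLp_one_iff_integrable.2 h.h_integrable)).ae_eq hh.symm)
  · filter_upwards [hq, hh, hb, hf.quasi.ae h.nonneg] with ξ h1 h2 h3 ⟨h4, h5, h6⟩
    have := hf.deriv_nonneg ξ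
    simp only [LagState.relabel, h1, h2, h3]
    exact ⟨by positivity, by positivity, by positivity⟩
  · have := hy0.add hlim
    simpa [LagState.relabel, Function.comp_def] using this
  · filter_upwards [hq, hh, hf.quasi.ae hC, hd] with ξ h1 h2 ⟨h3, h4⟩ h5
    simp only [LagState.relabel, h1, h2, ← add_mul]
    refine ⟨mul_pos h3 (hε.trans_le h5), ?_⟩
    rw [← div_div]
    exact div_le_div₀ ((one_div_pos.2 h3).le.trans h4) h4 hε h5
  · filter_upwards [hq, hw, hb, hr, hf.quasi.ae h.relation] with ξ h1 h2 h3 h4 h5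
    simp only [LagState.relabel, h1, h2, h3, h4]
    linear_combination deriv f.1 ξ ^ 2 * h5
  · filter_upwards [hb, hh, hf.quasi.ae h.hb_le] with ξ h1 h2 h3
    simp only [LagState.relabel, h1, h2]
    exact mul_le_mul_of_nonneg_right h3 (hf.deriv_nonneg ξ)

/-! ### The semigroup -/

lemma Evolves.congr {x x' F F' : ℝ → ℝ} (h : Evolves x F) (hx : ∀ t, 0 ≤ t → x t = x' t)
    (hF : ∀ t, 0 ≤ t → F t = F' t) : Evolves x' F' := fun t ht => by
  rw [← hx t ht, ← hx 0 le_rfl]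
  exact h.congr_deriv hF t ht

lemma BoundedInTime.congr {N : (ℝ → ℝ) → ℝ≥0∞} {u v : ℝ → ℝ → ℝ} (h : BoundedInTime N u)
    (huv : ∀ t, 0 ≤ t → u t = v t) : BoundedInTime N v := fun T =>
  (h T).imp fun _ hC t ht => huv t ht.1 ▸ hC t ht

lemma LipschitzInTime.congr {N : (ℝ → ℝ) → ℝ≥0∞} {u v : ℝ → ℝ → ℝ} (h : LipschitzInTime N u)
    (huv : ∀ t, 0 ≤ t → u t = v t) : LipschitzInTime N v :=
  ⟨h.1.congr huv, fun T => (h.2 T).imp fun _ hC s hs t ht =>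
    huv t ht.1 ▸ huv s hs.1 ▸ hC s hs t ht⟩

lemma IsDissipativeSolution.congr {α : ℝ} {Θ Θ' : ℝ → LagState} (h : IsDissipativeSolution α Θ)
    (he : ∀ t, 0 ≤ t → Θ t = Θ' t) : IsDissipativeSolution α Θ' := by
  obtain ⟨hr, q, w, hb, η, r, hrep, hm, hs⟩ := h
  refine ⟨⟨fun t ht => he t ht ▸ hr.deriv_y t ht, fun t ht => he t ht ▸ hr.deriv_U t ht,
    hr.zeta.congr fun t ht => by rw [he t ht], hr.U.congr fun t ht => by rw [he t ht],
    hr.zetaXi.congr fun t ht => by rw [he t ht], hr.w.congr fun t ht => by rw [he t ht],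
    hr.r.congr fun t ht => by rw [he t ht], hr.hb.congr fun t ht => by rw [he t ht],
    hr.h.congr fun t ht => by rw [he t ht]⟩, q, w, hb, η, r, fun t ht => he t ht ▸ hrep t ht, hm,
    hs.mono fun ξ h => ⟨h.tau_tendsto, h.y_eq.congr (fun t ht => by rw [he t ht])
      fun t ht => by rw [he t ht], h.U_eq.congr (fun t ht => by rw [he t ht])
      fun t ht => by rw [he t ht], h.q_eq, h.w_eq.congr_deriv fun t ht => by rw [he t ht],
      h.h_eq.congr_deriv fun t ht => by rw [he t ht], h.r_eq, h.hb_eq, h.hb_jump⟩⟩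

/-- Existence and uniqueness of dissipative solutions. -/
theorem exists_solution {α : ℝ} (hα : α ∈ Icc (0 : ℝ) 1) (Θ₀ : LagF α) : ∃ Φ : ℝ → LagF α,
    (∀ Θ : ℝ → LagState, (IsDissipativeSolution α Θ ∧ Θ 0 = Θ₀.1) ↔ ∀ t, 0 ≤ t → Θ t = (Φ t).1) ∧
    ∀ s, 0 ≤ s → IsDissipativeSolution α fun t => (Φ (s + t)).1 := by
  obtain ⟨c, X, y₀, h₀, r₀, d, hd⟩ := Θ₀.2.1.exists_flowData hα
  have he : ∀ t, 0 ≤ t → flowState c X y₀ h₀ r₀ t = flowState c X y₀ h₀ r₀ (max t 0) :=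
    fun t ht => by rw [max_eq_left ht]
  have hsol : ∀ s, 0 ≤ s → IsDissipativeSolution α
      fun t => flowState c X y₀ h₀ r₀ (max (s + t) 0) := fun s hs =>
    (d.isDissipativeSolution hs).congr fun t ht => he _ (add_nonneg hs ht)
  refine ⟨fun t => ⟨flowState c X y₀ h₀ r₀ (max t 0), d.memF hα (le_max_right t 0)⟩,
    fun Θ => ⟨fun h t ht => (d.eq_of_isDissipativeSolution h.1 (h.2.trans hd.symm) ht).trans (he t ht),
      fun h => ⟨((hsol 0 le_rfl).congr fun t ht => ?_), ?_⟩⟩, hsol⟩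
  · rw [h t ht, zero_add]
  · exact (h 0 le_rfl).trans ((he 0 le_rfl).symm.trans hd)

theorem theorem3p6 (α : ℝ) (hα : α ∈ Icc (0 : ℝ) 1) :
    ∃ S : ℝ → LagF α → LagF α,
      -- `S` is the solution map: existence and uniqueness of solutions with data in `ℱ`
      (∀ (Θ₀ : LagF α) (Θ : ℝ → LagState),
        (IsDissipativeSolution α Θ ∧ Θ 0 = Θ₀.1) ↔ ∀ t, 0 ≤ t → Θ t = (S t Θ₀).1) ∧
      -- it is a semigroup
      (∀ Θ₀, S 0 Θ₀ = Θ₀) ∧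
      (∀ s t, 0 ≤ s → 0 ≤ t → ∀ Θ₀, S (s + t) Θ₀ = S s (S t Θ₀)) ∧
      -- the relabelings of elements of `ℱ` that lie in `ℱ`
      (∀ (Θ₀ : LagF α) (f : RelabelingGroup),
        MemF α (Θ₀.1.relabel f) ↔ Tendsto (fun ξ => f.1 ξ - ξ) atBot (𝓝 0)) ∧
      -- equivariance
      (∀ t, 0 < t → ∀ (Θ₀ : LagF α) (f : RelabelingGroup) (hf : MemF α (Θ₀.1.relabel f)),
        (S t ⟨Θ₀.1.relabel f, hf⟩).1 = (S t Θ₀).1.relabel f) ∧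
      -- equivariance for all relabeling functions: `S_t(Θ₀) ∘ f` is the solution from `Θ₀ ∘ f`
      (∀ (Θ₀ : LagF α) (f : RelabelingGroup) (Θ : ℝ → LagState),
        (IsDissipativeSolution α Θ ∧ Θ 0 = Θ₀.1.relabel f) ↔
          ∀ t, 0 ≤ t → Θ t = (S t Θ₀).1.relabel f) ∧
      -- the induced semigroup on `ℱ/G`
      ∃ S' : ℝ → LagFQuot α → LagFQuot α,
        (∀ t, 0 ≤ t → ∀ Θ₀ : LagF α, S' t ⟦Θ₀⟧ = ⟦S t Θ₀⟧) ∧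
        (∀ x, S' 0 x = x) ∧
        (∀ s t, 0 ≤ s → 0 ≤ t → ∀ x, S' (s + t) x = S' s (S' t x)) := by
  choose Φ hΦ hshift using exists_solution hα
  have hself : ∀ Θ₀, IsDissipativeSolution α (fun t => (Φ Θ₀ t).1) ∧ (Φ Θ₀ 0).1 = Θ₀.1 :=
    fun Θ₀ => (hΦ Θ₀ _).2 fun _ _ => rfl
  have h0 : ∀ Θ₀, Φ Θ₀ 0 = Θ₀ := fun Θ₀ => Subtype.ext (hself Θ₀).2
  have hadd : ∀ s t, 0 ≤ s → 0 ≤ t → ∀ Θ₀, Φ Θ₀ (s + t) = Φ (Φ Θ₀ t) s := fun s t hs ht Θ₀ => by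
    refine Subtype.ext ?_
    rw [add_comm]
    exact (hΦ (Φ Θ₀ t) fun s => (Φ Θ₀ (t + s)).1).1 ⟨hshift Θ₀ t ht, by simp⟩ s hs
  have hrel : ∀ (Θ₀ : LagF α) (f : RelabelingGroup) (Θ : ℝ → LagState),
      (IsDissipativeSolution α Θ ∧ Θ 0 = Θ₀.1.relabel f) ↔
        ∀ t, 0 ≤ t → Θ t = (Φ Θ₀ t).1.relabel f := fun Θ₀ f Θ => by
    refine ⟨fun h t ht => ?_, fun h => ⟨((hself Θ₀).1.relabel f).congr fun t ht => (h t ht).symm, ?_⟩⟩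
    · have := (hΦ Θ₀ fun t => (Θ t).relabel f⁻¹).1 ⟨h.1.relabel f⁻¹, by
        rw [h.2, ← LagState.relabel_mul, mul_inv_cancel, LagState.relabel_one]⟩ t ht
      rw [← this, ← LagState.relabel_mul, inv_mul_cancel, LagState.relabel_one]
    · rw [h 0 le_rfl, h0]
  have hequiv : ∀ t, 0 ≤ t → ∀ (Θ₀ Θ₁ : LagF α) (f : RelabelingGroup), Θ₁.1 = Θ₀.1.relabel f →
      (Φ Θ₁ t).1 = (Φ Θ₀ t).1.relabel f := fun t ht Θ₀ Θ₁ f h =>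
    (hrel Θ₀ f fun t => (Φ Θ₁ t).1).1 ⟨(hself Θ₁).1, (hself Θ₁).2.trans h⟩ t ht
  have hq : ∀ t, 0 ≤ t → ∀ Θ₀ Θ₁ : LagF α, Θ₀ ≈ Θ₁ → Φ Θ₀ t ≈ Φ Θ₁ t :=
    fun t ht Θ₀ Θ₁ ⟨f, hf⟩ => ⟨f, hequiv t ht Θ₀ Θ₁ f hf⟩
  refine ⟨fun t Θ₀ => Φ Θ₀ t, hΦ, h0, hadd, fun Θ₀ f => Θ₀.2.relabel_iff f,
    fun t ht Θ₀ f hf => hequiv t ht.le Θ₀ ⟨_, hf⟩ f rfl, hrel,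
    fun t => Quotient.map (fun Θ₀ => Φ Θ₀ (max t 0)) (hq _ (le_max_right t 0)), ?_, ?_, ?_⟩
  · intro t ht Θ₀
    change ⟦Φ Θ₀ (max t 0)⟧ = ⟦Φ Θ₀ t⟧
    rw [max_eq_left ht]
  · rintro ⟨Θ₀⟩
    change ⟦Φ Θ₀ (max 0 0)⟧ = ⟦Θ₀⟧
    rw [max_self, h0]
  · rintro s t hs ht ⟨Θ₀⟩
    change ⟦Φ Θ₀ (max (s + t) 0)⟧ = ⟦Φ (Φ Θ₀ (max t 0)) (max s 0)⟧
    rw [max_eq_left hs, max_eq_left ht, max_eq_left (add_nonneg hs ht), hadd s t hs ht]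

end
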